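/- **Setting.** On $\mathbb C^{3,1}=\mathbb C^4$ with coordinates $(z^0,z^1,z^2,z^3)$ let $\langle z,\bar w\rangle=z^1\bar w^1+z^2\bar w^2+\mathrm i(z^0\bar w^3-z^3\bar w^0)$, and let $\Sigma\subset\mathbb{CP}^3$ be the set of null lines (the pseudoconformal 5-sphere). Let $M$ be a smooth oriented surface (Hausdorff, second countable, without boundary, not necessarily compact or connected) and $X:M\to\Sigma$ a smooth Legendrian immersion: for local lifts $X=[s]$ one has $\langle ds,\bar s\rangle=0$. A 3-adapted frame on an open set of $M$ is a smooth map $Z=(Z_0,Z_1,Z_2,Z_3)$ into $\mathrm{SU}(3,1)$ (unimodular matrices preserving $\langle\,,\rangle$) with $[Z_0]=X$ such that the components of $\pi=Z^{-1}dZ=(\pi^A_B)$ satisfy: $\omega^i=\pi^i_0$ ($i=1,2$) are real with $\omega^1\wedge\omega^2>0$; writing $\pi^i_j-\delta_{ij}\pi^0_0=\alpha^i_j+\mathrm i\beta^i_j$ with $\alpha^i_j,\beta^i_j$ real, $\beta^1_1+\beta^2_2=0$; writing $\pi^i_3=\mu^i+\mathrm i\nu^i$ with $\mu^i,\nu^i$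 real, $\mu^i=\sum_j p_{ij}\omega^j$ with $p_{11}+p_{22}=0$. Put $\omega=\omega^1+\mathrm i\omega^2$, $\nu=\nu^1+\mathrm i\nu^2$, $\rho=\alpha^1_2$, $\phi=\mathrm{Re}\,\pi^0_0$, and define $h,p,q$ and $r$ by $$\beta^1_1-\mathrm i\beta^1_2=h\,\omega,\qquad \mu^1-\mathrm i\mu^2=p\,\omega,\qquad \pi^0_3=q\,\omega+\bar q\,\bar\omega,\qquad dq+(\mathrm i\rho+3\phi)q=-p\,\nu-r\,\bar\omega+x\,\omega$$ for some function $x$. The 2-form $\Omega_X=\mathrm i|h|^2\,\omega\wedge\bar\omega$ and the quartic differential $\Phi=(hq-\tfrac12p^2)\,\omega^4$ do not depend on the choice of the frame, and $M$ carries the complex structure for which $\omega$ is of type $(1,0)$. The Willmore functional is $\mathcal W(X)=\int_M\Omega_X$. The surface $X$ is called *Willmore* if it is critical for compactly supported Legendrian variations: for every compact $K\subset M$ and every smooth family $X_t$, $|t|<\varepsilon$, of Legendrian immersions $M\to\Sigma$ with $X_0=X$ and $X_t=X$ outside $K$, $\left.\frac{d}{dt}\right|_{t=0}\int_K\Omega_{X_t}=0$.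 **Proposition 3.1 (Euler–Lagrange equation).** Let $X:M\to\Sigma$ be an oriented Legendrian surface. Then $X$ is Willmore if and only if the quartic differential $\Phi$ is holomorphic; and $\Phi$ is holomorphic if and only if the structure coefficient $r$ vanishes identically (in every 3-adapted frame). -/

import Mathlib

open scoped Manifold ContDiff LinearAlgebra.Projectivization

noncomputable section

namespace WillmoreLegendrian

/-! ### The pseudoconformal 5-sphere -/

/-- The ambient space `ℂ^{3,1}`, with coordinates `(z⁰, z¹, z², z³)`. -/
abbrev C31 : Type := Fin 4 → ℂ

/-- The Hermitian product `⟨z, w̄⟩ = z¹ w̄¹ + z² w̄² + i (z⁰ w̄³ - z³ w̄⁰)`. -/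
def herm (z w : C31) : ℂ :=
  z 1 * star (w 1) + z 2 * star (w 2)
    + Complex.I * (z 0 * star (w 3) - z 3 * star (w 0))

/-- The pseudoconformal sphere `Σ`: null vectors up to complex scale. -/
abbrev PCSphere : Type := {l : ℙ ℂ C31 // herm l.rep l.rep = 0}

/-- The nonzero vector `v` represents the point `l`, that is, `l = [v]`. -/
def Represents (v : C31) (l : PCSphere) : Prop :=
  ∃ hv : v ≠ 0, Projectivization.mk ℂ v hv = l.1

/-- `Z` belongs to `SU(3,1)`: it is unimodular and preserves the Hermitian product. -/
def IsSU31 (Z : Matrix (Fin 4) (Fin 4) ℂ) : Prop :=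
  Z.det = 1 ∧ ∀ z w : C31, herm (Z.mulVec z) (Z.mulVec w) = herm z w

/-! ### Oriented surfaces, Legendrian immersions and their variations -/

/-- The model plane `ℝ²`. -/
abbrev Plane : Type := EuclideanSpace ℝ (Fin 2)

/-- The first vector of the standard oriented basis of `ℝ²`. -/
abbrev e₁ : Plane := EuclideanSpace.single 0 1

/-- The second vector of the standard oriented basis of `ℝ²`. -/
abbrev e₂ : Plane := EuclideanSpace.single 1 1

/-- The atlas of `M` is an oriented atlas: all its coordinate changes have positive Jacobian.
The orientation of `M` is the one in which the charts of the atlas are positive. -/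
def IsOrientedAtlas (M : Type*) [TopologicalSpace M] [ChartedSpace Plane M] : Prop :=
  ∀ c ∈ atlas Plane M, ∀ c' ∈ atlas Plane M, ∀ x ∈ (c.symm.trans c').source,
    0 < (fderiv ℝ (c.symm.trans c') x).det

/-- Smoothness on the open set `D` of a map from a manifold to `Σ`: locally on `D` the map is
represented by a smooth map to the nonzero vectors of `ℂ^{3,1}`. -/
def SmoothIntoSphere {E H N : Type*} [NormedAddCommGroup E] [NormedSpace ℝ E]
    [TopologicalSpace H] (I : ModelWithCorners ℝ E H) [TopologicalSpace N] [ChartedSpace H N]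
    (X : N → PCSphere) (D : Set N) : Prop :=
  ∀ p ∈ D, ∃ U : Set N, IsOpen U ∧ p ∈ U ∧ U ⊆ D ∧ ∃ s : N → C31,
    ContMDiffOn I 𝓘(ℝ, C31) ∞ s U ∧ ∀ y ∈ U, Represents (s y) (X y)

section Surface

variable {M : Type*} [TopologicalSpace M] [ChartedSpace Plane M]

/-- The differential of a `ℂ^{3,1}`-valued function on a surface. -/
def dVec (s : M → C31) (m : M) : TangentSpace (𝓡 2) m →L[ℝ] C31 :=
  mfderiv (𝓡 2) 𝓘(ℝ, C31) s m

/-- `X` is a smooth Legendrian immersion into `Σ`. For a local smooth representative `s`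
the contact hyperplane field pulls back to the kernel of `⟨ds, s̄⟩`, and the kernel of the
differential of `X = [s]` consists of the `v` with `ds(v) ∈ ℂ s`. -/
def IsLegendrianImmersion (X : M → PCSphere) : Prop :=
  ∀ m : M, ∃ U : Set M, IsOpen U ∧ m ∈ U ∧ ∃ s : M → C31,
    ContMDiffOn (𝓡 2) 𝓘(ℝ, C31) ∞ s U ∧
    ∀ y ∈ U, Represents (s y) (X y) ∧
      (∀ v : TangentSpace (𝓡 2) y, herm (dVec s y v) (s y) = 0) ∧
      (∀ v : TangentSpace (𝓡 2) y, ∀ a : ℂ, dVec s y v = a • s y → v = 0)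

/-- `Xt t`, for `|t| < ε`, is a smooth variation of `X` through Legendrian immersions which is
supported in the set `K`. -/
structure IsLegendrianVariation (X : M → PCSphere) (K : Set M) (ε : ℝ)
    (Xt : ℝ → M → PCSphere) : Prop where
  pos : 0 < ε
  zero : Xt 0 = X
  smooth : SmoothIntoSphere (𝓘(ℝ, ℝ).prod (𝓡 2)) (fun q : ℝ × M => Xt q.1 q.2)
    (Set.Ioo (-ε) ε ×ˢ Set.univ)
  legendrian : ∀ t ∈ Set.Ioo (-ε) ε, IsLegendrianImmersion (Xt t)
  support : ∀ t ∈ Set.Ioo (-ε) ε, ∀ m ∉ K, Xt t m = X m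

end Surface

/-! ### Differential forms on domains of the plane

One-forms are complex valued; a two-form is given by its value on `(e₁, e₂)`. -/

/-- Complex valued covectors of the plane. -/
abbrev Cov : Type := Plane →L[ℝ] ℂ

/-- The real part of a covector, as a complex valued covector. -/
def reForm (θ : Cov) : Cov := (Complex.ofRealCLM.comp Complex.reCLM).comp θ

/-- The imaginary part of a covector, as a complex valued covector. -/
def imForm (θ : Cov) : Cov := (Complex.ofRealCLM.comp Complex.imCLM).comp θ

/-- The conjugate covector. -/
def conjForm (θ : Cov) : Cov := (Complex.conjCLE : ℂ →L[ℝ] ℂ).comp θ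

/-- The value of `θ ∧ η` on `(e₁, e₂)`. -/
def wedge (θ η : Cov) : ℂ := θ e₁ * η e₂ - θ e₂ * η e₁

/-- The value of `dθ` on `(e₁, e₂)` at the point `x`. -/
def extD (θ : Plane → Cov) (x : Plane) : ℂ :=
  fderiv ℝ (fun y => θ y e₂) x e₁ - fderiv ℝ (fun y => θ y e₁) x e₂

/-- The coefficient `a` in `θ = a κ + b κ̄`, for a covector `κ` with `κ ∧ κ̄ ≠ 0`. -/
def coeff (κ θ : Cov) : ℂ := wedge θ (conjForm κ) / wedge κ (conjForm κ)

/-- The coefficient `b` in `θ = a κ + b κ̄`, for a covector `κ` with `κ ∧ κ̄ ≠ 0`. -/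
def coeffBar (κ θ : Cov) : ℂ := wedge κ θ / wedge κ (conjForm κ)

/-! ### Moving frames

A frame field `Z` on a domain of the plane is a function with values in the `4 × 4` matrices;
its columns are the vectors `Z₀, Z₁, Z₂, Z₃`. -/

/-- Frame fields. -/
abbrev FrameField : Type := Plane → Matrix (Fin 4) (Fin 4) ℂ

namespace FrameField

/-- The component `π^A_B` of the Maurer–Cartan form `π = Z⁻¹ dZ`. -/
def mc (Z : FrameField) (A B : Fin 4) (x : Plane) : Cov :=
  ∑ C : Fin 4, (Z x)⁻¹ A C • fderiv ℝ (fun y => Z y C B) x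

/-- The position `1, 2` in the frame of the index `i ∈ {1, 2}`. -/
def pos (i : Fin 2) : Fin 4 := if i = 0 then 1 else 2

/-- `ω^i = π^i_0`. -/
def om (Z : FrameField) (i : Fin 2) (x : Plane) : Cov := Z.mc (pos i) 0 x

/-- `ω = ω¹ + i ω²`. -/
def omega (Z : FrameField) (x : Plane) : Cov := Z.om 0 x + Complex.I • Z.om 1 x

/-- `π^i_j - δ_{ij} π^0_0`. -/
def conn (Z : FrameField) (i j : Fin 2) (x : Plane) : Cov :=
  Z.mc (pos i) (pos j) x - if i = j then Z.mc 0 0 x else 0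

/-- `α^i_j`, the real part of `π^i_j - δ_{ij} π^0_0`. -/
def alpha (Z : FrameField) (i j : Fin 2) (x : Plane) : Cov := reForm (Z.conn i j x)

/-- `β^i_j`, the imaginary part of `π^i_j - δ_{ij} π^0_0`. -/
def beta (Z : FrameField) (i j : Fin 2) (x : Plane) : Cov := imForm (Z.conn i j x)

/-- `φ`, the real part of `π^0_0`. -/
def phi (Z : FrameField) (x : Plane) : Cov := reForm (Z.mc 0 0 x)

/-- `ρ = α^1_2`. -/
def rho (Z : FrameField) (x : Plane) : Cov := Z.alpha 0 1 x

/-- `μ^i`, the real part of `π^i_3`. -/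
def mu (Z : FrameField) (i : Fin 2) (x : Plane) : Cov := reForm (Z.mc (pos i) 3 x)

/-- `ν^i`, the imaginary part of `π^i_3`. -/
def nu (Z : FrameField) (i : Fin 2) (x : Plane) : Cov := imForm (Z.mc (pos i) 3 x)

/-- `ν = ν¹ + i ν²`. -/
def nuC (Z : FrameField) (x : Plane) : Cov := Z.nu 0 x + Complex.I • Z.nu 1 x

/-- The coefficient `h` in `β^1_1 - i β^1_2 = h ω`. -/
def h (Z : FrameField) (x : Plane) : ℂ :=
  coeff (Z.omega x) (Z.beta 0 0 x - Complex.I • Z.beta 0 1 x)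

/-- The coefficient `p` in `μ¹ - i μ² = p ω`. -/
def p (Z : FrameField) (x : Plane) : ℂ :=
  coeff (Z.omega x) (Z.mu 0 x - Complex.I • Z.mu 1 x)

/-- The coefficient `q` in `π^0_3 = q ω + q̄ ω̄`. -/
def q (Z : FrameField) (x : Plane) : ℂ := coeff (Z.omega x) (Z.mc 0 3 x)

/-- The coefficient `r` in `dq + (i ρ + 3 φ) q = - p ν - r ω̄ + x ω`. -/
def r (Z : FrameField) (x : Plane) : ℂ :=
  - coeffBar (Z.omega x)
      (fderiv ℝ Z.q x + Z.q x • (Complex.I • Z.rho x + (3 : ℂ) • Z.phi x) + Z.p x • Z.nuC x)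

/-- The coefficient `h q - p² / 2` of the quartic differential `Φ = (h q - p² / 2) ω⁴`. -/
def quartic (Z : FrameField) (x : Plane) : ℂ := Z.h x * Z.q x - 1 / 2 * Z.p x ^ 2

/-- The value on `(e₁, e₂)` of the two-form `Ω = i |h|² ω ∧ ω̄`. -/
def willmoreForm (Z : FrameField) (x : Plane) : ℝ :=
  (Complex.I * (‖Z.h x‖ ^ 2 : ℝ) * wedge (Z.omega x) (conjForm (Z.omega x))).re

end FrameField

/-- `Z` is a smooth section over the open set `V ⊆ ℝ²` of the 3-adapted frame bundle of the
(locally defined) oriented Legendrian surface `Y`. -/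
structure IsAdaptedFrame (Y : Plane → PCSphere) (V : Set Plane) (Z : FrameField) : Prop where
  isOpen : IsOpen V
  smooth : ∀ A B : Fin 4, ContDiffOn ℝ ∞ (fun y => Z y A B) V
  unitary : ∀ x ∈ V, IsSU31 (Z x)
  base : ∀ x ∈ V, Represents (fun A => Z x A 0) (Y x)
  /-- `ω¹` and `ω²` are real -/
  real : ∀ x ∈ V, ∀ i : Fin 2, imForm (Z.om i x) = 0
  /-- `ω¹ ∧ ω² > 0` -/
  positive : ∀ x ∈ V, 0 < (wedge (Z.om 0 x) (Z.om 1 x)).re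
  /-- `tr (β^i_j) = 0` -/
  trace_beta : ∀ x ∈ V, ∑ i : Fin 2, Z.beta i i x = 0
  /-- `tr (p_{ij}) = 0`, where `μ^i = p_{ij} ω^j` -/
  trace_p : ∀ x ∈ V, ∃ P : Matrix (Fin 2) (Fin 2) ℝ, P.trace = 0 ∧
    ∀ i : Fin 2, Z.mu i x = ∑ j : Fin 2, P i j • Z.om j x

/-! ### The quartic differential, the coefficient `r` and the Willmore functional -/

/-- The value on `(e₁, e₂)` of `df ∧ κ + 4 f dκ`, which represents `∂̄ (f κ⁴)` for a
`(1,0)`-coframe `κ` of the complex structure of an oriented surface: if `κ = u dζ` for a local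
holomorphic coordinate `ζ`, then `f κ⁴ = g dζ⁴` with `g = f u⁴`, and
`df ∧ κ + 4 f dκ = u⁻³ dg ∧ dζ` vanishes exactly where `∂g / ∂ζ̄ = 0`. -/
def dbarQuartic (κ : Plane → Cov) (f : Plane → ℂ) (x : Plane) : ℂ :=
  wedge (fderiv ℝ f x) (κ x) + 4 * f x * extD κ x

/-- The value on `(e₁, e₂)` of the Willmore two-form `Ω_Y` of the local Legendrian surface `Y`,
computed in a 3-adapted frame near `x` (it does not depend on the frame). -/
def localWillmoreForm (Y : Plane → PCSphere) (x : Plane) : ℝ :=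
  open Classical in
  if H : ∃ Z : FrameField, ∃ V : Set Plane, x ∈ V ∧ IsAdaptedFrame Y V Z then
    (Classical.choose H).willmoreForm x
  else 0

section Surface

variable {M : Type*} [TopologicalSpace M] [ChartedSpace Plane M]

/-- `Φ = (h q - p² / 2) ω⁴` is a holomorphic quartic differential for the complex structure
induced on `M`, the one for which `ω` is of type `(1,0)`: `∂̄ Φ = 0` in all local 3-adapted
frames. -/
def IsHolomorphicPhi (X : M → PCSphere) : Prop :=
  ∀ c ∈ atlas Plane M, ∀ V ⊆ c.target, ∀ Z : FrameField,
    IsAdaptedFrame (X ∘ c.symm) V Z → ∀ x ∈ V, dbarQuartic Z.omega Z.quartic x = 0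

/-- The structure coefficient `r` vanishes identically on the 3-adapted frame bundle. -/
def RVanishes (X : M → PCSphere) : Prop :=
  ∀ c ∈ atlas Plane M, ∀ V ⊆ c.target, ∀ Z : FrameField,
    IsAdaptedFrame (X ∘ c.symm) V Z → ∀ x ∈ V, Z.r x = 0

variable [IsManifold (𝓡 2) ∞ M] [T2Space M] [SigmaCompactSpace M]

variable (M) in
/-- A smooth partition of unity subordinate to the charts `chartAt i`, `i ∈ M`. -/
def chartPartition : SmoothPartitionOfUnity M (𝓡 2) M Set.univ :=
  (SmoothPartitionOfUnity.exists_isSubordinate_chartAt_source (𝓡 2) M).choose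

/-- The integral over `K` of the two-form `Ω_X`, for the orientation of `M` given by its charts.
For compact `M` and `K = M` it is the Willmore functional `𝒲(X)`. -/
def willmoreEnergy (K : Set M) (X : M → PCSphere) : ℝ :=
  ∑ᶠ i : M, ∫ x in (chartAt Plane i).target ∩ (chartAt Plane i).symm ⁻¹' K,
    chartPartition M i ((chartAt Plane i).symm x)
      * localWillmoreForm (X ∘ (chartAt Plane i).symm) x

/-- `X` is Willmore: it is critical for `𝒲` under all compactly supported Legendrian variations.
The functional is taken over a compact set outside of which the variation is constant. -/
def IsWillmore (X : M → PCSphere) : Prop :=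
  ∀ (K : Set M) (ε : ℝ) (Xt : ℝ → M → PCSphere), IsCompact K →
    IsLegendrianVariation X K ε Xt →
    HasDerivAt (fun t => willmoreEnergy K (Xt t)) 0 0

end Surface

end WillmoreLegendrian

end

open scoped Manifold ContDiff LinearAlgebra.Projectivization

noncomputable section

namespace WillmoreLegendrian

/-! ### The Hermitian product -/

/-! For an adapted frame, π = Z⁻¹dZ satisfies dπ = -π ∧ π. Put η = β¹₁ - iβ¹₂, μ = μ¹ - iμ², κ =
π⁰₃. The symmetries of the Lie algebra of SU(3,1) and the normalisations of the frame force η = hω,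
μ = pω and κ = qω + q̄ω̄. The equations for dη, dμ, dκ then express the ω̄-derivatives of h, p, q
through p, q, r and show that r is real. Two consequences follow. By the Leibniz rule ∂̄Φ is h r
times a nonvanishing factor (`IsLegFrame.dbarQuartic_eq`). On an open set where h = 0, the equations
give successively p = 0, q = 0 and r = 0 (`IsLegFrame.r_eq_zero_of_h`). Near a point with r ≠ 0 the
identity h r = 0 would force h = 0, hence r = 0; so h r vanishes identically exactly when r does.
This is the second equivalence.

For the first equivalence, let Z(t, x) be adapted frames of a family of Legendrian surfaces. On the
product of time and surface Z⁻¹dZ is still flat, so ∂ₜπ = dΛ + [π, Λ], where Λ is its time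
component. The entry f = Λ³₀ is the contact Hamiltonian of the variation. Since Ω = i η ∧ η̄, a
computation gives ∂ₜΩ = 2 Re(i dΞ) - 4 f r ω¹∧ω² with an explicit one-form Ξ
(`IsFrameFamily.hasDerivAt_willmoreForm`). The form Ξ does not depend on the frames
(`IsFrameFamily.boundaryForm_change`) or on the coordinates, and it vanishes where the variation is
constant. Stokes' theorem, carried out with a partition of unity, therefore shows that the energy
has derivative -4 ∫ f r ω¹∧ω² (`IsLegendrianVariation.hasDerivAt_willmoreEnergy`). If r = 0, the
surface is Willmore.

Conversely, near each point a compactly supported function is, up to a positive factor, the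
Hamiltonian of a variation: in affine coordinates with z⁰ = 1 a Legendrian surface is the 1-jet
graph of a function u over (Re z¹, Re z²), and replacing u by u + 2tw keeps it Legendrian for every
t. If r(x₀) ≠ 0, a bump function with the sign of r(x₀) makes f r nonnegative everywhere and
positive at x₀, against criticality (`IsChartLift.r_eq_zero`). This is done in frames built from the
affine lift; the transformation law of ∂̄Φ carries the conclusion to all frames.

The supporting material is the local existence of smooth families of adapted frames
(`IsLegLift.isFrameFamily`), obtained by Gram–Schmidt and two unipotent corrections, and the laws by
which h, p, q and the components of Λ change with the frame. -/

theorem herm_add_left (z z' w : C31) : herm (z + z') w = herm z w + herm z' w := by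
  simp only [herm, Pi.add_apply]; ring

theorem herm_add_right (z w w' : C31) : herm z (w + w') = herm z w + herm z w' := by
  simp only [herm, Pi.add_apply, star_add]; ring

theorem herm_smul_left (a : ℂ) (z w : C31) : herm (a • z) w = a * herm z w := by
  simp only [herm, Pi.smul_apply, smul_eq_mul]; ring

theorem herm_smul_right (a : ℂ) (z w : C31) : herm z (a • w) = star a * herm z w := by
  simp only [herm, Pi.smul_apply, smul_eq_mul, star_mul']; ring

theorem star_herm (z w : C31) : star (herm z w) = herm w z := by
  simp only [herm, star_add, star_mul', star_sub, Complex.star_def, Complex.conj_I,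
    Complex.conj_conj]
  ring

/-- The Hermitian product as a continuous real bilinear map. -/
def hermL : C31 →L[ℝ] C31 →L[ℝ] ℂ :=
  LinearMap.toContinuousLinearMap
    ((LinearMap.toContinuousLinearMap (𝕜 := ℝ) (E := C31) (F' := ℂ)).toLinearMap ∘ₗ
      LinearMap.mk₂ ℝ herm herm_add_left
        (fun c z w => by
          have := herm_smul_left (c : ℂ) z w
          simpa [Complex.real_smul] using this)
        herm_add_right
        (fun c z w => by
          have := herm_smul_right (c : ℂ) z w
          simpa [Complex.real_smul] using this))

@[simp] theorem hermL_apply (z w : C31) : hermL z w = herm z w := rfl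

/-! ### Differentiating Hermitian products and conjugates -/

section Calculus

variable {E : Type*} [NormedAddCommGroup E] [NormedSpace ℝ E]

theorem fderiv_herm {f g : E → C31} {x : E} (hf : DifferentiableAt ℝ f x)
    (hg : DifferentiableAt ℝ g x) (u : E) :
    fderiv ℝ (fun y => herm (f y) (g y)) x u =
      herm (fderiv ℝ f x u) (g x) + herm (f x) (fderiv ℝ g x u) := by
  have := hermL.fderiv_of_bilinear hf hg
  simp only [hermL_apply] at this
  rw [this]
  simp [ContinuousLinearMap.precompR, ContinuousLinearMap.precompL, add_comm]

theorem _root_.ContDiffOn.herm {f g : E → C31} {s : Set E} {n : WithTop ℕ∞}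
    (hf : ContDiffOn ℝ n f s) (hg : ContDiffOn ℝ n g s) :
    ContDiffOn ℝ n (fun y => WillmoreLegendrian.herm (f y) (g y)) s :=
  (hermL.contDiff.comp_contDiffOn hf).clm_apply hg

theorem _root_.ContDiffOn.star_complex {f : E → ℂ} {s : Set E} {n : WithTop ℕ∞}
    (hf : ContDiffOn ℝ n f s) : ContDiffOn ℝ n (fun y => star (f y)) s :=
  Complex.conjCLE.contDiff.comp_contDiffOn hf

theorem fderiv_star_apply {f : E → ℂ} (x u : E) (hf : DifferentiableAt ℝ f x) :
    fderiv ℝ (fun y => star (f y)) x u = star (fderiv ℝ f x u) := by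
  have h : HasFDerivAt (fun y => star (f y))
      ((Complex.conjCLE : ℂ →L[ℝ] ℂ).comp (fderiv ℝ f x)) x :=
    (Complex.conjCLE : ℂ →L[ℝ] ℂ).hasFDerivAt.comp x hf.hasFDerivAt
  rw [h.fderiv]; rfl

end Calculus

/-! ### Unitary matrices -/

/-- The columns of a matrix. -/
def col (Z : Matrix (Fin 4) (Fin 4) ℂ) (A : Fin 4) : C31 := fun C => Z C A

theorem mulVec_single_eq_col (Z : Matrix (Fin 4) (Fin 4) ℂ) (A : Fin 4) :
    Z.mulVec (Pi.single A 1) = col Z A := by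
  ext C; simp [col]

/-- The Hermitian products of the columns of a unitary matrix. -/
def gram : Fin 4 → Fin 4 → ℂ :=
  ![![0, 0, 0, Complex.I], ![0, 1, 0, 0], ![0, 0, 1, 0], ![-Complex.I, 0, 0, 0]]

theorem IsSU31.herm_col {Z : Matrix (Fin 4) (Fin 4) ℂ} (hZ : IsSU31 Z) (A B : Fin 4) :
    herm (col Z A) (col Z B) = gram A B := by
  rw [← mulVec_single_eq_col, ← mulVec_single_eq_col, hZ.2]
  fin_cases A <;> fin_cases B <;> simp [herm, gram]

/-- The inverse of a unitary matrix. -/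
def dualMatrix (Z : Matrix (Fin 4) (Fin 4) ℂ) : Matrix (Fin 4) (Fin 4) ℂ :=
  Matrix.of ![fun C => -Complex.I * herm (Pi.single C 1) (col Z 3),
    fun C => herm (Pi.single C 1) (col Z 1), fun C => herm (Pi.single C 1) (col Z 2),
    fun C => Complex.I * herm (Pi.single C 1) (col Z 0)]

theorem herm_eq_sum (v w : C31) : herm v w = ∑ C, herm (Pi.single C 1) w * v C := by
  simp [Fin.sum_univ_four, herm, Pi.single_apply]; ring

/-- A vector is recovered from its products with the columns: the Gram matrix pairs column 0 with
column 3 and each of the columns 1, 2 with itself, which dictates the rows of `dualMatrix`. -/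
theorem dualMatrix_mul_of_gram {Z : Matrix (Fin 4) (Fin 4) ℂ}
    (hZ : ∀ A B, herm (col Z A) (col Z B) = gram A B) : dualMatrix Z * Z = 1 := by
  have key : ∀ A B, (dualMatrix Z * Z) A B =
      ![-Complex.I * herm (col Z B) (col Z 3), herm (col Z B) (col Z 1),
        herm (col Z B) (col Z 2), Complex.I * herm (col Z B) (col Z 0)] A := by
    intro A B
    rw [Matrix.mul_apply]
    simp only [herm_eq_sum (col Z B), Finset.mul_sum]
    fin_cases A <;> simp [dualMatrix, col, mul_assoc]
  ext A B
  rw [key]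
  simp only [hZ]
  fin_cases A <;> fin_cases B <;> simp [gram]

theorem IsSU31.inv_eq {Z : Matrix (Fin 4) (Fin 4) ℂ} (hZ : IsSU31 Z) : Z⁻¹ = dualMatrix Z :=
  Matrix.inv_eq_left_inv (dualMatrix_mul_of_gram hZ.herm_col)

theorem IsSU31.isUnit_det {Z : Matrix (Fin 4) (Fin 4) ℂ} (hZ : IsSU31 Z) : IsUnit Z.det := by
  rw [hZ.1]; exact isUnit_one

theorem mulVec_eq_col (Z : Matrix (Fin 4) (Fin 4) ℂ) (z : C31) :
    Z.mulVec z = z 0 • col Z 0 + z 1 • col Z 1 + z 2 • col Z 2 + z 3 • col Z 3 := by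
  ext C
  simp [Matrix.mulVec, dotProduct, Fin.sum_univ_four, col]
  ring

theorem isSU31_of_gram {Z : Matrix (Fin 4) (Fin 4) ℂ}
    (h : ∀ A B, herm (col Z A) (col Z B) = gram A B) (hd : Z.det = 1) : IsSU31 Z := by
  refine ⟨hd, fun z w => ?_⟩
  rw [mulVec_eq_col, mulVec_eq_col]
  simp only [herm_add_left, herm_add_right, herm_smul_left, herm_smul_right, h]
  simp [gram, herm]
  ring

/-! ### The Maurer-Cartan form of a matrix valued function -/

section MaurerCartan

variable {E : Type*} [NormedAddCommGroup E] [NormedSpace ℝ E]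

/-- The entries of `Z⁻¹ dZ`. -/
def mcForm (Z : E → Matrix (Fin 4) (Fin 4) ℂ) (A B : Fin 4) (x : E) : E →L[ℝ] ℂ :=
  ∑ C : Fin 4, (Z x)⁻¹ A C • fderiv ℝ (fun y => Z y C B) x

theorem FrameField.mc_eq (Z : FrameField) (A B : Fin 4) (x : Plane) :
    Z.mc A B x = mcForm Z A B x := rfl

/-- `Z` is a smooth `SU(3,1)`-valued function on the open set `V`. -/
structure SmoothSU (Z : E → Matrix (Fin 4) (Fin 4) ℂ) (V : Set E) : Prop where
  isOpen : IsOpen V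
  smooth : ∀ A B : Fin 4, ContDiffOn ℝ ∞ (fun y => Z y A B) V
  unitary : ∀ x ∈ V, IsSU31 (Z x)

variable {Z : E → Matrix (Fin 4) (Fin 4) ℂ} {V : Set E}

namespace SmoothSU

theorem contDiffOn_col (hZ : SmoothSU Z V) (A : Fin 4) :
    ContDiffOn ℝ ∞ (fun y => col (Z y) A) V :=
  contDiffOn_pi.2 fun C => hZ.smooth C A

theorem differentiableAt (hZ : SmoothSU Z V) {x : E} (hx : x ∈ V) (A B : Fin 4) :
    DifferentiableAt ℝ (fun y => Z y A B) x :=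
  ((hZ.smooth A B).contDiffAt (hZ.isOpen.mem_nhds hx)).differentiableAt (by simp)

theorem differentiableAt_col (hZ : SmoothSU Z V) {x : E} (hx : x ∈ V) (A : Fin 4) :
    DifferentiableAt ℝ (fun y => col (Z y) A) x :=
  differentiableAt_pi.2 fun C => hZ.differentiableAt hx C A

theorem fderiv_col (hZ : SmoothSU Z V) {x : E} (hx : x ∈ V) (A : Fin 4) (u : E) (C : Fin 4) :
    fderiv ℝ (fun y => col (Z y) A) x u C = fderiv ℝ (fun y => Z y C A) x u := by
  have := fderiv_pi (𝕜 := ℝ) (φ := fun C y => Z y C A) (x := x)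
    (fun C => hZ.differentiableAt hx C A)
  have h2 : fderiv ℝ (fun y => col (Z y) A) x =
      ContinuousLinearMap.pi fun i => fderiv ℝ (fun y => Z y i A) x := this
  rw [h2]; rfl

/-- The entries of the inverse are Hermitian products with columns of Z, so their smoothness needs
no division by a determinant. -/
theorem contDiffOn_inv (hZ : SmoothSU Z V) (A B : Fin 4) :
    ContDiffOn ℝ ∞ (fun y => (Z y)⁻¹ A B) V := by
  have h : ContDiffOn ℝ ∞ (fun y => dualMatrix (Z y) A B) V := by
    have hc : ∀ D, ContDiffOn ℝ ∞ (fun y => herm (Pi.single B 1) (col (Z y) D)) V :=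
      fun D => contDiffOn_const.herm (hZ.contDiffOn_col D)
    fin_cases A
    · exact contDiffOn_const.mul (hc 3)
    · exact hc 1
    · exact hc 2
    · exact contDiffOn_const.mul (hc 0)
  exact h.congr fun y hy => by rw [(hZ.unitary y hy).inv_eq]

theorem contDiffOn_mcForm (hZ : SmoothSU Z V) (A B : Fin 4) :
    ContDiffOn ℝ ∞ (fun y => mcForm Z A B y) V := by
  unfold mcForm
  refine ContDiffOn.sum fun C _ => ?_
  exact (hZ.contDiffOn_inv A C).smul ((hZ.smooth C B).fderiv_of_isOpen hZ.isOpen (by simp))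

theorem differentiableAt_mcForm (hZ : SmoothSU Z V) {x : E} (hx : x ∈ V) (A B : Fin 4) :
    DifferentiableAt ℝ (fun y => mcForm Z A B y) x :=
  ((hZ.contDiffOn_mcForm A B).contDiffAt (hZ.isOpen.mem_nhds hx)).differentiableAt (by simp)

/-- This is dZ = Zπ; differentiating it once more yields the Maurer-Cartan equation. -/
theorem sum_mul_mcForm (hZ : SmoothSU Z V) {x : E} (hx : x ∈ V) (A B : Fin 4) (u : E) :
    ∑ C, Z x A C * mcForm Z C B x u = fderiv ℝ (fun y => Z y A B) x u := by
  have h1 : Z x * (Z x)⁻¹ = 1 := Matrix.mul_nonsing_inv _ (hZ.unitary x hx).isUnit_det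
  have : ∀ C, Z x A C * mcForm Z C B x u =
      ∑ D, (Z x A C * (Z x)⁻¹ C D) * fderiv ℝ (fun y => Z y D B) x u := by
    intro C
    simp [mcForm, Finset.mul_sum, mul_assoc]
  simp_rw [this]
  rw [Finset.sum_comm]
  simp_rw [← Finset.sum_mul, ← Matrix.mul_apply, h1]
  simp [Matrix.one_apply]

/-- The Maurer-Cartan equation `dπ = - π ∧ π`. -/
theorem maurerCartan (hZ : SmoothSU Z V) {x : E} (hx : x ∈ V) (A B : Fin 4) (u v : E) :
    fderiv ℝ (fun y => mcForm Z A B y v) x u - fderiv ℝ (fun y => mcForm Z A B y u) x v =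
      - ∑ C, (mcForm Z A C x u * mcForm Z C B x v - mcForm Z A C x v * mcForm Z C B x u) := by
  have hd : ∀ (C D : Fin 4) (w : E), DifferentiableAt ℝ (fun y => mcForm Z C D y w) x :=
    fun C D w => (hZ.differentiableAt_mcForm hx C D).clm_apply (differentiableAt_const w)
  -- The Leibniz rule applied to dZ = Zπ computes the second derivative of Z.
  have second : ∀ (D : Fin 4) (u v : E),
      ∑ C, (Z x D C * fderiv ℝ (fun y => mcForm Z C B y v) x u
        + fderiv ℝ (fun y => Z y D C) x u * mcForm Z C B x v) =
      fderiv ℝ (fderiv ℝ (fun y => Z y D B)) x u v := by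
    intro D u v
    have hev : (fun y : E => ∑ C : Fin 4, Z y D C * (mcForm Z C B y v : ℂ)) =ᶠ[nhds x]
        fun y => fderiv ℝ (fun y => Z y D B) y v := by
      filter_upwards [hZ.isOpen.mem_nhds hx] with y hy
      exact hZ.sum_mul_mcForm hy D B v
    have h2 : fderiv ℝ (fun y : E => ∑ C : Fin 4, Z y D C * (mcForm Z C B y v : ℂ)) x u =
        fderiv ℝ (fun y => fderiv ℝ (fun y => Z y D B) y v) x u := by rw [hev.fderiv_eq]
    have h3 : DifferentiableAt ℝ (fderiv ℝ (fun y => Z y D B)) x :=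
      (((hZ.smooth D B).fderiv_of_isOpen hZ.isOpen (m := ∞) (by simp)).contDiffAt
        (hZ.isOpen.mem_nhds hx)).differentiableAt (by simp)
    rw [fderiv_clm_apply h3 (differentiableAt_const v)] at h2
    rw [fderiv_fun_sum fun C _ => (hZ.differentiableAt hx D C).fun_mul (hd C B v)] at h2
    have h4 : ∀ C, fderiv ℝ (fun y => Z y D C * mcForm Z C B y v) x u =
        Z x D C * fderiv ℝ (fun y => mcForm Z C B y v) x u
        + fderiv ℝ (fun y => Z y D C) x u * mcForm Z C B x v := by
      intro C
      rw [fderiv_fun_mul (hZ.differentiableAt hx D C) (hd C B v)]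
      simp [mul_comm]
    simp only [sum_apply, h4] at h2
    rw [h2]
    simp
  have symm : ∀ D, fderiv ℝ (fderiv ℝ (fun y => Z y D B)) x u v =
      fderiv ℝ (fderiv ℝ (fun y => Z y D B)) x v u := by
    intro D
    have hc : ContDiffAt ℝ ∞ (fun y => Z y D B) x :=
      (hZ.smooth D B).contDiffAt (hZ.isOpen.mem_nhds hx)
    exact (hc.isSymmSndFDerivAt (by simp; exact WithTop.coe_le_coe.2 le_top)).eq u v
  -- By symmetry of the second derivative the two expressions agree; substituting dZ = Zπ once more
  -- leaves Z times the Maurer-Cartan equation, and Z is invertible.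
  have key : ∀ D, ∑ C, Z x D C * (fderiv ℝ (fun y => mcForm Z C B y v) x u
      - fderiv ℝ (fun y => mcForm Z C B y u) x v +
      ∑ F, (mcForm Z C F x u * mcForm Z F B x v - mcForm Z C F x v * mcForm Z F B x u)) = 0 := by
    intro D
    have e1 := second D u v
    have e2 := second D v u
    rw [symm D, ← e2] at e1
    simp_rw [← hZ.sum_mul_mcForm hx] at e1
    simp only [Fin.sum_univ_four] at e1 ⊢
    linear_combination e1
  have h1 : (Z x)⁻¹ * Z x = 1 := Matrix.nonsing_inv_mul _ (hZ.unitary x hx).isUnit_det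
  have h2 : (Z x).mulVec (fun C => fderiv ℝ (fun y => mcForm Z C B y v) x u
      - fderiv ℝ (fun y => mcForm Z C B y u) x v +
      ∑ F, (mcForm Z C F x u * mcForm Z F B x v - mcForm Z C F x v * mcForm Z F B x u)) = 0 := by
    ext D; exact key D
  have h3 := congrArg (fun w => (Z x)⁻¹.mulVec w) h2
  simp only [Matrix.mulVec_mulVec, h1, Matrix.one_mulVec, Matrix.mulVec_zero] at h3
  have := congrFun h3 A
  simp only [Pi.zero_apply] at this
  linear_combination this

/-- Since the rows of Z⁻¹ are products with the columns of Z, each entry of π is a product of a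
differentiated column with a column. This makes the Legendre condition visible: π³₀ = i⟨dZ₀, Z̄₀⟩.
-/
theorem mcForm_apply (hZ : SmoothSU Z V) {x : E} (hx : x ∈ V) (A B : Fin 4) (u : E) :
    mcForm Z A B x u =
      ![-Complex.I * herm (fderiv ℝ (fun y => col (Z y) B) x u) (col (Z x) 3),
        herm (fderiv ℝ (fun y => col (Z y) B) x u) (col (Z x) 1),
        herm (fderiv ℝ (fun y => col (Z y) B) x u) (col (Z x) 2),
        Complex.I * herm (fderiv ℝ (fun y => col (Z y) B) x u) (col (Z x) 0)] A := by
  simp only [herm_eq_sum (fderiv ℝ (fun y => col (Z y) B) x u), hZ.fderiv_col hx]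
  simp only [mcForm, (hZ.unitary x hx).inv_eq, sum_apply,
    smul_apply, smul_eq_mul, Finset.mul_sum]
  fin_cases A <;> simp [dualMatrix, mul_assoc]

/-- The Gram matrix of the columns is constant, so its derivative vanishes. -/
theorem herm_skew (hZ : SmoothSU Z V) {x : E} (hx : x ∈ V) (A B : Fin 4) (u : E) :
    herm (fderiv ℝ (fun y => col (Z y) A) x u) (col (Z x) B) +
      star (herm (fderiv ℝ (fun y => col (Z y) B) x u) (col (Z x) A)) = 0 := by
  rw [star_herm, ← fderiv_herm (hZ.differentiableAt_col hx A) (hZ.differentiableAt_col hx B)]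
  have : (fun y => herm (col (Z y) A) (col (Z y) B)) =ᶠ[nhds x] fun _ => gram A B := by
    filter_upwards [hZ.isOpen.mem_nhds hx] with y hy
    exact (hZ.unitary y hy).herm_col A B
  rw [this.fderiv_eq]; simp

/-- Jacobi's formula: the trace of Z⁻¹dZ is the derivative of det Z, here the constant 1. -/
theorem trace_mcForm (hZ : SmoothSU Z V) {x : E} (hx : x ∈ V) (u : E) :
    ∑ A, mcForm Z A A x u = 0 := by
  have hinv : (Z x)⁻¹ = (Z x).adjugate := by
    rw [Matrix.inv_def, (hZ.unitary x hx).1]; simp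
  have h1 : HasFDerivAt (fun y => (Z y).det)
      (∑ σ : Equiv.Perm (Fin 4), ((Equiv.Perm.sign σ : ℤ) : ℂ) •
        ∑ i, (∏ j ∈ Finset.univ.erase i, Z x (σ j) j) • fderiv ℝ (fun y => Z y (σ i) i) x) x := by
    have : (fun y => (Z y).det) = fun y => ∑ σ : Equiv.Perm (Fin 4),
        ((Equiv.Perm.sign σ : ℤ) : ℂ) * ∏ i, Z y (σ i) i := by
      ext y; rw [Matrix.det_apply']
    rw [this]
    refine HasFDerivAt.fun_sum fun σ _ => ?_
    refine HasFDerivAt.const_mul ?_ _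
    exact HasFDerivAt.finsetProd fun i _ => (hZ.differentiableAt hx (σ i) i).hasFDerivAt
  have h2 : (fun y => (Z y).det) =ᶠ[nhds x] fun _ => 1 := by
    filter_upwards [hZ.isOpen.mem_nhds hx] with y hy
    exact (hZ.unitary y hy).1
  have h3 := congrArg (fun L => L u) (h1.fderiv.symm.trans h2.fderiv_eq)
  simp only [fderiv_fun_const, Pi.zero_apply, zero_apply,
    sum_apply, smul_apply, smul_eq_mul] at h3
  rw [← h3]
  -- Because det Z = 1 the inverse is the adjugate, and Cramer's rule writes each diagonal entry of
  -- π as a determinant with one column differentiated.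
  have h4 : ∀ A, mcForm Z A A x u =
      ((Z x).updateCol A (fun C => fderiv ℝ (fun y => Z y C A) x u)).det := by
    intro A
    rw [← Matrix.cramer_apply, Matrix.cramer_eq_adjugate_mulVec, ← hinv]
    simp [mcForm, Matrix.mulVec, dotProduct]
  simp_rw [h4, Matrix.det_apply', Finset.mul_sum]
  rw [Finset.sum_comm]
  refine Finset.sum_congr rfl fun σ _ => Finset.sum_congr rfl fun i _ => ?_
  rw [← Finset.mul_prod_erase Finset.univ _ (Finset.mem_univ i)]
  have : ∏ j ∈ Finset.univ.erase i,
      (Z x).updateCol i (fun C => fderiv ℝ (fun y => Z y C i) x u) (σ j) j =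
      ∏ j ∈ Finset.univ.erase i, Z x (σ j) j :=
    Finset.prod_congr rfl fun j hj => by
      rw [Matrix.updateCol_ne (Finset.ne_of_mem_erase hj)]
  rw [this]
  simp
  ring

/-- The relations defining the Lie algebra of `SU(3,1)`. -/
theorem star_mcForm (hZ : SmoothSU Z V) {x : E} (hx : x ∈ V) (u : E) :
    star (mcForm Z 3 0 x u) = mcForm Z 3 0 x u ∧
    mcForm Z 3 1 x u = -Complex.I * star (mcForm Z 1 0 x u) ∧
    mcForm Z 3 2 x u = -Complex.I * star (mcForm Z 2 0 x u) ∧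
    mcForm Z 0 1 x u = Complex.I * star (mcForm Z 1 3 x u) ∧
    mcForm Z 0 2 x u = Complex.I * star (mcForm Z 2 3 x u) ∧
    star (mcForm Z 0 3 x u) = mcForm Z 0 3 x u ∧
    mcForm Z 3 3 x u = - star (mcForm Z 0 0 x u) ∧
    star (mcForm Z 1 1 x u) = - mcForm Z 1 1 x u ∧
    star (mcForm Z 2 2 x u) = - mcForm Z 2 2 x u ∧
    mcForm Z 2 1 x u = - star (mcForm Z 1 2 x u) := by
  have I2 := Complex.I_mul_I
  have k := fun A B => hZ.herm_skew hx A B u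
  have k' : ∀ A B, star (herm (fderiv ℝ (fun y => col (Z y) A) x u) (col (Z x) B)) =
      - herm (fderiv ℝ (fun y => col (Z y) B) x u) (col (Z x) A) :=
    fun A B => by linear_combination k B A
  simp only [hZ.mcForm_apply hx, Matrix.cons_val, star_mul', star_neg, k', Complex.star_def,
    Complex.conj_I]
  refine ⟨?_, ?_, ?_, ?_, ?_, ?_, ?_, ?_, ?_, ?_⟩ <;> (try ring_nf) <;> trivial

end SmoothSU

end MaurerCartan

/-! ### Exterior calculus on the plane -/

theorem extD_congr {θ η : Plane → Cov} {x : Plane} (h : θ =ᶠ[nhds x] η) :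
    extD θ x = extD η x := by
  have h' : ∀ v : Plane, (fun y => θ y v) =ᶠ[nhds x] fun y => η y v := fun v =>
    h.mono fun y hy => by simp only [hy]
  simp only [extD, (h' _).fderiv_eq]

theorem fderiv_cov_apply {θ : Plane → Cov} {x : Plane} (h : DifferentiableAt ℝ θ x) (v u : Plane) :
    fderiv ℝ (fun y => θ y v) x u = fderiv ℝ θ x u v := by
  rw [fderiv_clm_apply h (differentiableAt_const v)]; simp

theorem extD_eq {θ : Plane → Cov} {x : Plane} (h : DifferentiableAt ℝ θ x) :
    extD θ x = fderiv ℝ θ x e₁ e₂ - fderiv ℝ θ x e₂ e₁ := by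
  simp only [extD, fderiv_cov_apply h]

theorem extD_add {θ η : Plane → Cov} {x : Plane} (h : DifferentiableAt ℝ θ x)
    (h' : DifferentiableAt ℝ η x) : extD (fun y => θ y + η y) x = extD θ x + extD η x := by
  rw [extD_eq h, extD_eq h', extD_eq (h.fun_add h'), fderiv_fun_add h h']
  simp only [add_apply]; ring

theorem extD_sub {θ η : Plane → Cov} {x : Plane} (h : DifferentiableAt ℝ θ x)
    (h' : DifferentiableAt ℝ η x) : extD (fun y => θ y - η y) x = extD θ x - extD η x := by
  rw [extD_eq h, extD_eq h', extD_eq (h.fun_sub h'), fderiv_fun_sub h h']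
  simp only [sub_apply]; ring

theorem extD_const_smul {θ : Plane → Cov} {x : Plane} (c : ℂ) (h : DifferentiableAt ℝ θ x) :
    extD (fun y => c • θ y) x = c * extD θ x := by
  rw [extD_eq h, extD_eq (h.fun_const_smul c), fderiv_fun_const_smul h]
  simp only [smul_apply, smul_eq_mul]; ring

theorem extD_smul {f : Plane → ℂ} {θ : Plane → Cov} {x : Plane} (hf : DifferentiableAt ℝ f x)
    (h : DifferentiableAt ℝ θ x) :
    extD (fun y => f y • θ y) x = wedge (fderiv ℝ f x) (θ x) + f x * extD θ x := by
  rw [extD_eq h, extD_eq (hf.fun_smul h), fderiv_fun_smul hf h]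
  simp [wedge]; ring

theorem _root_.DifferentiableAt.conjForm {θ : Plane → Cov} {x : Plane}
    (h : DifferentiableAt ℝ θ x) :
    DifferentiableAt ℝ (fun y => WillmoreLegendrian.conjForm (θ y)) x :=
  (ContinuousLinearMap.compL ℝ Plane ℂ ℂ (Complex.conjCLE : ℂ →L[ℝ] ℂ)).differentiableAt.comp x h

theorem extD_conjForm {θ : Plane → Cov} {x : Plane} (h : DifferentiableAt ℝ θ x) :
    extD (fun y => conjForm (θ y)) x = star (extD θ x) := by
  have h' : ∀ v, DifferentiableAt ℝ (fun y => θ y v) x := fun v =>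
    h.clm_apply (differentiableAt_const v)
  have : ∀ v u, fderiv ℝ (fun y => conjForm (θ y) v) x u = star (fderiv ℝ (fun y => θ y v) x u) :=
    fun v u => fderiv_star_apply x u (h' v)
  simp only [extD, this, star_sub]

@[simp] theorem reForm_apply (θ : Cov) (v : Plane) : reForm θ v = ((θ v).re : ℂ) := rfl
@[simp] theorem imForm_apply (θ : Cov) (v : Plane) : imForm θ v = ((θ v).im : ℂ) := rfl
@[simp] theorem conjForm_apply (θ : Cov) (v : Plane) : conjForm θ v = star (θ v) := rfl

theorem cov_ext {θ η : Cov} (h₁ : θ e₁ = η e₁) (h₂ : θ e₂ = η e₂) : θ = η := by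
  ext v
  have hv : v = v 0 • e₁ + v 1 • e₂ := by
    ext i; fin_cases i <;> simp
  rw [hv]; simp only [map_add, map_smul, h₁, h₂]

/-- A covector is a combination of a coframe and its conjugate. -/
theorem eq_coeff_smul {κ : Cov} (hκ : wedge κ (conjForm κ) ≠ 0) (θ : Cov) :
    θ = coeff κ θ • κ + coeffBar κ θ • conjForm κ := by
  apply cov_ext <;>
  · simp only [coeff, coeffBar, add_apply, smul_apply, smul_eq_mul]
    field_simp
    simp only [wedge]; ring

theorem coeff_of_wedge_eq_zero {κ θ : Cov} (hκ : wedge κ (conjForm κ) ≠ 0) (h : wedge κ θ = 0) :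
    θ = coeff κ θ • κ := by
  conv_lhs => rw [eq_coeff_smul hκ θ]
  simp only [coeffBar, h, zero_div]
  ext u; simp

/-! ### Structure equations of an adapted frame -/

theorem IsAdaptedFrame.smoothSU {Y : Plane → PCSphere} {V : Set Plane} {Z : FrameField}
    (hZ : IsAdaptedFrame Y V Z) : SmoothSU (E := Plane) Z V :=
  ⟨hZ.isOpen, hZ.smooth, hZ.unitary⟩

namespace FrameField

/-- The form `β^1_1 - i β^1_2 = h ω`. -/
def eta (Z : FrameField) (x : Plane) : Cov := Z.beta 0 0 x - Complex.I • Z.beta 0 1 x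

/-- The form `μ¹ - i μ² = p ω`. -/
def muC (Z : FrameField) (x : Plane) : Cov := Z.mu 0 x - Complex.I • Z.mu 1 x

end FrameField

/-- The entries at a point of the Maurer-Cartan form of an adapted frame, in terms of the
real forms defined by it. -/
structure MCPattern (Z : FrameField) (x : Plane) : Prop where
  mc00 : Z.mc 0 0 x = Z.phi x
  mc30 : Z.mc 3 0 x = 0
  mc11 : Z.mc 1 1 x = Complex.I • Z.beta 0 0 x
  mc22 : Z.mc 2 2 x = -Complex.I • Z.beta 0 0 x
  mc12 : Z.mc 1 2 x = Z.rho x + Complex.I • Z.beta 0 1 x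
  mc21 : Z.mc 2 1 x = -Z.rho x + Complex.I • Z.beta 0 1 x
  mc31 : Z.mc 3 1 x = -Complex.I • Z.mc 1 0 x
  mc32 : Z.mc 3 2 x = -Complex.I • Z.mc 2 0 x
  mc13 : Z.mc 1 3 x = Z.mu 0 x + Complex.I • Z.nu 0 x
  mc23 : Z.mc 2 3 x = Z.mu 1 x + Complex.I • Z.nu 1 x
  mc01 : Z.mc 0 1 x = Z.nu 0 x + Complex.I • Z.mu 0 x
  mc02 : Z.mc 0 2 x = Z.nu 1 x + Complex.I • Z.mu 1 x
  mc33 : Z.mc 3 3 x = -Z.phi x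
  star10 : ∀ u, star (Z.mc 1 0 x u) = Z.mc 1 0 x u
  star20 : ∀ u, star (Z.mc 2 0 x u) = Z.mc 2 0 x u
  star03 : ∀ u, star (Z.mc 0 3 x u) = Z.mc 0 3 x u
  star_phi : ∀ u, star (Z.phi x u) = Z.phi x u
  star_rho : ∀ u, star (Z.rho x u) = Z.rho x u
  star_beta : ∀ i j u, star (Z.beta i j x u) = Z.beta i j x u
  star_mu : ∀ i u, star (Z.mu i x u) = Z.mu i x u
  star_nu : ∀ i u, star (Z.nu i x u) = Z.nu i x u
  pos : 0 < (wedge (Z.mc 1 0 x) (Z.mc 2 0 x)).re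

/-- An adapted frame of a Legendrian surface: the contact form `π^3_0` vanishes. -/
structure IsLegFrame (Y : Plane → PCSphere) (V : Set Plane) (Z : FrameField) : Prop
    extends IsAdaptedFrame Y V Z where
  leg : ∀ x ∈ V, Z.mc 3 0 x = 0

/-- The symmetry π³₃ = -conj π⁰₀ doubles the imaginary part of π⁰₀ in the vanishing trace. -/
theorem im_trace {V : Set Plane} {Z : FrameField} (hZ : SmoothSU (E := Plane) Z V) {x : Plane} (hx : x ∈ V) (u : Plane) :
    (Z.mc 1 1 x u).im + (Z.mc 2 2 x u).im + 2 * (Z.mc 0 0 x u).im = 0 := by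
  have htr := hZ.trace_mcForm hx u
  have h33 := (hZ.star_mcForm hx u).2.2.2.2.2.2.1
  simp only [← FrameField.mc_eq] at *
  have h := congrArg Complex.im htr
  rw [Fin.sum_univ_four, h33] at h
  simp at h
  linarith

namespace IsLegFrame

variable {Y : Plane → PCSphere} {V : Set Plane} {Z : FrameField}

/-- The normalisation tr β = 0 reads Im π¹₁ + Im π²₂ = 2 Im π⁰₀, while the trace relation has -2 in
place of 2. Both together make π⁰₀ real and give π²₂ = -π¹₁; the other entries follow from the
symmetries of the Lie algebra. -/
theorem pattern (hZ : IsLegFrame Y V Z) {x : Plane} (hx : x ∈ V) : MCPattern Z x := by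
  have k := hZ.smoothSU.star_mcForm hx
  simp only [← FrameField.mc_eq] at k
  have tb : ∀ u, (Z.mc 1 1 x u).im + (Z.mc 2 2 x u).im = 2 * (Z.mc 0 0 x u).im := by
    intro u
    have := congrArg (fun L : Cov => (L u).re) (hZ.trace_beta x hx)
    simp [FrameField.beta, FrameField.conn, FrameField.pos] at this
    linarith
  have t := fun u => im_trace hZ.smoothSU hx u
  have im00 : ∀ u, (Z.mc 0 0 x u).im = 0 := fun u => by linarith [tb u, t u]
  have im22 : ∀ u, (Z.mc 2 2 x u).im = -(Z.mc 1 1 x u).im := fun u => by linarith [tb u, im00 u]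
  have im10 : ∀ u, (Z.mc 1 0 x u).im = 0 := fun u => by
    simpa [FrameField.om, FrameField.pos] using
      congrArg (fun L : Cov => (L u).re) (hZ.real x hx 0)
  have im20 : ∀ u, (Z.mc 2 0 x u).im = 0 := fun u => by
    simpa [FrameField.om, FrameField.pos] using
      congrArg (fun L : Cov => (L u).re) (hZ.real x hx 1)
  have re11 : ∀ u, (Z.mc 1 1 x u).re = 0 := fun u => by
    have := congrArg Complex.re (k u).2.2.2.2.2.2.2.1
    simp at this; linarith
  have re22 : ∀ u, (Z.mc 2 2 x u).re = 0 := fun u => by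
    have := congrArg Complex.re (k u).2.2.2.2.2.2.2.2.1
    simp at this; linarith
  constructor
  case pos => simpa [FrameField.om, FrameField.pos] using hZ.positive x hx
  case mc30 => exact hZ.leg x hx
  case star03 => exact fun u => (k u).2.2.2.2.2.1
  all_goals first | intro i j u | intro i u | intro u | ext u
  all_goals try obtain ⟨-, k31, k32, k01, k02, k03, k33, -, -, k21⟩ := k u
  all_goals
    apply Complex.ext <;>
    simp [FrameField.phi, FrameField.rho, FrameField.alpha, FrameField.beta, FrameField.conn,
      FrameField.pos, FrameField.mu, FrameField.nu, *]

theorem eventually_mem (hZ : IsLegFrame Y V Z) {x : Plane} (hx : x ∈ V) : ∀ᶠ y in nhds x, y ∈ V :=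
  hZ.isOpen.mem_nhds hx

theorem extD_mc (hZ : IsLegFrame Y V Z) {x : Plane} (hx : x ∈ V) (A B : Fin 4) :
    extD (fun y => Z.mc A B y) x = - ∑ C, wedge (Z.mc A C x) (Z.mc C B x) :=
  hZ.smoothSU.maurerCartan hx A B e₁ e₂

theorem differentiableAt_mc (hZ : IsLegFrame Y V Z) {x : Plane} (hx : x ∈ V) (A B : Fin 4) :
    DifferentiableAt ℝ (fun y => Z.mc A B y) x := hZ.smoothSU.differentiableAt_mcForm hx A B

theorem omega_eq (Z : FrameField) (y : Plane) :
    Z.omega y = Z.mc 1 0 y + Complex.I • Z.mc 2 0 y := rfl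

theorem conj_omega_eq (hZ : IsLegFrame Y V Z) {y : Plane} (hy : y ∈ V) :
    conjForm (Z.omega y) = Z.mc 1 0 y - Complex.I • Z.mc 2 0 y := by
  have P := hZ.pattern hy
  ext u
  simp only [omega_eq, conjForm_apply, add_apply, sub_apply, smul_apply, smul_eq_mul, star_add,
    star_mul', P.star10, P.star20, Complex.star_def, Complex.conj_I]
  ring

/-- Taking imaginary parts does not commute with the complex Maurer-Cartan equations. Writing η as a
complex-linear combination of entries of π lets dη and ∂ₜη be read off from them directly. The same
device is used for μ. -/
theorem eta_eq (hZ : IsLegFrame Y V Z) {y : Plane} (hy : y ∈ V) :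
    Z.eta y = -Complex.I • Z.mc 1 1 y - (2⁻¹ : ℂ) • (Z.mc 1 2 y + Z.mc 2 1 y) := by
  have P := hZ.pattern hy
  ext u
  simp only [P.mc11, P.mc12, P.mc21, FrameField.eta, neg_apply, add_apply, sub_apply, smul_apply,
    smul_eq_mul]
  linear_combination (Z.beta 0 0 y u) * Complex.I_mul_I

theorem muC_eq (hZ : IsLegFrame Y V Z) {y : Plane} (hy : y ∈ V) :
    Z.muC y = (2⁻¹ : ℂ) • (Z.mc 1 3 y - Complex.I • Z.mc 0 1 y) -
      (Complex.I * 2⁻¹ : ℂ) • (Z.mc 2 3 y - Complex.I • Z.mc 0 2 y) := by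
  have P := hZ.pattern hy
  ext u
  simp only [P.mc13, P.mc23, P.mc01, P.mc02, FrameField.muC, add_apply, sub_apply, smul_apply,
    smul_eq_mul]
  linear_combination (2⁻¹ * Z.mu 0 y u - 2⁻¹ * Complex.I * Z.mu 1 y u) * Complex.I_mul_I

theorem wedge_omega (hZ : IsLegFrame Y V Z) {x : Plane} (hx : x ∈ V) :
    wedge (Z.omega x) (conjForm (Z.omega x)) =
      -2 * Complex.I * wedge (Z.mc 1 0 x) (Z.mc 2 0 x) := by
  rw [hZ.conj_omega_eq hx, omega_eq]
  simp only [wedge, add_apply, sub_apply, smul_apply, smul_eq_mul]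
  ring

theorem wedge_omega_ne (hZ : IsLegFrame Y V Z) {x : Plane} (hx : x ∈ V) :
    wedge (Z.omega x) (conjForm (Z.omega x)) ≠ 0 := by
  rw [hZ.wedge_omega hx]
  have h := (hZ.pattern hx).pos
  have : wedge (Z.mc 1 0 x) (Z.mc 2 0 x) ≠ 0 := by
    intro h0; rw [h0] at h; simp at h
  simp [this]

theorem differentiableAt_omega (hZ : IsLegFrame Y V Z) {x : Plane} (hx : x ∈ V) :
    DifferentiableAt ℝ (fun y => Z.omega y) x :=
  (hZ.differentiableAt_mc hx 1 0).add ((hZ.differentiableAt_mc hx 2 0).fun_const_smul _)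

/-- The Maurer-Cartan equations evaluated on an adapted frame. -/
theorem extD_mc_apply (hZ : IsLegFrame Y V Z) {x : Plane} (hx : x ∈ V) (A B : Fin 4) :
    extD (fun y => Z.mc A B y) x =
      - (wedge (Z.mc A 0 x) (Z.mc 0 B x) + wedge (Z.mc A 1 x) (Z.mc 1 B x) +
        wedge (Z.mc A 2 x) (Z.mc 2 B x) + wedge (Z.mc A 3 x) (Z.mc 3 B x)) := by
  rw [hZ.extD_mc hx, Fin.sum_univ_four]

/-- The relations π³ᵢ = -iπⁱ₀ give two expressions for dωⁱ. Their mean contains no β and is the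
stated equation; their difference is a constraint on β, recorded in `wedge_eta`. -/
theorem extD_omega (hZ : IsLegFrame Y V Z) {x : Plane} (hx : x ∈ V) :
    extD (fun y => Z.omega y) x = wedge (Z.phi x + Complex.I • Z.rho x) (Z.omega x) := by
  have P := hZ.pattern hx
  have h1 := hZ.extD_mc_apply hx 1 0
  have h2 := hZ.extD_mc_apply hx 2 0
  have h3 := hZ.extD_mc_apply hx 3 1
  have h4 := hZ.extD_mc_apply hx 3 2
  have c3 : extD (fun y => Z.mc 3 1 y) x = -Complex.I * extD (fun y => Z.mc 1 0 y) x := by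
    rw [← extD_const_smul _ (hZ.differentiableAt_mc hx 1 0)]
    exact extD_congr ((hZ.eventually_mem hx).mono fun y hy => (hZ.pattern hy).mc31)
  have c4 : extD (fun y => Z.mc 3 2 y) x = -Complex.I * extD (fun y => Z.mc 2 0 y) x := by
    rw [← extD_const_smul _ (hZ.differentiableAt_mc hx 2 0)]
    exact extD_congr ((hZ.eventually_mem hx).mono fun y hy => (hZ.pattern hy).mc32)
  have e : extD (fun y => Z.omega y) x =
      extD (fun y => Z.mc 1 0 y) x + Complex.I * extD (fun y => Z.mc 2 0 y) x := by
    rw [← extD_const_smul _ (hZ.differentiableAt_mc hx 2 0),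
      ← extD_add (hZ.differentiableAt_mc hx 1 0) ((hZ.differentiableAt_mc hx 2 0).fun_const_smul _)]
    rfl
  rw [e, omega_eq]
  rw [c3] at h3
  rw [c4] at h4
  simp only [P.mc00, P.mc30, P.mc11, P.mc22, P.mc12, P.mc21, P.mc31, P.mc32, P.mc33, wedge,
    add_apply, neg_apply, smul_apply, zero_apply, smul_eq_mul] at h1 h2 h3 h4 ⊢
  linear_combination (norm := (ring_nf; simp only [Complex.I_sq, Complex.I_pow_three]; ring)) h1 / 2 + Complex.I * h2 / 2 + Complex.I * h3 / 2 - h4 / 2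

/-- Comparing dπ³ᵢ with -i dπⁱ₀ shows that β is symmetric as a quadratic form in ω¹, ω². As it is
also trace free, η has no ω̄ component. -/
theorem wedge_eta (hZ : IsLegFrame Y V Z) {x : Plane} (hx : x ∈ V) :
    wedge (Z.omega x) (Z.eta x) = 0 := by
  have P := hZ.pattern hx
  have h1 := hZ.extD_mc_apply hx 1 0
  have h2 := hZ.extD_mc_apply hx 2 0
  have h3 := hZ.extD_mc_apply hx 3 1
  have h4 := hZ.extD_mc_apply hx 3 2
  have c3 : extD (fun y => Z.mc 3 1 y) x = -Complex.I * extD (fun y => Z.mc 1 0 y) x := by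
    rw [← extD_const_smul _ (hZ.differentiableAt_mc hx 1 0)]
    exact extD_congr ((hZ.eventually_mem hx).mono fun y hy => (hZ.pattern hy).mc31)
  have c4 : extD (fun y => Z.mc 3 2 y) x = -Complex.I * extD (fun y => Z.mc 2 0 y) x := by
    rw [← extD_const_smul _ (hZ.differentiableAt_mc hx 2 0)]
    exact extD_congr ((hZ.eventually_mem hx).mono fun y hy => (hZ.pattern hy).mc32)
  rw [c3, h1] at h3
  rw [c4, h2] at h4
  rw [omega_eq]
  simp only [P.mc00, P.mc30, P.mc11, P.mc22, P.mc12, P.mc21, P.mc31, P.mc32, P.mc33, wedge,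
    add_apply, sub_apply, neg_apply, smul_apply, zero_apply, smul_eq_mul, FrameField.eta] at h3 h4 ⊢
  ring_nf at h3 h4 ⊢
  simp only [Complex.I_sq] at h3 h4 ⊢
  ring_nf at h3 h4 ⊢
  linear_combination h3 / 2 - Complex.I * h4 / 2

/-- Obtained from dπ³₃ = -dπ⁰₀. It expresses the symmetry of the matrix p_{ij}. -/
theorem mu_wedge_om (hZ : IsLegFrame Y V Z) {x : Plane} (hx : x ∈ V) :
    wedge (Z.mu 0 x) (Z.mc 1 0 x) + wedge (Z.mu 1 x) (Z.mc 2 0 x) = 0 := by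
  have P := hZ.pattern hx
  have h1 := hZ.extD_mc_apply hx 0 0
  have h2 := hZ.extD_mc_apply hx 3 3
  have c : extD (fun y => Z.mc 3 3 y) x = -1 * extD (fun y => Z.mc 0 0 y) x := by
    rw [← extD_const_smul _ (hZ.differentiableAt_mc hx 0 0)]
    refine extD_congr ((hZ.eventually_mem hx).mono fun y hy => ?_)
    ext u
    simp [(hZ.pattern hy).mc33, (hZ.pattern hy).mc00]
  rw [c, h1] at h2
  simp only [P.mc00, P.mc30, P.mc13, P.mc23, P.mc01, P.mc02, P.mc31, P.mc32, P.mc33, wedge,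
    add_apply, neg_apply, smul_apply, zero_apply, smul_eq_mul] at h2 ⊢
  ring_nf at h2 ⊢
  simp only [Complex.I_sq] at h2 ⊢
  linear_combination (norm := (ring_nf; simp only [Complex.I_sq]; ring)) (-Complex.I / 2) * h2

/-- Here the normalisation tr(p_{ij}) = 0 enters. Symmetry and vanishing trace together leave μ¹ -
iμ² without an ω̄ component. -/
theorem mu_wedge_om' (hZ : IsLegFrame Y V Z) {x : Plane} (hx : x ∈ V) :
    wedge (Z.mu 0 x) (Z.mc 2 0 x) - wedge (Z.mu 1 x) (Z.mc 1 0 x) = 0 := by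
  obtain ⟨A, tr, hA⟩ := hZ.trace_p x hx
  have a1 := hA 0
  have a2 := hA 1
  rw [Matrix.trace_fin_two] at tr
  simp only [Fin.sum_univ_two, FrameField.om, FrameField.pos] at a1 a2
  norm_num at a1 a2
  have tr' : (A 0 0 : ℂ) + A 1 1 = 0 := by exact_mod_cast tr
  simp only [wedge, add_apply, smul_apply, a1, a2, Complex.real_smul]
  linear_combination (Z.mc 1 0 x e₁ * Z.mc 2 0 x e₂ - Z.mc 1 0 x e₂ * Z.mc 2 0 x e₁) * tr'

theorem wedge_muC (hZ : IsLegFrame Y V Z) {x : Plane} (hx : x ∈ V) :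
    wedge (Z.omega x) (Z.muC x) = 0 := by
  have h1 := hZ.mu_wedge_om hx
  have h2 := hZ.mu_wedge_om' hx
  rw [omega_eq]
  simp only [wedge, add_apply, sub_apply, smul_apply, smul_eq_mul, FrameField.muC] at h1 h2 ⊢
  linear_combination (norm := (ring_nf; simp only [Complex.I_sq]; ring)) -h1 - Complex.I * h2

theorem eta_eq_smul (hZ : IsLegFrame Y V Z) {x : Plane} (hx : x ∈ V) :
    Z.eta x = Z.h x • Z.omega x :=
  coeff_of_wedge_eq_zero (hZ.wedge_omega_ne hx) (hZ.wedge_eta hx)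

theorem muC_eq_smul (hZ : IsLegFrame Y V Z) {x : Plane} (hx : x ∈ V) :
    Z.muC x = Z.p x • Z.omega x :=
  coeff_of_wedge_eq_zero (hZ.wedge_omega_ne hx) (hZ.wedge_muC hx)

/-- π⁰₃ is real-valued, so its ω̄ coefficient is the conjugate of its ω coefficient. -/
theorem kappa_eq (hZ : IsLegFrame Y V Z) {x : Plane} (hx : x ∈ V) :
    Z.mc 0 3 x = Z.q x • Z.omega x + star (Z.q x) • conjForm (Z.omega x) := by
  have P := hZ.pattern hx
  have : coeffBar (Z.omega x) (Z.mc 0 3 x) = star (Z.q x) := by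
    simp only [coeffBar, FrameField.q, coeff, star_div₀]
    rw [← neg_div_neg_eq]
    congr 1 <;> simp only [wedge, conjForm_apply, star_sub, star_mul', star_star, P.star03] <;> ring
  rw [← this]
  exact eq_coeff_smul (hZ.wedge_omega_ne hx) _

/-- The term μ ∧ ω̄ is what ties p to the ω̄-derivative of h; in `extD_muC` the term -ω̄ ∧ κ plays
the same role for q and p. -/
theorem extD_eta (hZ : IsLegFrame Y V Z) {x : Plane} (hx : x ∈ V) :
    extD (fun y => Z.eta y) x =
      -2 * Complex.I * wedge (Z.rho x) (Z.eta x) + wedge (Z.muC x) (conjForm (Z.omega x)) := by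
  have P := hZ.pattern hx
  have h1 := hZ.extD_mc_apply hx 1 1
  have h2 := hZ.extD_mc_apply hx 1 2
  have h3 := hZ.extD_mc_apply hx 2 1
  have m1 := hZ.mu_wedge_om hx
  have d := hZ.differentiableAt_mc hx
  have e : extD (fun y => Z.eta y) x = -Complex.I * extD (fun y => Z.mc 1 1 y) x -
      2⁻¹ * (extD (fun y => Z.mc 1 2 y) x + extD (fun y => Z.mc 2 1 y) x) := by
    rw [← extD_add (d 1 2) (d 2 1), ← extD_const_smul _ (d 1 1),
      ← extD_const_smul _ ((d 1 2).fun_add (d 2 1)),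
      ← extD_sub ((d 1 1).fun_const_smul _) (((d 1 2).fun_add (d 2 1)).fun_const_smul _)]
    exact extD_congr ((hZ.eventually_mem hx).mono fun y hy => hZ.eta_eq hy)
  rw [e, hZ.conj_omega_eq hx, h1, h2, h3]
  simp only [P.mc11, P.mc22, P.mc12, P.mc21, P.mc31, P.mc32, P.mc13, P.mc23, P.mc01, P.mc02, wedge,
    add_apply, sub_apply, neg_apply, smul_apply, smul_eq_mul, FrameField.muC, FrameField.eta] at m1 ⊢
  linear_combination (norm := (ring_nf; simp only [Complex.I_sq, Complex.I_pow_three]; ring)) m1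

theorem extD_muC (hZ : IsLegFrame Y V Z) {x : Plane} (hx : x ∈ V) :
    extD (fun y => Z.muC y) x = - wedge (conjForm (Z.omega x)) (Z.mc 0 3 x) -
      wedge (Z.phi x + Complex.I • Z.rho x) (Z.muC x) + wedge (Z.eta x) (Z.nuC x) := by
  have P := hZ.pattern hx
  have h1 := hZ.extD_mc_apply hx 1 3
  have h2 := hZ.extD_mc_apply hx 0 1
  have h3 := hZ.extD_mc_apply hx 2 3
  have h4 := hZ.extD_mc_apply hx 0 2
  have d := hZ.differentiableAt_mc hx
  have e : extD (fun y => Z.muC y) x =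
      2⁻¹ * (extD (fun y => Z.mc 1 3 y) x - Complex.I * extD (fun y => Z.mc 0 1 y) x) -
      (Complex.I * 2⁻¹) * (extD (fun y => Z.mc 2 3 y) x -
        Complex.I * extD (fun y => Z.mc 0 2 y) x) := by
    rw [← extD_const_smul _ (d 0 1), ← extD_const_smul _ (d 0 2),
      ← extD_sub (d 1 3) ((d 0 1).fun_const_smul _), ← extD_sub (d 2 3) ((d 0 2).fun_const_smul _),
      ← extD_const_smul _ ((d 1 3).fun_sub ((d 0 1).fun_const_smul _)),
      ← extD_const_smul _ ((d 2 3).fun_sub ((d 0 2).fun_const_smul _)),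
      ← extD_sub (((d 1 3).fun_sub ((d 0 1).fun_const_smul _)).fun_const_smul _)
        (((d 2 3).fun_sub ((d 0 2).fun_const_smul _)).fun_const_smul _)]
    exact extD_congr ((hZ.eventually_mem hx).mono fun y hy => hZ.muC_eq hy)
  rw [e, hZ.conj_omega_eq hx, h1, h2, h3, h4]
  simp only [P.mc00, P.mc11, P.mc22, P.mc12, P.mc21, P.mc31, P.mc32, P.mc13, P.mc23, P.mc01, P.mc02,
    P.mc33, wedge, add_apply, sub_apply, neg_apply, smul_apply, smul_eq_mul, FrameField.muC,
    FrameField.eta, FrameField.nuC]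
  ring_nf; simp only [Complex.I_sq, Complex.I_pow_three, Complex.I_pow_four]; ring

theorem extD_kappa (hZ : IsLegFrame Y V Z) {x : Plane} (hx : x ∈ V) :
    extD (fun y => Z.mc 0 3 y) x = -2 * wedge (Z.phi x) (Z.mc 0 3 x) -
      wedge (Z.nuC x) (Z.muC x) - star (wedge (Z.nuC x) (Z.muC x)) := by
  have P := hZ.pattern hx
  rw [hZ.extD_mc_apply hx 0 3]
  simp only [P.mc00, P.mc13, P.mc23, P.mc01, P.mc02, P.mc33, wedge, add_apply, sub_apply, neg_apply,
    smul_apply, smul_eq_mul, FrameField.muC, FrameField.nuC, star_sub, star_mul', star_add,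
    P.star_mu, P.star_nu, Complex.star_def, Complex.conj_I]
  ring_nf; simp only [Complex.I_sq]; ring

/-! ### Smoothness of the structure coefficients -/

theorem contDiffOn_mc (hZ : IsLegFrame Y V Z) (A B : Fin 4) :
    ContDiffOn ℝ ∞ (fun y => Z.mc A B y) V := hZ.smoothSU.contDiffOn_mcForm A B

theorem contDiffOn_omega (hZ : IsLegFrame Y V Z) : ContDiffOn ℝ ∞ Z.omega V :=
  (hZ.contDiffOn_mc 1 0).add (contDiffOn_const.fun_smul (hZ.contDiffOn_mc 2 0))

end IsLegFrame

/-! ### Smoothness of forms and of their coefficients -/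

theorem _root_.ContDiffOn.wedge {E : Type*} [NormedAddCommGroup E] [NormedSpace ℝ E]
    {θ η : E → Cov} {V : Set E} {n : WithTop ℕ∞} (hθ : ContDiffOn ℝ n θ V)
    (hη : ContDiffOn ℝ n η V) : ContDiffOn ℝ n (fun y => wedge (θ y) (η y)) V := by
  unfold WillmoreLegendrian.wedge
  exact ((hθ.clm_apply contDiffOn_const).mul (hη.clm_apply contDiffOn_const)).sub
    ((hθ.clm_apply contDiffOn_const).mul (hη.clm_apply contDiffOn_const))

theorem _root_.ContDiffOn.conjForm {E : Type*} [NormedAddCommGroup E] [NormedSpace ℝ E]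
    {θ : E → Cov} {V : Set E} {n : WithTop ℕ∞} (hθ : ContDiffOn ℝ n θ V) :
    ContDiffOn ℝ n (fun y => conjForm (θ y)) V :=
  (ContinuousLinearMap.compL ℝ Plane ℂ ℂ (Complex.conjCLE : ℂ →L[ℝ] ℂ)).contDiff.comp_contDiffOn hθ

theorem _root_.ContDiffOn.reForm {E : Type*} [NormedAddCommGroup E] [NormedSpace ℝ E]
    {θ : E → Cov} {V : Set E} {n : WithTop ℕ∞} (hθ : ContDiffOn ℝ n θ V) :
    ContDiffOn ℝ n (fun y => reForm (θ y)) V :=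
  (ContinuousLinearMap.compL ℝ Plane ℂ ℂ
    (Complex.ofRealCLM.comp Complex.reCLM)).contDiff.comp_contDiffOn hθ

theorem _root_.ContDiffOn.imForm {E : Type*} [NormedAddCommGroup E] [NormedSpace ℝ E]
    {θ : E → Cov} {V : Set E} {n : WithTop ℕ∞} (hθ : ContDiffOn ℝ n θ V) :
    ContDiffOn ℝ n (fun y => imForm (θ y)) V :=
  (ContinuousLinearMap.compL ℝ Plane ℂ ℂ
    (Complex.ofRealCLM.comp Complex.imCLM)).contDiff.comp_contDiffOn hθ

namespace IsLegFrame

variable {Y : Plane → PCSphere} {V : Set Plane} {Z : FrameField}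

theorem contDiffOn_beta (hZ : IsLegFrame Y V Z) (i j : Fin 2) :
    ContDiffOn ℝ ∞ (Z.beta i j) V := by
  refine ContDiffOn.imForm ?_
  refine (hZ.contDiffOn_mc _ _).sub ?_
  split_ifs
  · exact hZ.contDiffOn_mc _ _
  · exact contDiffOn_const

theorem contDiffOn_eta (hZ : IsLegFrame Y V Z) : ContDiffOn ℝ ∞ Z.eta V :=
  (hZ.contDiffOn_beta 0 0).sub (contDiffOn_const.fun_smul (hZ.contDiffOn_beta 0 1))

theorem contDiffOn_muC (hZ : IsLegFrame Y V Z) : ContDiffOn ℝ ∞ Z.muC V :=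
  (hZ.contDiffOn_mc _ _).reForm.sub (contDiffOn_const.fun_smul (hZ.contDiffOn_mc _ _).reForm)

theorem contDiffOn_nuC (hZ : IsLegFrame Y V Z) : ContDiffOn ℝ ∞ Z.nuC V :=
  (hZ.contDiffOn_mc _ _).imForm.add (contDiffOn_const.fun_smul (hZ.contDiffOn_mc _ _).imForm)

theorem contDiffOn_phi (hZ : IsLegFrame Y V Z) : ContDiffOn ℝ ∞ Z.phi V :=
  (hZ.contDiffOn_mc _ _).reForm

theorem contDiffOn_rho (hZ : IsLegFrame Y V Z) : ContDiffOn ℝ ∞ Z.rho V := by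
  refine ContDiffOn.reForm ((hZ.contDiffOn_mc _ _).sub ?_)
  split_ifs
  · exact hZ.contDiffOn_mc _ _
  · exact contDiffOn_const

theorem contDiffOn_coeff (hZ : IsLegFrame Y V Z) {θ : Plane → Cov} (hθ : ContDiffOn ℝ ∞ θ V) :
    ContDiffOn ℝ ∞ (fun y => coeff (Z.omega y) (θ y)) V := by
  unfold coeff
  simp only [div_eq_mul_inv]
  exact (hθ.wedge hZ.contDiffOn_omega.conjForm).mul
    ((hZ.contDiffOn_omega.wedge hZ.contDiffOn_omega.conjForm).inv fun x hx => hZ.wedge_omega_ne hx)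

theorem contDiffOn_h (hZ : IsLegFrame Y V Z) : ContDiffOn ℝ ∞ Z.h V :=
  hZ.contDiffOn_coeff hZ.contDiffOn_eta

theorem contDiffOn_p (hZ : IsLegFrame Y V Z) : ContDiffOn ℝ ∞ Z.p V :=
  hZ.contDiffOn_coeff hZ.contDiffOn_muC

theorem contDiffOn_q (hZ : IsLegFrame Y V Z) : ContDiffOn ℝ ∞ Z.q V :=
  hZ.contDiffOn_coeff (hZ.contDiffOn_mc 0 3)

theorem _root_.ContDiffOn.differentiableAt_top {E F : Type*} [NormedAddCommGroup E]
    [NormedSpace ℝ E] [NormedAddCommGroup F] [NormedSpace ℝ F] {f : E → F} {V : Set E}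
    (hf : ContDiffOn ℝ ∞ f V) (hV : IsOpen V) {x : E} (hx : x ∈ V) : DifferentiableAt ℝ f x :=
  (hf.contDiffAt (hV.mem_nhds hx)).differentiableAt (by simp)

theorem contDiffOn_r (hZ : IsLegFrame Y V Z) : ContDiffOn ℝ ∞ Z.r V := by
  unfold FrameField.r coeffBar
  simp only [div_eq_mul_inv]
  refine ContDiffOn.neg (ContDiffOn.mul (ContDiffOn.wedge hZ.contDiffOn_omega ?_)
    ((hZ.contDiffOn_omega.wedge hZ.contDiffOn_omega.conjForm).inv
      fun x hx => hZ.wedge_omega_ne hx))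
  refine ContDiffOn.add (ContDiffOn.add (hZ.contDiffOn_q.fderiv_of_isOpen hZ.isOpen (by simp))
    (hZ.contDiffOn_q.fun_smul ?_)) (hZ.contDiffOn_p.fun_smul hZ.contDiffOn_nuC)
  exact (contDiffOn_const.fun_smul hZ.contDiffOn_rho).add (contDiffOn_const.fun_smul hZ.contDiffOn_phi)

/-! ### Derivatives of the structure coefficients -/

/-- Exterior derivative of η = hω; wedging with ω keeps exactly the ω̄-derivative of h. -/
theorem wedge_dh (hZ : IsLegFrame Y V Z) {x : Plane} (hx : x ∈ V) :
    wedge (fderiv ℝ Z.h x) (Z.omega x) = extD Z.eta x - Z.h x * extD Z.omega x := by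
  have := extD_smul (hZ.contDiffOn_h.differentiableAt_top hZ.isOpen hx)
    (hZ.contDiffOn_omega.differentiableAt_top hZ.isOpen hx)
  rw [extD_congr (η := Z.eta) ((hZ.eventually_mem hx).mono fun y hy => (hZ.eta_eq_smul hy).symm)]
    at this
  linear_combination -this

theorem wedge_dp (hZ : IsLegFrame Y V Z) {x : Plane} (hx : x ∈ V) :
    wedge (fderiv ℝ Z.p x) (Z.omega x) = extD Z.muC x - Z.p x * extD Z.omega x := by
  have := extD_smul (hZ.contDiffOn_p.differentiableAt_top hZ.isOpen hx)
    (hZ.contDiffOn_omega.differentiableAt_top hZ.isOpen hx)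
  rw [extD_congr (η := Z.muC) ((hZ.eventually_mem hx).mono fun y hy => (hZ.muC_eq_smul hy).symm)]
    at this
  linear_combination -this

theorem wedge_dq (hZ : IsLegFrame Y V Z) {x : Plane} (hx : x ∈ V) :
    wedge (fderiv ℝ Z.q x) (Z.omega x) =
      Z.r x * wedge (Z.omega x) (conjForm (Z.omega x)) - Z.p x * wedge (Z.nuC x) (Z.omega x)
      - Z.q x * wedge (Complex.I • Z.rho x + (3 : ℂ) • Z.phi x) (Z.omega x) := by
  have hne := hZ.wedge_omega_ne hx
  simp only [FrameField.r, coeffBar]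
  field_simp
  simp only [wedge, add_apply, smul_apply, smul_eq_mul]
  ring

/-- κ is real, so dκ = d(qω) + conj d(qω). Here r enters through r ω∧ω̄, and ω∧ω̄ is imaginary, so
the sum contains (r - r̄) ω∧ω̄. The remaining terms match the structure equation for dκ. -/
theorem star_r (hZ : IsLegFrame Y V Z) {x : Plane} (hx : x ∈ V) : star (Z.r x) = Z.r x := by
  have hne := hZ.wedge_omega_ne hx
  have P := hZ.pattern hx
  have dq := hZ.wedge_dq hx
  have dom := hZ.extD_omega hx
  have dk := hZ.extD_kappa hx
  have hq := hZ.contDiffOn_q.differentiableAt_top hZ.isOpen hx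
  have hom := hZ.contDiffOn_omega.differentiableAt_top hZ.isOpen hx
  have e : extD (fun y => Z.mc 0 3 y) x = extD (fun y => Z.q y • Z.omega y) x +
      star (extD (fun y => Z.q y • Z.omega y) x) := by
    rw [← extD_conjForm (hq.fun_smul hom), ← extD_add (hq.fun_smul hom) (hq.fun_smul hom).conjForm]
    refine extD_congr ((hZ.eventually_mem hx).mono fun y hy => ?_)
    simp only
    rw [hZ.kappa_eq hy]
    ext u; simp
  rw [extD_smul hq hom, dq] at e
  rw [dom] at e
  rw [dk, hZ.kappa_eq hx] at e
  rw [hZ.muC_eq_smul hx] at e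
  have : (Z.r x - star (Z.r x)) * wedge (Z.omega x) (conjForm (Z.omega x)) = 0 := by
    simp only [wedge, add_apply, smul_apply, smul_eq_mul, conjForm_apply, star_add, star_sub,
      star_mul', star_star, P.star_phi, P.star_rho] at e ⊢
    simp only [Complex.star_def, Complex.conj_I, map_ofNat] at e ⊢
    simp only [← Complex.star_def] at e ⊢
    linear_combination -e
  rcases mul_eq_zero.1 this with h | h
  · exact (sub_eq_zero.1 h).symm
  · exact absurd h hne

/-- `∂̄ Φ = - h r ω̄⁴`-type formula: the failure of `Φ` to be holomorphic is `h r`. -/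
theorem dbarQuartic_eq (hZ : IsLegFrame Y V Z) {x : Plane} (hx : x ∈ V) :
    dbarQuartic Z.omega Z.quartic x =
      Z.h x * Z.r x * wedge (Z.omega x) (conjForm (Z.omega x)) := by
  have hh := hZ.contDiffOn_h.differentiableAt_top hZ.isOpen hx
  have hp := hZ.contDiffOn_p.differentiableAt_top hZ.isOpen hx
  have hq := hZ.contDiffOn_q.differentiableAt_top hZ.isOpen hx
  have d : fderiv ℝ Z.quartic x = Z.q x • fderiv ℝ Z.h x + Z.h x • fderiv ℝ Z.q x
      - Z.p x • fderiv ℝ Z.p x := by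
    have : HasFDerivAt Z.quartic (Z.h x • fderiv ℝ Z.q x + Z.q x • fderiv ℝ Z.h x -
        (1 / 2 : ℂ) • ((2 • Z.p x ^ (2 - 1)) • fderiv ℝ Z.p x)) x :=
      (hh.hasFDerivAt.mul hq.hasFDerivAt).sub ((hp.hasFDerivAt.pow 2).const_mul (1 / 2 : ℂ))
    rw [this.fderiv]
    ext u
    simp; ring
  have k : wedge (fderiv ℝ Z.quartic x) (Z.omega x) = Z.q x * wedge (fderiv ℝ Z.h x) (Z.omega x) +
      Z.h x * wedge (fderiv ℝ Z.q x) (Z.omega x) - Z.p x * wedge (fderiv ℝ Z.p x) (Z.omega x) := by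
    rw [d]; simp only [wedge, add_apply, sub_apply, smul_apply, smul_eq_mul]; ring
  have dom := hZ.extD_omega hx
  have deta := hZ.extD_eta hx
  have dmu := hZ.extD_muC hx
  -- The term pq ω∧ω̄ coming from q dh cancels the one coming from p dp, the two terms in hp ν∧ω
  -- cancel each other, and the connection forms cancel against 4Φ dω. Only h r ω∧ω̄, from h dq,
  -- survives.
  rw [dbarQuartic, k, hZ.wedge_dh hx, hZ.wedge_dp hx, hZ.wedge_dq hx]
  simp only [FrameField.quartic]
  rw [dom, deta, dmu, hZ.kappa_eq hx, hZ.muC_eq_smul hx, hZ.eta_eq_smul hx]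
  simp only [wedge, add_apply, smul_apply, smul_eq_mul, conjForm_apply]
  ring

/-- If `h` vanishes near a point, then `r` vanishes there. -/
theorem r_eq_zero_of_h (hZ : IsLegFrame Y V Z) {x : Plane} (hx : x ∈ V)
    (hh : ∀ᶠ y in nhds x, Z.h y = 0) : Z.r x = 0 := by
  -- When h vanishes near y, so does η, and the equation for dη reduces to 0 = p ω∧ω̄.
  have step_p : ∀ y ∈ V, (∀ᶠ z in nhds y, Z.h z = 0) → Z.p y = 0 := by
    intro y hy hy0
    have e := hZ.wedge_dh hy
    have h0 : Z.h y = 0 := hy0.self_of_nhds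
    have : fderiv ℝ Z.h y = 0 := by
      rw [(show Z.h =ᶠ[nhds y] fun _ => 0 from hy0).fderiv_eq]; simp
    have deta := hZ.extD_eta hy
    rw [this, h0, deta, hZ.eta_eq_smul hy, h0, hZ.muC_eq_smul hy] at e
    have hne := hZ.wedge_omega_ne hy
    have : Z.p y * wedge (Z.omega y) (conjForm (Z.omega y)) = 0 := by
      simp only [wedge, smul_apply, smul_eq_mul, zero_apply, conjForm_apply] at e ⊢
      linear_combination -e
    simpa [hne] using this
  -- When h and p vanish near y, the equation for dμ reduces to -ω̄∧κ = q ω∧ω̄ = 0.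
  have step_q : ∀ y ∈ V, (∀ᶠ z in nhds y, Z.h z = 0) → Z.q y = 0 := by
    intro y hy hy0
    have e := hZ.wedge_dp hy
    have h0 : Z.h y = 0 := hy0.self_of_nhds
    have hp : ∀ᶠ z in nhds y, Z.p z = 0 := by
      filter_upwards [hZ.eventually_mem hy, hy0.eventually_nhds] with z hz hz0 using step_p z hz hz0
    have : fderiv ℝ Z.p y = 0 := by
      rw [(show Z.p =ᶠ[nhds y] fun _ => 0 from hp).fderiv_eq]; simp
    have dmu := hZ.extD_muC hy
    rw [this, hp.self_of_nhds, dmu, hZ.eta_eq_smul hy, h0, hZ.muC_eq_smul hy, hp.self_of_nhds,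
      hZ.kappa_eq hy] at e
    have hne := hZ.wedge_omega_ne hy
    have : Z.q y * wedge (Z.omega y) (conjForm (Z.omega y)) = 0 := by
      simp only [wedge, add_apply, smul_apply, smul_eq_mul, zero_apply, conjForm_apply] at e ⊢
      linear_combination -e
    simpa [hne] using this
  have hp : Z.p x = 0 := step_p x hx hh
  have hq : ∀ᶠ z in nhds x, Z.q z = 0 := by
    filter_upwards [hZ.eventually_mem hx, hh.eventually_nhds] with z hz hz0 using step_q z hz hz0
  have : fderiv ℝ Z.q x = 0 := by
    rw [(show Z.q =ᶠ[nhds x] fun _ => 0 from hq).fderiv_eq]; simp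
  simp only [FrameField.r, this, hp, hq.self_of_nhds]
  simp [coeffBar, wedge]

/-- From h r = 0 alone r = 0 does not follow pointwise. If r(x) ≠ 0, continuity gives r ≠ 0 and
hence h = 0 in a neighbourhood of x, which forces r(x) = 0. -/
theorem dbarQuartic_eq_zero_iff (hZ : IsLegFrame Y V Z) :
    (∀ x ∈ V, dbarQuartic Z.omega Z.quartic x = 0) ↔ ∀ x ∈ V, Z.r x = 0 := by
  constructor
  · intro H x hx
    by_contra hr
    have hcont : ContinuousAt Z.r x :=
      (hZ.contDiffOn_r.differentiableAt_top hZ.isOpen hx).continuousAt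
    have hh : ∀ᶠ y in nhds x, Z.h y = 0 := by
      filter_upwards [hZ.eventually_mem hx, hcont.eventually_ne hr] with y hy hry
      have e := H y hy
      rw [hZ.dbarQuartic_eq hy] at e
      simpa [hry, hZ.wedge_omega_ne hy] using e
    exact hr (hZ.r_eq_zero_of_h hx hh)
  · intro H x hx
    rw [hZ.dbarQuartic_eq hx, H x hx]; simp

end IsLegFrame

/-! ### One-parameter families of adapted frames -/

/-- The frame field at time `t` of a family of frame fields. -/
def slice (Z : ℝ × Plane → Matrix (Fin 4) (Fin 4) ℂ) (t : ℝ) : FrameField := fun x => Z (t, x)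

/-- A smooth one-parameter family of adapted frames. -/
structure IsFrameFamily (Y : ℝ → Plane → PCSphere) (O : Set (ℝ × Plane))
    (Z : ℝ × Plane → Matrix (Fin 4) (Fin 4) ℂ) : Prop where
  isOpen : IsOpen O
  smooth : ∀ A B : Fin 4, ContDiffOn ℝ ∞ (fun y => Z y A B) O
  frame : ∀ t, IsLegFrame (Y t) {x | (t, x) ∈ O} (slice Z t)

/-- The component of `Z⁻¹ dZ` in the time direction. -/
def timeMC (Z : ℝ × Plane → Matrix (Fin 4) (Fin 4) ℂ) (A B : Fin 4) (t : ℝ) (x : Plane) : ℂ :=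
  mcForm Z A B (t, x) (1, 0)

/-- The contact Hamiltonian of the variation, in the given frames. -/
def hamiltonian (Z : ℝ × Plane → Matrix (Fin 4) (Fin 4) ℂ) (t : ℝ) (x : Plane) : ℂ :=
  timeMC Z 3 0 t x

/-- The conjugate of the complex normal component of the variation. -/
def normalConj (Z : ℝ × Plane → Matrix (Fin 4) (Fin 4) ℂ) (t : ℝ) (x : Plane) : ℂ :=
  -(2⁻¹ : ℂ) * (timeMC Z 3 1 t x + Complex.I * timeMC Z 1 0 t x - Complex.I * timeMC Z 3 2 t x +
    timeMC Z 2 0 t x)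

/-- The Hopf-type part of the infinitesimal rotation of the frame. -/
def hopfTime (Z : ℝ × Plane → Matrix (Fin 4) (Fin 4) ℂ) (t : ℝ) (x : Plane) : ℂ :=
  -(2⁻¹ : ℂ) * (Complex.I * (timeMC Z 1 1 t x - timeMC Z 2 2 t x) + timeMC Z 1 2 t x +
    timeMC Z 2 1 t x)

/-- The one-form whose exterior derivative gives the exact part of the first variation. -/
def boundaryForm (Z : ℝ × Plane → Matrix (Fin 4) (Fin 4) ℂ) (t : ℝ) (x : Plane) : Cov :=
  hopfTime Z t x • conjForm ((slice Z t).eta x) + normalConj Z t x • conjForm ((slice Z t).muC x) -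
    (hamiltonian Z t x * star ((slice Z t).q x)) • conjForm ((slice Z t).omega x)

/-- The time derivative of the Maurer-Cartan form. -/
def mcDot (Z : ℝ × Plane → Matrix (Fin 4) (Fin 4) ℂ) (A B : Fin 4) (t : ℝ) (x : Plane) : Cov :=
  (fderiv ℝ (mcForm Z A B) (t, x) (1, 0)).comp (ContinuousLinearMap.inr ℝ ℝ Plane)

theorem hasFDerivAt_pair (t : ℝ) (x : Plane) :
    HasFDerivAt (fun y : Plane => (t, y)) (ContinuousLinearMap.inr ℝ ℝ Plane) x :=
  hasFDerivAt_prodMk_right t x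

theorem hasDerivAt_pair (t : ℝ) (x : Plane) :
    HasDerivAt (fun s : ℝ => (s, x)) ((1, 0) : ℝ × Plane) t :=
  (hasDerivAt_id t).prodMk (hasDerivAt_const t x)

namespace IsFrameFamily

variable {Y : ℝ → Plane → PCSphere} {O : Set (ℝ × Plane)}
  {Z : ℝ × Plane → Matrix (Fin 4) (Fin 4) ℂ}

theorem smoothSU (hZ : IsFrameFamily Y O Z) : SmoothSU Z O :=
  ⟨hZ.isOpen, hZ.smooth, fun y hy => (hZ.frame y.1).unitary y.2 hy⟩

theorem mc_slice (hZ : IsFrameFamily Y O Z) {t : ℝ} {x : Plane} (hx : (t, x) ∈ O) (A B : Fin 4) :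
    (slice Z t).mc A B x = (mcForm Z A B (t, x)).comp (ContinuousLinearMap.inr ℝ ℝ Plane) := by
  have : ∀ C, fderiv ℝ (fun y => slice Z t y C B) x =
      (fderiv ℝ (fun y => Z y C B) (t, x)).comp (ContinuousLinearMap.inr ℝ ℝ Plane) := fun C =>
    ((hZ.smoothSU.differentiableAt hx C B).hasFDerivAt.comp x (hasFDerivAt_pair t x)).fderiv
  ext u
  simp only [FrameField.mc, mcForm, this]
  simp [slice]

theorem hasDerivAt_mc (hZ : IsFrameFamily Y O Z) {t : ℝ} {x : Plane} (hx : (t, x) ∈ O)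
    (A B : Fin 4) (v : Plane) :
    HasDerivAt (fun s => (slice Z s).mc A B x v) (mcDot Z A B t x v) t := by
  have h1 : HasDerivAt (fun s => mcForm Z A B (s, x)) (fderiv ℝ (mcForm Z A B) (t, x) (1, 0)) t :=
    HasFDerivAt.comp_hasDerivAt (f := fun s : ℝ => (s, x)) t
      (hZ.smoothSU.differentiableAt_mcForm hx A B).hasFDerivAt (hasDerivAt_pair t x)
  have h2 := h1.clm_apply (hasDerivAt_const t ((0, v) : ℝ × Plane))
  have hev : ∀ᶠ s in nhds t, (s, x) ∈ O :=
    (hasDerivAt_pair t x).continuousAt.eventually (hZ.isOpen.mem_nhds hx)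
  refine HasDerivAt.congr_of_eventuallyEq (f := fun s => mcForm Z A B (s, x) (0, v)) ?_ ?_
  · simpa [mcDot] using h2
  · filter_upwards [hev] with s hs
    rw [hZ.mc_slice hs]; simp

theorem contDiffOn_timeMC (hZ : IsFrameFamily Y O Z) (A B : Fin 4) :
    ContDiffOn ℝ ∞ (fun y : ℝ × Plane => timeMC Z A B y.1 y.2) O :=
  (hZ.smoothSU.contDiffOn_mcForm A B).clm_apply contDiffOn_const

theorem contDiffOn_slice {F : Type*} [NormedAddCommGroup F] [NormedSpace ℝ F] {g : ℝ × Plane → F}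
    {O : Set (ℝ × Plane)} (hg : ContDiffOn ℝ ∞ g O) (t : ℝ) :
    ContDiffOn ℝ ∞ (fun x => g (t, x)) {x | (t, x) ∈ O} :=
  hg.comp (contDiffOn_const.prodMk contDiffOn_id) fun _ hx => hx

theorem differentiableAt_timeMC (hZ : IsFrameFamily Y O Z) {t : ℝ} {x : Plane} (hx : (t, x) ∈ O)
    (A B : Fin 4) : DifferentiableAt ℝ (timeMC Z A B t) x :=
  (contDiffOn_slice (hZ.contDiffOn_timeMC A B) t).differentiableAt_top (hZ.frame t).isOpen hx

/-- The evolution of the Maurer-Cartan form: `∂ₜπ = dΛ + [π, Λ]`. -/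
theorem mcDot_eq (hZ : IsFrameFamily Y O Z) {t : ℝ} {x : Plane} (hx : (t, x) ∈ O)
    (A B : Fin 4) (v : Plane) :
    mcDot Z A B t x v = fderiv ℝ (timeMC Z A B t) x v +
      ∑ C, ((slice Z t).mc A C x v * timeMC Z C B t x -
        timeMC Z A C t x * (slice Z t).mc C B x v) := by
  have k := hZ.smoothSU.maurerCartan hx A B (1, 0) (0, v)
  have hd := hZ.smoothSU.differentiableAt_mcForm hx A B
  rw [fderiv_clm_apply hd (differentiableAt_const _)] at k
  have h2 : fderiv ℝ (timeMC Z A B t) x v =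
      fderiv ℝ (fun y => mcForm Z A B y (1, 0)) (t, x) (0, v) := by
    have := ((hd.clm_apply (differentiableAt_const ((1, 0) : ℝ × Plane))).hasFDerivAt.comp x
      (hasFDerivAt_pair t x)).fderiv
    have h3 : timeMC Z A B t = (fun y => mcForm Z A B y (1, 0)) ∘ fun y => (t, y) := rfl
    rw [h3, this]; simp
  rw [h2]
  simp only [hZ.mc_slice hx]
  simp only [Fin.sum_univ_four, ContinuousLinearMap.comp_apply, ContinuousLinearMap.inr_apply,
    timeMC, mcDot] at k ⊢
  simp at k
  linear_combination k

theorem eventually_time (hZ : IsFrameFamily Y O Z) {t : ℝ} {x : Plane} (hx : (t, x) ∈ O) :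
    ∀ᶠ s in nhds t, (s, x) ∈ O :=
  (hasDerivAt_pair t x).continuousAt.eventually (hZ.isOpen.mem_nhds hx)

/-- Adaptedness holds at every time, so the linear constraints it puts on π may be differentiated in
t. Combined with ∂ₜπ = dΛ + [π, Λ] they become differential equations for Λ. -/
theorem mcDot_linear (hZ : IsFrameFamily Y O Z) {t : ℝ} {x : Plane} (hx : (t, x) ∈ O)
    {A B A' B' : Fin 4} {c : ℂ} (h : ∀ s, (s, x) ∈ O →
      (slice Z s).mc A B x = c • (slice Z s).mc A' B' x) (v : Plane) :
    mcDot Z A B t x v = c * mcDot Z A' B' t x v := by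
  refine ((hZ.hasDerivAt_mc hx A B v).congr_of_eventuallyEq ?_).unique
    ((hZ.hasDerivAt_mc hx A' B' v).const_mul c)
  filter_upwards [hZ.eventually_time hx] with s hs
  rw [h s hs]; rfl

/-- The infinitesimal Legendre condition. -/
theorem fderiv_hamiltonian (hZ : IsFrameFamily Y O Z) {t : ℝ} {x : Plane} (hx : (t, x) ∈ O)
    (v : Plane) :
    fderiv ℝ (hamiltonian Z t) x v = 2 * (slice Z t).phi x v * hamiltonian Z t x +
      (Complex.I * timeMC Z 1 0 t x + timeMC Z 3 1 t x) * (slice Z t).mc 1 0 x v +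
      (Complex.I * timeMC Z 2 0 t x + timeMC Z 3 2 t x) * (slice Z t).mc 2 0 x v := by
  have P := (hZ.frame t).pattern hx
  have k := hZ.mcDot_eq hx 3 0 v
  -- The constraint π³₀ = 0 is expressed as proportionality of π³₀ to itself with factor 0.
  have k0 := hZ.mcDot_linear hx (A := 3) (B := 0) (A' := 3) (B' := 0) (c := 0)
    (fun s hs => by ext u; simp [((hZ.frame s).pattern hs).mc30]) v
  rw [k0, Fin.sum_univ_four, P.mc00, P.mc30, P.mc31, P.mc32, P.mc33] at k
  simp only [neg_apply, smul_apply, zero_apply, smul_eq_mul] at k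
  change 0 * _ = fderiv ℝ (hamiltonian Z t) x v + _ at k
  simp only [hamiltonian]
  linear_combination -k

/-- Comes from differentiating π³ᵢ = -iπⁱ₀ in time. The coefficient T of ω̄ may stay unspecified: dy
is only wedged with μ̄, a multiple of ω̄. -/
theorem fderiv_normalConj (hZ : IsFrameFamily Y O Z) {t : ℝ} {x : Plane} (hx : (t, x) ∈ O) :
    ∃ T : ℂ, ∀ v, fderiv ℝ (normalConj Z t) x v =
      ((slice Z t).phi x v - Complex.I * (slice Z t).rho x v) * normalConj Z t x
      - hamiltonian Z t x * star ((slice Z t).nuC x v)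
      - 2⁻¹ * (timeMC Z 1 0 t x + Complex.I * timeMC Z 3 1 t x + Complex.I * timeMC Z 2 0 t x
        - timeMC Z 3 2 t x) * (slice Z t).eta x v
      + T * star ((slice Z t).omega x v) + hopfTime Z t x * (slice Z t).omega x v := by
  have P := (hZ.frame t).pattern hx
  refine ⟨-Complex.I / 2 * (timeMC Z 1 1 t x + timeMC Z 2 2 t x - timeMC Z 0 0 t x - timeMC Z 3 3 t
    x),
    fun v => ?_⟩
  have k1 := hZ.mcDot_eq hx 1 0 v
  have k2 := hZ.mcDot_eq hx 2 0 v
  have k3 := hZ.mcDot_eq hx 3 1 v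
  have k4 := hZ.mcDot_eq hx 3 2 v
  have l3 := hZ.mcDot_linear hx (fun s hs => ((hZ.frame s).pattern hs).mc31) v
  have l4 := hZ.mcDot_linear hx (fun s hs => ((hZ.frame s).pattern hs).mc32) v
  rw [l3, k1] at k3
  rw [l4, k2] at k4
  have d := fun A B => hZ.differentiableAt_timeMC hx A B
  have e : fderiv ℝ (normalConj Z t) x v = -(2⁻¹ : ℂ) * (fderiv ℝ (timeMC Z 3 1 t) x v +
      Complex.I * fderiv ℝ (timeMC Z 1 0 t) x v - Complex.I * fderiv ℝ (timeMC Z 3 2 t) x v +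
      fderiv ℝ (timeMC Z 2 0 t) x v) := by
    have : HasFDerivAt (normalConj Z t) _ x :=
      (((((d 3 1).hasFDerivAt.add ((d 1 0).hasFDerivAt.const_mul Complex.I)).sub
        ((d 3 2).hasFDerivAt.const_mul Complex.I)).add (d 2 0).hasFDerivAt).const_mul (-(2⁻¹ : ℂ)))
    rw [this.fderiv]
    simp only [add_apply, sub_apply, smul_apply, smul_eq_mul]
  rw [e]
  simp only [Fin.sum_univ_four, P.mc00, P.mc30, P.mc31, P.mc32, P.mc33, P.mc11, P.mc12, P.mc21,
    P.mc22, P.mc13, P.mc23, P.mc01, P.mc02] at k3 k4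
  simp only [FrameField.nuC, FrameField.eta, IsLegFrame.omega_eq, hamiltonian, normalConj, hopfTime,
    add_apply, sub_apply, neg_apply, smul_apply, zero_apply, smul_eq_mul, star_add, star_mul',
    P.star_nu, P.star10, P.star20, Complex.star_def, Complex.conj_I] at k3 k4 ⊢
  linear_combination (norm := (ring_nf; simp only [Complex.I_sq, Complex.I_pow_three]; ring)) k3 /
    2 - Complex.I / 2 * k4

/-- The evolution of the form `η = h ω`. -/
theorem exists_hasDerivAt_eta (hZ : IsFrameFamily Y O Z) {t : ℝ} {x : Plane} (hx : (t, x) ∈ O) :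
    ∃ T : ℂ, ∀ v, HasDerivAt (fun s => (slice Z s).eta x v)
      (fderiv ℝ (hopfTime Z t) x v + 2 * Complex.I * (slice Z t).rho x v * hopfTime Z t x
        - Complex.I * (timeMC Z 1 2 t x - timeMC Z 2 1 t x) * (slice Z t).eta x v
        + T * star ((slice Z t).omega x v)
        - 2⁻¹ * (timeMC Z 1 0 t x + Complex.I * timeMC Z 3 1 t x - Complex.I * timeMC Z 2 0 t x
          + timeMC Z 3 2 t x) * (slice Z t).muC x v
        - normalConj Z t x * star ((slice Z t).nuC x v)) t := by
  have P := (hZ.frame t).pattern hx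
  -- This coefficient of ω̄ drops out later, since ∂ₜη is wedged with η̄ = h̄ω̄.
  refine ⟨-Complex.I / 2 * (timeMC Z 0 1 t x + Complex.I * timeMC Z 1 3 t x) -
    1 / 2 * (timeMC Z 0 2 t x + Complex.I * timeMC Z 2 3 t x), fun v => ?_⟩
  have h1 := hZ.hasDerivAt_mc hx 1 1 v
  have h2 := hZ.hasDerivAt_mc hx 1 2 v
  have h3 := hZ.hasDerivAt_mc hx 2 1 v
  have D := (h1.const_mul (-Complex.I)).sub ((h2.add h3).const_mul (2⁻¹ : ℂ))
  refine (D.congr_of_eventuallyEq ?_).congr_deriv ?_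
  · filter_upwards [hZ.eventually_time hx] with s hs
    rw [(hZ.frame s).eta_eq hs]
    simp [mul_add]
  have k1 := hZ.mcDot_eq hx 1 1 v
  have k2 := hZ.mcDot_eq hx 1 2 v
  have k3 := hZ.mcDot_eq hx 2 1 v
  have k4 := hZ.mcDot_eq hx 2 2 v
  -- Differentiating π²₂ = -π¹₁ in time brings in the difference Λ¹₁ - Λ²₂ that appears in
  -- `hopfTime`.
  have l4 := hZ.mcDot_linear hx (A := 2) (B := 2) (A' := 1) (B' := 1) (c := -1) (fun s hs => by
    ext u
    simp [((hZ.frame s).pattern hs).mc22, ((hZ.frame s).pattern hs).mc11]) v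
  rw [l4] at k4
  have d := fun A B => hZ.differentiableAt_timeMC hx A B
  have e : fderiv ℝ (hopfTime Z t) x v = -(2⁻¹ : ℂ) * (Complex.I * (fderiv ℝ (timeMC Z 1 1 t) x v -
      fderiv ℝ (timeMC Z 2 2 t) x v) + fderiv ℝ (timeMC Z 1 2 t) x v +
      fderiv ℝ (timeMC Z 2 1 t) x v) := by
    have : HasFDerivAt (hopfTime Z t) _ x :=
      ((((d 1 1).hasFDerivAt.sub (d 2 2).hasFDerivAt).const_mul Complex.I).add
        (d 1 2).hasFDerivAt).add (d 2 1).hasFDerivAt |>.const_mul (-(2⁻¹ : ℂ))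
    rw [this.fderiv]
    simp only [add_apply, sub_apply, smul_apply, smul_eq_mul]
  rw [e]
  simp only [Fin.sum_univ_four, P.mc31, P.mc32, P.mc11, P.mc12, P.mc21,
    P.mc22, P.mc13, P.mc23, P.mc01, P.mc02] at k1 k2 k3 k4
  simp only [FrameField.nuC, FrameField.muC, FrameField.eta, IsLegFrame.omega_eq, normalConj,
    hopfTime,
    add_apply, sub_apply, neg_apply, smul_apply, smul_eq_mul, star_add, star_mul',
    P.star_nu, P.star10, P.star20, Complex.star_def, Complex.conj_I] at k1 k2 k3 k4 ⊢
  linear_combination (norm := (ring_nf; simp only [Complex.I_sq, Complex.I_pow_three]; ring))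
    (-Complex.I / 2) * k1 + Complex.I / 2 * k4 - k2 / 2 - k3 / 2

theorem contDiffOn_hamiltonian (hZ : IsFrameFamily Y O Z) :
    ContDiffOn ℝ ∞ (fun y : ℝ × Plane => hamiltonian Z y.1 y.2) O := hZ.contDiffOn_timeMC 3 0

theorem contDiffOn_normalConj (hZ : IsFrameFamily Y O Z) :
    ContDiffOn ℝ ∞ (fun y : ℝ × Plane => normalConj Z y.1 y.2) O := by
  have d := hZ.contDiffOn_timeMC
  exact contDiffOn_const.mul ((((d 3 1).add (contDiffOn_const.mul (d 1 0))).sub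
    (contDiffOn_const.mul (d 3 2))).add (d 2 0))

theorem contDiffOn_hopfTime (hZ : IsFrameFamily Y O Z) :
    ContDiffOn ℝ ∞ (fun y : ℝ × Plane => hopfTime Z y.1 y.2) O := by
  have d := hZ.contDiffOn_timeMC
  exact contDiffOn_const.mul (((contDiffOn_const.mul ((d 1 1).sub (d 2 2))).add (d 1 2)).add
    (d 2 1))

theorem contDiffOn_boundaryForm (hZ : IsFrameFamily Y O Z) (t : ℝ) :
    ContDiffOn ℝ ∞ (boundaryForm Z t) {x | (t, x) ∈ O} := by
  have F := hZ.frame t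
  exact (((contDiffOn_slice hZ.contDiffOn_hopfTime t).fun_smul F.contDiffOn_eta.conjForm).add
    ((contDiffOn_slice hZ.contDiffOn_normalConj t).fun_smul F.contDiffOn_muC.conjForm)).sub
    (((contDiffOn_slice hZ.contDiffOn_hamiltonian t).mul F.contDiffOn_q.star_complex).fun_smul
      F.contDiffOn_omega.conjForm)

theorem extD_boundaryForm (hZ : IsFrameFamily Y O Z) {t : ℝ} {x : Plane} (hx : (t, x) ∈ O) :
    extD (boundaryForm Z t) x =
      wedge (fderiv ℝ (hopfTime Z t) x) (conjForm ((slice Z t).eta x)) +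
        hopfTime Z t x * star (extD (slice Z t).eta x) +
      (wedge (fderiv ℝ (normalConj Z t) x) (conjForm ((slice Z t).muC x)) +
        normalConj Z t x * star (extD (slice Z t).muC x)) -
      (star ((slice Z t).q x) *
          wedge (fderiv ℝ (hamiltonian Z t) x) (conjForm ((slice Z t).omega x)) -
        hamiltonian Z t x * star (wedge (slice Z t |>.omega x) (fderiv ℝ (slice Z t).q x)) +
        hamiltonian Z t x * star ((slice Z t).q x) * star (extD (slice Z t).omega x)) := by
  have F := hZ.frame t
  have hV := F.isOpen
  have hx' : x ∈ {x | (t, x) ∈ O} := hx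
  have dB := (contDiffOn_slice hZ.contDiffOn_hopfTime t).differentiableAt_top hV hx'
  have dy := (contDiffOn_slice hZ.contDiffOn_normalConj t).differentiableAt_top hV hx'
  have df := (contDiffOn_slice hZ.contDiffOn_hamiltonian t).differentiableAt_top hV hx'
  have dq := F.contDiffOn_q.differentiableAt_top hV hx'
  have de := F.contDiffOn_eta.differentiableAt_top hV hx'
  have dm := F.contDiffOn_muC.differentiableAt_top hV hx'
  have dw := F.contDiffOn_omega.differentiableAt_top hV hx'
  have dqs : DifferentiableAt ℝ (fun y => star ((slice Z t).q y)) x :=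
    F.contDiffOn_q.star_complex.differentiableAt_top hV hx'
  have hfq : fderiv ℝ (fun y => hamiltonian Z t y * star ((slice Z t).q y)) x =
      hamiltonian Z t x • conjForm (fderiv ℝ (slice Z t).q x) +
        star ((slice Z t).q x) • fderiv ℝ (hamiltonian Z t) x := by
    rw [fderiv_fun_mul df dqs]
    congr 2
    ext u
    exact fderiv_star_apply x u dq
  unfold boundaryForm
  rw [extD_sub ((dB.fun_smul de.conjForm).fun_add (dy.fun_smul dm.conjForm))
      ((df.fun_mul dqs).fun_smul dw.conjForm),
    extD_add (dB.fun_smul de.conjForm) (dy.fun_smul dm.conjForm), extD_smul dB de.conjForm,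
    extD_smul dy dm.conjForm, extD_smul (df.fun_mul dqs) dw.conjForm, hfq, extD_conjForm de,
    extD_conjForm dm, extD_conjForm dw]
  simp only [wedge, add_apply, smul_apply, smul_eq_mul, conjForm_apply, star_sub, star_mul']
  ring

/-- In terms of η alone the two-form contains no quotient, so it can be differentiated in t entry by
entry. -/
theorem willmoreForm_eq {Y : Plane → PCSphere} {V : Set Plane} {Z : FrameField}
    (hZ : IsLegFrame Y V Z) {x : Plane} (hx : x ∈ V) :
    Z.willmoreForm x = (Complex.I * wedge (Z.eta x) (conjForm (Z.eta x))).re := by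
  rw [FrameField.willmoreForm, hZ.eta_eq_smul hx]
  congr 1
  have : ((‖Z.h x‖ ^ 2 : ℝ) : ℂ) = Z.h x * star (Z.h x) := by
    rw [Complex.star_def, Complex.mul_conj, Complex.normSq_eq_norm_sq]
  rw [this]
  simp only [wedge, smul_apply, smul_eq_mul, conjForm_apply, star_mul']
  ring

/-- The first variation of the Willmore form: up to an exact form it is given by the contact
Hamiltonian and the coefficient `r`. -/
theorem hasDerivAt_willmoreForm (hZ : IsFrameFamily Y O Z) {t : ℝ} {x : Plane} (hx : (t, x) ∈ O) :
    HasDerivAt (fun s => (slice Z s).willmoreForm x)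
      (2 * (Complex.I * extD (boundaryForm Z t) x).re -
        4 * ((hamiltonian Z t x).re * (slice Z t |>.r x).re *
          (wedge ((slice Z t).mc 1 0 x) ((slice Z t).mc 2 0 x)).re)) t := by
  have F := hZ.frame t
  have P := F.pattern hx
  obtain ⟨T, hT⟩ := hZ.exists_hasDerivAt_eta hx
  obtain ⟨T', hT'⟩ := hZ.fderiv_normalConj hx
  have hf := hZ.fderiv_hamiltonian hx
  set E : Plane → ℂ := fun v =>
    (fderiv ℝ (hopfTime Z t) x v + 2 * Complex.I * (slice Z t).rho x v * hopfTime Z t x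
        - Complex.I * (timeMC Z 1 2 t x - timeMC Z 2 1 t x) * (slice Z t).eta x v
        + T * star ((slice Z t).omega x v)
        - 2⁻¹ * (timeMC Z 1 0 t x + Complex.I * timeMC Z 3 1 t x - Complex.I * timeMC Z 2 0 t x
          + timeMC Z 3 2 t x) * (slice Z t).muC x v
        - normalConj Z t x * star ((slice Z t).nuC x v)) with hE
  have hs : ∀ v, HasDerivAt (fun s => star ((slice Z s).eta x v)) (star (E v)) t := fun v =>
    (Complex.conjCLE : ℂ →L[ℝ] ℂ).hasFDerivAt.comp_hasDerivAt t (hT v)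
  have D := (((hT e₁).mul (hs e₂)).sub ((hT e₂).mul (hs e₁))).const_mul Complex.I
  have D' := Complex.reCLM.hasFDerivAt.comp_hasDerivAt t D
  refine (D'.congr_of_eventuallyEq ?_).congr_deriv ?_
  · filter_upwards [hZ.eventually_time hx] with s hs
    exact willmoreForm_eq (hZ.frame s) hs
  have L := hZ.smoothSU.star_mcForm hx (1, 0)
  change star (timeMC Z 3 0 t x) = timeMC Z 3 0 t x ∧ timeMC Z 3 1 t x = _ * star
    (timeMC Z 1 0 t x) ∧
    timeMC Z 3 2 t x = _ * star (timeMC Z 2 0 t x) ∧ _ ∧ _ ∧ _ ∧ _ ∧ _ ∧ _ ∧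
    timeMC Z 2 1 t x = - star (timeMC Z 1 2 t x) at L
  obtain ⟨Lf, L31, L32, -, -, -, -, -, -, L21⟩ := L
  -- E is ∂ₜη. Expanding dΞ by the structure equations reproduces ∂ₜη ∧ η̄ up to the Hamiltonian
  -- term and a multiple of ω∧ω̄; the terms in T and T' vanish because ω̄∧ω̄ = 0.
  have key : E e₁ * star ((slice Z t).eta x e₂) - E e₂ * star ((slice Z t).eta x e₁) =
      extD (boundaryForm Z t) x - hamiltonian Z t x * star ((slice Z t).r x) *
        wedge ((slice Z t).omega x) (conjForm ((slice Z t).omega x)) +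
      (2⁻¹ * (timeMC Z 1 0 t x + Complex.I * timeMC Z 3 1 t x + Complex.I * timeMC Z 2 0 t x
        - timeMC Z 3 2 t x) * (slice Z t).h x * star ((slice Z t).p x) -
       2⁻¹ * (timeMC Z 1 0 t x + Complex.I * timeMC Z 3 1 t x - Complex.I * timeMC Z 2 0 t x
          + timeMC Z 3 2 t x) * (slice Z t).p x * star ((slice Z t).h x) -
       Complex.I * (timeMC Z 1 2 t x - timeMC Z 2 1 t x) *
        ((slice Z t).h x * star ((slice Z t).h x))) *
        wedge ((slice Z t).omega x) (conjForm ((slice Z t).omega x)) := by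
    have dq := F.wedge_dq hx
    have dq' : wedge (slice Z t |>.omega x) (fderiv ℝ (slice Z t).q x) =
      - wedge (fderiv ℝ (slice Z t).q x) (slice Z t |>.omega x) := by simp only [wedge]; ring
    rw [hZ.extD_boundaryForm hx, F.extD_eta hx, F.extD_muC hx, F.extD_omega hx, dq', dq]
    simp only [hE]
    simp only [wedge, add_apply, smul_apply, smul_eq_mul, conjForm_apply, hf, hT', F.kappa_eq hx,
      F.muC_eq_smul hx, F.eta_eq_smul hx, star_add, star_sub, star_mul', star_neg, star_star,
      P.star_phi, P.star_rho]
    simp only [IsLegFrame.omega_eq, add_apply, smul_apply, smul_eq_mul, star_add, star_mul',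
      P.star10, P.star20, Complex.star_def, Complex.conj_I, map_ofNat, normalConj]
    ring_nf
    simp only [Complex.I_sq]
    ring
  set c : ℂ := (2⁻¹ * (timeMC Z 1 0 t x + Complex.I * timeMC Z 3 1 t x +
      Complex.I * timeMC Z 2 0 t x - timeMC Z 3 2 t x) * (slice Z t).h x * star ((slice Z t).p x) -
    2⁻¹ * (timeMC Z 1 0 t x + Complex.I * timeMC Z 3 1 t x - Complex.I * timeMC Z 2 0 t x
      + timeMC Z 3 2 t x) * (slice Z t).p x * star ((slice Z t).h x) -
    Complex.I * (timeMC Z 1 2 t x - timeMC Z 2 1 t x) *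
      ((slice Z t).h x * star ((slice Z t).h x))) with hc
  -- By the symmetries of Λ the coefficients of h p̄ and of p h̄ in c are a and -ā, where a is the
  -- complex tangential velocity, and Λ¹₂ - Λ²₁ is real. So c is imaginary and does not contribute
  -- to ∂ₜΩ.
  have hc0 : c.re = 0 := by
    have : c + star c = 0 := by
      simp only [hc, L31, L32, L21, star_sub, star_add, star_mul', star_neg,
        Complex.star_def, Complex.conj_I, map_inv₀, map_ofNat, Complex.conj_conj]
      ring_nf
      simp only [Complex.I_sq]
      ring
    have h2 := congrArg Complex.re this
    simp at h2
    linarith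
  have hf0 : (hamiltonian Z t x).im = 0 := by
    have := congrArg Complex.im Lf
    simp at this
    simp only [hamiltonian]; linarith
  have hr0 : (slice Z t |>.r x).im = 0 := by
    have := congrArg Complex.im (F.star_r hx)
    simp at this
    linarith
  have hw0 : (wedge ((slice Z t).mc 1 0 x) ((slice Z t).mc 2 0 x)).im = 0 := by
    have : star (wedge ((slice Z t).mc 1 0 x) ((slice Z t).mc 2 0 x)) =
        wedge ((slice Z t).mc 1 0 x) ((slice Z t).mc 2 0 x) := by
      simp only [wedge, star_sub, star_mul', P.star10, P.star20]
    have := congrArg Complex.im this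
    simp at this
    linarith
  have goal_eq : Complex.I * (E e₁ * star ((slice Z t).eta x e₂) + (slice Z t).eta x e₁ * star
      (E e₂) -
      (E e₂ * star ((slice Z t).eta x e₁) + (slice Z t).eta x e₂ * star (E e₁))) =
      Complex.I * ((E e₁ * star ((slice Z t).eta x e₂) - E e₂ * star ((slice Z t).eta x e₁)) -
        star (E e₁ * star ((slice Z t).eta x e₂) - E e₂ * star ((slice Z t).eta x e₁))) := by
    simp only [star_sub, star_mul', star_star]; ring
  change (Complex.I * (E e₁ * star ((slice Z t).eta x e₂) + (slice Z t).eta x e₁ * star (E e₂) -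
      (E e₂ * star ((slice Z t).eta x e₁) + (slice Z t).eta x e₂ * star (E e₁)))).re = _
  rw [goal_eq, key, F.wedge_omega hx]
  simp [hc0, hf0, hr0, hw0]
  ring

end IsFrameFamily

/-! ### Change of frames -/

theorem IsFrameFamily.mono {Y : ℝ → Plane → PCSphere} {O O' : Set (ℝ × Plane)}
    {Z : ℝ × Plane → Matrix (Fin 4) (Fin 4) ℂ} (hZ : IsFrameFamily Y O Z) (hO : IsOpen O')
    (h : O' ⊆ O) : IsFrameFamily Y O' Z where
  isOpen := hO
  smooth A B := (hZ.smooth A B).mono h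
  frame t :=
    { isOpen := hO.preimage (Continuous.prodMk_right t)
      smooth := fun A B => ((hZ.frame t).smooth A B).mono fun _ hx => h hx
      unitary := fun x hx => (hZ.frame t).unitary x (h hx)
      base := fun x hx => (hZ.frame t).base x (h hx)
      real := fun x hx => (hZ.frame t).real x (h hx)
      positive := fun x hx => (hZ.frame t).positive x (h hx)
      trace_beta := fun x hx => (hZ.frame t).trace_beta x (h hx)
      trace_p := fun x hx => (hZ.frame t).trace_p x (h hx)
      leg := fun x hx => (hZ.frame t).leg x (h hx) }

theorem Represents.exists_smul {v w : C31} {l : PCSphere} (hv : Represents v l)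
    (hw : Represents w l) : ∃ a : ℂ, a ≠ 0 ∧ w = a • v := by
  obtain ⟨hv0, hv⟩ := hv
  obtain ⟨hw0, hw⟩ := hw
  obtain ⟨a, ha⟩ := (Projectivization.mk_eq_mk_iff' ℂ w v hw0 hv0).1 (hw.trans hv.symm)
  refine ⟨a, ?_, ha.symm⟩
  rintro rfl
  exact hw0 (by rw [← ha, zero_smul])

theorem IsSU31.inv_mul {A B : Matrix (Fin 4) (Fin 4) ℂ} (hA : IsSU31 A) (hB : IsSU31 B) :
    IsSU31 (A⁻¹ * B) := by
  have h1 : A * A⁻¹ = 1 := Matrix.mul_nonsing_inv _ hA.isUnit_det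
  refine ⟨?_, fun z w => ?_⟩
  · have := congrArg Matrix.det h1
    rw [Matrix.det_mul, hA.1, one_mul, Matrix.det_one] at this
    rw [Matrix.det_mul, this, hB.1, one_mul]
  · rw [← hA.2, Matrix.mulVec_mulVec, Matrix.mulVec_mulVec, ← Matrix.mul_assoc, h1, Matrix.one_mul,
      hB.2]

/-- The matrix expressing one frame in terms of another one. -/
def transition (Z Z' : ℝ × Plane → Matrix (Fin 4) (Fin 4) ℂ) (y : ℝ × Plane) :
    Matrix (Fin 4) (Fin 4) ℂ := (Z y)⁻¹ * Z' y

/-- The matrix expressing one frame in terms of another one, divided by its first entry. -/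
def normTransition (Z Z' : ℝ × Plane → Matrix (Fin 4) (Fin 4) ℂ) (A B : Fin 4) (y : ℝ × Plane) : ℂ
    :=
  transition Z Z' y A B / transition Z Z' y 0 0

theorem eq_zero_of_coframe {a b u₁ u₂ v₁ v₂ : ℂ} (h : u₁ * v₂ - u₂ * v₁ ≠ 0)
    (h₁ : a * u₁ + b * v₁ = 0) (h₂ : a * u₂ + b * v₂ = 0) : a = 0 ∧ b = 0 := by
  constructor
  · have : a * (u₁ * v₂ - u₂ * v₁) = 0 := by linear_combination v₂ * h₁ - v₁ * h₂
    simpa [h] using this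
  · have : b * (u₁ * v₂ - u₂ * v₁) = 0 := by linear_combination u₁ * h₂ - u₂ * h₁
    simpa [h] using this

/-- Lagrange's identity gives (ad - bc)² = N², and positivity selects ad - bc = N. Then (d - a)² +
(b + c)² = 2N - 2N = 0. -/
theorem real_conformal {a b c d N : ℝ} (h₁ : a ^ 2 + c ^ 2 = N) (h₂ : b ^ 2 + d ^ 2 = N)
    (h₃ : a * b + c * d = 0) (h₄ : 0 < a * d - b * c) : d = a ∧ b = -c := by
  have hN : 0 ≤ N := by nlinarith [sq_nonneg a, sq_nonneg c]
  have hD : a * d - b * c = N := by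
    have : (a * d - b * c) ^ 2 = N ^ 2 := by
      calc (a * d - b * c) ^ 2 = (a ^ 2 + c ^ 2) * (b ^ 2 + d ^ 2) - (a * b + c * d) ^ 2 := by ring
        _ = N ^ 2 := by rw [h₁, h₂, h₃]; ring
    exact (pow_left_inj₀ h₄.le hN two_ne_zero).1 this
  have h5 : (d - a) ^ 2 + (b + c) ^ 2 = 0 := by linear_combination h₁ + h₂ - 2 * hD
  constructor
  · nlinarith [sq_nonneg (d - a), sq_nonneg (b + c)]
  · nlinarith [sq_nonneg (d - a), sq_nonneg (b + c)]

section

variable {Y : ℝ → Plane → PCSphere} {O : Set (ℝ × Plane)}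
  {Z Z' : ℝ × Plane → Matrix (Fin 4) (Fin 4) ℂ}

namespace IsFrameFamily

theorem isSU31_transition (hZ : IsFrameFamily Y O Z) (hZ' : IsFrameFamily Y O Z') {y : ℝ × Plane}
    (hy : y ∈ O) : IsSU31 (transition Z Z' y) :=
  (hZ.smoothSU.unitary y hy).inv_mul (hZ'.smoothSU.unitary y hy)

theorem mul_transition (hZ : IsFrameFamily Y O Z) {y : ℝ × Plane} (hy : y ∈ O) (A B : Fin 4) :
    ∑ C, Z y A C * transition Z Z' y C B = Z' y A B := by
  rw [← Matrix.mul_apply, transition, ← Matrix.mul_assoc,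
    Matrix.mul_nonsing_inv _ (hZ.smoothSU.unitary y hy).isUnit_det, Matrix.one_mul]

theorem contDiffOn_transition (hZ : IsFrameFamily Y O Z) (hZ' : IsFrameFamily Y O Z')
    (A B : Fin 4) : ContDiffOn ℝ ∞ (fun y => transition Z Z' y A B) O := by
  have : (fun y => transition Z Z' y A B) = fun y => ∑ C, (Z y)⁻¹ A C * Z' y C B := by
    ext y; rw [transition, Matrix.mul_apply]
  rw [this]
  exact ContDiffOn.sum fun C _ => (hZ.smoothSU.contDiffOn_inv A C).mul (hZ'.smooth C B)

/-- Both first columns represent the same point of the sphere, hence are proportional. -/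
theorem transition_col_zero (hZ : IsFrameFamily Y O Z) (hZ' : IsFrameFamily Y O Z') {y : ℝ × Plane}
    (hy : y ∈ O) : transition Z Z' y 0 0 ≠ 0 ∧ transition Z Z' y 1 0 = 0 ∧
      transition Z Z' y 2 0 = 0 ∧ transition Z Z' y 3 0 = 0 := by
  obtain ⟨a, ha, h⟩ := ((hZ.frame y.1).base y.2 hy).exists_smul ((hZ'.frame y.1).base y.2 hy)
  have h1 : (Z y)⁻¹ * Z y = 1 := Matrix.nonsing_inv_mul _ (hZ.smoothSU.unitary y hy).isUnit_det
  have key : ∀ A, transition Z Z' y A 0 = a * (1 : Matrix (Fin 4) (Fin 4) ℂ) A 0 := by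
    intro A
    rw [← h1, transition, Matrix.mul_apply, Matrix.mul_apply, Finset.mul_sum]
    refine Finset.sum_congr rfl fun C _ => ?_
    have : Z' y C 0 = a * Z y C 0 := congrFun h C
    rw [this]; ring
  simp [key, ha]

/-- The gauge transformation of the Maurer-Cartan form. -/
theorem transition_gauge (hZ : IsFrameFamily Y O Z) (hZ' : IsFrameFamily Y O Z') {y : ℝ × Plane}
    (hy : y ∈ O) (A B : Fin 4) (u : ℝ × Plane) :
    ∑ C, transition Z Z' y A C * mcForm Z' C B y u =
      ∑ C, mcForm Z A C y u * transition Z Z' y C B +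
        fderiv ℝ (fun y => transition Z Z' y A B) y u := by
  have d : ∀ A B, DifferentiableAt ℝ (fun y => transition Z Z' y A B) y := fun A B =>
    (hZ.contDiffOn_transition hZ' A B).differentiableAt_top hZ.isOpen hy
  have h1 : (Z y)⁻¹ * Z y = 1 := Matrix.nonsing_inv_mul _ (hZ.smoothSU.unitary y hy).isUnit_det
  have e : ∀ A, fderiv ℝ (fun y => Z' y A B) y u =
      ∑ C, (Z y A C * fderiv ℝ (fun y => transition Z Z' y C B) y u +
        fderiv ℝ (fun y => Z y A C) y u * transition Z Z' y C B) := by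
    intro A
    have hev : (fun y => Z' y A B) =ᶠ[nhds y] fun y => ∑ C, Z y A C * transition Z Z' y C B := by
      filter_upwards [hZ.isOpen.mem_nhds hy] with z hz
      exact (hZ.mul_transition hz A B).symm
    rw [hev.fderiv_eq, fderiv_fun_sum fun C _ => (hZ.smoothSU.differentiableAt hy A C).fun_mul
      (d C B)]
    rw [sum_apply]
    refine Finset.sum_congr rfl fun C _ => ?_
    rw [fderiv_fun_mul (hZ.smoothSU.differentiableAt hy A C) (d C B)]
    simp [mul_comm]
  have lhs : ∑ C, transition Z Z' y A C * mcForm Z' C B y u =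
      ∑ D, (Z y)⁻¹ A D * fderiv ℝ (fun y => Z' y D B) y u := by
    simp_rw [← hZ'.smoothSU.sum_mul_mcForm hy, Finset.mul_sum]
    rw [Finset.sum_comm]
    refine Finset.sum_congr rfl fun C _ => ?_
    simp only [transition, Matrix.mul_apply, Finset.sum_mul, mul_assoc]
  rw [lhs]
  simp_rw [e, Finset.mul_sum, mul_add, Finset.sum_add_distrib]
  rw [add_comm]
  congr 1
  · rw [Finset.sum_comm]
    refine Finset.sum_congr rfl fun C _ => ?_
    simp [mcForm, Finset.sum_mul, mul_assoc]
  · rw [Finset.sum_comm]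
    have : ∀ C, ∑ D, (Z y)⁻¹ A D * (Z y D C * fderiv ℝ (fun y => transition Z Z' y C B) y u) =
        (1 : Matrix (Fin 4) (Fin 4) ℂ) A C * fderiv ℝ (fun y => transition Z Z' y C B) y u := by
      intro C
      rw [← h1, Matrix.mul_apply, Finset.sum_mul]
      simp only [mul_assoc]
    simp_rw [this]
    simp [Matrix.one_apply]

theorem contDiffOn_normTransition (hZ : IsFrameFamily Y O Z) (hZ' : IsFrameFamily Y O Z')
    (A B : Fin 4) : ContDiffOn ℝ ∞ (normTransition Z Z' A B) O := by
  unfold normTransition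
  simp only [div_eq_mul_inv]
  exact (hZ.contDiffOn_transition hZ' A B).mul ((hZ.contDiffOn_transition hZ' 0 0).inv
    fun y hy => (hZ.transition_col_zero hZ' hy).1)

/-- The gauge transformation in terms of the normalised transition matrix. -/
theorem normTransition_gauge (hZ : IsFrameFamily Y O Z) (hZ' : IsFrameFamily Y O Z')
    {y : ℝ × Plane} (hy : y ∈ O) (A B : Fin 4) (u : ℝ × Plane) :
    ∑ C, normTransition Z Z' A C y * mcForm Z' C B y u =
      ∑ C, mcForm Z A C y u * normTransition Z Z' C B y +
        fderiv ℝ (normTransition Z Z' A B) y u +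
        fderiv ℝ (fun y => transition Z Z' y 0 0) y u / transition Z Z' y 0 0 *
          normTransition Z Z' A B y := by
  have hc := (hZ.transition_col_zero hZ' hy).1
  have d : ∀ A B, DifferentiableAt ℝ (fun y => transition Z Z' y A B) y := fun A B =>
    (hZ.contDiffOn_transition hZ' A B).differentiableAt_top hZ.isOpen hy
  have dn := (hZ.contDiffOn_normTransition hZ' A B).differentiableAt_top hZ.isOpen hy
  have g := hZ.transition_gauge hZ' hy A B u
  have e : fderiv ℝ (fun y => transition Z Z' y A B) y u =
      transition Z Z' y 0 0 * fderiv ℝ (normTransition Z Z' A B) y u +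
      fderiv ℝ (fun y => transition Z Z' y 0 0) y u * normTransition Z Z' A B y := by
    have hev : (fun y => transition Z Z' y A B) =ᶠ[nhds y]
        fun y => transition Z Z' y 0 0 * normTransition Z Z' A B y := by
      filter_upwards [hZ.isOpen.mem_nhds hy] with z hz
      rw [normTransition, mul_div_cancel₀ _ (hZ.transition_col_zero hZ' hz).1]
    rw [hev.fderiv_eq, fderiv_fun_mul (d 0 0) dn]
    simp [mul_comm]
  have hS : ∀ A B, transition Z Z' y A B = transition Z Z' y 0 0 * normTransition Z Z' A B y :=
    fun A B => by rw [normTransition, mul_div_cancel₀ _ hc]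
  rw [e] at g
  simp only [Fin.sum_univ_four] at g ⊢
  rw [hS A 0, hS A 1, hS A 2, hS A 3, hS 0 B, hS 1 B, hS 2 B, hS 3 B] at g
  have hγ := div_mul_cancel₀ (fderiv ℝ (fun y => transition Z Z' y 0 0) y u) hc
  set γ := fderiv ℝ (fun y => transition Z Z' y 0 0) y u / transition Z Z' y 0 0
  rw [← hγ] at g
  refine mul_left_cancel₀ hc ?_
  linear_combination g

/-- The part of the shape of the normalised transition matrix which follows from unitarity. -/
theorem normTransition_unitary (hZ : IsFrameFamily Y O Z) (hZ' : IsFrameFamily Y O Z')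
    {y : ℝ × Plane} (hy : y ∈ O) :
    (normTransition Z Z' 0 0 y = 1 ∧ normTransition Z Z' 1 0 y = 0 ∧
      normTransition Z Z' 2 0 y = 0 ∧ normTransition Z Z' 3 0 y = 0) ∧
    (normTransition Z Z' 3 1 y = 0 ∧ normTransition Z Z' 3 2 y = 0) ∧
    normTransition Z Z' 3 3 y * (transition Z Z' y 0 0 * star (transition Z Z' y 0 0)) = 1 := by
  obtain ⟨hc, h1, h2, h3⟩ := hZ.transition_col_zero hZ' hy
  have U := hZ.isSU31_transition hZ' hy
  have hc' : star (transition Z Z' y 0 0) ≠ 0 := star_ne_zero.2 hc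
  have e : ∀ A, herm (col (transition Z Z' y) A) (col (transition Z Z' y) 0) = gram A 0 :=
    fun A => U.herm_col A 0
  have e1 := e 1
  have e2 := e 2
  have e3 := e 3
  simp only [herm, col, h1, h2, h3, star_zero, mul_zero, zero_sub, add_zero, gram] at e1 e2 e3
  simp at e1 e2 e3
  have t31 : transition Z Z' y 3 1 = 0 := e1.resolve_right hc
  have t32 : transition Z Z' y 3 2 = 0 := e2.resolve_right hc
  refine ⟨⟨div_self hc, ?_, ?_, ?_⟩, ⟨?_, ?_⟩, ?_⟩
  · simp [normTransition, h1]
  · simp [normTransition, h2]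
  · simp [normTransition, h3]
  · simp [normTransition, t31]
  · simp [normTransition, t32]
  · rw [normTransition, ← mul_assoc, div_mul_cancel₀ _ hc]
    exact e3

/-- Both coframes are real, and the gauge equation in column 0 relates them by the middle 2×2 block,
which is therefore real. Unitarity makes it conformal, and the common orientation makes it a
rotation times a dilation. Division by the entry (0,0) has removed the phase that would spoil
reality. -/
theorem normTransition_conformal (hZ : IsFrameFamily Y O Z) (hZ' : IsFrameFamily Y O Z')
    {y : ℝ × Plane} (hy : y ∈ O) :
    star (normTransition Z Z' 1 1 y) = normTransition Z Z' 1 1 y ∧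
    star (normTransition Z Z' 2 1 y) = normTransition Z Z' 2 1 y ∧
    normTransition Z Z' 2 2 y = normTransition Z Z' 1 1 y ∧
    normTransition Z Z' 1 2 y = -normTransition Z Z' 2 1 y ∧
    normTransition Z Z' 3 3 y = normTransition Z Z' 1 1 y ^ 2 + normTransition Z Z' 2 1 y ^ 2 ∧
    transition Z Z' y 0 0 ^ 2 = star (transition Z Z' y 0 0) ^ 2 := by
  obtain ⟨⟨s00, s10, s20, s30⟩, ⟨s31, s32⟩, s33⟩ := hZ.normTransition_unitary hZ' hy
  obtain ⟨hc, t1, t2, t3⟩ := hZ.transition_col_zero hZ' hy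
  have U := hZ.isSU31_transition hZ' hy
  have P := (hZ.frame y.1).pattern hy
  have P' := (hZ'.frame y.1).pattern hy
  have m : ∀ A B v, (slice Z y.1).mc A B y.2 v = mcForm Z A B y (0, v) := fun A B v => by
    rw [hZ.mc_slice hy]; rfl
  have m' : ∀ A B v, (slice Z' y.1).mc A B y.2 v = mcForm Z' A B y (0, v) := fun A B v => by
    rw [hZ'.mc_slice hy]; rfl
  have d0 : ∀ A : Fin 4, A ≠ 0 → ∀ u, fderiv ℝ (normTransition Z Z' A 0) y u = 0 := by
    intro A hA u
    have hev : normTransition Z Z' A 0 =ᶠ[nhds y] fun _ => 0 := by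
      filter_upwards [hZ.isOpen.mem_nhds hy] with z hz
      obtain ⟨⟨-, h1, h2, h3⟩, -⟩ := hZ.normTransition_unitary hZ' hz
      fin_cases A
      · exact absurd rfl hA
      · exact h1
      · exact h2
      · exact h3
    rw [hev.fderiv_eq]; simp
  have g : ∀ A : Fin 4, A ≠ 0 → ∀ v, normTransition Z Z' A 1 y * (slice Z' y.1).mc 1 0 y.2 v +
      normTransition Z Z' A 2 y * (slice Z' y.1).mc 2 0 y.2 v +
      normTransition Z Z' A 0 y * (slice Z' y.1).mc 0 0 y.2 v = (slice Z y.1).mc A 0 y.2 v := by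
    intro A hA v
    have k := hZ.normTransition_gauge hZ' hy A 0 (0, v)
    rw [d0 A hA] at k
    simp only [Fin.sum_univ_four, s00, s10, s20, s30, ← m, ← m', P'.mc30] at k
    have hA0 : normTransition Z Z' A 0 y = 0 := by
      fin_cases A
      · exact absurd rfl hA
      · exact s10
      · exact s20
      · exact s30
    rw [hA0] at k ⊢
    simp only [zero_apply] at k
    linear_combination k
  have hw : wedge ((slice Z' y.1).mc 1 0 y.2) ((slice Z' y.1).mc 2 0 y.2) ≠ 0 := by
    intro h0; have := P'.pos; rw [h0] at this; simp at this
  have real : ∀ A : Fin 4, normTransition Z Z' A 0 y = 0 → A ≠ 0 →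
      (∀ v, star ((slice Z y.1).mc A 0 y.2 v) = (slice Z y.1).mc A 0 y.2 v) →
      star (normTransition Z Z' A 1 y) = normTransition Z Z' A 1 y ∧
      star (normTransition Z Z' A 2 y) = normTransition Z Z' A 2 y := by
    intro A h0 hA hr
    have k : ∀ v, (star (normTransition Z Z' A 1 y) - normTransition Z Z' A 1 y) *
        (slice Z' y.1).mc 1 0 y.2 v +
        (star (normTransition Z Z' A 2 y) - normTransition Z Z' A 2 y) *
        (slice Z' y.1).mc 2 0 y.2 v = 0 := by
      intro v
      have g1 := g A hA v
      have g2 := congrArg star g1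
      rw [h0] at g1 g2
      simp only [star_add, star_mul', P'.star10, P'.star20, hr, zero_mul, star_zero] at g1 g2
      linear_combination g2 - g1
    obtain ⟨r1, r2⟩ := eq_zero_of_coframe hw (k e₁) (k e₂)
    exact ⟨sub_eq_zero.1 r1, sub_eq_zero.1 r2⟩
  obtain ⟨r11, r12⟩ := real 1 s10 (by decide) P.star10
  obtain ⟨r21, r22⟩ := real 2 s20 (by decide) P.star20
  set c := transition Z Z' y 0 0 with hcdef
  have hS : ∀ A B, transition Z Z' y A B = c * normTransition Z Z' A B y :=
    fun A B => by rw [normTransition, mul_div_cancel₀ _ hc]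
  have hcc : c * star c ≠ 0 := mul_ne_zero hc (star_ne_zero.2 hc)
  have e11 := U.herm_col 1 1
  have e22 := U.herm_col 2 2
  have e12 := U.herm_col 1 2
  simp only [herm, col, hS, s31, s32, mul_zero, star_zero, zero_mul, sub_zero, star_mul',
    r11, r12, r21, r22, add_zero, gram] at e11 e22 e12
  simp at e11 e22 e12
  simp only [← Complex.star_def] at e11 e22 e12
  have q11 : normTransition Z Z' 1 1 y ^ 2 + normTransition Z Z' 2 1 y ^ 2 =
      normTransition Z Z' 3 3 y :=
    mul_right_cancel₀ hcc (by linear_combination e11 - s33)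
  have q22 : normTransition Z Z' 1 2 y ^ 2 + normTransition Z Z' 2 2 y ^ 2 =
      normTransition Z Z' 3 3 y :=
    mul_right_cancel₀ hcc (by linear_combination e22 - s33)
  have q12 : normTransition Z Z' 1 1 y * normTransition Z Z' 1 2 y +
      normTransition Z Z' 2 1 y * normTransition Z Z' 2 2 y = 0 :=
    mul_right_cancel₀ hcc (by linear_combination e12)
  have hpos : 0 < (wedge ((slice Z y.1).mc 1 0 y.2) ((slice Z y.1).mc 2 0 y.2)).re := P.pos
  have hwe : wedge ((slice Z y.1).mc 1 0 y.2) ((slice Z y.1).mc 2 0 y.2) =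
      (normTransition Z Z' 1 1 y * normTransition Z Z' 2 2 y -
        normTransition Z Z' 1 2 y * normTransition Z Z' 2 1 y) *
      wedge ((slice Z' y.1).mc 1 0 y.2) ((slice Z' y.1).mc 2 0 y.2) := by
    simp only [wedge, ← g 1 (by decide), ← g 2 (by decide), s10, s20]
    ring
  have re : ∀ z : ℂ, star z = z → ((z.re : ℝ) : ℂ) = z := fun z hz => Complex.conj_eq_iff_re.1 hz
  have hwim : ((wedge ((slice Z' y.1).mc 1 0 y.2) ((slice Z' y.1).mc 2 0 y.2)).re : ℂ) =
      wedge ((slice Z' y.1).mc 1 0 y.2) ((slice Z' y.1).mc 2 0 y.2) := by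
    apply re
    simp only [wedge, star_sub, star_mul', P'.star10, P'.star20]
  have hpos' := P'.pos
  rw [hwe, ← hwim] at hpos
  rw [← re _ r11, ← re _ r12, ← re _ r21, ← re _ r22] at hpos
  have rN : star (normTransition Z Z' 3 3 y) = normTransition Z Z' 3 3 y := by
    rw [← q11]; simp only [star_add, star_pow, r11, r21]
  have hreal := real_conformal (a := (normTransition Z Z' 1 1 y).re)
    (b := (normTransition Z Z' 1 2 y).re) (c := (normTransition Z Z' 2 1 y).re)
    (d := (normTransition Z Z' 2 2 y).re) (N := (normTransition Z Z' 3 3 y).re)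
    (by apply Complex.ofReal_injective; push_cast; rw [re _ r11, re _ r21, re _ rN, q11])
    (by apply Complex.ofReal_injective; push_cast; rw [re _ r12, re _ r22, re _ rN, q22])
    (by apply Complex.ofReal_injective; push_cast; rw [re _ r11, re _ r12, re _ r21, re _ r22, q12])
    (by
      have h5 := hpos
      rw [← Complex.ofReal_mul, ← Complex.ofReal_mul, ← Complex.ofReal_sub, ← Complex.ofReal_mul,
        Complex.ofReal_re] at h5
      exact pos_of_mul_pos_left h5 hpos'.le)
  have h22 : normTransition Z Z' 2 2 y = normTransition Z Z' 1 1 y := by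
    rw [← re _ r22, ← re _ r11, hreal.1]
  have h12 : normTransition Z Z' 1 2 y = -normTransition Z Z' 2 1 y := by
    rw [← re _ r12, ← re _ r21, hreal.2]; push_cast; rfl
  refine ⟨r11, r21, h22, h12, q11.symm, ?_⟩
  -- The block form of the transition gives c⁴S₃₃² = 1 for its determinant. Comparison with the
  -- square of S₃₃ c c̄ = 1 gives c² = c̄².
  have hdet := U.1
  rw [Matrix.det_succ_column_zero, Fin.sum_univ_four] at hdet
  simp [Matrix.det_fin_three, t1, t2, t3, Fin.succAbove, hS, s31, s32, h22, h12, s00] at hdet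
  have hd4 : c ^ 4 * normTransition Z Z' 3 3 y ^ 2 = 1 := by
    rw [← hdet, ← q11]; ring
  have hN : normTransition Z Z' 3 3 y ≠ 0 := by
    intro h0; rw [h0] at s33; simp at s33
  refine mul_left_cancel₀ (pow_ne_zero 2 hc) (mul_right_cancel₀ (pow_ne_zero 2 hN) ?_)
  linear_combination hd4 - (normTransition Z Z' 3 3 y * (c * star c) + 1) * s33


end IsFrameFamily

end

section

variable {Y : ℝ → Plane → PCSphere} {O : Set (ℝ × Plane)}
  {Z Z' : ℝ × Plane → Matrix (Fin 4) (Fin 4) ℂ}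

namespace IsFrameFamily

/-- The square of the entry is real, so by differentiation its logarithmic derivative is real; the
phase is locally constant. -/
theorem star_logDeriv_transition (hZ : IsFrameFamily Y O Z) (hZ' : IsFrameFamily Y O Z')
    {y : ℝ × Plane} (hy : y ∈ O) (u : ℝ × Plane) :
    star (fderiv ℝ (fun y => transition Z Z' y 0 0) y u / transition Z Z' y 0 0) =
      fderiv ℝ (fun y => transition Z Z' y 0 0) y u / transition Z Z' y 0 0 := by
  have hc := (hZ.transition_col_zero hZ' hy).1
  have hc' : star (transition Z Z' y 0 0) ≠ 0 := star_ne_zero.2 hc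
  have d : DifferentiableAt ℝ (fun y => transition Z Z' y 0 0) y :=
    (hZ.contDiffOn_transition hZ' 0 0).differentiableAt_top hZ.isOpen hy
  have d' : DifferentiableAt ℝ (fun y => star (transition Z Z' y 0 0)) y :=
    (hZ.contDiffOn_transition hZ' 0 0).star_complex.differentiableAt_top hZ.isOpen hy
  have hev : (fun y => transition Z Z' y 0 0 * transition Z Z' y 0 0) =ᶠ[nhds y]
      fun y => star (transition Z Z' y 0 0) * star (transition Z Z' y 0 0) := by
    filter_upwards [hZ.isOpen.mem_nhds hy] with z hz
    have := (hZ.normTransition_conformal hZ' hz).2.2.2.2.2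
    rw [← sq, this, sq]
  have k : fderiv ℝ (fun y => transition Z Z' y 0 0 * transition Z Z' y 0 0) y u =
      fderiv ℝ (fun y => star (transition Z Z' y 0 0) * star (transition Z Z' y 0 0)) y u := by
    rw [hev.fderiv_eq]
  rw [fderiv_fun_mul d d, fderiv_fun_mul d' d'] at k
  simp only [add_apply, smul_apply, smul_eq_mul, fderiv_star_apply y u d] at k
  have hcc := (hZ.normTransition_conformal hZ' hy).2.2.2.2.2
  rw [star_div₀, div_eq_div_iff hc' hc]
  set c := transition Z Z' y 0 0
  set D := fderiv ℝ (fun y => transition Z Z' y 0 0) y u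
  refine mul_left_cancel₀ hc ?_
  linear_combination (-star c) * k / 2 + star D * hcc

/-- The entries of the normalised transition matrix between two families of frames. -/
structure NormTransitionPattern (S : Fin 4 → Fin 4 → ℂ) : Prop where
  s00 : S 0 0 = 1
  s10 : S 1 0 = 0
  s20 : S 2 0 = 0
  s30 : S 3 0 = 0
  s31 : S 3 1 = 0
  s32 : S 3 2 = 0
  s22 : S 2 2 = S 1 1
  s12 : S 1 2 = -S 2 1
  s33 : S 3 3 = S 1 1 ^ 2 + S 2 1 ^ 2
  s13 : S 1 3 = Complex.I * (S 1 1 * S 0 1 - S 2 1 * S 0 2)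
  s23 : S 2 3 = Complex.I * (S 2 1 * S 0 1 + S 1 1 * S 0 2)
  star11 : star (S 1 1) = S 1 1
  star21 : star (S 2 1) = S 2 1
  star01 : star (S 0 1) = S 0 1
  star02 : star (S 0 2) = S 0 2
  ne : S 3 3 ≠ 0

/-- The (0,0) gauge equation involves only real forms besides S₀₁ and S₀₂, which makes these two
real. Orthogonality of column 3 to the columns 1 and 2 then determines S₁₃ and S₂₃. -/
theorem normTransition_pattern (hZ : IsFrameFamily Y O Z) (hZ' : IsFrameFamily Y O Z')
    {y : ℝ × Plane} (hy : y ∈ O) :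
    NormTransitionPattern fun A B => normTransition Z Z' A B y := by
  obtain ⟨⟨s00, s10, s20, s30⟩, ⟨s31, s32⟩, h33⟩ := hZ.normTransition_unitary hZ' hy
  obtain ⟨r11, r21, s22, s12, s33, -⟩ := hZ.normTransition_conformal hZ' hy
  have hc := (hZ.transition_col_zero hZ' hy).1
  have U := hZ.isSU31_transition hZ' hy
  have P := (hZ.frame y.1).pattern hy
  have P' := (hZ'.frame y.1).pattern hy
  have hN : normTransition Z Z' 3 3 y ≠ 0 := by
    intro h0; rw [h0] at h33; simp at h33
  have m : ∀ A B v, (slice Z y.1).mc A B y.2 v = mcForm Z A B y (0, v) := fun A B v => by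
    rw [hZ.mc_slice hy]; rfl
  have m' : ∀ A B v, (slice Z' y.1).mc A B y.2 v = mcForm Z' A B y (0, v) := fun A B v => by
    rw [hZ'.mc_slice hy]; rfl
  have hw : wedge ((slice Z' y.1).mc 1 0 y.2) ((slice Z' y.1).mc 2 0 y.2) ≠ 0 := by
    intro h0; have := P'.pos; rw [h0] at this; simp at this
  have k : ∀ v, (star (normTransition Z Z' 0 1 y) - normTransition Z Z' 0 1 y) *
      (slice Z' y.1).mc 1 0 y.2 v +
      (star (normTransition Z Z' 0 2 y) - normTransition Z Z' 0 2 y) *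
      (slice Z' y.1).mc 2 0 y.2 v = 0 := by
    intro v
    have hev : normTransition Z Z' 0 0 =ᶠ[nhds y] fun _ => 1 := by
      filter_upwards [hZ.isOpen.mem_nhds hy] with z hz
      exact (hZ.normTransition_unitary hZ' hz).1.1
    have g := hZ.normTransition_gauge hZ' hy 0 0 (0, v)
    have hγ := hZ.star_logDeriv_transition hZ' hy (0, v)
    rw [hev.fderiv_eq] at g
    simp only [Fin.sum_univ_four, s00, s10, s20, s30, ← m, ← m', P'.mc30, P.mc00, P'.mc00] at g
    have g2 := congrArg star g
    simp only [star_add, star_mul', hγ, P.star_phi, P'.star_phi, P'.star10, P'.star20] at g2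
    simp at g2 g
    simp only [← Complex.star_def] at g2
    linear_combination g2 - g
  obtain ⟨r1, r2⟩ := eq_zero_of_coframe hw (k e₁) (k e₂)
  rw [sub_eq_zero] at r1 r2
  have hS : ∀ A B, transition Z Z' y A B = transition Z Z' y 0 0 * normTransition Z Z' A B y :=
    fun A B => by rw [normTransition, mul_div_cancel₀ _ hc]
  have e31 : herm (col (transition Z Z' y) 3) (col (transition Z Z' y) 1) = 0 := U.herm_col 3 1
  have e32 : herm (col (transition Z Z' y) 3) (col (transition Z Z' y) 2) = 0 := U.herm_col 3 2
  have hcc : transition Z Z' y 0 0 * star (transition Z Z' y 0 0) ≠ 0 :=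
    mul_ne_zero hc (star_ne_zero.2 hc)
  simp only [herm, col, hS _ 1, hS _ 2, hS _ 3, s31, s32, mul_zero, star_zero, zero_sub, star_mul',
    star_neg, s12, s22,
    r11, r21, r1, r2] at e31 e32
  have f31 := mul_left_cancel₀ hcc (b := normTransition Z Z' 1 3 y * normTransition Z Z' 1 1 y +
    normTransition Z Z' 2 3 y * normTransition Z Z' 2 1 y - Complex.I * normTransition Z Z' 3 3 y *
    normTransition Z Z' 0 1 y) (c := 0) (by linear_combination e31)
  have f32 := mul_left_cancel₀ hcc (b := -normTransition Z Z' 1 3 y * normTransition Z Z' 2 1 y +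
    normTransition Z Z' 2 3 y * normTransition Z Z' 1 1 y - Complex.I * normTransition Z Z' 3 3 y *
    normTransition Z Z' 0 2 y) (c := 0) (by linear_combination e32)
  have s13 : normTransition Z Z' 1 3 y = Complex.I * (normTransition Z Z' 1 1 y *
      normTransition Z Z' 0 1 y - normTransition Z Z' 2 1 y * normTransition Z Z' 0 2 y) := by
    refine mul_left_cancel₀ hN ?_
    linear_combination normTransition Z Z' 1 1 y * f31 - normTransition Z Z' 2 1 y * f32 +
      normTransition Z Z' 1 3 y * s33
  have s23 : normTransition Z Z' 2 3 y = Complex.I * (normTransition Z Z' 2 1 y *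
      normTransition Z Z' 0 1 y + normTransition Z Z' 1 1 y * normTransition Z Z' 0 2 y) := by
    refine mul_left_cancel₀ hN ?_
    linear_combination normTransition Z Z' 2 1 y * f31 + normTransition Z Z' 1 1 y * f32 +
      normTransition Z Z' 2 3 y * s33
  exact ⟨s00, s10, s20, s30, s31, s32, s22, s12, s33, s13, s23, r11, r21, r1, r2, hN⟩

end IsFrameFamily

end

/-! ### How the entries of the Maurer-Cartan form change with the frame -/

section

variable {Y : ℝ → Plane → PCSphere} {O : Set (ℝ × Plane)}
  {Z Z' : ℝ × Plane → Matrix (Fin 4) (Fin 4) ℂ}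

namespace IsFrameFamily

theorem fderiv_eq_const_mul (hZ : IsFrameFamily Y O Z) {f g : ℝ × Plane → ℂ} {y : ℝ × Plane}
    (hy : y ∈ O) (c : ℂ) (hg : DifferentiableAt ℝ g y) (h : ∀ z ∈ O, f z = c * g z)
    (u : ℝ × Plane) : fderiv ℝ f y u = c * fderiv ℝ g y u := by
  have hev : f =ᶠ[nhds y] fun z => c * g z := by
    filter_upwards [hZ.isOpen.mem_nhds hy] with z hz using h z hz
  rw [hev.fderiv_eq, fderiv_const_mul hg]; simp

theorem differentiableAt_normTransition (hZ : IsFrameFamily Y O Z) (hZ' : IsFrameFamily Y O Z')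
    {y : ℝ × Plane} (hy : y ∈ O) (A B : Fin 4) :
    DifferentiableAt ℝ (normTransition Z Z' A B) y :=
  (hZ.contDiffOn_normTransition hZ' A B).differentiableAt_top hZ.isOpen hy

/-- In row 3 the normalised transition has only its last entry. The vector u is arbitrary, so these
laws serve spatial and time directions alike. -/
theorem hamiltonian_change (hZ : IsFrameFamily Y O Z) (hZ' : IsFrameFamily Y O Z')
    {y : ℝ × Plane} (hy : y ∈ O) (u : ℝ × Plane) :
    mcForm Z 3 0 y u = normTransition Z Z' 3 3 y * mcForm Z' 3 0 y u := by
  have N := hZ.normTransition_pattern hZ' hy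
  have g := hZ.normTransition_gauge hZ' hy 3 0 u
  rw [hZ.fderiv_eq_const_mul (g := normTransition Z Z' 0 0) hy 0
    (hZ.differentiableAt_normTransition hZ' hy 0 0)
    (fun z hz => by rw [(hZ.normTransition_pattern hZ' hz).s30, zero_mul])] at g
  simp only [Fin.sum_univ_four, N.s00, N.s10, N.s20, N.s30, N.s31, N.s32] at g
  linear_combination -g

theorem tangent_change (hZ : IsFrameFamily Y O Z) (hZ' : IsFrameFamily Y O Z')
    {y : ℝ × Plane} (hy : y ∈ O) (u : ℝ × Plane) :
    mcForm Z 1 0 y u = normTransition Z Z' 1 1 y * mcForm Z' 1 0 y u -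
      normTransition Z Z' 2 1 y * mcForm Z' 2 0 y u +
      normTransition Z Z' 1 3 y * mcForm Z' 3 0 y u ∧
    mcForm Z 2 0 y u = normTransition Z Z' 2 1 y * mcForm Z' 1 0 y u +
      normTransition Z Z' 1 1 y * mcForm Z' 2 0 y u +
      normTransition Z Z' 2 3 y * mcForm Z' 3 0 y u := by
  have N := hZ.normTransition_pattern hZ' hy
  have g1 := hZ.normTransition_gauge hZ' hy 1 0 u
  have g2 := hZ.normTransition_gauge hZ' hy 2 0 u
  rw [hZ.fderiv_eq_const_mul (g := normTransition Z Z' 0 0) hy 0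
    (hZ.differentiableAt_normTransition hZ' hy 0 0)
    (fun z hz => by rw [(hZ.normTransition_pattern hZ' hz).s10, zero_mul])] at g1
  rw [hZ.fderiv_eq_const_mul (g := normTransition Z Z' 0 0) hy 0
    (hZ.differentiableAt_normTransition hZ' hy 0 0)
    (fun z hz => by rw [(hZ.normTransition_pattern hZ' hz).s20, zero_mul])] at g2
  simp only [Fin.sum_univ_four, N.s00, N.s10, N.s20, N.s30, N.s22, N.s12] at g1 g2
  constructor
  · linear_combination -g1
  · linear_combination -g2

theorem normalConj_change_aux (hZ : IsFrameFamily Y O Z) (hZ' : IsFrameFamily Y O Z')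
    {y : ℝ × Plane} (hy : y ∈ O) (u : ℝ × Plane) :
    mcForm Z 3 1 y u = normTransition Z Z' 1 1 y * mcForm Z' 3 1 y u -
      normTransition Z Z' 2 1 y * mcForm Z' 3 2 y u - mcForm Z' 3 0 y u *
      (normTransition Z Z' 1 1 y * normTransition Z Z' 0 1 y -
        normTransition Z Z' 2 1 y * normTransition Z Z' 0 2 y) ∧
    mcForm Z 3 2 y u = normTransition Z Z' 2 1 y * mcForm Z' 3 1 y u +
      normTransition Z Z' 1 1 y * mcForm Z' 3 2 y u - mcForm Z' 3 0 y u *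
      (normTransition Z Z' 2 1 y * normTransition Z Z' 0 1 y +
        normTransition Z Z' 1 1 y * normTransition Z Z' 0 2 y) := by
  have N := hZ.normTransition_pattern hZ' hy
  have g1 := hZ.normTransition_gauge hZ' hy 3 1 u
  have g2 := hZ.normTransition_gauge hZ' hy 3 2 u
  rw [hZ.fderiv_eq_const_mul (g := normTransition Z Z' 0 0) hy 0
    (hZ.differentiableAt_normTransition hZ' hy 0 0)
    (fun z hz => by rw [(hZ.normTransition_pattern hZ' hz).s31, zero_mul])] at g1
  rw [hZ.fderiv_eq_const_mul (g := normTransition Z Z' 0 0) hy 0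
    (hZ.differentiableAt_normTransition hZ' hy 0 0)
    (fun z hz => by rw [(hZ.normTransition_pattern hZ' hz).s32, zero_mul])] at g2
  simp only [Fin.sum_univ_four, N.s30, N.s31, N.s32, N.s22, N.s12,
    hZ.hamiltonian_change hZ' hy] at g1 g2
  have h33 := N.s33
  have hN := N.ne
  constructor
  · refine mul_left_cancel₀ hN ?_
    linear_combination -normTransition Z Z' 1 1 y * g1 + normTransition Z Z' 2 1 y * g2 +
      mcForm Z 3 1 y u * h33
  · refine mul_left_cancel₀ hN ?_
    linear_combination -normTransition Z Z' 2 1 y * g1 - normTransition Z Z' 1 1 y * g2 +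
      mcForm Z 3 2 y u * h33

/-- The combination i(π¹₁ - π²₂) + π¹₂ + π²₁ is blind to the derivative of the conformal block,
since S₂₂ = S₁₁ and S₁₂ = -S₂₁. In spatial directions it yields the law for η, in the time direction
the law for `hopfTime`. -/
theorem hopf_change (hZ : IsFrameFamily Y O Z) (hZ' : IsFrameFamily Y O Z')
    {y : ℝ × Plane} (hy : y ∈ O) (u : ℝ × Plane) :
    (normTransition Z Z' 1 1 y + Complex.I * normTransition Z Z' 2 1 y) *
      (Complex.I * (mcForm Z 1 1 y u - mcForm Z 2 2 y u) + mcForm Z 1 2 y u + mcForm Z 2 1 y u) +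
    (normTransition Z Z' 0 1 y - Complex.I * normTransition Z Z' 0 2 y) *
      (Complex.I * mcForm Z 1 0 y u + mcForm Z 2 0 y u) =
    (normTransition Z Z' 1 1 y - Complex.I * normTransition Z Z' 2 1 y) *
      (Complex.I * (mcForm Z' 1 1 y u - mcForm Z' 2 2 y u) + mcForm Z' 1 2 y u + mcForm Z' 2 1 y u)
        +
    (normTransition Z Z' 1 1 y - Complex.I * normTransition Z Z' 2 1 y) *
      (normTransition Z Z' 0 1 y - Complex.I * normTransition Z Z' 0 2 y) *
      (-mcForm Z' 3 1 y u + Complex.I * mcForm Z' 3 2 y u) := by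
  have N := hZ.normTransition_pattern hZ' hy
  have g11 := hZ.normTransition_gauge hZ' hy 1 1 u
  have g12 := hZ.normTransition_gauge hZ' hy 1 2 u
  have g21 := hZ.normTransition_gauge hZ' hy 2 1 u
  have g22 := hZ.normTransition_gauge hZ' hy 2 2 u
  rw [hZ.fderiv_eq_const_mul (g := normTransition Z Z' 1 1) hy 1
    (hZ.differentiableAt_normTransition hZ' hy 1 1)
    (fun z hz => by rw [(hZ.normTransition_pattern hZ' hz).s22, one_mul])] at g22
  rw [hZ.fderiv_eq_const_mul (g := normTransition Z Z' 2 1) hy (-1)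
    (hZ.differentiableAt_normTransition hZ' hy 2 1)
    (fun z hz => by rw [(hZ.normTransition_pattern hZ' hz).s12, neg_one_mul])] at g12
  simp only [Fin.sum_univ_four, N.s10, N.s20, N.s31, N.s32, N.s22, N.s12, N.s13, N.s23]
    at g11 g12 g21 g22
  linear_combination (norm := (ring_nf; simp only [Complex.I_sq, Complex.I_pow_three]; ring))
    -(Complex.I * (g11 - g22) + g12 + g21)

end IsFrameFamily

end

/-! ### The transformation laws in complex notation -/

section

variable {Y : ℝ → Plane → PCSphere} {O : Set (ℝ × Plane)}
  {Z Z' : ℝ × Plane → Matrix (Fin 4) (Fin 4) ℂ}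

/-- The rotation and dilation part of the change of frames. -/
def rotation (Z Z' : ℝ × Plane → Matrix (Fin 4) (Fin 4) ℂ) (y : ℝ × Plane) : ℂ :=
  normTransition Z Z' 1 1 y + Complex.I * normTransition Z Z' 2 1 y

/-- The translation part of the change of frames. -/
def translation (Z Z' : ℝ × Plane → Matrix (Fin 4) (Fin 4) ℂ) (y : ℝ × Plane) : ℂ :=
  normTransition Z Z' 0 1 y + Complex.I * normTransition Z Z' 0 2 y

namespace IsFrameFamily

theorem mc_slice_apply (hZ : IsFrameFamily Y O Z) {t : ℝ} {x : Plane} (hx : (t, x) ∈ O)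
    (A B : Fin 4) (v : Plane) : mcForm Z A B (t, x) (0, v) = (slice Z t).mc A B x v := by
  rw [hZ.mc_slice hx]; rfl

theorem star_rotation (hZ : IsFrameFamily Y O Z) (hZ' : IsFrameFamily Y O Z') {y : ℝ × Plane}
    (hy : y ∈ O) : star (rotation Z Z' y) =
      normTransition Z Z' 1 1 y - Complex.I * normTransition Z Z' 2 1 y := by
  have N := hZ.normTransition_pattern hZ' hy
  simp only [rotation, star_add, star_mul', N.star11, N.star21, Complex.star_def, Complex.conj_I]
  ring

theorem star_translation (hZ : IsFrameFamily Y O Z) (hZ' : IsFrameFamily Y O Z') {y : ℝ × Plane}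
    (hy : y ∈ O) : star (translation Z Z' y) =
      normTransition Z Z' 0 1 y - Complex.I * normTransition Z Z' 0 2 y := by
  have N := hZ.normTransition_pattern hZ' hy
  simp only [translation, star_add, star_mul', N.star01, N.star02, Complex.star_def, Complex.conj_I]
  ring

theorem rotation_mul_star (hZ : IsFrameFamily Y O Z) (hZ' : IsFrameFamily Y O Z') {y : ℝ × Plane}
    (hy : y ∈ O) : rotation Z Z' y * star (rotation Z Z' y) = normTransition Z Z' 3 3 y := by
  rw [hZ.star_rotation hZ' hy, rotation, (hZ.normTransition_pattern hZ' hy).s33]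
  linear_combination -normTransition Z Z' 2 1 y ^ 2 * Complex.I_sq

theorem rotation_ne (hZ : IsFrameFamily Y O Z) (hZ' : IsFrameFamily Y O Z') {y : ℝ × Plane}
    (hy : y ∈ O) : rotation Z Z' y ≠ 0 := by
  intro h
  have := hZ.rotation_mul_star hZ' hy
  rw [h, zero_mul] at this
  exact (hZ.normTransition_pattern hZ' hy).ne this.symm

theorem omega_change (hZ : IsFrameFamily Y O Z) (hZ' : IsFrameFamily Y O Z') {t : ℝ} {x : Plane}
    (hx : (t, x) ∈ O) :
    (slice Z t).omega x = rotation Z Z' (t, x) • (slice Z' t).omega x := by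
  have N := hZ.normTransition_pattern hZ' hx
  have P' := (hZ'.frame t).pattern hx
  ext v
  obtain ⟨g1, g2⟩ := hZ.tangent_change hZ' hx (0, v)
  simp only [hZ.mc_slice_apply hx, hZ'.mc_slice_apply hx, P'.mc30, zero_apply, mul_zero,
    add_zero] at g1 g2
  simp only [IsLegFrame.omega_eq, rotation, add_apply, smul_apply, smul_eq_mul, g1, g2]
  linear_combination -normTransition Z Z' 2 1 (t, x) * (slice Z' t).mc 2 0 x v * Complex.I_sq

theorem eta_change (hZ : IsFrameFamily Y O Z) (hZ' : IsFrameFamily Y O Z') {t : ℝ} {x : Plane}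
    (hx : (t, x) ∈ O) :
    rotation Z Z' (t, x) • (slice Z t).eta x =
      star (rotation Z Z' (t, x)) • (slice Z' t).eta x := by
  have P := (hZ.frame t).pattern hx
  have P' := (hZ'.frame t).pattern hx
  ext v
  have g := hZ.hopf_change hZ' hx (0, v)
  obtain ⟨g1, g2⟩ := hZ.tangent_change hZ' hx (0, v)
  rw [g1, g2] at g
  simp only [hZ.mc_slice_apply hx, hZ'.mc_slice_apply hx, P.mc11, P.mc12, P.mc21, P.mc22,
    P'.mc11, P'.mc12, P'.mc21, P'.mc22, P'.mc30, P'.mc31, P'.mc32, add_apply, neg_apply,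
    smul_apply, zero_apply, smul_eq_mul] at g
  rw [hZ.star_rotation hZ' hx]
  simp only [FrameField.eta, rotation, sub_apply, smul_apply, smul_eq_mul]
  have I4 := Complex.I_pow_four
  linear_combination
    (norm := (ring_nf; simp only [Complex.I_sq, Complex.I_pow_three, I4]; ring)) -(2⁻¹ : ℂ) * g

theorem h_change (hZ : IsFrameFamily Y O Z) (hZ' : IsFrameFamily Y O Z') {t : ℝ} {x : Plane}
    (hx : (t, x) ∈ O) :
    rotation Z Z' (t, x) ^ 2 * (slice Z t).h x =
      star (rotation Z Z' (t, x)) * (slice Z' t).h x := by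
  have g := hZ.eta_change hZ' hx
  rw [(hZ.frame t).eta_eq_smul hx, (hZ'.frame t).eta_eq_smul hx, hZ.omega_change hZ' hx] at g
  have hw := (hZ'.frame t).wedge_omega_ne hx
  have k : ∀ v, (rotation Z Z' (t, x) ^ 2 * (slice Z t).h x -
      star (rotation Z Z' (t, x)) * (slice Z' t).h x) * (slice Z' t).omega x v +
      0 * conjForm ((slice Z' t).omega x) v = 0 := by
    intro v
    have := DFunLike.congr_fun g v
    simp only [smul_apply, smul_eq_mul] at this
    linear_combination this
  exact sub_eq_zero.1 (eq_zero_of_coframe hw (k e₁) (k e₂)).1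

/-- These are the real parts of the gauge equations in the entries (1,3) and (2,3). As S₁₃ and S₂₃
are imaginary, their derivatives do not contribute. -/
theorem mu_change_aux (hZ : IsFrameFamily Y O Z) (hZ' : IsFrameFamily Y O Z') {t : ℝ} {x : Plane}
    (hx : (t, x) ∈ O) (v : Plane) :
    star (rotation Z Z' (t, x)) * (slice Z' t).muC x v =
      (2⁻¹ : ℂ) * (normTransition Z Z' 0 3 (t, x) + star (normTransition Z Z' 0 3 (t, x))) *
        conjForm ((slice Z t).omega x) v +
      normTransition Z Z' 3 3 (t, x) * (slice Z t).muC x v -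
      (slice Z t).eta x v * (rotation Z Z' (t, x) * translation Z Z' (t, x)) := by
  have N := hZ.normTransition_pattern hZ' hx
  have P := (hZ.frame t).pattern hx
  have P' := (hZ'.frame t).pattern hx
  have d := hZ.differentiableAt_normTransition hZ' hx
  have hγ := hZ.star_logDeriv_transition hZ' hx (0, v)
  have g1 := hZ.normTransition_gauge hZ' hx 1 3 (0, v)
  have g2 := hZ.normTransition_gauge hZ' hx 2 3 (0, v)
  have D1 : star (fderiv ℝ (normTransition Z Z' 1 3) (t, x) (0, v)) =
      -fderiv ℝ (normTransition Z Z' 1 3) (t, x) (0, v) := by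
    rw [← fderiv_star_apply _ _ (d 1 3), ← neg_one_mul]
    refine hZ.fderiv_eq_const_mul hx (-1) (d 1 3) (fun z hz => ?_) _
    have Nz := hZ.normTransition_pattern hZ' hz
    simp only [Nz.s13, star_mul', star_sub, Nz.star11, Nz.star21, Nz.star01, Nz.star02,
      Complex.star_def, Complex.conj_I]
    ring
  have D2 : star (fderiv ℝ (normTransition Z Z' 2 3) (t, x) (0, v)) =
      -fderiv ℝ (normTransition Z Z' 2 3) (t, x) (0, v) := by
    rw [← fderiv_star_apply _ _ (d 2 3), ← neg_one_mul]
    refine hZ.fderiv_eq_const_mul hx (-1) (d 2 3) (fun z hz => ?_) _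
    have Nz := hZ.normTransition_pattern hZ' hz
    simp only [Nz.s23, star_mul', star_add, Nz.star11, Nz.star21, Nz.star01, Nz.star02,
      Complex.star_def, Complex.conj_I]
    ring
  simp only [Fin.sum_univ_four, hZ.mc_slice_apply hx, hZ'.mc_slice_apply hx, N.s10, N.s20, N.s22,
    N.s12, N.s13, N.s23, P.mc11, P.mc12, P.mc21, P.mc22, P.mc13, P.mc23, P'.mc13, P'.mc23,
    P'.mc33, add_apply, neg_apply, smul_apply, smul_eq_mul] at g1 g2
  set γ := fderiv ℝ (fun y => transition Z Z' y 0 0) (t, x) (0, v) / transition Z Z' (t, x) 0 0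
  have c1 := congrArg star g1
  have c2 := congrArg star g2
  have rN : star (normTransition Z Z' 3 3 (t, x)) = normTransition Z Z' 3 3 (t, x) := by
    rw [N.s33]; simp only [star_add, star_pow, N.star11, N.star21]
  have cI : star Complex.I = -Complex.I := Complex.conj_I
  simp only [star_add, star_mul', star_sub, star_neg, star_zero, N.star11, N.star21, N.star01,
    N.star02, rN, hγ, D1, D2, P.star10, P.star20, P'.star_phi, P.star_beta, P.star_rho,
    P.star_mu, P'.star_mu, P.star_nu, P'.star_nu, cI] at c1 c2
  rw [hZ.star_rotation hZ' hx, (hZ.frame t).conj_omega_eq hx]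
  simp only [FrameField.muC, FrameField.eta, rotation, translation, sub_apply, smul_apply,
    smul_eq_mul]
  linear_combination (norm := (ring_nf; simp only [Complex.I_sq, Complex.I_pow_three]; ring))
    (2⁻¹ : ℂ) * (g1 + c1) - (2⁻¹ : ℂ) * Complex.I * (g2 + c2)

/-- In both frames μ is a multiple of ω. The ω̄ component of the change of μ therefore forces S₀₃ to
be imaginary, and the ω component is the law for p. -/
theorem p_change_aux (hZ : IsFrameFamily Y O Z) (hZ' : IsFrameFamily Y O Z') {t : ℝ} {x : Plane}
    (hx : (t, x) ∈ O) :
    star (normTransition Z Z' 0 3 (t, x)) = -normTransition Z Z' 0 3 (t, x) ∧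
    rotation Z Z' (t, x) ^ 2 * (slice Z t).p x =
      (slice Z' t).p x + translation Z Z' (t, x) * (slice Z' t).h x := by
  have g := hZ.mu_change_aux hZ' hx
  have gh := hZ.h_change hZ' hx
  have he := hZ.rotation_ne hZ' hx
  have he' : star (rotation Z Z' (t, x)) ≠ 0 := star_ne_zero.2 he
  rw [(hZ.frame t).eta_eq_smul hx, (hZ.frame t).muC_eq_smul hx, (hZ'.frame t).muC_eq_smul hx,
    hZ.omega_change hZ' hx, ← hZ.rotation_mul_star hZ' hx] at g
  have hw := (hZ'.frame t).wedge_omega_ne hx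
  set e := rotation Z Z' (t, x)
  have k : ∀ v, (star e * (slice Z' t).p x - star e * e ^ 2 * (slice Z t).p x +
      (slice Z t).h x * e ^ 2 * translation Z Z' (t, x)) * (slice Z' t).omega x v +
      (-(2⁻¹ : ℂ) * (normTransition Z Z' 0 3 (t, x) + star (normTransition Z Z' 0 3 (t, x))) *
        star e) * conjForm ((slice Z' t).omega x) v = 0 := by
    intro v
    have := g v
    simp only [smul_apply, smul_eq_mul, conjForm_apply, star_mul'] at this ⊢
    linear_combination this
  obtain ⟨k1, k2⟩ := eq_zero_of_coframe hw (k e₁) (k e₂)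
  constructor
  · have := (mul_eq_zero.1 k2).resolve_right he'
    linear_combination -2 * this
  · refine mul_left_cancel₀ he' ?_
    linear_combination -k1 + translation Z Z' (t, x) * gh

/-- The real part of the (0,3) gauge equation: S₀₃ is imaginary, so its derivative drops out. The
remaining terms in μ turn the translation into the terms linear and quadratic in it. -/
theorem q_change (hZ : IsFrameFamily Y O Z) (hZ' : IsFrameFamily Y O Z') {t : ℝ} {x : Plane}
    (hx : (t, x) ∈ O) :
    normTransition Z Z' 3 3 (t, x) * rotation Z Z' (t, x) * (slice Z t).q x =
      (slice Z' t).q x + translation Z Z' (t, x) * (slice Z' t).p x +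
      (2⁻¹ : ℂ) * translation Z Z' (t, x) ^ 2 * (slice Z' t).h x := by
  have N := hZ.normTransition_pattern hZ' hx
  have P := (hZ.frame t).pattern hx
  have P' := (hZ'.frame t).pattern hx
  have d := hZ.differentiableAt_normTransition hZ' hx
  have rN : star (normTransition Z Z' 3 3 (t, x)) = normTransition Z Z' 3 3 (t, x) := by
    rw [N.s33]; simp only [star_add, star_pow, N.star11, N.star21]
  have cI : star Complex.I = -Complex.I := Complex.conj_I
  have s03 : star (normTransition Z Z' 0 3 (t, x)) = -normTransition Z Z' 0 3 (t, x) :=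
    (hZ.p_change_aux hZ' hx).1
  have hp := (hZ.p_change_aux hZ' hx).2
  have hw := (hZ'.frame t).wedge_omega_ne hx
  have hτ := hZ.star_translation hZ' hx
  have hE := hZ.star_rotation hZ' hx
  have key : ∀ v, normTransition Z Z' 3 3 (t, x) * (slice Z t).mc 0 3 x v =
      (slice Z' t).mc 0 3 x v + (2⁻¹ : ℂ) * (translation Z Z' (t, x) * (slice Z' t).muC x v +
        star (translation Z Z' (t, x) * (slice Z' t).muC x v)) +
      (2⁻¹ : ℂ) * (rotation Z Z' (t, x) * translation Z Z' (t, x) * (slice Z t).muC x v +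
        star (rotation Z Z' (t, x) * translation Z Z' (t, x) * (slice Z t).muC x v)) := by
    intro v
    have hγ := hZ.star_logDeriv_transition hZ' hx (0, v)
    have g := hZ.normTransition_gauge hZ' hx 0 3 (0, v)
    have D : star (fderiv ℝ (normTransition Z Z' 0 3) (t, x) (0, v)) =
        -fderiv ℝ (normTransition Z Z' 0 3) (t, x) (0, v) := by
      rw [← fderiv_star_apply _ _ (d 0 3), ← neg_one_mul]
      refine hZ.fderiv_eq_const_mul hx (-1) (d 0 3) (fun z hz => ?_) _
      rw [(hZ.p_change_aux hZ' (t := z.1) (x := z.2) hz).1, neg_one_mul]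
    simp only [Fin.sum_univ_four, hZ.mc_slice_apply hx, hZ'.mc_slice_apply hx, N.s00, N.s13, N.s23,
      P.mc00, P.mc01, P.mc02, P'.mc13, P'.mc23, P'.mc33, add_apply, neg_apply, smul_apply,
      smul_eq_mul] at g
    set γ := fderiv ℝ (fun y => transition Z Z' y 0 0) (t, x) (0, v) / transition Z Z' (t, x) 0 0
    have c := congrArg star g
    simp only [star_add, star_mul', star_sub, star_neg, star_one, N.star11, N.star21,
      N.star01, N.star02, rN, hγ, D, s03, P.star03, P'.star03, P.star_phi, P'.star_phi, P.star_mu,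
      P'.star_mu, P.star_nu, P'.star_nu, cI] at c
    simp only [star_mul', hτ, hE, FrameField.muC, sub_apply, smul_apply, smul_eq_mul, star_sub,
      P.star_mu, P'.star_mu, cI]
    simp only [rotation, translation]
    linear_combination (norm := (ring_nf; simp only [Complex.I_sq]; ring))
      -(2⁻¹ : ℂ) * (g + c)
  rw [(hZ.frame t).kappa_eq hx, (hZ'.frame t).kappa_eq hx, (hZ.frame t).muC_eq_smul hx,
    (hZ'.frame t).muC_eq_smul hx, hZ.omega_change hZ' hx] at key
  have k : ∀ v, (normTransition Z Z' 3 3 (t, x) * rotation Z Z' (t, x) * (slice Z t).q x -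
      ((slice Z' t).q x + translation Z Z' (t, x) * (slice Z' t).p x +
      (2⁻¹ : ℂ) * translation Z Z' (t, x) ^ 2 * (slice Z' t).h x)) * (slice Z' t).omega x v +
      star (normTransition Z Z' 3 3 (t, x) * rotation Z Z' (t, x) * (slice Z t).q x -
      ((slice Z' t).q x + translation Z Z' (t, x) * (slice Z' t).p x +
      (2⁻¹ : ℂ) * translation Z Z' (t, x) ^ 2 * (slice Z' t).h x)) *
        conjForm ((slice Z' t).omega x) v = 0 := by
    intro v
    have k1 := key v
    have hps := congrArg star hp
    have c2 : star (2⁻¹ : ℂ) = 2⁻¹ := by simp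
    simp only [add_apply, smul_apply, smul_eq_mul, conjForm_apply, star_mul', star_add, star_sub,
      star_pow, rN, c2] at k1 hps ⊢
    linear_combination k1 + (2⁻¹ : ℂ) * translation Z Z' (t, x) * (slice Z' t).omega x v * hp +
      (2⁻¹ : ℂ) * star (translation Z Z' (t, x)) * star ((slice Z' t).omega x v) * hps
  exact sub_eq_zero.1 (eq_zero_of_coframe hw (k e₁) (k e₂)).1

theorem normalConj_change (hZ : IsFrameFamily Y O Z) (hZ' : IsFrameFamily Y O Z') {t : ℝ}
    {x : Plane} (hx : (t, x) ∈ O) :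
    normalConj Z t x = star (rotation Z Z' (t, x)) *
      (normalConj Z' t x + star (translation Z Z' (t, x)) * hamiltonian Z' t x) := by
  have N := hZ.normTransition_pattern hZ' hx
  obtain ⟨g1, g2⟩ := hZ.tangent_change hZ' hx (1, 0)
  obtain ⟨g3, g4⟩ := hZ.normalConj_change_aux hZ' hx (1, 0)
  rw [hZ.star_rotation hZ' hx, hZ.star_translation hZ' hx]
  simp only [normalConj, hamiltonian, timeMC, g1, g2, g3, g4, N.s13, N.s23]
  linear_combination (norm := (ring_nf; simp only [Complex.I_sq]; ring))

theorem hopfTime_change (hZ : IsFrameFamily Y O Z) (hZ' : IsFrameFamily Y O Z') {t : ℝ}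
    {x : Plane} (hx : (t, x) ∈ O) :
    rotation Z Z' (t, x) * hopfTime Z t x = star (rotation Z Z' (t, x)) *
      (hopfTime Z' t x - star (translation Z Z' (t, x)) * normalConj Z' t x -
        (2⁻¹ : ℂ) * star (translation Z Z' (t, x)) ^ 2 * hamiltonian Z' t x) := by
  have N := hZ.normTransition_pattern hZ' hx
  obtain ⟨g1, g2⟩ := hZ.tangent_change hZ' hx (1, 0)
  have g := hZ.hopf_change hZ' hx (1, 0)
  rw [g1, g2, N.s13, N.s23] at g
  rw [hZ.star_rotation hZ' hx, hZ.star_translation hZ' hx]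
  simp only [normalConj, hamiltonian, timeMC, hopfTime, rotation] at g ⊢
  linear_combination (norm := (ring_nf; simp only [Complex.I_sq, Complex.I_pow_three]; ring))
    -(2⁻¹ : ℂ) * g

/-- The boundary form does not depend on the choice of the frames. -/
theorem boundaryForm_change (hZ : IsFrameFamily Y O Z) (hZ' : IsFrameFamily Y O Z') {t : ℝ}
    {x : Plane} (hx : (t, x) ∈ O) : boundaryForm Z t x = boundaryForm Z' t x := by
  have he := hZ.rotation_ne hZ' hx
  have he' : star (rotation Z Z' (t, x)) ≠ 0 := star_ne_zero.2 he
  have hN := hZ.rotation_mul_star hZ' hx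
  have hB := hZ.hopfTime_change hZ' hx
  have hy := hZ.normalConj_change hZ' hx
  have hf : hamiltonian Z t x = normTransition Z Z' 3 3 (t, x) * hamiltonian Z' t x :=
    hZ.hamiltonian_change hZ' hx (1, 0)
  have hh := congrArg star (hZ.h_change hZ' hx)
  have hp := congrArg star (hZ.p_change_aux hZ' hx).2
  have hq := congrArg star (hZ.q_change hZ' hx)
  have c2 : star (2⁻¹ : ℂ) = 2⁻¹ := by simp
  rw [← hN] at hq hf
  ext v
  simp only [boundaryForm, (hZ.frame t).eta_eq_smul hx, (hZ'.frame t).eta_eq_smul hx,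
    (hZ.frame t).muC_eq_smul hx, (hZ'.frame t).muC_eq_smul hx, hZ.omega_change hZ' hx,
    add_apply, sub_apply, smul_apply, smul_eq_mul, conjForm_apply, star_mul', star_add, star_star,
    star_pow, c2] at *
  set e := rotation Z Z' (t, x)
  set τ := star (translation Z Z' (t, x))
  -- Ξ is a scalar times ω̄. The laws for the time components (B, y, f) are dual to those for (h, p,
  -- q), so the translation terms cancel; the factor ē that remains is the one in ω̄ = ē ω̄'.
  have key : star e * (hopfTime Z t x * star ((slice Z t).h x) +
      normalConj Z t x * star ((slice Z t).p x) - hamiltonian Z t x * star ((slice Z t).q x)) =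
      hopfTime Z' t x * star ((slice Z' t).h x) + normalConj Z' t x * star ((slice Z' t).p x) -
      hamiltonian Z' t x * star ((slice Z' t).q x) := by
    refine mul_left_cancel₀ he ?_
    rw [hf, hy]
    linear_combination star e * star ((slice Z t).h x) * hB +
      (hopfTime Z' t x - τ * normalConj Z' t x - 2⁻¹ * τ ^ 2 * hamiltonian Z' t x) * hh +
      e * (normalConj Z' t x + τ * hamiltonian Z' t x) * hp - e * hamiltonian Z' t x * hq
  linear_combination star ((slice Z' t).omega x v) * key

theorem willmoreForm_change (hZ : IsFrameFamily Y O Z) (hZ' : IsFrameFamily Y O Z') {t : ℝ}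
    {x : Plane} (hx : (t, x) ∈ O) : (slice Z t).willmoreForm x = (slice Z' t).willmoreForm x := by
  have he := hZ.rotation_ne hZ' hx
  have he' : star (rotation Z Z' (t, x)) ≠ 0 := star_ne_zero.2 he
  rw [willmoreForm_eq (hZ.frame t) hx, willmoreForm_eq (hZ'.frame t) hx]
  congr 2
  have g := hZ.eta_change hZ' hx
  have k : ∀ v, rotation Z Z' (t, x) * (slice Z t).eta x v =
      star (rotation Z Z' (t, x)) * (slice Z' t).eta x v := fun v => DFunLike.congr_fun g v
  have k' : ∀ v, star (rotation Z Z' (t, x)) * star ((slice Z t).eta x v) =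
      rotation Z Z' (t, x) * star ((slice Z' t).eta x v) := fun v => by
    have := congrArg star (k v)
    simpa only [star_mul', star_star] using this
  simp only [wedge, conjForm_apply]
  refine mul_left_cancel₀ (mul_ne_zero he he') ?_
  linear_combination star (rotation Z Z' (t, x)) * star ((slice Z t).eta x e₂) * k e₁ +
    star (rotation Z Z' (t, x)) * (slice Z' t).eta x e₁ * k' e₂ -
    star (rotation Z Z' (t, x)) * star ((slice Z t).eta x e₁) * k e₂ -
    star (rotation Z Z' (t, x)) * (slice Z' t).eta x e₂ * k' e₁

end IsFrameFamily

end

/-! ### Normalisation of frames -/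

/-- A unipotent element of `SU(3,1)` which fixes the first basis vector. -/
def shear (a b c : ℝ) : Matrix (Fin 4) (Fin 4) ℂ :=
  Matrix.of ![![1, Complex.I * a, Complex.I * b, c + Complex.I * (a ^ 2 + b ^ 2) / 2],
    ![0, 1, 0, a], ![0, 0, 1, b], ![0, 0, 0, 1]]

theorem isSU31_shear (a b c : ℝ) : IsSU31 (shear a b c) := by
  constructor
  · rw [Matrix.det_succ_column_zero, Fin.sum_univ_four]
    simp [Matrix.det_fin_three, shear, Fin.succAbove]
  · intro z w
    simp [herm, shear, Matrix.mulVec, dotProduct, Fin.sum_univ_four]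
    ring_nf
    simp only [Complex.I_sq]
    ring

theorem IsSU31.mul {A B : Matrix (Fin 4) (Fin 4) ℂ} (hA : IsSU31 A) (hB : IsSU31 B) :
    IsSU31 (A * B) :=
  ⟨by rw [Matrix.det_mul, hA.1, hB.1, one_mul], fun z w => by
    rw [← Matrix.mulVec_mulVec, ← Matrix.mulVec_mulVec, hA.2, hB.2]⟩

theorem col_mul_shear (Z : Matrix (Fin 4) (Fin 4) ℂ) (a b c : ℝ) :
    col (Z * shear a b c) 0 = col Z 0 ∧
    col (Z * shear a b c) 1 = col Z 1 + (Complex.I * a) • col Z 0 ∧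
    col (Z * shear a b c) 2 = col Z 2 + (Complex.I * b) • col Z 0 ∧
    col (Z * shear a b c) 3 = col Z 3 + (a : ℂ) • col Z 1 + (b : ℂ) • col Z 2 +
      (c + Complex.I * (a ^ 2 + b ^ 2) / 2) • col Z 0 := by
  refine ⟨?_, ?_, ?_, ?_⟩ <;> ext i <;>
    simp [col, Matrix.mul_apply, Fin.sum_univ_four, shear] <;> ring

section

variable {E : Type*} [NormedAddCommGroup E] [NormedSpace ℝ E]
  {Z : E → Matrix (Fin 4) (Fin 4) ℂ} {V : Set E} {a b c : E → ℝ}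

theorem _root_.ContDiffOn.ofReal_complex {f : E → ℝ} {s : Set E} {n : WithTop ℕ∞}
    (hf : ContDiffOn ℝ n f s) : ContDiffOn ℝ n (fun y => (f y : ℂ)) s :=
  Complex.ofRealCLM.contDiff.comp_contDiffOn hf

theorem _root_.ContDiffOn.re_complex {f : E → ℂ} {s : Set E} {n : WithTop ℕ∞}
    (hf : ContDiffOn ℝ n f s) : ContDiffOn ℝ n (fun y => (f y).re) s :=
  Complex.reCLM.contDiff.comp_contDiffOn hf

theorem _root_.ContDiffOn.im_complex {f : E → ℂ} {s : Set E} {n : WithTop ℕ∞}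
    (hf : ContDiffOn ℝ n f s) : ContDiffOn ℝ n (fun y => (f y).im) s :=
  Complex.imCLM.contDiff.comp_contDiffOn hf

namespace SmoothSU

theorem mul_shear (hZ : SmoothSU Z V) (ha : ContDiffOn ℝ ∞ a V) (hb : ContDiffOn ℝ ∞ b V)
    (hc : ContDiffOn ℝ ∞ c V) : SmoothSU (fun y => Z y * shear (a y) (b y) (c y)) V where
  isOpen := hZ.isOpen
  unitary x hx := (hZ.unitary x hx).mul (isSU31_shear _ _ _)
  smooth A B := by
    have ha' := ha.ofReal_complex
    have hb' := hb.ofReal_complex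
    have hc' := hc.ofReal_complex
    simp only [Matrix.mul_apply]
    refine ContDiffOn.sum fun C _ => (hZ.smooth A C).mul ?_
    fin_cases C <;> fin_cases B <;> simp [shear] <;>
      first
      | exact contDiffOn_const
      | exact contDiffOn_const.mul ha'
      | exact contDiffOn_const.mul hb'
      | exact ha'
      | exact hb'
      | exact hc'.add ((contDiffOn_const.mul ((ha'.pow 2).add (hb'.pow 2))).div_const _)

/-- The first column is unchanged, and multiples of Z₀ added to the other columns are invisible to
dZ₀ in directions where π³₀ vanishes. What remains is the shift of π⁰₀ by -i(aω¹ + bω²), used to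
make it real. -/
theorem mcForm_mul_shear (hZ : SmoothSU Z V) (ha : ContDiffOn ℝ ∞ a V) (hb : ContDiffOn ℝ ∞ b V)
    (hc : ContDiffOn ℝ ∞ c V) {x : E} (hx : x ∈ V) {u : E} (hu : mcForm Z 3 0 x u = 0) :
    mcForm (fun y => Z y * shear (a y) (b y) (c y)) 3 0 x u = 0 ∧
    mcForm (fun y => Z y * shear (a y) (b y) (c y)) 1 0 x u = mcForm Z 1 0 x u ∧
    mcForm (fun y => Z y * shear (a y) (b y) (c y)) 2 0 x u = mcForm Z 2 0 x u ∧
    mcForm (fun y => Z y * shear (a y) (b y) (c y)) 0 0 x u =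
      mcForm Z 0 0 x u - Complex.I * (a x * mcForm Z 1 0 x u + b x * mcForm Z 2 0 x u) := by
  have hW := hZ.mul_shear ha hb hc
  simp only [hW.mcForm_apply hx, (col_mul_shear _ _ _ _).1, (col_mul_shear _ _ _ _).2.1,
    (col_mul_shear _ _ _ _).2.2.1, (col_mul_shear _ _ _ _).2.2.2]
  simp only [hZ.mcForm_apply hx] at hu ⊢
  have h0 : herm (fderiv ℝ (fun y => col (Z y) 0) x u) (col (Z x) 0) = 0 := by
    simpa using hu
  simp only [herm_add_right, herm_smul_right, h0]
  simp
  ring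

/-- The derivative of c contributes only a multiple of Z₀, orthogonal to Z₁ and Z₂; so μⁱ is shifted
by cωⁱ and its trace by 2c. -/
theorem mcForm_mul_shear_zero (hZ : SmoothSU Z V) (hc : ContDiffOn ℝ ∞ c V) {x : E} (hx : x ∈ V)
    (u : E) :
    mcForm (fun y => Z y * shear 0 0 (c y)) 1 3 x u = mcForm Z 1 3 x u + c x * mcForm Z 1 0 x u ∧
    mcForm (fun y => Z y * shear 0 0 (c y)) 2 3 x u =
      mcForm Z 2 3 x u + c x * mcForm Z 2 0 x u := by
  have hW := hZ.mul_shear (a := fun _ => 0) (b := fun _ => 0) contDiffOn_const contDiffOn_const hc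
  have d : fderiv ℝ (fun y => col (Z y * shear 0 0 (c y)) 3) x u =
      fderiv ℝ (fun y => col (Z y) 3) x u + ((c x : ℂ) • fderiv ℝ (fun y => col (Z y) 0) x u +
        (fderiv ℝ (fun y => (c y : ℂ)) x u) • col (Z x) 0) := by
    have : (fun y => col (Z y * shear 0 0 (c y)) 3) =
        fun y => col (Z y) 3 + (c y : ℂ) • col (Z y) 0 := by
      ext y i
      rw [(col_mul_shear _ _ _ _).2.2.2]; simp
    have hcd : DifferentiableAt ℝ (fun y => (c y : ℂ)) x :=
      hc.ofReal_complex.differentiableAt_top hZ.isOpen hx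
    rw [this, fderiv_fun_add (hZ.differentiableAt_col hx 3)
      (hcd.fun_smul (hZ.differentiableAt_col hx 0)),
      fderiv_fun_smul hcd (hZ.differentiableAt_col hx 0)]
    simp
  simp only [hW.mcForm_apply hx, d]
  simp only [hZ.mcForm_apply hx, (col_mul_shear _ _ _ _).2.1, (col_mul_shear _ _ _ _).2.2.1]
  have g1 : herm (col (Z x) 0) (col (Z x) 1) = 0 := (hZ.unitary x hx).herm_col 0 1
  have g2 : herm (col (Z x) 0) (col (Z x) 2) = 0 := (hZ.unitary x hx).herm_col 0 2
  simp [herm_add_left, herm_smul_left, g1, g2, -Complex.coe_smul]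

theorem slice {Z : ℝ × Plane → Matrix (Fin 4) (Fin 4) ℂ} {O : Set (ℝ × Plane)}
    (hZ : SmoothSU Z O) (t : ℝ) :
    SmoothSU (WillmoreLegendrian.slice Z t) {x | (t, x) ∈ O} where
  isOpen := hZ.isOpen.preimage (Continuous.prodMk_right t)
  smooth A B := (hZ.smooth A B).comp (contDiffOn_const.prodMk contDiffOn_id) fun _ hx => hx
  unitary x hx := hZ.unitary (t, x) hx

theorem mc_slice {Z : ℝ × Plane → Matrix (Fin 4) (Fin 4) ℂ} {O : Set (ℝ × Plane)}
    (hZ : SmoothSU Z O) {t : ℝ} {x : Plane} (hx : (t, x) ∈ O) (A B : Fin 4) (v : Plane) :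
    (WillmoreLegendrian.slice Z t).mc A B x v = mcForm Z A B (t, x) (0, v) := by
  have : ∀ C, fderiv ℝ (fun y => WillmoreLegendrian.slice Z t y C B) x =
      (fderiv ℝ (fun y => Z y C B) (t, x)).comp (ContinuousLinearMap.inr ℝ ℝ Plane) := fun C =>
    ((hZ.differentiableAt hx C B).hasFDerivAt.comp x (hasFDerivAt_pair t x)).fderiv
  simp only [FrameField.mc, mcForm, this]
  simp [WillmoreLegendrian.slice]

theorem contDiffOn_mc_slice {Z : ℝ × Plane → Matrix (Fin 4) (Fin 4) ℂ} {O : Set (ℝ × Plane)}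
    (hZ : SmoothSU Z O) (A B : Fin 4) (v : Plane) :
    ContDiffOn ℝ ∞ (fun y : ℝ × Plane => (WillmoreLegendrian.slice Z y.1).mc A B y.2 v) O :=
  ((hZ.contDiffOn_mcForm A B).clm_apply contDiffOn_const).congr fun _ hy => hZ.mc_slice hy A B v

end SmoothSU

end

/-- A smooth one-parameter family of first order adapted frames. -/
structure IsFirstOrderFamily (Y : ℝ → Plane → PCSphere) (O : Set (ℝ × Plane))
    (Z : ℝ × Plane → Matrix (Fin 4) (Fin 4) ℂ) : Prop where
  smoothSU : SmoothSU Z O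
  base : ∀ y ∈ O, Represents (col (Z y) 0) (Y y.1 y.2)
  leg : ∀ y ∈ O, (slice Z y.1).mc 3 0 y.2 = 0
  star10 : ∀ y ∈ O, ∀ v, star ((slice Z y.1).mc 1 0 y.2 v) = (slice Z y.1).mc 1 0 y.2 v
  star20 : ∀ y ∈ O, ∀ v, star ((slice Z y.1).mc 2 0 y.2 v) = (slice Z y.1).mc 2 0 y.2 v
  pos : ∀ y ∈ O, 0 < (wedge ((slice Z y.1).mc 1 0 y.2) ((slice Z y.1).mc 2 0 y.2)).re

/-- The area element of the coframe. -/
def FrameField.area (Z : FrameField) (x : Plane) : ℝ := (wedge (Z.mc 1 0 x) (Z.mc 2 0 x)).re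

/-- Change the frame such that `tr β = 0`. -/
def FrameField.normalizeTrace (Z : FrameField) : FrameField := fun x =>
  Z x * shear ((wedge (imForm (Z.mc 0 0 x)) (Z.mc 2 0 x)).re / Z.area x)
    ((wedge (Z.mc 1 0 x) (imForm (Z.mc 0 0 x))).re / Z.area x) 0

/-- Change the frame such that the trace of `μ` vanishes. -/
def FrameField.normalizeMean (Z : FrameField) : FrameField := fun x =>
  Z x * shear 0 0 (-(wedge (Z.mu 0 x) (Z.mc 2 0 x) + wedge (Z.mc 1 0 x) (Z.mu 1 x)).re /
    (2 * Z.area x))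

namespace IsFirstOrderFamily

variable {Y : ℝ → Plane → PCSphere} {O : Set (ℝ × Plane)}
  {Z : ℝ × Plane → Matrix (Fin 4) (Fin 4) ℂ}

theorem mul_shear (hZ : IsFirstOrderFamily Y O Z) {a b c : ℝ × Plane → ℝ}
    (ha : ContDiffOn ℝ ∞ a O) (hb : ContDiffOn ℝ ∞ b O) (hc : ContDiffOn ℝ ∞ c O) :
    IsFirstOrderFamily Y O (fun y => Z y * shear (a y) (b y) (c y)) := by
  have hW := hZ.smoothSU.mul_shear ha hb hc
  have k := fun (y : ℝ × Plane) (hy : y ∈ O) v =>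
    hZ.smoothSU.mcForm_mul_shear ha hb hc hy (u := ((0 : ℝ), v))
      (by rw [← hZ.smoothSU.mc_slice hy, hZ.leg y hy]; rfl)
  have k1 : ∀ y ∈ O, (slice (fun y => Z y * shear (a y) (b y) (c y)) y.1).mc 1 0 y.2 =
      (slice Z y.1).mc 1 0 y.2 := fun y hy => by
    ext v; rw [hW.mc_slice hy, hZ.smoothSU.mc_slice hy, (k y hy v).2.1]
  have k2 : ∀ y ∈ O, (slice (fun y => Z y * shear (a y) (b y) (c y)) y.1).mc 2 0 y.2 =
      (slice Z y.1).mc 2 0 y.2 := fun y hy => by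
    ext v; rw [hW.mc_slice hy, hZ.smoothSU.mc_slice hy, (k y hy v).2.2.1]
  refine ⟨hW, fun y hy => ?_, fun y hy => ?_, fun y hy => ?_, fun y hy => ?_, fun y hy => ?_⟩
  · rw [(col_mul_shear _ _ _ _).1]; exact hZ.base y hy
  · ext v; rw [hW.mc_slice hy, (k y hy v).1]; rfl
  · rw [k1 y hy]; exact hZ.star10 y hy
  · rw [k2 y hy]; exact hZ.star20 y hy
  · rw [k1 y hy, k2 y hy]; exact hZ.pos y hy

theorem contDiffOn_area (hZ : IsFirstOrderFamily Y O Z) :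
    ContDiffOn ℝ ∞ (fun y : ℝ × Plane => (slice Z y.1).area y.2) O := by
  have k := hZ.smoothSU.contDiffOn_mc_slice
  exact (((k 1 0 e₁).mul (k 2 0 e₂)).sub ((k 1 0 e₂).mul (k 2 0 e₁))).re_complex

/-- The shear parameters are the coefficients of Im π⁰₀ in the real coframe ω¹, ω², given by
Cramer's rule. -/
theorem normalizeTrace (hZ : IsFirstOrderFamily Y O Z) :
    IsFirstOrderFamily Y O (fun y => (slice Z y.1).normalizeTrace y.2) ∧
    ∀ y ∈ O, ∀ v,
      ((slice (fun y => (slice Z y.1).normalizeTrace y.2) y.1).mc 0 0 y.2 v).im = 0 := by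
  have k := hZ.smoothSU.contDiffOn_mc_slice
  have ki := fun v => (k 0 0 v).im_complex.ofReal_complex
  have hne : ∀ y ∈ O, (slice Z y.1).area y.2 ≠ 0 := fun y hy => (hZ.pos y hy).ne'
  have ha : ContDiffOn ℝ ∞ (fun y : ℝ × Plane => (wedge (imForm ((slice Z y.1).mc 0 0 y.2))
      ((slice Z y.1).mc 2 0 y.2)).re / (slice Z y.1).area y.2) O :=
    ((((ki e₁).mul (k 2 0 e₂)).sub ((ki e₂).mul (k 2 0 e₁))).re_complex).div hZ.contDiffOn_area hne
  have hb : ContDiffOn ℝ ∞ (fun y : ℝ × Plane => (wedge ((slice Z y.1).mc 1 0 y.2)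
      (imForm ((slice Z y.1).mc 0 0 y.2))).re / (slice Z y.1).area y.2) O :=
    ((((k 1 0 e₁).mul (ki e₂)).sub ((k 1 0 e₂).mul (ki e₁))).re_complex).div hZ.contDiffOn_area hne
  have hW := hZ.mul_shear ha hb (c := fun _ => 0) contDiffOn_const
  refine ⟨hW, fun y hy v => ?_⟩
  have key : ∀ v, ((slice Z y.1).mc 0 0 y.2 v).im =
      (wedge (imForm ((slice Z y.1).mc 0 0 y.2)) ((slice Z y.1).mc 2 0 y.2)).re /
        (slice Z y.1).area y.2 * ((slice Z y.1).mc 1 0 y.2 v).re +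
      (wedge ((slice Z y.1).mc 1 0 y.2) (imForm ((slice Z y.1).mc 0 0 y.2))).re /
        (slice Z y.1).area y.2 * ((slice Z y.1).mc 2 0 y.2 v).re := by
    have i1 : ∀ v, ((slice Z y.1).mc 1 0 y.2 v).im = 0 := fun v =>
      Complex.conj_eq_iff_im.1 (hZ.star10 y hy v)
    have i2 : ∀ v, ((slice Z y.1).mc 2 0 y.2 v).im = 0 := fun v =>
      Complex.conj_eq_iff_im.1 (hZ.star20 y hy v)
    have hA := hne y hy
    have ext : ∀ (f g : Plane →L[ℝ] ℝ), f e₁ = g e₁ → f e₂ = g e₂ → f = g := by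
      intro f g h1 h2
      ext v
      have hv : v = v 0 • e₁ + v 1 • e₂ := by
        ext i; fin_cases i <;> simp
      rw [hv]; simp only [map_add, map_smul, h1, h2]
    have := ext (Complex.imCLM.comp ((slice Z y.1).mc 0 0 y.2))
      (((wedge (imForm ((slice Z y.1).mc 0 0 y.2)) ((slice Z y.1).mc 2 0 y.2)).re /
        (slice Z y.1).area y.2) • Complex.reCLM.comp ((slice Z y.1).mc 1 0 y.2) +
      ((wedge ((slice Z y.1).mc 1 0 y.2) (imForm ((slice Z y.1).mc 0 0 y.2))).re /
        (slice Z y.1).area y.2) • Complex.reCLM.comp ((slice Z y.1).mc 2 0 y.2)) ?_ ?_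
    · intro v; simpa using DFunLike.congr_fun this v
    all_goals
      simp only [add_apply, smul_apply, ContinuousLinearMap.comp_apply, Complex.imCLM_apply,
        Complex.reCLM_apply, smul_eq_mul]
      field_simp
      simp [FrameField.area, wedge, i1, i2]
      ring
  have h := (hZ.smoothSU.mcForm_mul_shear ha hb (c := fun _ => 0) contDiffOn_const hy
    (u := ((0 : ℝ), v)) (by rw [← hZ.smoothSU.mc_slice hy, hZ.leg y hy]; rfl)).2.2.2
  rw [← hW.smoothSU.mc_slice hy, ← hZ.smoothSU.mc_slice hy, ← hZ.smoothSU.mc_slice hy,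
    ← hZ.smoothSU.mc_slice hy] at h
  have h2 := congrArg Complex.im h
  have e := key v
  simp at h2
  refine h2.trans ?_
  linarith

/-- The parameter is minus half the trace of p_{ij}. A shear with a = b = 0 leaves π⁰₀ alone, so the
earlier normalisation persists. -/
theorem normalizeMean (hZ : IsFirstOrderFamily Y O Z)
    (h0 : ∀ y ∈ O, ∀ v, ((slice Z y.1).mc 0 0 y.2 v).im = 0) :
    IsFrameFamily Y O (fun y => (slice Z y.1).normalizeMean y.2) := by
  have k := hZ.smoothSU.contDiffOn_mc_slice
  have k1 := fun v => (k 1 3 v).re_complex.ofReal_complex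
  have k2 := fun v => (k 2 3 v).re_complex.ofReal_complex
  have hne : ∀ y ∈ O, 2 * (slice Z y.1).area y.2 ≠ 0 := fun y hy =>
    mul_ne_zero two_ne_zero (hZ.pos y hy).ne'
  have hc : ContDiffOn ℝ ∞ (fun y : ℝ × Plane =>
      -(wedge ((slice Z y.1).mu 0 y.2) ((slice Z y.1).mc 2 0 y.2) +
        wedge ((slice Z y.1).mc 1 0 y.2) ((slice Z y.1).mu 1 y.2)).re /
      (2 * (slice Z y.1).area y.2)) O :=
    ((((((k1 e₁).mul (k 2 0 e₂)).sub ((k1 e₂).mul (k 2 0 e₁))).add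
      (((k 1 0 e₁).mul (k2 e₂)).sub ((k 1 0 e₂).mul (k2 e₁)))).re_complex).neg).div
      (contDiffOn_const.mul hZ.contDiffOn_area) hne
  set c : ℝ × Plane → ℝ := fun y : ℝ × Plane =>
      -(wedge ((slice Z y.1).mu 0 y.2) ((slice Z y.1).mc 2 0 y.2) +
        wedge ((slice Z y.1).mc 1 0 y.2) ((slice Z y.1).mu 1 y.2)).re /
      (2 * (slice Z y.1).area y.2) with hcdef
  have hW := hZ.mul_shear (a := fun _ => 0) (b := fun _ => 0) contDiffOn_const contDiffOn_const hc
  change IsFrameFamily Y O (fun y => Z y * shear 0 0 (c y))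
  set W : ℝ × Plane → Matrix (Fin 4) (Fin 4) ℂ := fun y => Z y * shear 0 0 (c y) with hWdef
  refine ⟨hW.smoothSU.isOpen, hW.smoothSU.smooth, fun t => ?_⟩
  have hS := hW.smoothSU.slice t
  refine { isOpen := hS.isOpen, smooth := hS.smooth, unitary := hS.unitary, base := ?_, real := ?_,
           positive := ?_, trace_beta := ?_, trace_p := ?_, leg := ?_ }
  · exact fun x hx => hW.base (t, x) hx
  · intro x hx i
    ext v
    have : ((slice W t).om i x v).im = 0 := by
      apply Complex.conj_eq_iff_im.1
      fin_cases i
      · exact hW.star10 (t, x) hx v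
      · exact hW.star20 (t, x) hx v
    simp [this]
  · exact fun x hx => hW.pos (t, x) hx
  · intro x hx
    have h00 : ∀ v, ((slice W t).mc 0 0 x v).im = 0 := by
      intro v
      have h := (hZ.smoothSU.mcForm_mul_shear (a := fun _ => 0) (b := fun _ => 0) contDiffOn_const
        contDiffOn_const hc hx (u := ((0 : ℝ), v))
        (by rw [← hZ.smoothSU.mc_slice hx, hZ.leg _ hx]; rfl)).2.2.2
      rw [← hW.smoothSU.mc_slice hx, ← hZ.smoothSU.mc_slice hx, ← hZ.smoothSU.mc_slice hx,
        ← hZ.smoothSU.mc_slice hx] at h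
      have h2 := congrArg Complex.im h
      simp at h2
      exact h2.trans (h0 (t, x) hx v)
    ext v
    -- Once π⁰₀ is real, the trace relation of the Lie algebra is the condition tr β = 0.
    have := im_trace hS hx v
    rw [h00 v] at this
    simp only [Fin.sum_univ_two, FrameField.beta, FrameField.conn, FrameField.pos, add_apply,
      imForm_apply]
    simp [h00 v]
    exact_mod_cast (by linarith : ((slice W t).mc 1 1 x v).im + ((slice W t).mc 2 2 x v).im = 0)
  · intro x hx
    have hA : (slice Z t).area x ≠ 0 := (hZ.pos (t, x) hx).ne'
    have i1 : ∀ v, ((slice Z t).mc 1 0 x v).im = 0 := fun v =>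
      Complex.conj_eq_iff_im.1 (hZ.star10 (t, x) hx v)
    have i2 : ∀ v, ((slice Z t).mc 2 0 x v).im = 0 := fun v =>
      Complex.conj_eq_iff_im.1 (hZ.star20 (t, x) hx v)
    have w10 : (slice W t).mc 1 0 x = (slice Z t).mc 1 0 x := by
      ext v
      have h := (hZ.smoothSU.mcForm_mul_shear (a := fun _ => 0) (b := fun _ => 0) contDiffOn_const
        contDiffOn_const hc hx (u := ((0 : ℝ), v))
        (by rw [← hZ.smoothSU.mc_slice hx, hZ.leg _ hx]; rfl)).2.1
      rw [hW.smoothSU.mc_slice hx, hZ.smoothSU.mc_slice hx]; exact h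
    have w20 : (slice W t).mc 2 0 x = (slice Z t).mc 2 0 x := by
      ext v
      have h := (hZ.smoothSU.mcForm_mul_shear (a := fun _ => 0) (b := fun _ => 0) contDiffOn_const
        contDiffOn_const hc hx (u := ((0 : ℝ), v))
        (by rw [← hZ.smoothSU.mc_slice hx, hZ.leg _ hx]; rfl)).2.2.1
      rw [hW.smoothSU.mc_slice hx, hZ.smoothSU.mc_slice hx]; exact h
    have m1 : ∀ v, (slice W t).mc 1 3 x v =
        (slice Z t).mc 1 3 x v + c (t, x) * (slice Z t).mc 1 0 x v := by
      intro v
      rw [hW.smoothSU.mc_slice hx, hZ.smoothSU.mc_slice hx, hZ.smoothSU.mc_slice hx]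
      exact (hZ.smoothSU.mcForm_mul_shear_zero hc hx (0, v)).1
    have m2 : ∀ v, (slice W t).mc 2 3 x v =
        (slice Z t).mc 2 3 x v + c (t, x) * (slice Z t).mc 2 0 x v := by
      intro v
      rw [hW.smoothSU.mc_slice hx, hZ.smoothSU.mc_slice hx, hZ.smoothSU.mc_slice hx]
      exact (hZ.smoothSU.mcForm_mul_shear_zero hc hx (0, v)).2
    -- Cramer's rule for a real covector in the coframe ω¹, ω²; it provides the matrix p_{ij}.
    have expand : ∀ f : Cov, (∀ v, (f v).im = 0) → f =
        ((wedge f ((slice Z t).mc 2 0 x)).re / (slice Z t).area x) • (slice Z t).mc 1 0 x +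
        ((wedge ((slice Z t).mc 1 0 x) f).re / (slice Z t).area x) • (slice Z t).mc 2 0 x := by
      intro f hf
      apply cov_ext <;> apply Complex.ext <;>
        simp only [add_apply, smul_apply, Complex.add_re, Complex.add_im, Complex.smul_re,
          Complex.smul_im, smul_eq_mul, hf, i1, i2] <;>
        field_simp <;> simp [FrameField.area, wedge, i1, i2, hf] <;> ring
    have q1 : (slice W t).mu 0 x = (slice Z t).mu 0 x + c (t, x) • (slice Z t).mc 1 0 x := by
      ext v
      apply Complex.ext <;> simp [FrameField.mu, FrameField.pos, m1, i1]
    have q2 : (slice W t).mu 1 x = (slice Z t).mu 1 x + c (t, x) • (slice Z t).mc 2 0 x := by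
      ext v
      apply Complex.ext <;> simp [FrameField.mu, FrameField.pos, m2, i2]
    have mi : ∀ i v, ((slice Z t).mu i x v).im = 0 := fun i v => by simp [FrameField.mu]
    refine ⟨Matrix.of ![![(wedge ((slice Z t).mu 0 x) ((slice Z t).mc 2 0 x)).re /
        (slice Z t).area x + c (t, x),
        (wedge ((slice Z t).mc 1 0 x) ((slice Z t).mu 0 x)).re / (slice Z t).area x],
      ![(wedge ((slice Z t).mu 1 x) ((slice Z t).mc 2 0 x)).re / (slice Z t).area x,
        (wedge ((slice Z t).mc 1 0 x) ((slice Z t).mu 1 x)).re / (slice Z t).area x + c (t, x)]],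
      ?_, ?_⟩
    · rw [Matrix.trace_fin_two]
      simp only [hcdef, Matrix.of_apply, Matrix.cons_val_zero, Matrix.cons_val_one,
        Complex.add_re]
      field_simp
      ring
    · intro i
      rw [Fin.sum_univ_two]
      have o0 : (slice W t).om 0 x = (slice Z t).mc 1 0 x := w10
      have o1 : (slice W t).om 1 x = (slice Z t).mc 2 0 x := w20
      rw [o0, o1]
      fin_cases i
      · simp only [Fin.zero_eta, q1]
        conv_lhs => rw [expand _ (mi 0)]
        simp only [Matrix.of_apply, Matrix.cons_val_zero, Matrix.cons_val_one]
        module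
      · simp only [Fin.mk_one, q2]
        conv_lhs => rw [expand _ (mi 1)]
        simp only [Matrix.of_apply, Matrix.cons_val_zero, Matrix.cons_val_one]
        module
  · exact fun x hx => hW.leg (t, x) hx

end IsFirstOrderFamily

/-! ### Construction of first order adapted frames -/

theorem herm_self_eq (v : C31) : ((herm v v).re : ℂ) = herm v v :=
  Complex.conj_eq_iff_re.1 (star_herm v v)

theorem herm_sub_left (z z' w : C31) : herm (z - z') w = herm z w - herm z' w := by
  simp only [herm, Pi.sub_apply]; ring

theorem herm_sub_right (z w w' : C31) : herm z (w - w') = herm z w - herm z w' := by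
  simp only [herm, Pi.sub_apply, star_sub]; ring

/-- The Hermitian product is positive on the orthogonal complement of a null vector, modulo
this vector. -/
theorem herm_self_pos {σ v : C31} (h0 : σ ≠ 0) (h1 : herm σ σ = 0) (h2 : herm v σ = 0)
    (h3 : ∀ a : ℂ, v ≠ a • σ) : 0 < (herm v v).re := by
  have nn : ∀ z : ℂ, z * star z = ((‖z‖ ^ 2 : ℝ) : ℂ) := fun z => by
    rw [Complex.star_def, Complex.mul_conj, Complex.normSq_eq_norm_sq]
  have sq0 : ∀ a b : ℂ, ‖a‖ ^ 2 + ‖b‖ ^ 2 = 0 → a = 0 ∧ b = 0 := by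
    intro a b h
    constructor <;> rw [← norm_eq_zero] <;> nlinarith [sq_nonneg ‖a‖, sq_nonneg ‖b‖]
  by_cases hσ : σ 3 = 0
  · have e : ‖σ 1‖ ^ 2 + ‖σ 2‖ ^ 2 = 0 := by
      have := h1
      simp only [herm, hσ, star_zero, mul_zero, zero_mul, sub_zero, add_zero, nn] at this
      exact_mod_cast this
    obtain ⟨e1, e2⟩ := sq0 _ _ e
    have hσ0 : σ 0 ≠ 0 := by
      intro h; exact h0 (by ext i; fin_cases i <;> simp [h, e1, e2, hσ])
    have hv3 : v 3 = 0 := by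
      simpa [herm, hσ, e1, e2, hσ0] using h2
    have hv : herm v v = ((‖v 1‖ ^ 2 + ‖v 2‖ ^ 2 : ℝ) : ℂ) := by
      simp only [herm, hv3, nn]; push_cast; simp
    rw [hv, Complex.ofReal_re]
    refine lt_of_le_of_ne (by positivity) fun h => ?_
    obtain ⟨f1, f2⟩ := sq0 _ _ h.symm
    refine h3 (v 0 / σ 0) ?_
    ext i; fin_cases i <;> simp [e1, e2, hσ, f1, f2, hv3, hσ0]
  -- Subtracting a multiple of σ does not alter the products involved and removes the last
  -- coordinate, so that only the positive terms |v¹|² + |v²|² remain.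
  · set a := v 3 / σ 3 with ha
    set v' := v - a • σ with hv'
    have h2' : herm v' σ = 0 := by
      rw [hv', herm_sub_left, herm_smul_left, h1, h2]; simp
    have h2s : herm σ v' = 0 := by rw [← star_herm, h2', star_zero]
    have hvv : herm v v = herm v' v' := by
      have : v = v' + a • σ := by rw [hv']; abel
      conv_lhs => rw [this]
      simp only [herm_add_left, herm_add_right, herm_smul_left, herm_smul_right, h1, h2', h2s]
      ring
    have h30 : v' 3 = 0 := by simp [hv', ha, hσ]
    have hv : herm v' v' = ((‖v' 1‖ ^ 2 + ‖v' 2‖ ^ 2 : ℝ) : ℂ) := by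
      simp only [herm, h30, nn]; push_cast; simp
    rw [hvv, hv, Complex.ofReal_re]
    refine lt_of_le_of_ne (by positivity) fun h => ?_
    obtain ⟨f1, f2⟩ := sq0 _ _ h.symm
    have f0 : v' 0 = 0 := by
      simpa [herm, f1, f2, h30, hσ] using h2'
    refine h3 a ?_
    rw [← sub_eq_zero, ← hv']
    ext i; fin_cases i <;> simp [f0, f1, f2, h30]

/-- The orthogonal projection along the first tangent vector. -/
def gramSchmidt (v₁ v₂ : C31) : C31 := v₂ - (((herm v₁ v₂).re / (herm v₁ v₁).re : ℝ) : ℂ) • v₁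

/-- A vector divided by its length. -/
def unitVec (v : C31) : C31 := (((√(herm v v).re)⁻¹ : ℝ) : ℂ) • v

/-- The projection of `w` to the vectors orthogonal to two tangent vectors, normalised with
respect to `σ`. -/
def dualVec (w σ z₁ z₂ : C31) : C31 :=
  (-Complex.I / herm w σ) • (w - herm w z₁ • z₁ - herm w z₂ • z₂)

/-- The last vector of the frame. -/
def nullVec (w σ z₁ z₂ : C31) : C31 :=
  dualVec w σ z₁ z₂ + (Complex.I * herm (dualVec w σ z₁ z₂) (dualVec w σ z₁ z₂) / 2) • σ

/-- The frame obtained from a null vector and two tangent vectors. -/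
def preFrame (w σ v₁ v₂ : C31) : Matrix (Fin 4) (Fin 4) ℂ :=
  Matrix.of fun C => ![σ C, unitVec v₁ C, unitVec (gramSchmidt v₁ v₂) C,
    nullVec w σ (unitVec v₁) (unitVec (gramSchmidt v₁ v₂)) C]

theorem col_preFrame (w σ v₁ v₂ : C31) :
    col (preFrame w σ v₁ v₂) 0 = σ ∧ col (preFrame w σ v₁ v₂) 1 = unitVec v₁ ∧
    col (preFrame w σ v₁ v₂) 2 = unitVec (gramSchmidt v₁ v₂) ∧
    col (preFrame w σ v₁ v₂) 3 = nullVec w σ (unitVec v₁) (unitVec (gramSchmidt v₁ v₂)) :=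
  ⟨rfl, rfl, rfl, rfl⟩

theorem herm_unitVec {v : C31} (h : 0 < (herm v v).re) : herm (unitVec v) (unitVec v) = 1 := by
  have h1 : √(herm v v).re ≠ 0 := (Real.sqrt_pos.2 h).ne'
  rw [unitVec, herm_smul_left, herm_smul_right, ← herm_self_eq, Complex.star_def,
    Complex.conj_ofReal]
  norm_cast
  field_simp
  rw [Real.sq_sqrt h.le]

/-- A real coefficient suffices because the product of the two vectors is real. This keeps the new
vector in the real tangent plane of the surface. -/
theorem herm_gramSchmidt {v₁ v₂ : C31} (h : 0 < (herm v₁ v₁).re)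
    (hr : star (herm v₁ v₂) = herm v₁ v₂) :
    herm v₁ (gramSchmidt v₁ v₂) = 0 := by
  rw [gramSchmidt, herm_sub_right, herm_smul_right, ← herm_self_eq v₁, Complex.star_def,
    Complex.conj_ofReal]
  rw [← Complex.conj_eq_iff_re.1 hr]
  norm_cast
  field_simp
  simp

/-- The vector d is orthogonal to both unit tangent vectors and has product -i with σ; adding (i⟨d,
d⟩/2)σ makes it null without disturbing these products. -/
theorem preFrame_gram {w σ v₁ v₂ : C31} (h0 : herm σ σ = 0) (h1 : herm v₁ σ = 0)
    (h2 : herm v₂ σ = 0) (hr : star (herm v₁ v₂) = herm v₁ v₂) (hp₁ : 0 < (herm v₁ v₁).re)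
    (hp₂ : 0 < (herm (gramSchmidt v₁ v₂) (gramSchmidt v₁ v₂)).re) (hw : herm w σ ≠ 0)
    (A B : Fin 4) :
    herm (col (preFrame w σ v₁ v₂) A) (col (preFrame w σ v₁ v₂) B) = gram A B := by
  set z₁ := unitVec v₁ with hz₁
  set z₂ := unitVec (gramSchmidt v₁ v₂) with hz₂
  have e11 : herm z₁ z₁ = 1 := herm_unitVec hp₁
  have e22 : herm z₂ z₂ = 1 := herm_unitVec hp₂
  have e12 : herm z₁ z₂ = 0 := by
    rw [hz₁, hz₂, unitVec, unitVec, herm_smul_left, herm_smul_right, herm_gramSchmidt hp₁ hr]; simp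
  have e10 : herm z₁ σ = 0 := by rw [hz₁, unitVec, herm_smul_left, h1, mul_zero]
  have e20 : herm z₂ σ = 0 := by
    have : herm (gramSchmidt v₁ v₂) σ = 0 := by
      rw [gramSchmidt, herm_sub_left, herm_smul_left, h1, h2]; simp
    rw [hz₂, unitVec, herm_smul_left, this, mul_zero]
  have flip : ∀ {a b : C31} {c : ℂ}, herm a b = c → herm b a = star c := fun h => by
    rw [← h, star_herm]
  set d := dualVec w σ z₁ z₂ with hd
  have d0 : herm d σ = -Complex.I := by
    rw [hd, dualVec]
    simp only [herm_smul_left, herm_sub_left, e10, e20]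
    field_simp
    simp
  have d1 : herm d z₁ = 0 := by
    rw [hd, dualVec]
    simp only [herm_smul_left, herm_sub_left, e11, flip e12]
    simp
  have d2 : herm d z₂ = 0 := by
    rw [hd, dualVec]
    simp only [herm_smul_left, herm_sub_left, e22, e12]
    simp
  set m := nullVec w σ z₁ z₂ with hm
  have n0 : herm m σ = -Complex.I := by
    rw [hm, nullVec, ← hd, herm_add_left, herm_smul_left, h0, d0]; simp
  have n1 : herm m z₁ = 0 := by
    rw [hm, nullVec, ← hd, herm_add_left, herm_smul_left, flip e10, d1]; simp
  have n2 : herm m z₂ = 0 := by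
    rw [hm, nullVec, ← hd, herm_add_left, herm_smul_left, flip e20, d2]; simp
  have n3 : herm m m = 0 := by
    rw [hm, nullVec, ← hd]
    simp only [herm_add_left, herm_add_right, herm_smul_left, herm_smul_right, h0, d0, flip d0]
    have hs : star (herm d d) = herm d d := star_herm d d
    simp only [star_div₀, star_mul', hs, star_neg, Complex.star_def, Complex.conj_I, map_ofNat]
    ring_nf
    simp only [Complex.I_sq]
    ring
  obtain ⟨c0, c1, c2, c3⟩ := col_preFrame w σ v₁ v₂
  rw [← hz₁] at c1
  rw [← hz₂] at c2
  rw [← hz₁, ← hz₂, ← hm] at c3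
  have cI : star (-Complex.I) = Complex.I := by simp
  fin_cases A <;> fin_cases B <;>
    simp only [Fin.zero_eta, Fin.mk_one, Fin.reduceFinMk, c0, c1, c2, c3, h0, e10, e20, e11, e12,
      e22, n0, n1, n2, n3, flip e10, flip e20, flip e12, flip n0, flip n1, flip n2, cI, star_zero]
        <;>
    simp [gram]

/-- Taking determinants in ZᵀGZ̄ = G, with G the invertible Gram matrix. -/
theorem det_mul_star_of_gram {Z : Matrix (Fin 4) (Fin 4) ℂ}
    (h : ∀ A B, herm (col Z A) (col Z B) = gram A B) : Z.det * star Z.det = 1 := by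
  have e : Z.transpose * Matrix.of gram * Z.map (starRingEnd ℂ) = Matrix.of gram := by
    ext A B
    rw [Matrix.of_apply, ← h A B]
    simp [Matrix.mul_apply, Fin.sum_univ_four, gram, herm, col]
    ring
  have hd := congrArg Matrix.det e
  rw [Matrix.det_mul, Matrix.det_mul, Matrix.det_transpose] at hd
  have hg : (Matrix.of gram).det ≠ 0 := by
    rw [Matrix.det_succ_column_zero, Fin.sum_univ_four]
    simp [Matrix.det_fin_three, gram, Fin.succAbove]
  have hm : (Z.map (starRingEnd ℂ)).det = star Z.det := by
    rw [← RingHom.mapMatrix_apply, ← RingHom.map_det]; rfl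
  rw [hm] at hd
  exact mul_right_cancel₀ hg (by linear_combination hd)

/-- A fourth root of `d⁻¹`, for `d` in the domain where `d l⁴` is not a negative number. -/
def phase (l d : ℂ) : ℂ := l * Complex.exp (-(Complex.log (d * l ^ 4) / 4))

/-- The factor l moves the branch cut of the logarithm but has no effect on the fourth power. -/
theorem phase_pow {l d : ℂ} (hl : l ≠ 0) (hd : d ≠ 0) : phase l d ^ 4 * d = 1 := by
  have h : d * l ^ 4 ≠ 0 := mul_ne_zero hd (pow_ne_zero 4 hl)
  rw [phase, mul_pow, ← Complex.exp_nat_mul]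
  have : ((4 : ℕ) : ℂ) * -(Complex.log (d * l ^ 4) / 4) = -Complex.log (d * l ^ 4) := by
    push_cast; ring
  rw [this, Complex.exp_neg, Complex.exp_log h]
  field_simp

theorem phase_mul_star {l d : ℂ} (hl : l ≠ 0) (hd : d * star d = 1) :
    phase l d * star (phase l d) = 1 := by
  have hd0 : d ≠ 0 := by rintro rfl; simp at hd
  have nn : ∀ z : ℂ, z * star z = ((‖z‖ ^ 2 : ℝ) : ℂ) := fun z => by
    rw [Complex.star_def, Complex.mul_conj, Complex.normSq_eq_norm_sq]
  have h1 : ‖d‖ ^ 2 = 1 := by rw [nn] at hd; exact_mod_cast hd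
  have h2 : ‖d‖ = 1 := (pow_eq_one_iff_of_nonneg (norm_nonneg _) two_ne_zero).1 h1
  have h3 := congrArg norm (phase_pow hl hd0)
  rw [norm_mul, norm_pow, h2, mul_one, norm_one] at h3
  have h4 : ‖phase l d‖ = 1 := (pow_eq_one_iff_of_nonneg (norm_nonneg _) (by norm_num)).1 h3
  rw [nn, h4]; simp

theorem col_smul (l : ℂ) (Z : Matrix (Fin 4) (Fin 4) ℂ) (A : Fin 4) :
    col (l • Z) A = l • col Z A := rfl

theorem isSU31_phase_smul {Z : Matrix (Fin 4) (Fin 4) ℂ} {l : ℂ} (hl : l ≠ 0)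
    (h : ∀ A B, herm (col Z A) (col Z B) = gram A B) : IsSU31 (phase l Z.det • Z) := by
  have hd := det_mul_star_of_gram h
  have hd0 : Z.det ≠ 0 := by intro h; rw [h] at hd; simp at hd
  refine isSU31_of_gram (fun A B => ?_) ?_
  · rw [col_smul, col_smul, herm_smul_left, herm_smul_right, h, ← mul_assoc, phase_mul_star hl hd,
      one_mul]
  · rw [Matrix.det_smul, Fintype.card_fin, phase_pow hl hd0]

/-! ### Frames of a family of Legendrian immersions -/

/-- `s` is a smooth lift of the one-parameter family `Y` of Legendrian immersions. -/
structure IsLegLift (Y : ℝ → Plane → PCSphere) (O : Set (ℝ × Plane)) (s : ℝ × Plane → C31) :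
    Prop where
  isOpen : IsOpen O
  smooth : ContDiffOn ℝ ∞ s O
  base : ∀ y ∈ O, Represents (s y) (Y y.1 y.2)
  leg : ∀ y ∈ O, ∀ v : Plane, herm (fderiv ℝ s y (0, v)) (s y) = 0
  imm : ∀ y ∈ O, ∀ v : Plane, ∀ a : ℂ, fderiv ℝ s y (0, v) = a • s y → v = 0

theorem Represents.herm_self {v : C31} {l : PCSphere} (h : Represents v l) : herm v v = 0 := by
  obtain ⟨h0, h⟩ := h
  have hr := l.2
  rw [← h] at hr
  obtain ⟨a, ha⟩ := Projectivization.exists_smul_eq_mk_rep ℂ v h0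
  rw [← ha] at hr
  change herm ((a : ℂ) • v) ((a : ℂ) • v) = 0 at hr
  rw [herm_smul_left, herm_smul_right] at hr
  simpa using hr

theorem Represents.smul {v : C31} {l : PCSphere} (h : Represents v l) {a : ℂ} (ha : a ≠ 0) :
    Represents (a • v) l := by
  obtain ⟨h0, h⟩ := h
  refine ⟨smul_ne_zero ha h0, ?_⟩
  rw [← h]
  exact (Projectivization.mk_eq_mk_iff' ℂ _ _ _ _).2 ⟨a, rfl⟩

/-- The frame field obtained from a lift of a surface. -/
def liftFrame (w : C31) (l : ℂ) (s : Plane → C31) : FrameField := fun x =>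
  phase l (preFrame w (s x) (fderiv ℝ s x e₁) (fderiv ℝ s x e₂)).det •
    preFrame w (s x) (fderiv ℝ s x e₁) (fderiv ℝ s x e₂)

/-- The adapted frame field obtained from a lift of a Legendrian surface. -/
def adaptedFrame (w : C31) (l : ℂ) (s : Plane → C31) : FrameField :=
  (liftFrame w l s).normalizeTrace.normalizeMean

namespace IsLegLift

variable {Y : ℝ → Plane → PCSphere} {O : Set (ℝ × Plane)} {s : ℝ × Plane → C31}

theorem mono {O' : Set (ℝ × Plane)} (hs : IsLegLift Y O s) (hO : IsOpen O') (h : O' ⊆ O) :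
    IsLegLift Y O' s :=
  ⟨hO, hs.smooth.mono h, fun y hy => hs.base y (h hy), fun y hy => hs.leg y (h hy),
    fun y hy => hs.imm y (h hy)⟩

theorem differentiableAt (hs : IsLegLift Y O s) {y : ℝ × Plane} (hy : y ∈ O) :
    DifferentiableAt ℝ s y :=
  (hs.smooth.contDiffAt (hs.isOpen.mem_nhds hy)).differentiableAt (by simp)

theorem contDiffOn_fderiv (hs : IsLegLift Y O s) (v : ℝ × Plane) :
    ContDiffOn ℝ ∞ (fun y => fderiv ℝ s y v) O :=
  (hs.smooth.fderiv_of_isOpen hs.isOpen (by simp)).clm_apply contDiffOn_const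

theorem fderiv_slice (hs : IsLegLift Y O s) {y : ℝ × Plane} (hy : y ∈ O) (v : Plane) :
    fderiv ℝ (fun x => s (y.1, x)) y.2 v = fderiv ℝ s y (0, v) := by
  have : HasFDerivAt (fun x => s (y.1, x))
      ((fderiv ℝ s y).comp (ContinuousLinearMap.inr ℝ ℝ Plane)) y.2 :=
    HasFDerivAt.comp y.2 (f := fun x : Plane => (y.1, x)) (hs.differentiableAt hy).hasFDerivAt
      (hasFDerivAt_pair y.1 y.2)
  rw [this.fderiv]; rfl

/-- Differentiating ⟨ds(v), s̄⟩ = 0 along u expresses the product of tangent vectors through the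
second derivative of s, which is symmetric. Hermitian symmetry then gives reality. -/
theorem star_herm_tangent (hs : IsLegLift Y O s) {y : ℝ × Plane} (hy : y ∈ O) (u v : Plane) :
    star (herm (fderiv ℝ s y (0, u)) (fderiv ℝ s y (0, v))) =
      herm (fderiv ℝ s y (0, u)) (fderiv ℝ s y (0, v)) := by
  have hd : ∀ v : ℝ × Plane, DifferentiableAt ℝ (fun y => fderiv ℝ s y v) y := fun v =>
    ((hs.contDiffOn_fderiv v).contDiffAt (hs.isOpen.mem_nhds hy)).differentiableAt (by simp)
  have hd2 : DifferentiableAt ℝ (fderiv ℝ s) y :=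
    (((hs.smooth.fderiv_of_isOpen hs.isOpen (m := ∞) (by simp)).contDiffAt
      (hs.isOpen.mem_nhds hy))).differentiableAt (by simp)
  have k : ∀ u v : Plane, herm (fderiv ℝ (fderiv ℝ s) y (0, u) (0, v)) (s y) +
      herm (fderiv ℝ s y (0, v)) (fderiv ℝ s y (0, u)) = 0 := by
    intro u v
    have hev : (fun z => herm (fderiv ℝ s z (0, v)) (s z)) =ᶠ[nhds y] fun _ => 0 := by
      filter_upwards [hs.isOpen.mem_nhds hy] with z hz using hs.leg z hz v
    have h := fderiv_herm (hd (0, v)) (hs.differentiableAt hy) (0, u)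
    rw [hev.fderiv_eq] at h
    rw [fderiv_clm_apply hd2 (differentiableAt_const _)] at h
    simpa using h.symm
  have symm : fderiv ℝ (fderiv ℝ s) y (0, u) (0, v) = fderiv ℝ (fderiv ℝ s) y (0, v) (0, u) :=
    ((hs.smooth.contDiffAt (hs.isOpen.mem_nhds hy)).isSymmSndFDerivAt
      (by simp; exact WithTop.coe_le_coe.2 le_top)).eq _ _
  rw [star_herm]
  have h1 := k u v
  have h2 := k v u
  rw [symm] at h1
  linear_combination h1 - h2

theorem herm_pos (hs : IsLegLift Y O s) {y : ℝ × Plane} (hy : y ∈ O) {v : Plane} (hv : v ≠ 0) :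
    0 < (herm (fderiv ℝ s y (0, v)) (fderiv ℝ s y (0, v))).re :=
  herm_self_pos (hs.base y hy).1 (hs.base y hy).herm_self (hs.leg y hy v) fun a ha =>
    hv (hs.imm y hy v a ha)

/-- The orthogonalised vector is the image of a real, nonzero tangent vector, so `herm_pos` applies
to it. -/
theorem gramSchmidt_eq (s : ℝ × Plane → C31) (y : ℝ × Plane) :
    gramSchmidt (fderiv ℝ s y (0, e₁)) (fderiv ℝ s y (0, e₂)) =
      fderiv ℝ s y (0, e₂ - ((herm (fderiv ℝ s y (0, e₁)) (fderiv ℝ s y (0, e₂))).re /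
        (herm (fderiv ℝ s y (0, e₁)) (fderiv ℝ s y (0, e₁))).re) • e₁) := by
  have : ∀ (c : ℝ) (u v : Plane), ((0 : ℝ), v - c • u) = (0, v) - c • ((0 : ℝ), u) := fun c u v =>
      by
    simp
  rw [this, map_sub, map_smul, gramSchmidt, Complex.coe_smul]

theorem tangent_ne (c : ℝ) : (e₂ : Plane) - c • e₁ ≠ 0 := by
  intro h
  have := congrArg (fun v : Plane => v 1) h
  simp at this

/-- The frame matrix in terms of the derivative of the lift. -/
def frameOf (s : ℝ × Plane → C31) (w : C31) (y : ℝ × Plane) : Matrix (Fin 4) (Fin 4) ℂ :=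
  preFrame w (s y) (fderiv ℝ s y (0, e₁)) (fderiv ℝ s y (0, e₂))

/-- The domain of the frame constructed from a lift. -/
def domain (s : ℝ × Plane → C31) (O : Set (ℝ × Plane)) (w : C31) (l : ℂ) : Set (ℝ × Plane) :=
  {y | (y ∈ O ∧ herm w (s y) ≠ 0) ∧ (frameOf s w y).det * l ^ 4 ∈ Complex.slitPlane}

theorem frameOf_gram (hs : IsLegLift Y O s) {y : ℝ × Plane} (hy : y ∈ O) {w : C31}
    (hw : herm w (s y) ≠ 0) (A B : Fin 4) :
    herm (col (frameOf s w y) A) (col (frameOf s w y) B) = gram A B :=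
  preFrame_gram (hs.base y hy).herm_self (hs.leg y hy _) (hs.leg y hy _)
    (hs.star_herm_tangent hy _ _) (hs.herm_pos hy (by simp))
    (by rw [gramSchmidt_eq]; exact hs.herm_pos hy (tangent_ne _)) hw A B

theorem contDiffOn_frameOf (hs : IsLegLift Y O s) (w : C31) (hw : ∀ y ∈ O, herm w (s y) ≠ 0)
    (A B : Fin 4) : ContDiffOn ℝ ∞ (fun y => frameOf s w y A B) O := by
  have c1 := hs.contDiffOn_fderiv (0, e₁)
  have c2 := hs.contDiffOn_fderiv (0, e₂)
  have p1 : ∀ y ∈ O, 0 < (herm (fderiv ℝ s y (0, e₁)) (fderiv ℝ s y (0, e₁))).re :=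
    fun y hy => hs.herm_pos hy (by simp)
  have unit : ∀ {f : ℝ × Plane → C31}, ContDiffOn ℝ ∞ f O →
      (∀ y ∈ O, 0 < (herm (f y) (f y)).re) → ContDiffOn ℝ ∞ (fun y => unitVec (f y)) O := by
    intro f hf hp
    exact (((hf.herm hf).re_complex.sqrt fun y hy => (hp y hy).ne').inv
      fun y hy => (Real.sqrt_pos.2 (hp y hy)).ne').ofReal_complex.smul hf
  have cg : ContDiffOn ℝ ∞ (fun y =>
      gramSchmidt (fderiv ℝ s y (0, e₁)) (fderiv ℝ s y (0, e₂))) O :=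
    c2.sub (((c1.herm c2).re_complex.div (c1.herm c1).re_complex
      fun y hy => (p1 y hy).ne').ofReal_complex.smul c1)
  have u1 := unit c1 p1
  have u2 := unit cg fun y hy => by rw [gramSchmidt_eq]; exact hs.herm_pos hy (tangent_ne _)
  have cd := ((contDiffOn_const (c := -Complex.I)).mul
    (((contDiffOn_const (c := w)).herm hs.smooth).inv hw)).smul
    (((contDiffOn_const (c := w)).sub (((contDiffOn_const (c := w)).herm u1).smul u1)).sub
      (((contDiffOn_const (c := w)).herm u2).smul u2))
  have cn := cd.add ((((contDiffOn_const (c := Complex.I)).mul (cd.herm cd)).div_const 2).smul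
    hs.smooth)
  fin_cases B
  · exact contDiffOn_pi.1 hs.smooth A
  · exact contDiffOn_pi.1 u1 A
  · exact contDiffOn_pi.1 u2 A
  · exact contDiffOn_pi.1 cn A

theorem _root_.ContDiffOn.matrix_det {E : Type*} [NormedAddCommGroup E] [NormedSpace ℝ E]
    {Z : E → Matrix (Fin 4) (Fin 4) ℂ} {V : Set E}
    (h : ∀ A B, ContDiffOn ℝ ∞ (fun y => Z y A B) V) : ContDiffOn ℝ ∞ (fun y => (Z y).det) V := by
  simp only [Matrix.det_apply']
  exact ContDiffOn.sum fun σ _ => contDiffOn_const.mul (contDiffOn_prod fun i _ => h _ _)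

theorem isOpen_domain (hs : IsLegLift Y O s) (w : C31) (l : ℂ) : IsOpen (domain s O w l) := by
  have h1 : IsOpen {y | y ∈ O ∧ herm w (s y) ≠ 0} :=
    ((contDiffOn_const (c := w)).herm hs.smooth).continuousOn.isOpen_inter_preimage hs.isOpen
      isOpen_ne
  have hs' := hs.mono h1 fun y hy => hy.1
  exact ((ContDiffOn.matrix_det (hs'.contDiffOn_frameOf w fun y hy => hy.2)).mul
    contDiffOn_const).continuousOn.isOpen_inter_preimage h1 Complex.isOpen_slitPlane

theorem domain_subset (w : C31) (l : ℂ) : domain s O w l ⊆ O := fun _ hy => hy.1.1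

/-- The phase has modulus one and its derivative only adds multiples of s, which are orthogonal to
the columns 0, 1, 2. Hence π¹₀, π²₀, π³₀ can be computed from ds as if there were no phase. -/
theorem isFirstOrderFamily (hs : IsLegLift Y O s) (w : C31) {l : ℂ} (hl : l ≠ 0) :
    IsFirstOrderFamily Y (domain s O w l) (fun y => liftFrame w l (fun x => s (y.1, x)) y.2) := by
  have hD := hs.isOpen_domain w l
  have hs' := hs.mono hD (domain_subset w l)
  have e : ∀ y ∈ domain s O w l, liftFrame w l (fun x => s (y.1, x)) y.2 =
      phase l (frameOf s w y).det • frameOf s w y := fun y hy => by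
    simp only [liftFrame, hs'.fderiv_slice hy]; rfl
  have cf := hs'.contDiffOn_frameOf w fun y hy => hy.1.2
  have cph : ContDiffOn ℝ ∞ (fun y => phase l (frameOf s w y).det) (domain s O w l) := by
    have c1 : ContDiffOn ℝ ∞ (fun y => (frameOf s w y).det * l ^ 4) (domain s O w l) :=
      (ContDiffOn.matrix_det cf).mul contDiffOn_const
    have c2 : ContDiffOn ℝ ∞ (fun y => Complex.log ((frameOf s w y).det * l ^ 4))
        (domain s O w l) := fun y hy =>
      ContDiffAt.comp_contDiffWithinAt (g := Complex.log) y
        ((Complex.contDiffAt_log hy.2).restrict_scalars ℝ) (c1 y hy)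
    exact contDiffOn_const.mul ((c2.div_const 4).neg.cexp)
  set W : ℝ × Plane → Matrix (Fin 4) (Fin 4) ℂ := fun y =>
    liftFrame w l (fun x => s (y.1, x)) y.2 with hW
  have hSU : SmoothSU W (domain s O w l) := by
    refine ⟨hD, fun A B => ?_, fun y hy => ?_⟩
    · exact (cph.mul (cf A B)).congr fun y hy => by simp only [hW, e y hy]; rfl
    · simp only [hW, e y hy]
      exact isSU31_phase_smul hl (hs'.frameOf_gram hy hy.1.2)
  have hph : ∀ y ∈ domain s O w l,
      phase l (frameOf s w y).det * star (phase l (frameOf s w y).det) = 1 := fun y hy =>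
    phase_mul_star hl (det_mul_star_of_gram (hs'.frameOf_gram hy hy.1.2))
  have hcol : ∀ y ∈ domain s O w l, ∀ A, col (W y) A =
      phase l (frameOf s w y).det • col (frameOf s w y) A := fun y hy A => by
    simp only [hW, e y hy]; rfl
  have key : ∀ y ∈ domain s O w l, ∀ v A, herm (s y) (col (frameOf s w y) A) = 0 →
      herm (fderiv ℝ (fun z => col (W z) 0) y (0, v)) (col (W y) A) =
        herm (fderiv ℝ s y (0, v)) (col (frameOf s w y) A) := by
    intro y hy v A h0
    have hev : (fun z => col (W z) 0) =ᶠ[nhds y] fun z => phase l (frameOf s w z).det • s z := by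
      filter_upwards [hD.mem_nhds hy] with z hz using hcol z hz 0
    have hd : DifferentiableAt ℝ (fun z => phase l (frameOf s w z).det) y :=
      cph.differentiableAt_top hD hy
    rw [hev.fderiv_eq, fderiv_fun_smul hd (hs'.differentiableAt hy), hcol y hy A]
    simp only [add_apply, smul_apply, ContinuousLinearMap.smulRight_apply, herm_add_left,
      herm_smul_left, herm_smul_right, h0]
    linear_combination herm (fderiv ℝ s y (0, v)) (col (frameOf s w y) A) * hph y hy
  have lin : ∀ y (v : Plane), fderiv ℝ s y (0, v) =
      ((v 0 : ℝ) : ℂ) • fderiv ℝ s y (0, e₁) + ((v 1 : ℝ) : ℂ) • fderiv ℝ s y (0, e₂) := by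
    intro y v
    have hv : ((0 : ℝ), v) = v 0 • ((0 : ℝ), e₁) + v 1 • ((0 : ℝ), e₂) := by
      ext i
      · simp
      · fin_cases i <;> simp
    conv_lhs => rw [hv]
    simp only [map_add, map_smul, Complex.coe_smul]
  have m30 : ∀ y ∈ domain s O w l, ∀ v, (slice W y.1).mc 3 0 y.2 v = 0 := by
    intro y hy v
    rw [hSU.mc_slice hy, hSU.mcForm_apply hy]
    have := key y hy v 0 (hs'.base y hy).herm_self
    simp only [Matrix.cons_val]
    rw [this]
    have := hs'.leg y hy v
    simp [(col_preFrame _ _ _ _).1, frameOf, this]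
  have z1 : ∀ y ∈ domain s O w l, herm (s y) (col (frameOf s w y) 1) = 0 := fun y hy =>
    hs'.frameOf_gram hy hy.1.2 0 1
  have z2 : ∀ y ∈ domain s O w l, herm (s y) (col (frameOf s w y) 2) = 0 := fun y hy =>
    hs'.frameOf_gram hy hy.1.2 0 2
  have p1 : ∀ y ∈ domain s O w l,
      0 < (herm (fderiv ℝ s y (0, e₁)) (fderiv ℝ s y (0, e₁))).re :=
    fun y hy => hs'.herm_pos hy (by simp)
  have p2 : ∀ y ∈ domain s O w l, 0 < (herm
      (gramSchmidt (fderiv ℝ s y (0, e₁)) (fderiv ℝ s y (0, e₂)))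
      (gramSchmidt (fderiv ℝ s y (0, e₁)) (fderiv ℝ s y (0, e₂)))).re :=
    fun y hy => by rw [gramSchmidt_eq]; exact hs'.herm_pos hy (tangent_ne _)
  have m10 : ∀ y ∈ domain s O w l, ∀ v, (slice W y.1).mc 1 0 y.2 v =
      herm (fderiv ℝ s y (0, v)) (unitVec (fderiv ℝ s y (0, e₁))) := fun y hy v => by
    rw [hSU.mc_slice hy, hSU.mcForm_apply hy]
    exact key y hy v 1 (z1 y hy)
  have m20 : ∀ y ∈ domain s O w l, ∀ v, (slice W y.1).mc 2 0 y.2 v =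
      herm (fderiv ℝ s y (0, v))
        (unitVec (gramSchmidt (fderiv ℝ s y (0, e₁)) (fderiv ℝ s y (0, e₂)))) := fun y hy v => by
    rw [hSU.mc_slice hy, hSU.mcForm_apply hy]
    exact key y hy v 2 (z2 y hy)
  have st : ∀ y ∈ domain s O w l, ∀ u v : Plane,
      star (herm (fderiv ℝ s y (0, v)) (unitVec (fderiv ℝ s y (0, u)))) =
      herm (fderiv ℝ s y (0, v)) (unitVec (fderiv ℝ s y (0, u))) := by
    intro y hy u v
    rw [unitVec, herm_smul_right, star_mul', hs'.star_herm_tangent hy, star_star,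
      Complex.star_def, Complex.conj_ofReal]
  have g1 : ∀ y ∈ domain s O w l, herm (fderiv ℝ s y (0, e₁))
      (gramSchmidt (fderiv ℝ s y (0, e₁)) (fderiv ℝ s y (0, e₂))) = 0 := fun y hy =>
    herm_gramSchmidt (p1 y hy) (hs'.star_herm_tangent hy _ _)
  refine ⟨hSU, fun y hy => ?_, fun y hy => ?_, fun y hy v => ?_, fun y hy v => ?_, fun y hy => ?_⟩
  · rw [hcol y hy]
    refine (hs'.base y hy).smul fun h => ?_
    have := hph y hy
    rw [h, zero_mul] at this
    exact zero_ne_one this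
  · ext v; exact m30 y hy v
  · rw [m10 y hy]; exact st y hy _ v
  · rw [m20 y hy, gramSchmidt_eq]; exact st y hy _ v
  · rw [wedge, m10 y hy, m20 y hy, m20 y hy]
    -- ω² vanishes on e₁ by orthogonality, so the area is the product of ω¹(e₁) and ω²(e₂), the
    -- lengths of the orthogonalised tangent vectors.
    have a1 : herm (fderiv ℝ s y (0, e₁))
        (unitVec (gramSchmidt (fderiv ℝ s y (0, e₁)) (fderiv ℝ s y (0, e₂)))) = 0 := by
      rw [unitVec, herm_smul_right, g1 y hy, mul_zero]
    have a2 : herm (fderiv ℝ s y (0, e₁)) (unitVec (fderiv ℝ s y (0, e₁))) =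
        (((√(herm (fderiv ℝ s y (0, e₁)) (fderiv ℝ s y (0, e₁))).re)⁻¹ *
          (herm (fderiv ℝ s y (0, e₁)) (fderiv ℝ s y (0, e₁))).re : ℝ) : ℂ) := by
      rw [unitVec, herm_smul_right, Complex.star_def, Complex.conj_ofReal, Complex.ofReal_mul,
        herm_self_eq]
    have a3 : herm (fderiv ℝ s y (0, e₂))
        (unitVec (gramSchmidt (fderiv ℝ s y (0, e₁)) (fderiv ℝ s y (0, e₂)))) =
        (((√(herm (gramSchmidt (fderiv ℝ s y (0, e₁)) (fderiv ℝ s y (0, e₂)))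
            (gramSchmidt (fderiv ℝ s y (0, e₁)) (fderiv ℝ s y (0, e₂)))).re)⁻¹ *
          (herm (gramSchmidt (fderiv ℝ s y (0, e₁)) (fderiv ℝ s y (0, e₂)))
            (gramSchmidt (fderiv ℝ s y (0, e₁)) (fderiv ℝ s y (0, e₂)))).re : ℝ) : ℂ) := by
      rw [unitVec, herm_smul_right, Complex.star_def, Complex.conj_ofReal, Complex.ofReal_mul,
        herm_self_eq]
      congr 1
      conv_rhs => rw [gramSchmidt]
      rw [herm_sub_left, herm_smul_left, ← gramSchmidt, g1 y hy, mul_zero, sub_zero]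
    rw [a1, a2, a3, mul_zero, sub_zero, ← Complex.ofReal_mul, Complex.ofReal_re]
    have q1 := p1 y hy
    have q2 := p2 y hy
    positivity

theorem isFrameFamily (hs : IsLegLift Y O s) (w : C31) {l : ℂ} (hl : l ≠ 0) :
    IsFrameFamily Y (domain s O w l)
      (fun y => adaptedFrame w l (fun x => s (y.1, x)) y.2) := by
  obtain ⟨h1, h2⟩ := (hs.isFirstOrderFamily w hl).normalizeTrace
  exact h1.normalizeMean h2

/-- Nondegeneracy supplies w with ⟨w, s̄⟩ ≠ 0. With l a fourth root of the inverse determinant, the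
logarithm is evaluated near 1, away from its cut. -/
theorem exists_mem_domain (hs : IsLegLift Y O s) {y : ℝ × Plane} (hy : y ∈ O) :
    ∃ (w : C31) (l : ℂ), l ≠ 0 ∧ y ∈ domain s O w l := by
  have h0 : s y ≠ 0 := (hs.base y hy).1
  have : ∃ w : C31, herm w (s y) ≠ 0 := by
    by_contra! h
    apply h0
    have k0 := h (Pi.single 0 1)
    have k1 := h (Pi.single 1 1)
    have k2 := h (Pi.single 2 1)
    have k3 := h (Pi.single 3 1)
    simp [herm] at k0 k1 k2 k3
    ext i; fin_cases i <;> simp [k0, k1, k2, k3]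
  obtain ⟨w, hw⟩ := this
  have hd := det_mul_star_of_gram (hs.frameOf_gram hy hw)
  have hd0 : (frameOf s w y).det ≠ 0 := by intro h; rw [h] at hd; simp at hd
  obtain ⟨l, hl⟩ := IsAlgClosed.exists_pow_nat_eq ((frameOf s w y).det)⁻¹ (n := 4) (by norm_num)
  refine ⟨w, l, ?_, ⟨hy, hw⟩, ?_⟩
  · rintro rfl
    rw [zero_pow (by norm_num)] at hl
    exact inv_ne_zero hd0 hl.symm
  · rw [hl, mul_inv_cancel₀ hd0]; exact Complex.one_mem_slitPlane

end IsLegLift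

/-! ### Invariance of the quartic differential -/

namespace IsFrameFamily

variable {Y : ℝ → Plane → PCSphere} {O : Set (ℝ × Plane)}
  {Z Z' : ℝ × Plane → Matrix (Fin 4) (Fin 4) ℂ}

/-- In e⁴(hq - p²/2) the terms of q linear and quadratic in the translation are exactly cancelled by
the square of the shifted p. As ω = eω', this is the invariance of Φ. -/
theorem quartic_change (hZ : IsFrameFamily Y O Z) (hZ' : IsFrameFamily Y O Z') {t : ℝ} {x : Plane}
    (hx : (t, x) ∈ O) :
    rotation Z Z' (t, x) ^ 4 * (slice Z t).quartic x = (slice Z' t).quartic x := by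
  have he' : star (rotation Z Z' (t, x)) ≠ 0 := star_ne_zero.2 (hZ.rotation_ne hZ' hx)
  have hh := hZ.h_change hZ' hx
  have hp := (hZ.p_change_aux hZ' hx).2
  have hq := hZ.q_change hZ' hx
  rw [← hZ.rotation_mul_star hZ' hx] at hq
  have key : rotation Z Z' (t, x) ^ 4 * ((slice Z t).h x * (slice Z t).q x) =
      (slice Z' t).h x * ((slice Z' t).q x + translation Z Z' (t, x) * (slice Z' t).p x +
      (2⁻¹ : ℂ) * translation Z Z' (t, x) ^ 2 * (slice Z' t).h x) := by
    refine mul_left_cancel₀ he' ?_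
    linear_combination rotation Z Z' (t, x) ^ 2 * (slice Z t).h x * hq +
      ((slice Z' t).q x + translation Z Z' (t, x) * (slice Z' t).p x +
      (2⁻¹ : ℂ) * translation Z Z' (t, x) ^ 2 * (slice Z' t).h x) * hh
  simp only [FrameField.quartic]
  linear_combination key - (1 / 2) * (rotation Z Z' (t, x) ^ 2 * (slice Z t).p x +
    (slice Z' t).p x + translation Z Z' (t, x) * (slice Z' t).h x) * hp

theorem dbarQuartic_change (hZ : IsFrameFamily Y O Z) (hZ' : IsFrameFamily Y O Z') {t : ℝ}
    {x : Plane} (hx : (t, x) ∈ O) :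
    rotation Z Z' (t, x) ^ 3 * dbarQuartic (slice Z t).omega (slice Z t).quartic x =
      dbarQuartic (slice Z' t).omega (slice Z' t).quartic x := by
  have hV := (hZ.frame t).isOpen
  have ce : ContDiffOn ℝ ∞ (rotation Z Z') O :=
    (hZ.contDiffOn_normTransition hZ' 1 1).add
      (contDiffOn_const.mul (hZ.contDiffOn_normTransition hZ' 2 1))
  have de : DifferentiableAt ℝ (fun y => rotation Z Z' (t, y)) x :=
    (contDiffOn_slice ce t).differentiableAt_top hV hx
  have dq : DifferentiableAt ℝ (slice Z t).quartic x := by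
    have F := hZ.frame t
    have : ContDiffOn ℝ ∞ (slice Z t).quartic {x | (t, x) ∈ O} :=
      (F.contDiffOn_h.mul F.contDiffOn_q).sub (contDiffOn_const.mul (F.contDiffOn_p.pow 2))
    exact this.differentiableAt_top hV hx
  have dw : DifferentiableAt ℝ (fun y => (slice Z' t).omega y) x :=
    (hZ'.frame t).differentiableAt_omega hx
  have hnear : ∀ᶠ y in nhds x, (t, y) ∈ O := hV.mem_nhds hx
  have e1 : extD (slice Z t).omega x =
      wedge (fderiv ℝ (fun y => rotation Z Z' (t, y)) x) ((slice Z' t).omega x) +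
        rotation Z Z' (t, x) * extD (slice Z' t).omega x := by
    rw [← extD_smul de dw]
    exact extD_congr (hnear.mono fun y hy => hZ.omega_change hZ' hy)
  have e2 : fderiv ℝ (slice Z' t).quartic x =
      rotation Z Z' (t, x) ^ 4 • fderiv ℝ (slice Z t).quartic x +
      (4 * rotation Z Z' (t, x) ^ 3 * (slice Z t).quartic x) •
        fderiv ℝ (fun y => rotation Z Z' (t, y)) x := by
    have hev : (slice Z' t).quartic =ᶠ[nhds x]
        fun y => rotation Z Z' (t, y) ^ 4 * (slice Z t).quartic y :=
      hnear.mono fun y hy => (hZ.quartic_change hZ' hy).symm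
    rw [hev.fderiv_eq, fderiv_fun_mul (de.fun_pow 4) dq, fderiv_fun_pow 4 de]
    ext u
    simp
    ring
  rw [dbarQuartic, dbarQuartic, e1, e2, ← hZ.quartic_change hZ' hx, hZ.omega_change hZ' hx]
  simp only [wedge, add_apply, smul_apply, smul_eq_mul]
  ring

end IsFrameFamily

/-! ### Constant families -/

theorem IsFrameFamily.congr_base {Y Y' : ℝ → Plane → PCSphere} {O : Set (ℝ × Plane)}
    {Z : ℝ × Plane → Matrix (Fin 4) (Fin 4) ℂ} (hZ : IsFrameFamily Y O Z)
    (h : ∀ y ∈ O, Y y.1 y.2 = Y' y.1 y.2) : IsFrameFamily Y' O Z where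
  isOpen := hZ.isOpen
  smooth := hZ.smooth
  frame t :=
    { isOpen := (hZ.frame t).isOpen
      smooth := (hZ.frame t).smooth
      unitary := (hZ.frame t).unitary
      base := fun x hx => h (t, x) hx ▸ (hZ.frame t).base x hx
      real := (hZ.frame t).real
      positive := (hZ.frame t).positive
      trace_beta := (hZ.frame t).trace_beta
      trace_p := (hZ.frame t).trace_p
      leg := (hZ.frame t).leg }

theorem IsAdaptedFrame.mono {Y : Plane → PCSphere} {V V' : Set Plane} {Z : FrameField}
    (hZ : IsAdaptedFrame Y V Z) (hV : IsOpen V') (h : V' ⊆ V) : IsAdaptedFrame Y V' Z where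
  isOpen := hV
  smooth A B := (hZ.smooth A B).mono h
  unitary x hx := hZ.unitary x (h hx)
  base x hx := hZ.base x (h hx)
  real x hx := hZ.real x (h hx)
  positive x hx := hZ.positive x (h hx)
  trace_beta x hx := hZ.trace_beta x (h hx)
  trace_p x hx := hZ.trace_p x (h hx)

/-- A frame field as a constant family. -/
def constFamily (Z : FrameField) : ℝ × Plane → Matrix (Fin 4) (Fin 4) ℂ := fun y => Z y.2

/-- Constant families allow the transformation laws of frame families to be applied to single
frames. -/
theorem IsLegFrame.constFamily {Y : Plane → PCSphere} {V : Set Plane} {Z : FrameField}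
    (hZ : IsLegFrame Y V Z) : IsFrameFamily (fun _ => Y) (Prod.snd ⁻¹' V) (constFamily Z) where
  isOpen := hZ.isOpen.preimage continuous_snd
  smooth A B := (hZ.smooth A B).comp contDiffOn_snd fun _ hy => hy
  frame _ := hZ

theorem timeMC_constFamily (Z : FrameField) {V : Set Plane} {Y : Plane → PCSphere}
    (hZ : IsLegFrame Y V Z) {t : ℝ} {x : Plane} (hx : x ∈ V) (A B : Fin 4) :
    timeMC (constFamily Z) A B t x = 0 := by
  have : ∀ C, fderiv ℝ (fun y => constFamily Z y C B) (t, x) (1, 0) = 0 := by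
    intro C
    have h : HasFDerivAt (fun y : ℝ × Plane => Z y.2 C B)
        ((fderiv ℝ (fun y => Z y C B) x).comp (ContinuousLinearMap.snd ℝ ℝ Plane)) (t, x) :=
      HasFDerivAt.comp (t, x) (g := fun y => Z y C B)
        (hZ.smoothSU.differentiableAt hx C B).hasFDerivAt hasFDerivAt_snd
    have e : fderiv ℝ (fun y => WillmoreLegendrian.constFamily Z y C B) (t, x) = _ := h.fderiv
    rw [e]; simp
  simp [timeMC, mcForm, this]

theorem boundaryForm_constFamily (Z : FrameField) {V : Set Plane} {Y : Plane → PCSphere}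
    (hZ : IsLegFrame Y V Z) {t : ℝ} {x : Plane} (hx : x ∈ V) :
    boundaryForm (constFamily Z) t x = 0 := by
  have h := timeMC_constFamily Z hZ (t := t) hx
  simp only [boundaryForm, hopfTime, normalConj, hamiltonian, h]
  ext v; simp

/-- The Willmore form and the vanishing of `∂̄ Φ` do not depend on the frame. -/
theorem IsLegFrame.willmoreForm_change {Y : Plane → PCSphere} {V V' : Set Plane}
    {Z Z' : FrameField} (hZ : IsLegFrame Y V Z) (hZ' : IsLegFrame Y V' Z') {x : Plane}
    (hx : x ∈ V) (hx' : x ∈ V') : Z.willmoreForm x = Z'.willmoreForm x := by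
  have hO : IsOpen (Prod.snd ⁻¹' (V ∩ V') : Set (ℝ × Plane)) :=
    (hZ.isOpen.inter hZ'.isOpen).preimage continuous_snd
  exact (hZ.constFamily.mono hO fun _ h => h.1).willmoreForm_change
    (hZ'.constFamily.mono hO fun _ h => h.2) (t := 0) ⟨hx, hx'⟩

theorem IsLegFrame.dbarQuartic_change {Y : Plane → PCSphere} {V V' : Set Plane}
    {Z Z' : FrameField} (hZ : IsLegFrame Y V Z) (hZ' : IsLegFrame Y V' Z') {x : Plane}
    (hx : x ∈ V) (hx' : x ∈ V') (h : dbarQuartic Z.omega Z.quartic x = 0) :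
    dbarQuartic Z'.omega Z'.quartic x = 0 := by
  have hO : IsOpen (Prod.snd ⁻¹' (V ∩ V') : Set (ℝ × Plane)) :=
    (hZ.isOpen.inter hZ'.isOpen).preimage continuous_snd
  have := (hZ.constFamily.mono hO fun _ h => h.1).dbarQuartic_change
    (hZ'.constFamily.mono hO fun _ h => h.2) (t := 0) (x := x) ⟨hx, hx'⟩
  change _ * dbarQuartic Z.omega Z.quartic x = dbarQuartic Z'.omega Z'.quartic x at this
  rw [← this, h, mul_zero]

/-! ### Change of coordinates -/

theorem det_eq (A : Plane →L[ℝ] Plane) : A.det = A e₁ 0 * A e₂ 1 - A e₂ 0 * A e₁ 1 := by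
  have h := LinearMap.det_toMatrix (EuclideanSpace.basisFun (Fin 2) ℝ).toBasis
      (A : Plane →ₗ[ℝ] Plane)
  rw [Matrix.det_fin_two] at h
  rw [ContinuousLinearMap.det, ← h]
  simp [LinearMap.toMatrix_apply]

theorem plane_eq (v : Plane) : v = v 0 • e₁ + v 1 • e₂ := by
  ext i; fin_cases i <;> simp

theorem wedge_comp (θ η : Cov) (A : Plane →L[ℝ] Plane) :
    wedge (θ.comp A) (η.comp A) = A.det * wedge θ η := by
  have h : ∀ (κ : Cov) v, κ v = v 0 * κ e₁ + v 1 * κ e₂ := fun κ v => by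
    conv_lhs => rw [plane_eq v]
    simp
  simp only [wedge, ContinuousLinearMap.comp_apply, h θ (A _), h η (A _), det_eq]
  push_cast
  ring

section Pullback

variable {E F : Type*} [NormedAddCommGroup E] [NormedSpace ℝ E] [NormedAddCommGroup F]
  [NormedSpace ℝ F]

theorem SmoothSU.comp {Z : F → Matrix (Fin 4) (Fin 4) ℂ} {V : Set F} (hZ : SmoothSU Z V)
    {g : E → F} {U : Set E} (hU : IsOpen U) (hg : ContDiffOn ℝ ∞ g U) (h : Set.MapsTo g U V) :
    SmoothSU (fun y => Z (g y)) U :=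
  ⟨hU, fun A B => (hZ.smooth A B).comp hg h, fun _ hy => hZ.unitary _ (h hy)⟩

theorem SmoothSU.mcForm_comp {Z : F → Matrix (Fin 4) (Fin 4) ℂ} {V : Set F} (hZ : SmoothSU Z V)
    {g : E → F} {x : E} (hx : g x ∈ V) (hg : DifferentiableAt ℝ g x) (A B : Fin 4) :
    mcForm (fun y => Z (g y)) A B x = (mcForm Z A B (g x)).comp (fderiv ℝ g x) := by
  have : ∀ C, fderiv ℝ (fun y => Z (g y) C B) x =
      (fderiv ℝ (fun y => Z y C B) (g x)).comp (fderiv ℝ g x) := fun C =>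
    ((hZ.differentiableAt hx C B).hasFDerivAt.comp x hg.hasFDerivAt).fderiv
  ext u
  simp only [mcForm, this]
  simp

end Pullback

/-- The domain of the pullback of a family. -/
def pullbackSet (τ : Plane → Plane) (T : Set Plane) (O : Set (ℝ × Plane)) : Set (ℝ × Plane) :=
  {y | y.2 ∈ T ∧ (y.1, τ y.2) ∈ O}

/-- The pullback of a family of frames. -/
def pullback (τ : Plane → Plane) (Z : ℝ × Plane → Matrix (Fin 4) (Fin 4) ℂ) :
    ℝ × Plane → Matrix (Fin 4) (Fin 4) ℂ := fun y => Z (y.1, τ y.2)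

namespace IsFrameFamily

variable {Y : ℝ → Plane → PCSphere} {O : Set (ℝ × Plane)}
  {Z : ℝ × Plane → Matrix (Fin 4) (Fin 4) ℂ} {τ : Plane → Plane} {T : Set Plane}

theorem mc_pullback (hZ : IsFrameFamily Y O Z) (hT : IsOpen T) (hτ : ContDiffOn ℝ ∞ τ T) {t : ℝ}
    {x : Plane} (hx : (t, x) ∈ pullbackSet τ T O) (A B : Fin 4) :
    (slice (pullback τ Z) t).mc A B x = ((slice Z t).mc A B (τ x)).comp (fderiv ℝ τ x) :=
  (hZ.frame t).smoothSU.mcForm_comp (g := τ) hx.2 (hτ.differentiableAt_top hT hx.1) A B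

theorem timeMC_pullback (hZ : IsFrameFamily Y O Z) (hT : IsOpen T) (hτ : ContDiffOn ℝ ∞ τ T)
    {t : ℝ} {x : Plane} (hx : (t, x) ∈ pullbackSet τ T O) (A B : Fin 4) :
    timeMC (pullback τ Z) A B t x = timeMC Z A B t (τ x) := by
  have hg : HasFDerivAt (fun y : ℝ × Plane => (y.1, τ y.2))
      ((ContinuousLinearMap.fst ℝ ℝ Plane).prod
        ((fderiv ℝ τ x).comp (ContinuousLinearMap.snd ℝ ℝ Plane))) (t, x) :=
    hasFDerivAt_fst.prodMk (HasFDerivAt.comp (t, x) (g := τ)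
      (hτ.differentiableAt_top hT hx.1).hasFDerivAt hasFDerivAt_snd)
  have := hZ.smoothSU.mcForm_comp (g := fun y : ℝ × Plane => (y.1, τ y.2)) hx.2
    hg.differentiableAt A B
  change mcForm (fun y : ℝ × Plane => Z (y.1, τ y.2)) A B (t, x) (1, 0) = _
  rw [this, hg.fderiv]
  simp [timeMC]

/-- Apart from the sign of ω¹∧ω², which needs a positive Jacobian, every condition is an identity
between forms and is preserved by pullback. -/
theorem pullback_frame (hZ : IsFrameFamily Y O Z) (hT : IsOpen T) (hτ : ContDiffOn ℝ ∞ τ T)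
    (hdet : ∀ x ∈ T, 0 < (fderiv ℝ τ x).det) :
    IsFrameFamily (fun t x => Y t (τ x)) (pullbackSet τ T O) (pullback τ Z) := by
  have hg : ContDiffOn ℝ ∞ (fun y : ℝ × Plane => (y.1, τ y.2)) (Prod.snd ⁻¹' T) :=
    contDiffOn_fst.prodMk (hτ.comp contDiffOn_snd fun _ hy => hy)
  have hO : IsOpen (pullbackSet τ T O) :=
    hg.continuousOn.isOpen_inter_preimage (hT.preimage continuous_snd) hZ.isOpen
  have hSU : SmoothSU (pullback τ Z) (pullbackSet τ T O) :=
    hZ.smoothSU.comp hO (hg.mono fun _ hy => hy.1) fun _ hy => hy.2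
  refine ⟨hO, hSU.smooth, fun t => ?_⟩
  have hS := hSU.slice t
  have F := hZ.frame t
  have k : ∀ x ∈ {x | (t, x) ∈ pullbackSet τ T O}, ∀ A B,
      (slice (pullback τ Z) t).mc A B x = ((slice Z t).mc A B (τ x)).comp (fderiv ℝ τ x) :=
    fun x hx => hZ.mc_pullback hT hτ hx
  have kom : ∀ x ∈ {x | (t, x) ∈ pullbackSet τ T O}, ∀ i,
      (slice (pullback τ Z) t).om i x = ((slice Z t).om i (τ x)).comp (fderiv ℝ τ x) :=
    fun x hx i => k x hx _ _
  refine { isOpen := hS.isOpen, smooth := hS.smooth, unitary := hS.unitary, base := ?_, real := ?_,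
           positive := ?_, trace_beta := ?_, trace_p := ?_, leg := ?_ }
  · exact fun x hx => F.base (τ x) hx.2
  · intro x hx i
    rw [kom x hx]
    have := F.real (τ x) hx.2 i
    ext v; exact DFunLike.congr_fun this (fderiv ℝ τ x v)
  · intro x hx
    rw [kom x hx, kom x hx, wedge_comp, Complex.re_ofReal_mul]
    exact mul_pos (hdet x hx.1) (F.positive (τ x) hx.2)
  · intro x hx
    have := F.trace_beta (τ x) hx.2
    ext v
    have h2 := DFunLike.congr_fun this (fderiv ℝ τ x v)
    simp only [Fin.sum_univ_two, FrameField.beta, FrameField.conn, k x hx, add_apply,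
      imForm_apply, if_true] at h2 ⊢
    exact h2
  · intro x hx
    obtain ⟨P, h1, h2⟩ := F.trace_p (τ x) hx.2
    refine ⟨P, h1, fun i => ?_⟩
    ext v
    have h3 := DFunLike.congr_fun (h2 i) (fderiv ℝ τ x v)
    simp only [FrameField.mu, k x hx, kom x hx, sum_apply, smul_apply, reForm_apply] at h3 ⊢
    exact h3
  · intro x hx
    rw [k x hx, F.leg (τ x) hx.2]; rfl

theorem forms_pullback (hZ : IsFrameFamily Y O Z) (hT : IsOpen T) (hτ : ContDiffOn ℝ ∞ τ T)
    {t : ℝ} {x : Plane} (hx : (t, x) ∈ pullbackSet τ T O) :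
    (slice (pullback τ Z) t).omega x = ((slice Z t).omega (τ x)).comp (fderiv ℝ τ x) ∧
    (slice (pullback τ Z) t).eta x = ((slice Z t).eta (τ x)).comp (fderiv ℝ τ x) ∧
    (slice (pullback τ Z) t).muC x = ((slice Z t).muC (τ x)).comp (fderiv ℝ τ x) := by
  have k := hZ.mc_pullback hT hτ hx
  refine ⟨?_, ?_, ?_⟩ <;> ext v
  · simp [FrameField.omega, FrameField.om, k]
  · simp [FrameField.eta, FrameField.beta, FrameField.conn, k]
  · simp [FrameField.muC, FrameField.mu, k]

theorem q_pullback (hZ : IsFrameFamily Y O Z) (hT : IsOpen T) (hτ : ContDiffOn ℝ ∞ τ T)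
    (hdet : ∀ x ∈ T, 0 < (fderiv ℝ τ x).det)
    {t : ℝ} {x : Plane} (hx : (t, x) ∈ pullbackSet τ T O) :
    (slice (pullback τ Z) t).q x = (slice Z t).q (τ x) := by
  have hd : ((fderiv ℝ τ x).det : ℂ) ≠ 0 := by exact_mod_cast (hdet x hx.1).ne'
  have hc : ∀ θ : Cov, conjForm (θ.comp (fderiv ℝ τ x)) = (conjForm θ).comp (fderiv ℝ τ x) :=
    fun θ => rfl
  rw [FrameField.q, FrameField.q, coeff, coeff, (hZ.forms_pullback hT hτ hx).1,
    hZ.mc_pullback hT hτ hx, hc, wedge_comp, wedge_comp, mul_div_mul_left _ _ hd]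

theorem boundaryForm_pullback (hZ : IsFrameFamily Y O Z) (hT : IsOpen T) (hτ : ContDiffOn ℝ ∞ τ T)
    (hdet : ∀ x ∈ T, 0 < (fderiv ℝ τ x).det)
    {t : ℝ} {x : Plane} (hx : (t, x) ∈ pullbackSet τ T O) :
    boundaryForm (pullback τ Z) t x = (boundaryForm Z t (τ x)).comp (fderiv ℝ τ x) := by
  obtain ⟨h1, h2, h3⟩ := hZ.forms_pullback hT hτ hx
  have hm := hZ.timeMC_pullback hT hτ hx
  ext v
  simp only [boundaryForm, h1, h2, h3, hZ.q_pullback hT hτ hdet hx, hopfTime, normalConj,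
    hamiltonian, hm, add_apply, sub_apply, smul_apply, ContinuousLinearMap.comp_apply,
    conjForm_apply]

/-- r is a quotient of two-forms, numerator and denominator both picking up the Jacobian
determinant. -/
theorem r_pullback (hZ : IsFrameFamily Y O Z) (hT : IsOpen T) (hτ : ContDiffOn ℝ ∞ τ T)
    (hdet : ∀ x ∈ T, 0 < (fderiv ℝ τ x).det)
    {t : ℝ} {x : Plane} (hx : (t, x) ∈ pullbackSet τ T O) :
    (slice (pullback τ Z) t).r x = (slice Z t).r (τ x) := by
  have hd : ((fderiv ℝ τ x).det : ℂ) ≠ 0 := by exact_mod_cast (hdet x hx.1).ne'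
  have hc : ∀ θ : Cov, conjForm (θ.comp (fderiv ℝ τ x)) = (conjForm θ).comp (fderiv ℝ τ x) :=
    fun θ => rfl
  have k := hZ.mc_pullback hT hτ hx
  obtain ⟨h1, h2, h3⟩ := hZ.forms_pullback hT hτ hx
  have F := hZ.frame t
  have hp : (slice (pullback τ Z) t).p x = (slice Z t).p (τ x) := by
    change coeff _ ((slice (pullback τ Z) t).muC x) = coeff _ ((slice Z t).muC (τ x))
    rw [coeff, coeff, h1, h3, hc, wedge_comp, wedge_comp, mul_div_mul_left _ _ hd]
  have hev : (slice (pullback τ Z) t).q =ᶠ[nhds x] fun y => (slice Z t).q (τ y) := by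
    filter_upwards [((hZ.pullback_frame hT hτ hdet).frame t).isOpen.mem_nhds hx] with y hy
    exact hZ.q_pullback hT hτ hdet hy
  have hdq : fderiv ℝ (slice (pullback τ Z) t).q x =
      (fderiv ℝ (slice Z t).q (τ x)).comp (fderiv ℝ τ x) := by
    rw [hev.fderiv_eq]
    exact ((F.contDiffOn_q.differentiableAt_top F.isOpen hx.2).hasFDerivAt.comp x
      (hτ.differentiableAt_top hT hx.1).hasFDerivAt).fderiv
  have hsum : fderiv ℝ (slice (pullback τ Z) t).q x + (slice (pullback τ Z) t).q x •
        (Complex.I • (slice (pullback τ Z) t).rho x + (3 : ℂ) • (slice (pullback τ Z) t).phi x) +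
        (slice (pullback τ Z) t).p x • (slice (pullback τ Z) t).nuC x =
      (fderiv ℝ (slice Z t).q (τ x) + (slice Z t).q (τ x) •
        (Complex.I • (slice Z t).rho (τ x) + (3 : ℂ) • (slice Z t).phi (τ x)) +
        (slice Z t).p (τ x) • (slice Z t).nuC (τ x)).comp (fderiv ℝ τ x) := by
    rw [hdq, hp, hZ.q_pullback hT hτ hdet hx]
    ext v
    simp [FrameField.rho, FrameField.alpha, FrameField.conn, FrameField.phi, FrameField.nuC,
      FrameField.nu, k]
  rw [FrameField.r, FrameField.r, hsum, coeffBar, coeffBar, h1, hc, wedge_comp, wedge_comp,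
    mul_div_mul_left _ _ hd]

end IsFrameFamily

/-! ### Lifts of Legendrian immersions in charts -/

/-- The factor between two lifts is the quotient of corresponding coordinates, one of them nonzero
near y; so it is differentiable and the product rule applies. -/
theorem Represents.exists_fderiv_eq {E : Type*} [NormedAddCommGroup E] [NormedSpace ℝ E]
    {f g : E → C31} {L : E → PCSphere} {y : E} (hf : DifferentiableAt ℝ f y)
    (hg : DifferentiableAt ℝ g y) (hfL : ∀ᶠ x in nhds y, Represents (f x) (L x))
    (hgL : ∀ᶠ x in nhds y, Represents (g x) (L x)) :
    ∃ a : ℂ, a ≠ 0 ∧ f y = a • g y ∧ ∃ b : E →L[ℝ] ℂ, ∀ v,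
      fderiv ℝ f y v = a • fderiv ℝ g y v + b v • g y := by
  have h0 : g y ≠ 0 := hgL.self_of_nhds.1
  obtain ⟨k, hk⟩ := Function.ne_iff.1 h0
  have hdk : ∀ {f : E → C31}, DifferentiableAt ℝ f y → DifferentiableAt ℝ (fun x => f x k) y :=
    fun hf => differentiableAt_pi.1 hf k
  set l : E → ℂ := fun x => f x k * (g x k)⁻¹ with hl
  have hld : DifferentiableAt ℝ l y := (hdk hf).mul ((hdk hg).inv hk)
  have hev : ∀ᶠ x in nhds y, l x ≠ 0 ∧ f x = l x • g x := by
    filter_upwards [hfL, hgL, (hdk hg).continuousAt.eventually_ne hk] with x h1 h2 h3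
    obtain ⟨a, ha, hax⟩ := h2.exists_smul h1
    have : l x = a := by
      simp only [hl, hax, Pi.smul_apply, smul_eq_mul, mul_assoc]
      rw [mul_inv_cancel₀ h3, mul_one]
    rw [this]
    exact ⟨ha, hax⟩
  have hf' : f =ᶠ[nhds y] fun x => l x • g x := hev.mono fun x hx => hx.2
  refine ⟨l y, hev.self_of_nhds.1, hev.self_of_nhds.2, fderiv ℝ l y, fun v => ?_⟩
  rw [hf'.fderiv_eq, fderiv_fun_smul hld hg]
  simp

section Charts

variable {M : Type*} [TopologicalSpace M] [ChartedSpace Plane M] [IsManifold (𝓡 2) ∞ M]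
  {c : OpenPartialHomeomorph M Plane}

theorem contMDiffOn_chart_symm (hc : c ∈ atlas Plane M) :
    ContMDiffOn (𝓡 2) (𝓡 2) ∞ c.symm c.target :=
  contMDiffOn_symm_of_mem_maximalAtlas (IsManifold.subset_maximalAtlas hc)

theorem mdifferentiableAt_chart_symm (hc : c ∈ atlas Plane M) {x : Plane} (hx : x ∈ c.target) :
    MDifferentiableAt (𝓡 2) (𝓡 2) c.symm x :=
  ((contMDiffOn_chart_symm hc).contMDiffAt (c.open_target.mem_nhds hx)).mdifferentiableAt (by simp)

theorem mfderiv_chart_symm_injective (hc : c ∈ atlas Plane M) {x : Plane} (hx : x ∈ c.target) :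
    Function.Injective (mfderiv (𝓡 2) (𝓡 2) c.symm x) := by
  have : IsManifold (𝓡 2) 1 M := IsManifold.of_le (n := ∞) (by simp)
  have h := (mdifferentiable_of_mem_atlas (I := 𝓡 2) hc).symm
  exact h.mfderiv_injective (by simpa using hx)

theorem fderiv_comp_chart_symm (hc : c ∈ atlas Plane M) {x : Plane} (hx : x ∈ c.target)
    {s : M → C31} (hs : MDifferentiableAt (𝓡 2) 𝓘(ℝ, C31) s (c.symm x)) (v : Plane) :
    DifferentiableAt ℝ (s ∘ c.symm) x ∧
      fderiv ℝ (s ∘ c.symm) x v = dVec s (c.symm x) (mfderiv (𝓡 2) (𝓡 2) c.symm x v) := by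
  have h := hs.comp x (mdifferentiableAt_chart_symm hc hx)
  refine ⟨mdifferentiableAt_iff_differentiableAt.1 h, ?_⟩
  rw [← mfderiv_eq_fderiv, mfderiv_comp x hs (mdifferentiableAt_chart_symm hc hx)]
  rfl

/-- The definition provides one good lift. Replacing it by a multiple changes ds only by a scale and
a multiple of s, which affects neither the Legendre nor the immersion condition, since s is null. -/
theorem IsLegendrianImmersion.lift {X : M → PCSphere} (hX : IsLegendrianImmersion X)
    (hc : c ∈ atlas Plane M) {x : Plane} (hx : x ∈ c.target) {s : Plane → C31}
    (hs : DifferentiableAt ℝ s x) (hrep : ∀ᶠ y in nhds x, Represents (s y) (X (c.symm y))) :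
    (∀ v, herm (fderiv ℝ s x v) (s x) = 0) ∧ ∀ v, ∀ a : ℂ, fderiv ℝ s x v = a • s x → v = 0 := by
  obtain ⟨U, hU, hxU, u, hu, hprop⟩ := hX (c.symm x)
  have hum : MDifferentiableAt (𝓡 2) 𝓘(ℝ, C31) u (c.symm x) :=
    (hu.contMDiffAt (hU.mem_nhds hxU)).mdifferentiableAt (by simp)
  have hud := (fderiv_comp_chart_symm hc hx hum 0).1
  have hrep' : ∀ᶠ y in nhds x, Represents ((u ∘ c.symm) y) (X (c.symm y)) := by
    have : ContinuousAt c.symm x := c.continuousAt_symm hx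
    filter_upwards [this (hU.mem_nhds hxU)] with y hy using (hprop _ hy).1
  obtain ⟨l, hl0, hsx, b, hder⟩ := Represents.exists_fderiv_eq hs hud hrep hrep'
  have hself := hrep'.self_of_nhds.herm_self
  refine ⟨fun v => ?_, fun v a h => ?_⟩
  · rw [hder, hsx, herm_smul_right, herm_add_left, herm_smul_left, herm_smul_left, hself,
      (fderiv_comp_chart_symm hc hx hum v).2]
    have := (hprop _ hxU).2.1 (mfderiv (𝓡 2) (𝓡 2) c.symm x v)
    simp only [Function.comp_apply, this]
    simp
  · rw [hder, hsx, (fderiv_comp_chart_symm hc hx hum v).2] at h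
    have h2 : dVec u (c.symm x) (mfderiv (𝓡 2) (𝓡 2) c.symm x v) =
        (l⁻¹ * (a * l - b v)) • u (c.symm x) := by
      have h3 : dVec u (c.symm x) (mfderiv (𝓡 2) (𝓡 2) c.symm x v) =
        l⁻¹ • (l • dVec u (c.symm x) (mfderiv (𝓡 2) (𝓡 2) c.symm x v)) := by
        rw [smul_smul, inv_mul_cancel₀ hl0, one_smul]
      rw [h3, eq_sub_of_add_eq h]
      simp only [Function.comp_apply]
      module
    have h4 := (hprop _ hxU).2.2 _ _ h2
    exact mfderiv_chart_symm_injective hc hx (h4.trans (map_zero _).symm)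

theorem IsLegendrianVariation.exists_isLegLift {X : M → PCSphere} {K : Set M} {ε : ℝ}
    {Xt : ℝ → M → PCSphere} (hV : IsLegendrianVariation X K ε Xt) (hc : c ∈ atlas Plane M)
    {t : ℝ} (ht : t ∈ Set.Ioo (-ε) ε) {x : Plane} (hx : x ∈ c.target) :
    ∃ (O : Set (ℝ × Plane)) (s : ℝ × Plane → C31), (t, x) ∈ O ∧
      O ⊆ Set.Ioo (-ε) ε ×ˢ c.target ∧ IsLegLift (fun t => Xt t ∘ c.symm) O s := by
  obtain ⟨U, hU, hxU, -, u, hu, hrep⟩ := hV.smooth (t, c.symm x) ⟨ht, Set.mem_univ _⟩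
  set F : ℝ × Plane → ℝ × M := Prod.map id c.symm with hF
  have hT : IsOpen (Set.Ioo (-ε) ε ×ˢ c.target) := isOpen_Ioo.prod c.open_target
  have hFc : ContMDiffOn (𝓘(ℝ, ℝ).prod (𝓡 2)) (𝓘(ℝ, ℝ).prod (𝓡 2)) ∞ F
      (Set.Ioo (-ε) ε ×ˢ c.target) :=
    (contMDiffOn_id.prodMap (contMDiffOn_chart_symm hc))
  set O := Set.Ioo (-ε) ε ×ˢ c.target ∩ F ⁻¹' U with hOdef
  have hO : IsOpen O := hFc.continuousOn.isOpen_inter_preimage hT hU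
  have hsm : ContDiffOn ℝ ∞ (u ∘ F) O := by
    have := hu.comp (hFc.mono Set.inter_subset_left) (fun y hy => hy.2 : O ⊆ F ⁻¹' U)
    rw [← modelWithCornersSelf_prod, chartedSpaceSelf_prod] at this
    exact contMDiffOn_iff_contDiffOn.1 this
  have key : ∀ y ∈ O, (∀ v : Plane, herm (fderiv ℝ (u ∘ F) y (0, v)) ((u ∘ F) y) = 0) ∧
      ∀ v : Plane, ∀ a : ℂ, fderiv ℝ (u ∘ F) y (0, v) = a • (u ∘ F) y → v = 0 := by
    intro y hy
    have hd : HasFDerivAt (fun x => (u ∘ F) (y.1, x))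
        ((fderiv ℝ (u ∘ F) y).comp (ContinuousLinearMap.inr ℝ ℝ Plane)) y.2 :=
      HasFDerivAt.comp y.2 (f := fun x : Plane => (y.1, x)) (g := u ∘ F)
        (((hsm.contDiffAt (hO.mem_nhds hy)).differentiableAt (by simp)).hasFDerivAt)
        (hasFDerivAt_pair y.1 y.2)
    have hev : ∀ᶠ x in nhds y.2, Represents ((u ∘ F) (y.1, x)) (Xt y.1 (c.symm x)) := by
      have : ContinuousAt (fun x : Plane => (y.1, x)) y.2 := by fun_prop
      filter_upwards [this.preimage_mem_nhds (hO.mem_nhds hy)] with x hx using hrep _ hx.2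
    have h := (hV.legendrian y.1 hy.1.1).lift hc hy.1.2 hd.differentiableAt hev
    rw [hd.fderiv] at h
    exact h
  exact ⟨O, u ∘ F, ⟨⟨ht, hx⟩, hxU⟩, Set.inter_subset_left, hO, hsm, fun y hy => hrep _ hy.2,
    fun y hy => (key y hy).1, fun y hy => (key y hy).2⟩

/-- The first column of the frame is itself a lift, and π³₀ is i times its contact form. -/
theorem IsLegendrianImmersion.isLegFrame {X : M → PCSphere} (hX : IsLegendrianImmersion X)
    (hc : c ∈ atlas Plane M) {V : Set Plane} (hV : V ⊆ c.target) {Z : FrameField}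
    (hZ : IsAdaptedFrame (X ∘ c.symm) V Z) : IsLegFrame (X ∘ c.symm) V Z := by
  refine ⟨hZ, fun x hx => ?_⟩
  have hd : DifferentiableAt ℝ (fun y => col (Z y) 0) x :=
    differentiableAt_pi.2 fun A => (hZ.smooth A 0).differentiableAt_top hZ.isOpen hx
  have h := (hX.lift hc (hV hx) hd (by
    filter_upwards [hZ.isOpen.mem_nhds hx] with y hy using hZ.base y hy)).1
  ext v
  rw [FrameField.mc_eq, hZ.smoothSU.mcForm_apply hx]
  simp [h v]

/-! ### The Willmore form in local frames -/

theorem IsLegendrianImmersion.localWillmoreForm_eq {X : M → PCSphere}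
    (hX : IsLegendrianImmersion X) (hc : c ∈ atlas Plane M) {V : Set Plane} {Z : FrameField}
    (hZ : IsAdaptedFrame (X ∘ c.symm) V Z) {x : Plane} (hx : x ∈ V) (hxc : x ∈ c.target) :
    localWillmoreForm (X ∘ c.symm) x = Z.willmoreForm x := by
  have H : ∃ Z : FrameField, ∃ V : Set Plane, x ∈ V ∧ IsAdaptedFrame (X ∘ c.symm) V Z :=
    ⟨Z, V, hx, hZ⟩
  rw [localWillmoreForm, dif_pos H]
  obtain ⟨V', hx', hZ'⟩ := H.choose_spec
  -- The chosen frame may extend beyond the chart target, where nothing is known about the surface;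
  -- both frames are cut down to it before they are compared.
  have h1 := hX.isLegFrame hc Set.inter_subset_right
    (hZ.mono (hZ.isOpen.inter c.open_target) Set.inter_subset_left)
  have h2 := hX.isLegFrame hc Set.inter_subset_right
    (hZ'.mono (hZ'.isOpen.inter c.open_target) Set.inter_subset_left)
  exact h2.willmoreForm_change h1 ⟨hx', hxc⟩ ⟨hx, hxc⟩

theorem IsLegendrianVariation.exists_isFrameFamily {X : M → PCSphere} {K : Set M} {ε : ℝ}
    {Xt : ℝ → M → PCSphere} (hV : IsLegendrianVariation X K ε Xt) (hc : c ∈ atlas Plane M)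
    {t : ℝ} (ht : t ∈ Set.Ioo (-ε) ε) {x : Plane} (hx : x ∈ c.target) :
    ∃ (O : Set (ℝ × Plane)) (Z : ℝ × Plane → Matrix (Fin 4) (Fin 4) ℂ), (t, x) ∈ O ∧
      O ⊆ Set.Ioo (-ε) ε ×ˢ c.target ∧ IsFrameFamily (fun t => Xt t ∘ c.symm) O Z := by
  obtain ⟨O, s, hO, hsub, hs⟩ := hV.exists_isLegLift hc ht hx
  obtain ⟨w, l, hl, hmem⟩ := hs.exists_mem_domain hO
  exact ⟨_, _, hmem, (IsLegLift.domain_subset w l).trans hsub, hs.isFrameFamily w hl⟩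

end Charts

/-! ### Integration over domains of the plane -/

section Integration

open MeasureTheory

variable {T L : Set Plane}

theorem integrableOn_of_eq_zero_diff {F : Type*} [NormedAddCommGroup F] {f : Plane → F}
    (hf : ContinuousOn f T) (hT : IsOpen T) (hL : IsCompact L) (hLT : L ⊆ T)
    (h0 : ∀ x ∈ T \ L, f x = 0) : IntegrableOn f T :=
  ((hf.mono hLT).integrableOn_compact hL).of_forall_sdiff_eq_zero hT.measurableSet h0

/-- Extension by zero gives a smooth compactly supported function on the whole plane; integration by
parts against the constant 1 then applies. -/
theorem integral_fderiv_eq_zero {f : Plane → ℂ} (hf : ContDiffOn ℝ ∞ f T) (hT : IsOpen T)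
    (hL : IsCompact L) (hLT : L ⊆ T) (h0 : ∀ x ∈ T \ L, f x = 0) (v : Plane) :
    ∫ x in T, fderiv ℝ f x v = 0 := by
  set g := T.indicator f with hg
  have hgz : ∀ x ∉ L, g x = 0 := fun x hx => by
    by_cases hxT : x ∈ T
    · rw [hg, Set.indicator_of_mem hxT, h0 x ⟨hxT, hx⟩]
    · rw [hg, Set.indicator_of_notMem hxT]
  have hcs : HasCompactSupport g := HasCompactSupport.intro hL hgz
  have hgf : ∀ x ∈ T, g =ᶠ[nhds x] f := fun x hx => by
    filter_upwards [hT.mem_nhds hx] with y hy using Set.indicator_of_mem hy f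
  have hgs : ContDiff ℝ ∞ g := contDiff_iff_contDiffAt.2 fun x => by
    by_cases hxT : x ∈ T
    · exact (hf.contDiffAt (hT.mem_nhds hxT)).congr_of_eventuallyEq (hgf x hxT)
    · have : g =ᶠ[nhds x] fun _ => 0 := by
        filter_upwards [hL.isClosed.isOpen_compl.mem_nhds fun h => hxT (hLT h)] with y hy
          using hgz y hy
      exact contDiffAt_const.congr_of_eventuallyEq this
  have hd : Continuous fun x => fderiv ℝ g x v :=
    (hgs.continuous_fderiv (by simp)).clm_apply continuous_const
  have key := integral_smul_fderiv_eq_neg_fderiv_smul_of_integrable (μ := (volume : Measure Plane))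
    (f := fun _ : Plane => (1 : ℝ)) (g := g) (v := v) (by simp)
    (by simpa using hd.integrable_of_hasCompactSupport (hcs.fderiv_apply (𝕜 := ℝ) v))
    (by simpa using hgs.continuous.integrable_of_hasCompactSupport hcs)
    (fun _ _ => differentiableAt_const _) (fun x _ => hgs.differentiable (by simp) x)
  simp only [one_smul, fderiv_fun_const, Pi.zero_apply, zero_apply, zero_smul, integral_zero,
    neg_zero] at key
  rw [← key]
  refine (setIntegral_congr_fun hT.measurableSet fun x hx => ?_).trans
    (setIntegral_eq_integral_of_forall_compl_eq_zero (s := T) fun x hx => ?_)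
  · simp only [(hgf x hx).fderiv_eq]
  · have : g =ᶠ[nhds x] fun _ => 0 := by
      filter_upwards [hL.isClosed.isOpen_compl.mem_nhds fun h => hx (hLT h)] with y hy
        using hgz y hy
    rw [this.fderiv_eq]; simp

theorem ContDiffOn.extD {θ : Plane → Cov} (hθ : ContDiffOn ℝ ∞ θ T) (hT : IsOpen T) :
    ContDiffOn ℝ ∞ (extD θ) T := by
  have h : ∀ v w : Plane, ContDiffOn ℝ ∞ (fun x => fderiv ℝ (fun y => θ y w) x v) T := fun v w =>
    ((hθ.clm_apply contDiffOn_const).fderiv_of_isOpen hT (by simp)).clm_apply contDiffOn_const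
  exact (h e₁ e₂).sub (h e₂ e₁)

theorem integral_extD_eq_zero {θ : Plane → Cov} (hθ : ContDiffOn ℝ ∞ θ T) (hT : IsOpen T)
    (hL : IsCompact L) (hLT : L ⊆ T) (h0 : ∀ x ∈ T \ L, θ x = 0) :
    ∫ x in T, extD θ x = 0 := by
  have hs : ∀ w, ContDiffOn ℝ ∞ (fun y => θ y w) T := fun w => hθ.clm_apply contDiffOn_const
  have hz : ∀ w, ∀ x ∈ T \ L, θ x w = 0 := fun w x hx => by rw [h0 x hx]; rfl
  have hi : ∀ v w : Plane, IntegrableOn (fun x => fderiv ℝ (fun y => θ y w) x v) T := fun v w => by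
    refine integrableOn_of_eq_zero_diff (ContDiffOn.continuousOn (n := ∞)
      (((hs w).fderiv_of_isOpen hT (by simp)).clm_apply contDiffOn_const)) hT hL hLT fun x hx => ?_
    have : (fun y => θ y w) =ᶠ[nhds x] fun _ => 0 := by
      filter_upwards [(hT.sdiff hL.isClosed).mem_nhds hx] with y hy using hz w y hy
    rw [this.fderiv_eq]; simp
  change ∫ x in T, (fderiv ℝ (fun y => θ y e₂) x e₁ - fderiv ℝ (fun y => θ y e₁) x e₂) = 0
  rw [integral_sub (hi _ _) (hi _ _), integral_fderiv_eq_zero (hs _) hT hL hLT (hz _),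
    integral_fderiv_eq_zero (hs _) hT hL hLT (hz _), sub_zero]

/-- The time derivative is bounded on the product of L with a closed time interval around t₀, which
provides the dominating constant. -/
theorem hasDerivAt_setIntegral {G : ℝ × Plane → ℝ} {a b t₀ : ℝ}
    (hG : ContDiffOn ℝ ∞ G (Set.Ioo a b ×ˢ T)) (hT : IsOpen T) (hL : IsCompact L) (hLT : L ⊆ T)
    (ht : t₀ ∈ Set.Ioo a b) :
    HasDerivAt (fun t => ∫ x in L, G (t, x)) (∫ x in L, deriv (fun t => G (t, x)) t₀) t₀ := by
  have hO : IsOpen (Set.Ioo a b ×ˢ T) := isOpen_Ioo.prod hT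
  set G' : ℝ × Plane → ℝ := fun y => fderiv ℝ G y (1, 0) with hG'
  have hG'c : ContinuousOn G' (Set.Ioo a b ×ˢ T) :=
    ContDiffOn.continuousOn (n := ∞) ((hG.fderiv_of_isOpen hO (by simp)).clm_apply contDiffOn_const)
  have hder : ∀ t ∈ Set.Ioo a b, ∀ x ∈ T, HasDerivAt (fun t => G (t, x)) (G' (t, x)) t := by
    intro t ht x hx
    have h := (hG.contDiffAt (hO.mem_nhds (x := (t, x)) ⟨ht, hx⟩)).differentiableAt (by simp)
    exact HasFDerivAt.comp_hasDerivAt (f := fun t : ℝ => (t, x)) t h.hasFDerivAt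
      ((hasDerivAt_id t).prodMk (hasDerivAt_const t x))
  obtain ⟨δ, hδ, hball⟩ := Metric.nhds_basis_closedBall.mem_iff.1 (isOpen_Ioo.mem_nhds ht)
  have hcomp : IsCompact (Metric.closedBall t₀ δ ×ˢ L) := (isCompact_closedBall t₀ δ).prod hL
  obtain ⟨C, hC⟩ := hcomp.exists_bound_of_continuousOn
    (hG'c.mono (Set.prod_mono hball hLT))
  have hGL : ∀ t ∈ Set.Ioo a b, ContinuousOn (fun x => G (t, x)) L := fun t ht =>
    hG.continuousOn.comp (by fun_prop) fun x hx => ⟨ht, hLT hx⟩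
  have hG'L : ContinuousOn (fun x => G' (t₀, x)) L :=
    hG'c.comp (by fun_prop) fun x hx => ⟨ht, hLT hx⟩
  have hev : ∀ᶠ t in nhds t₀, t ∈ Set.Ioo a b := isOpen_Ioo.mem_nhds ht
  have key := (hasDerivAt_integral_of_dominated_loc_of_deriv_le (𝕜 := ℝ)
    (μ := (volume : Measure Plane).restrict L)
    (F := fun t x => G (t, x)) (F' := fun t x => G' (t, x)) (x₀ := t₀) (bound := fun _ => C)
    (s := Metric.closedBall t₀ δ)
    (Metric.closedBall_mem_nhds t₀ hδ)
    (hev.mono fun t ht => (hGL t ht).aestronglyMeasurable hL.measurableSet)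
    ((hGL t₀ ht).integrableOn_compact hL)
    (hG'L.aestronglyMeasurable hL.measurableSet)
    ((ae_restrict_iff' hL.measurableSet).2 (Filter.Eventually.of_forall fun x hx t ht =>
      hC (t, x) ⟨ht, hx⟩))
    (integrableOn_const hL.measure_lt_top.ne)
    ((ae_restrict_iff' hL.measurableSet).2 (Filter.Eventually.of_forall fun x hx t ht =>
      hder t (hball ht) x (hLT hx)))).2
  rwa [setIntegral_congr_fun hL.measurableSet fun x hx => ((hder t₀ ht x (hLT hx)).deriv).symm]
    at key

end Integration

/-! ### The boundary form and the residue of a family of Legendrian immersions -/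

/-- The boundary form of a family at time zero; it does not depend on the frames. -/
def familyBoundary (Y : ℝ → Plane → PCSphere) (x : Plane) : Cov :=
  open Classical in
  if H : ∃ Z : ℝ × Plane → Matrix (Fin 4) (Fin 4) ℂ, ∃ O : Set (ℝ × Plane),
      ((0 : ℝ), x) ∈ O ∧ IsFrameFamily Y O Z then
    boundaryForm (Classical.choose H) 0 x
  else 0

/-- The part of the first variation of the Willmore form which is not exact. -/
def familyResidue (Y : ℝ → Plane → PCSphere) (x : Plane) : ℝ :=
  (2 * (Complex.I * extD (familyBoundary Y) x).re -
    deriv (fun t => localWillmoreForm (Y t) x) 0) / 4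

section Family

variable {Y : ℝ → Plane → PCSphere} {O : Set (ℝ × Plane)}
  {Z : ℝ × Plane → Matrix (Fin 4) (Fin 4) ℂ}

theorem IsFrameFamily.familyBoundary_eq (hZ : IsFrameFamily Y O Z) {x : Plane}
    (hx : ((0 : ℝ), x) ∈ O) : familyBoundary Y x = boundaryForm Z 0 x := by
  have H : ∃ Z : ℝ × Plane → Matrix (Fin 4) (Fin 4) ℂ, ∃ O : Set (ℝ × Plane),
      ((0 : ℝ), x) ∈ O ∧ IsFrameFamily Y O Z := ⟨Z, O, hx, hZ⟩
  rw [familyBoundary, dif_pos H]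
  obtain ⟨O', hx', hZ'⟩ := H.choose_spec
  have hO := hZ.isOpen.inter hZ'.isOpen
  exact (hZ'.mono hO Set.inter_subset_right).boundaryForm_change (hZ.mono hO Set.inter_subset_left)
    ⟨hx, hx'⟩

theorem IsFrameFamily.familyBoundary_eventuallyEq (hZ : IsFrameFamily Y O Z) {x : Plane}
    (hx : ((0 : ℝ), x) ∈ O) : familyBoundary Y =ᶠ[nhds x] boundaryForm Z 0 := by
  filter_upwards [(hZ.frame 0).isOpen.mem_nhds hx] with y hy using hZ.familyBoundary_eq hy

/-- Subtracting the exact part from the first variation leaves f r ω¹∧ω². The definition of the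
residue uses no frame, hence it is meaningful on the whole chart. -/
theorem IsFrameFamily.familyResidue_eq (hZ : IsFrameFamily Y O Z) {x : Plane}
    (hx : ((0 : ℝ), x) ∈ O)
    (hw : ∀ᶠ t in nhds (0 : ℝ), localWillmoreForm (Y t) x = (slice Z t).willmoreForm x) :
    familyResidue Y x = (hamiltonian Z 0 x).re * ((slice Z 0).r x).re *
      (wedge ((slice Z 0).mc 1 0 x) ((slice Z 0).mc 2 0 x)).re := by
  have h1 : (fun t => localWillmoreForm (Y t) x) =ᶠ[nhds 0] fun t => (slice Z t).willmoreForm x :=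
      hw
  rw [familyResidue, h1.deriv_eq, (hZ.hasDerivAt_willmoreForm hx).deriv, extD_congr
    (hZ.familyBoundary_eventuallyEq hx)]
  ring

end Family

theorem IsFrameFamily.contDiffOn_willmoreForm {Y : ℝ → Plane → PCSphere} {O : Set (ℝ × Plane)}
    {Z : ℝ × Plane → Matrix (Fin 4) (Fin 4) ℂ} (hZ : IsFrameFamily Y O Z) :
    ContDiffOn ℝ ∞ (fun y : ℝ × Plane => (slice Z y.1).willmoreForm y.2) O := by
  have k := hZ.smoothSU.contDiffOn_mc_slice
  have hc : ∀ i j v, ContDiffOn ℝ ∞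
      (fun y : ℝ × Plane => (slice Z y.1).conn i j y.2 v) O := fun i j v => by
    simp only [FrameField.conn]
    split_ifs
    · exact (k _ _ v).sub (k _ _ v)
    · exact (k _ _ v).sub contDiffOn_const
  have he : ∀ v, ContDiffOn ℝ ∞ (fun y : ℝ × Plane => (slice Z y.1).eta y.2 v) O := fun v =>
    (hc 0 0 v).im_complex.ofReal_complex.sub
      (contDiffOn_const.mul (hc 0 1 v).im_complex.ofReal_complex)
  have hw : ContDiffOn ℝ ∞ (fun y : ℝ × Plane => (Complex.I * wedge ((slice Z y.1).eta y.2)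
      (conjForm ((slice Z y.1).eta y.2))).re) O :=
    (contDiffOn_const.mul (((he e₁).mul (he e₂).star_complex).sub
      ((he e₂).mul (he e₁).star_complex))).re_complex
  exact hw.congr fun y hy => willmoreForm_eq (hZ.frame y.1) hy

theorem IsLegendrianVariation.zero_mem {M : Type*} [TopologicalSpace M] [ChartedSpace Plane M]
    {X : M → PCSphere} {K : Set M} {ε : ℝ} {Xt : ℝ → M → PCSphere}
    (hV : IsLegendrianVariation X K ε Xt) : (0 : ℝ) ∈ Set.Ioo (-ε) ε :=
  ⟨neg_lt_zero.2 hV.pos, hV.pos⟩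

/-! ### The boundary form and the residue of a variation in charts -/

section Charts

variable {M : Type*} [TopologicalSpace M] [ChartedSpace Plane M] [IsManifold (𝓡 2) ∞ M]

theorem contDiffOn_transition {c c' : OpenPartialHomeomorph M Plane} (hc : c ∈ atlas Plane M)
    (hc' : c' ∈ atlas Plane M) :
    ContDiffOn ℝ ∞ (c.symm.trans c') (c.symm.trans c').source := by
  have h : ContMDiffOn (𝓡 2) (𝓡 2) ∞ c' c'.source :=
    contMDiffOn_of_mem_maximalAtlas (IsManifold.subset_maximalAtlas hc')
  exact contMDiffOn_iff_contDiffOn.1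
    (h.comp ((contMDiffOn_chart_symm hc).mono fun x hx => hx.1) fun x hx => hx.2)

namespace IsLegendrianVariation

variable {X : M → PCSphere} {K : Set M} {ε : ℝ} {Xt : ℝ → M → PCSphere}
  {c : OpenPartialHomeomorph M Plane} {O : Set (ℝ × Plane)}
  {Z : ℝ × Plane → Matrix (Fin 4) (Fin 4) ℂ}

theorem localWillmoreForm_eq (hV : IsLegendrianVariation X K ε Xt) (hc : c ∈ atlas Plane M)
    (hZ : IsFrameFamily (fun t => Xt t ∘ c.symm) O Z) {t : ℝ} (ht : t ∈ Set.Ioo (-ε) ε) {x : Plane}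
    (hx : (t, x) ∈ O) (hxc : x ∈ c.target) :
    localWillmoreForm (Xt t ∘ c.symm) x = (slice Z t).willmoreForm x :=
  (hV.legendrian t ht).localWillmoreForm_eq hc (hZ.frame t).toIsAdaptedFrame hx hxc

theorem contDiffOn_localWillmoreForm (hV : IsLegendrianVariation X K ε Xt)
    (hc : c ∈ atlas Plane M) :
    ContDiffOn ℝ ∞ (fun y : ℝ × Plane => localWillmoreForm (Xt y.1 ∘ c.symm) y.2)
      (Set.Ioo (-ε) ε ×ˢ c.target) := by
  rintro ⟨t, x⟩ ⟨ht, hx⟩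
  obtain ⟨O, Z, hmem, hsub, hZ⟩ := hV.exists_isFrameFamily hc ht hx
  refine (ContDiffAt.congr_of_eventuallyEq
    (hZ.contDiffOn_willmoreForm.contDiffAt (hZ.isOpen.mem_nhds hmem)) ?_).contDiffWithinAt
  filter_upwards [hZ.isOpen.mem_nhds hmem] with y hy
  exact hV.localWillmoreForm_eq hc hZ (hsub hy).1 hy (hsub hy).2

theorem contDiffOn_familyBoundary (hV : IsLegendrianVariation X K ε Xt)
    (hc : c ∈ atlas Plane M) :
    ContDiffOn ℝ ∞ (familyBoundary (fun t => Xt t ∘ c.symm)) c.target := by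
  intro x hx
  obtain ⟨O, Z, hmem, hsub, hZ⟩ := hV.exists_isFrameFamily hc hV.zero_mem hx
  exact (ContDiffAt.congr_of_eventuallyEq
    ((hZ.contDiffOn_boundaryForm 0).contDiffAt ((hZ.frame 0).isOpen.mem_nhds hmem))
    (hZ.familyBoundary_eventuallyEq hmem)).contDiffWithinAt

theorem familyResidue_eq (hV : IsLegendrianVariation X K ε Xt) (hc : c ∈ atlas Plane M)
    (hZ : IsFrameFamily (fun t => Xt t ∘ c.symm) O Z) {x : Plane}
    (hx : ((0 : ℝ), x) ∈ O) (hxc : x ∈ c.target) :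
    familyResidue (fun t => Xt t ∘ c.symm) x = (hamiltonian Z 0 x).re * ((slice Z 0).r x).re *
      (wedge ((slice Z 0).mc 1 0 x) ((slice Z 0).mc 2 0 x)).re := by
  refine hZ.familyResidue_eq hx ?_
  have hcont : ContinuousAt (fun t : ℝ => (t, x)) 0 := by fun_prop
  filter_upwards [isOpen_Ioo.mem_nhds hV.zero_mem,
    hcont.preimage_mem_nhds (hZ.isOpen.mem_nhds hx)] with t ht hy
  exact hV.localWillmoreForm_eq hc hZ ht hy hxc

/-- Off the closed set K the surfaces do not move, so one frame at time zero serves for all times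
and Λ = 0. The boundary form and the time derivative of the Willmore form therefore vanish there. -/
theorem exists_constFamily (hV : IsLegendrianVariation X K ε Xt) (hK : IsClosed K)
    (hc : c ∈ atlas Plane M) {x : Plane} (hx : x ∈ c.target) (hxK : c.symm x ∉ K) :
    ∃ (V : Set Plane) (Z : FrameField), x ∈ V ∧ V ⊆ c.target ∧ IsLegFrame (X ∘ c.symm) V Z ∧
      IsFrameFamily (fun t => Xt t ∘ c.symm) (Set.Ioo (-ε) ε ×ˢ V) (constFamily Z) := by
  obtain ⟨O, Z, hmem, hsub, hZ⟩ := hV.exists_isFrameFamily hc hV.zero_mem hx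
  set W := c.target ∩ c.symm ⁻¹' Kᶜ with hW
  have hWo : IsOpen W := c.continuousOn_symm.isOpen_inter_preimage c.open_target hK.isOpen_compl
  have F0 := hZ.frame 0
  rw [hV.zero] at F0
  have hVo : IsOpen ({x | ((0 : ℝ), x) ∈ O} ∩ W) := F0.isOpen.inter hWo
  have F : IsLegFrame (X ∘ c.symm) ({x | ((0 : ℝ), x) ∈ O} ∩ W) (slice Z 0) :=
    ⟨F0.toIsAdaptedFrame.mono hVo Set.inter_subset_left, fun x hx => F0.leg x hx.1⟩
  refine ⟨{x | ((0 : ℝ), x) ∈ O} ∩ W, slice Z 0, ⟨hmem, hx, hxK⟩, fun y hy => hy.2.1, F, ?_⟩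
  refine (F.constFamily.mono (isOpen_Ioo.prod hVo) fun y hy => hy.2).congr_base fun y hy => ?_
  exact (hV.support y.1 hy.1 _ hy.2.2.2).symm

theorem familyBoundary_eq_zero (hV : IsLegendrianVariation X K ε Xt) (hK : IsClosed K)
    (hc : c ∈ atlas Plane M) {x : Plane} (hx : x ∈ c.target) (hxK : c.symm x ∉ K) :
    familyBoundary (fun t => Xt t ∘ c.symm) x = 0 := by
  obtain ⟨V, Z, hxV, -, F, hF⟩ := hV.exists_constFamily hK hc hx hxK
  rw [hF.familyBoundary_eq ⟨hV.zero_mem, hxV⟩, boundaryForm_constFamily Z F hxV]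

theorem deriv_localWillmoreForm_eq_zero (hV : IsLegendrianVariation X K ε Xt) (hK : IsClosed K)
    (hc : c ∈ atlas Plane M) {x : Plane} (hx : x ∈ c.target) (hxK : c.symm x ∉ K) :
    deriv (fun t => localWillmoreForm (Xt t ∘ c.symm) x) 0 = 0 := by
  obtain ⟨V, Z, hxV, -, F, hF⟩ := hV.exists_constFamily hK hc hx hxK
  have : (fun t => localWillmoreForm (Xt t ∘ c.symm) x) =ᶠ[nhds 0] fun _ => Z.willmoreForm x := by
    filter_upwards [isOpen_Ioo.mem_nhds hV.zero_mem] with t ht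
      using hV.localWillmoreForm_eq hc hF ht ⟨ht, hxV⟩ hx
  rw [this.deriv_eq, deriv_const]

theorem extD_familyBoundary_eq_zero (hV : IsLegendrianVariation X K ε Xt) (hK : IsClosed K)
    (hc : c ∈ atlas Plane M) {x : Plane} (hx : x ∈ c.target) (hxK : c.symm x ∉ K) :
    extD (familyBoundary fun t => Xt t ∘ c.symm) x = 0 := by
  have hW : IsOpen (c.target ∩ c.symm ⁻¹' Kᶜ) :=
    c.continuousOn_symm.isOpen_inter_preimage c.open_target hK.isOpen_compl
  have h : familyBoundary (fun t => Xt t ∘ c.symm) =ᶠ[nhds x] fun _ => 0 := by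
    filter_upwards [hW.mem_nhds ⟨hx, hxK⟩] with y hy
      using hV.familyBoundary_eq_zero hK hc hy.1 hy.2
  rw [extD_congr h]; simp [extD]

/-- Pulling back frames by the coordinate change, orientation preserving by hypothesis, shows that
the local boundary forms fit together to a one-form on M. -/
theorem familyBoundary_transition (hM : IsOrientedAtlas M) (hV : IsLegendrianVariation X K ε Xt)
    (hc : c ∈ atlas Plane M) {c' : OpenPartialHomeomorph M Plane} (hc' : c' ∈ atlas Plane M)
    {x : Plane} (hx : x ∈ (c.symm.trans c').source) :
    familyBoundary (fun t => Xt t ∘ c.symm) x =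
      (familyBoundary (fun t => Xt t ∘ c'.symm) (c.symm.trans c' x)).comp
        (fderiv ℝ (c.symm.trans c') x) := by
  have hx' : c.symm.trans c' x ∈ c'.target := c'.map_source hx.2
  obtain ⟨O, Z, hmem, hsub, hZ⟩ := hV.exists_isFrameFamily hc' hV.zero_mem hx'
  have hT := (c.symm.trans c').open_source
  have hτ := contDiffOn_transition hc hc'
  have hp := (hZ.pullback_frame hT hτ (hM c hc c' hc')).congr_base
    (Y' := fun t => Xt t ∘ c.symm) fun y hy => by
      simp only [Function.comp_apply, OpenPartialHomeomorph.coe_trans, 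
        c'.left_inv (show c.symm y.2 ∈ c'.source from hy.1.2)]
  rw [hp.familyBoundary_eq ⟨hx, hmem⟩, hZ.familyBoundary_eq hmem,
    hZ.boundaryForm_pullback hT hτ (hM c hc c' hc') ⟨hx, hmem⟩]

theorem continuousOn_deriv_localWillmoreForm (hV : IsLegendrianVariation X K ε Xt)
    (hc : c ∈ atlas Plane M) :
    ContinuousOn (fun x => deriv (fun t => localWillmoreForm (Xt t ∘ c.symm) x) 0) c.target := by
  have hO : IsOpen (Set.Ioo (-ε) ε ×ˢ c.target) := isOpen_Ioo.prod c.open_target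
  have hG := hV.contDiffOn_localWillmoreForm hc
  have h : ContinuousOn (fun x : Plane => fderiv ℝ
      (fun y : ℝ × Plane => localWillmoreForm (Xt y.1 ∘ c.symm) y.2) (0, x) (1, 0)) c.target :=
    (ContDiffOn.continuousOn (n := ∞) ((hG.fderiv_of_isOpen hO (by simp)).clm_apply
      contDiffOn_const)).comp (by fun_prop) fun x hx => ⟨hV.zero_mem, hx⟩
  refine h.congr fun x hx => ?_
  have hd := (hG.contDiffAt (hO.mem_nhds (x := ((0 : ℝ), x)) ⟨hV.zero_mem, hx⟩)).differentiableAt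
    (by simp)
  exact (HasFDerivAt.comp_hasDerivAt (f := fun t : ℝ => (t, x)) 0 hd.hasFDerivAt
    ((hasDerivAt_id 0).prodMk (hasDerivAt_const 0 x))).deriv

theorem continuousOn_familyResidue (hV : IsLegendrianVariation X K ε Xt)
    (hc : c ∈ atlas Plane M) :
    ContinuousOn (familyResidue fun t => Xt t ∘ c.symm) c.target := by
  have h := (ContDiffOn.extD (hV.contDiffOn_familyBoundary hc) c.open_target).continuousOn
  exact ((continuousOn_const.mul (Complex.continuous_re.comp_continuousOn
    (continuousOn_const.mul h))).sub (hV.continuousOn_deriv_localWillmoreForm hc)).div_const _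

theorem familyResidue_eq_zero (hV : IsLegendrianVariation X K ε Xt) (hK : IsClosed K)
    (hc : c ∈ atlas Plane M) {x : Plane} (hx : x ∈ c.target) (hxK : c.symm x ∉ K) :
    familyResidue (fun t => Xt t ∘ c.symm) x = 0 := by
  simp [familyResidue, hV.extD_familyBoundary_eq_zero hK hc hx hxK,
    hV.deriv_localWillmoreForm_eq_zero hK hc hx hxK]

end IsLegendrianVariation

end Charts

/-! ### The first variation of the Willmore energy -/

section Energy

open MeasureTheory

theorem isCompact_chart_preimage {M : Type*} [TopologicalSpace M]
    (c : OpenPartialHomeomorph M Plane)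
    {K S : Set M} (hK : IsCompact K) (hS : IsClosed S) (hSc : S ⊆ c.source) :
    IsCompact (c.target ∩ c.symm ⁻¹' (K ∩ S)) := by
  have h : c.target ∩ c.symm ⁻¹' (K ∩ S) = c '' (K ∩ S) := by
    ext x
    constructor
    · rintro ⟨hx, hm⟩
      exact ⟨c.symm x, hm, c.right_inv hx⟩
    · rintro ⟨m, hm, rfl⟩
      refine ⟨c.map_source (hSc hm.2), ?_⟩
      rw [Set.mem_preimage, c.left_inv (hSc hm.2)]
      exact hm
  rw [h]
  exact (hK.inter_right hS).image_of_continuousOn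
    (c.continuousOn.mono (Set.inter_subset_right.trans hSc))

variable {M : Type*} [TopologicalSpace M] [ChartedSpace Plane M] [IsManifold (𝓡 2) ∞ M]
  [T2Space M] [SigmaCompactSpace M]

theorem tsupport_chartPartition_subset (i : M) :
    tsupport (chartPartition M i) ⊆ (chartAt Plane i).source :=
  (SmoothPartitionOfUnity.exists_isSubordinate_chartAt_source (𝓡 2) M).choose_spec i

theorem finite_chartPartition {K : Set M} (hK : IsCompact K) :
    {i : M | (Function.support (chartPartition M i) ∩ K).Nonempty}.Finite :=
  (chartPartition M).locallyFinite.finite_nonempty_inter_compact hK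

/-- The indices of the members of the partition of unity which do not vanish on `K`. -/
def chartIndices {K : Set M} (hK : IsCompact K) : Finset M := (finite_chartPartition hK).toFinset

theorem chartPartition_eq_zero {K : Set M} (hK : IsCompact K) {i m : M} (hi : i ∉ chartIndices hK)
    (hm : m ∈ K) : chartPartition M i m = 0 := by
  by_contra h
  exact hi ((finite_chartPartition hK).mem_toFinset.2 ⟨m, h, hm⟩)

theorem sum_chartPartition {K : Set M} (hK : IsCompact K) {m : M} (hm : m ∈ K) :
    ∑ i ∈ chartIndices hK, chartPartition M i m = 1 := by
  rw [← (chartPartition M).sum_eq_one (Set.mem_univ m)]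
  refine (finsum_eq_sum_of_support_subset _ fun i hi => ?_).symm
  by_contra h
  exact hi (chartPartition_eq_zero hK h hm)

/-- A member of the partition of unity in a chart. -/
def chartCutoff (c : OpenPartialHomeomorph M Plane) (i : M) (x : Plane) : ℂ :=
  (chartPartition M i (c.symm x) : ℂ)

/-- The compact set in the chart at `i` which contributes to an integral over `K`. -/
def cutoffSet (K : Set M) (i : M) : Set Plane :=
  (chartAt Plane i).target ∩ (chartAt Plane i).symm ⁻¹' (K ∩ tsupport (chartPartition M i))

theorem isCompact_cutoffSet {K : Set M} (hK : IsCompact K) (i : M) : IsCompact (cutoffSet K i) :=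
  isCompact_chart_preimage _ hK (isClosed_tsupport _) (tsupport_chartPartition_subset i)

theorem cutoffSet_subset (K : Set M) (i : M) : cutoffSet K i ⊆ (chartAt Plane i).target :=
  Set.inter_subset_left

theorem chartPartition_eq_zero_or {K : Set M} {i : M} {x : Plane}
    (hx : x ∈ (chartAt Plane i).target \ cutoffSet K i) :
    (chartAt Plane i).symm x ∉ K ∨
      (chartAt Plane i).symm x ∉ tsupport (chartPartition M i) := by
  by_contra h
  push Not at h
  exact hx.2 ⟨hx.1, h⟩

variable {c : OpenPartialHomeomorph M Plane}

theorem contDiffOn_chartPartition (hc : c ∈ atlas Plane M) (i : M) :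
    ContDiffOn ℝ ∞ (fun x => chartPartition M i (c.symm x)) c.target :=
  contMDiffOn_iff_contDiffOn.1
    ((chartPartition M i).contMDiff.contMDiffOn.comp (t := Set.univ) (contMDiffOn_chart_symm hc)
      fun _ _ => Set.mem_univ _)

theorem contDiffOn_chartCutoff (hc : c ∈ atlas Plane M) (i : M) :
    ContDiffOn ℝ ∞ (chartCutoff c i) c.target :=
  (contDiffOn_chartPartition hc i).ofReal_complex

theorem differentiableAt_chartCutoff (hc : c ∈ atlas Plane M) (i : M) {x : Plane}
    (hx : x ∈ c.target) : DifferentiableAt ℝ (chartCutoff c i) x :=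
  (contDiffOn_chartCutoff hc i).differentiableAt_top c.open_target hx

theorem chartCutoff_eventuallyEq_zero {i : M} {x : Plane} (hx : x ∈ c.target)
    (h : c.symm x ∉ tsupport (chartPartition M i)) : chartCutoff c i =ᶠ[nhds x] fun _ => 0 := by
  have h' : IsOpen (c.target ∩ c.symm ⁻¹' (tsupport (chartPartition M i))ᶜ) :=
    c.continuousOn_symm.isOpen_inter_preimage c.open_target (isClosed_tsupport _).isOpen_compl
  filter_upwards [h'.mem_nhds ⟨hx, h⟩] with y hy
  simp only [chartCutoff, image_eq_zero_of_notMem_tsupport hy.2, Complex.ofReal_zero]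

theorem chartCutoff_eq_zero {i : M} {x : Plane}
    (h : c.symm x ∉ tsupport (chartPartition M i)) : chartCutoff c i x = 0 := by
  simp only [chartCutoff, image_eq_zero_of_notMem_tsupport h, Complex.ofReal_zero]

theorem fderiv_chartCutoff_eq_zero {i : M} {x : Plane} (hx : x ∈ c.target)
    (h : c.symm x ∉ tsupport (chartPartition M i)) : fderiv ℝ (chartCutoff c i) x = 0 := by
  rw [(chartCutoff_eventuallyEq_zero hx h).fderiv_eq]; simp

/-- Only finitely many cutoffs meet K, and each integral lives on a compact set in its chart; this
makes differentiation under the integral legitimate. -/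
theorem willmoreEnergy_eq {K : Set M} (hK : IsCompact K) (Y : M → PCSphere) :
    willmoreEnergy K Y = ∑ i ∈ chartIndices hK, ∫ x in cutoffSet K i,
      chartPartition M i ((chartAt Plane i).symm x) *
        localWillmoreForm (Y ∘ (chartAt Plane i).symm) x := by
  rw [willmoreEnergy, finsum_eq_sum_of_support_subset (s := chartIndices hK)]
  · refine Finset.sum_congr rfl fun i _ => ?_
    have hO : IsOpen ((chartAt Plane i).target ∩ (chartAt Plane i).symm ⁻¹' Kᶜ) :=
      (chartAt Plane i).continuousOn_symm.isOpen_inter_preimage (chartAt Plane i).open_target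
        hK.isClosed.isOpen_compl
    have hm : MeasurableSet ((chartAt Plane i).target ∩ (chartAt Plane i).symm ⁻¹' K) := by
      have : (chartAt Plane i).target ∩ (chartAt Plane i).symm ⁻¹' K =
          (chartAt Plane i).target \ ((chartAt Plane i).target ∩
            (chartAt Plane i).symm ⁻¹' Kᶜ) := by
        ext x; simp
      rw [this]
      exact (chartAt Plane i).open_target.measurableSet.diff hO.measurableSet
    refine setIntegral_eq_of_subset_of_forall_sdiff_eq_zero hm
      (fun x hx => ⟨hx.1, hx.2.1⟩) fun x hx => ?_
    rw [image_eq_zero_of_notMem_tsupport fun h => hx.2 ⟨hx.1.1, hx.1.2, h⟩, zero_mul]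
  · intro i hi
    by_contra h
    refine hi (setIntegral_eq_zero_of_forall_eq_zero fun x hx => ?_)
    rw [chartPartition_eq_zero hK h hx.2, zero_mul]

/-! ### Differentiation under the integral and Stokes' theorem -/

namespace IsLegendrianVariation

variable {X : M → PCSphere} {K : Set M} {ε : ℝ} {Xt : ℝ → M → PCSphere}

/-- After differentiation the compact domain can be enlarged to the whole chart target: off K the
time derivative vanishes, and elsewhere outside the compact set the cutoff does. -/
theorem hasDerivAt_willmoreEnergy_deriv (hV : IsLegendrianVariation X K ε Xt) (hK : IsCompact K) :
    HasDerivAt (fun t => willmoreEnergy K (Xt t))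
      (∑ i ∈ chartIndices hK, ∫ x in (chartAt Plane i).target,
        chartPartition M i ((chartAt Plane i).symm x) *
          deriv (fun t => localWillmoreForm (Xt t ∘ (chartAt Plane i).symm) x) 0) 0 := by
  simp only [willmoreEnergy_eq hK]
  refine HasDerivAt.fun_sum fun i _ => ?_
  have hc := chart_mem_atlas Plane i
  have hG : ContDiffOn ℝ ∞ (fun y : ℝ × Plane => chartPartition M i ((chartAt Plane i).symm y.2) *
      localWillmoreForm (Xt y.1 ∘ (chartAt Plane i).symm) y.2)
      (Set.Ioo (-ε) ε ×ˢ (chartAt Plane i).target) :=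
    ((contDiffOn_chartPartition hc i).comp contDiffOn_snd fun y hy => hy.2).mul
      (hV.contDiffOn_localWillmoreForm hc)
  have key := hasDerivAt_setIntegral hG (chartAt Plane i).open_target (isCompact_cutoffSet hK i)
    (cutoffSet_subset K i) hV.zero_mem
  simp only [deriv_const_mul_field] at key
  rwa [← setIntegral_eq_of_subset_of_forall_sdiff_eq_zero
    (chartAt Plane i).open_target.measurableSet (cutoffSet_subset K i)] at key
  intro x hx
  rcases chartPartition_eq_zero_or hx with h | h
  · rw [hV.deriv_localWillmoreForm_eq_zero hK.isClosed hc hx.1 h, mul_zero]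
  · rw [image_eq_zero_of_notMem_tsupport h, zero_mul]

theorem sum_wedge_fderiv_chartCutoff (hV : IsLegendrianVariation X K ε Xt) (hK : IsCompact K)
    (hc : c ∈ atlas Plane M) {x : Plane} (hx : x ∈ c.target) :
    ∑ i ∈ chartIndices hK, wedge (fderiv ℝ (chartCutoff c i) x)
      (familyBoundary (fun t => Xt t ∘ c.symm) x) = 0 := by
  -- The selected cutoffs sum to 1 only on K. A point approached from outside K has Ξ = 0 by
  -- continuity; near any other point the sum is constantly 1 and its derivative vanishes.
  by_cases h : ∃ᶠ y in nhds x, c.symm y ∉ K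
  · have : familyBoundary (fun t => Xt t ∘ c.symm) x = 0 := by
      by_contra h0
      have hcont := ((hV.contDiffOn_familyBoundary hc).continuousOn.continuousAt
        (c.open_target.mem_nhds hx)).eventually_ne h0
      obtain ⟨y, h1, h2, h3⟩ :=
        (h.and_eventually (hcont.and (c.open_target.mem_nhds hx))).exists
      exact h2 (hV.familyBoundary_eq_zero hK.isClosed hc h3 h1)
    simp [this, wedge]
  · have hev : (fun y => ∑ i ∈ chartIndices hK, chartCutoff c i y) =ᶠ[nhds x] fun _ => 1 := by
      filter_upwards [Filter.not_frequently.1 h] with y hy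
      simp only [chartCutoff, ← Complex.ofReal_sum, sum_chartPartition hK (not_not.1 hy),
        Complex.ofReal_one]
    have hs := hev.fderiv_eq (𝕜 := ℝ)
    rw [fderiv_fun_sum fun i _ => differentiableAt_chartCutoff hc i hx, fderiv_fun_const] at hs
    have hv : ∀ v, ∑ i ∈ chartIndices hK, fderiv ℝ (chartCutoff c i) x v = 0 := fun v => by
      have := DFunLike.congr_fun hs v
      simpa using this
    simp only [wedge, Finset.sum_sub_distrib, ← Finset.sum_mul, hv, zero_mul, sub_zero]

/-- The integrand which is compared between charts. -/
def transitionDensity (Xt : ℝ → M → PCSphere) (c : OpenPartialHomeomorph M Plane) (i j : M)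
    (x : Plane) : ℂ :=
  chartCutoff c j x * wedge (fderiv ℝ (chartCutoff c i) x)
    (familyBoundary (fun t => Xt t ∘ c.symm) x)

theorem continuousOn_transitionDensity (hV : IsLegendrianVariation X K ε Xt)
    (hc : c ∈ atlas Plane M) (i j : M) : ContinuousOn (transitionDensity Xt c i j) c.target :=
  ((contDiffOn_chartCutoff hc j).mul
    (((contDiffOn_chartCutoff hc i).fderiv_of_isOpen c.open_target (m := ∞) (by simp)).wedge
      (hV.contDiffOn_familyBoundary hc))).continuousOn

theorem integrableOn_transitionDensity_left (hV : IsLegendrianVariation X K ε Xt)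
    (hK : IsCompact K) (i j : M) :
    IntegrableOn (transitionDensity Xt (chartAt Plane i) i j) (chartAt Plane i).target := by
  refine integrableOn_of_eq_zero_diff (hV.continuousOn_transitionDensity (chart_mem_atlas _ i) i j)
    (chartAt Plane i).open_target (isCompact_cutoffSet hK i) (cutoffSet_subset K i) fun x hx => ?_
  rcases chartPartition_eq_zero_or hx with h | h
  · simp [transitionDensity,
      hV.familyBoundary_eq_zero hK.isClosed (chart_mem_atlas _ i) hx.1 h, wedge]
  · simp [transitionDensity, fderiv_chartCutoff_eq_zero hx.1 h, wedge]

theorem integrableOn_transitionDensity_right (hV : IsLegendrianVariation X K ε Xt)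
    (hK : IsCompact K) (i j : M) :
    IntegrableOn (transitionDensity Xt (chartAt Plane j) i j) (chartAt Plane j).target := by
  refine integrableOn_of_eq_zero_diff (hV.continuousOn_transitionDensity (chart_mem_atlas _ j) i j)
    (chartAt Plane j).open_target (isCompact_cutoffSet hK j) (cutoffSet_subset K j) fun x hx => ?_
  rcases chartPartition_eq_zero_or hx with h | h
  · simp [transitionDensity,
      hV.familyBoundary_eq_zero hK.isClosed (chart_mem_atlas _ j) hx.1 h, wedge]
  · simp [transitionDensity, chartCutoff_eq_zero h]

theorem transitionDensity_transition (hM : IsOrientedAtlas M)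
    (hV : IsLegendrianVariation X K ε Xt) (hc : c ∈ atlas Plane M)
    {c' : OpenPartialHomeomorph M Plane} (hc' : c' ∈ atlas Plane M) (i j : M) {x : Plane}
    (hx : x ∈ (c.symm.trans c').source) :
    transitionDensity Xt c i j x = |(fderiv ℝ (c.symm.trans c') x).det| •
      transitionDensity Xt c' i j (c.symm.trans c' x) := by
  have hcut : ∀ i : M, ∀ y ∈ (c.symm.trans c').source,
      chartCutoff c i y = chartCutoff c' i (c.symm.trans c' y) := fun i y hy => by
    simp only [chartCutoff, OpenPartialHomeomorph.coe_trans, Function.comp_apply,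
      c'.left_inv (show c.symm y ∈ c'.source from hy.2)]
  have hx' : c.symm.trans c' x ∈ c'.target := c'.map_source hx.2
  have hev : chartCutoff c i =ᶠ[nhds x] chartCutoff c' i ∘ (c.symm.trans c') := by
    filter_upwards [(c.symm.trans c').open_source.mem_nhds hx] with y hy using hcut i y hy
  have hd : fderiv ℝ (chartCutoff c i) x =
      (fderiv ℝ (chartCutoff c' i) (c.symm.trans c' x)).comp (fderiv ℝ (c.symm.trans c') x) := by
    rw [hev.fderiv_eq]
    exact fderiv_comp x (differentiableAt_chartCutoff hc' i hx')
      ((contDiffOn_transition hc hc').differentiableAt_top (c.symm.trans c').open_source hx)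
  rw [transitionDensity, transitionDensity, hd, hV.familyBoundary_transition hM hc hc' hx,
    wedge_comp, abs_of_pos (hM c hc c' hc' x hx), hcut j x hx, Complex.real_smul]
  ring

/-- The density ρⱼ dρᵢ∧Ξ is supported in the overlap of the two charts. There it transforms with the
Jacobian, which is positive and so agrees with the absolute value in the change of variables. -/
theorem integral_transitionDensity (hM : IsOrientedAtlas M)
    (hV : IsLegendrianVariation X K ε Xt) (i j : M) :
    ∫ x in (chartAt Plane i).target, transitionDensity Xt (chartAt Plane i) i j x =
      ∫ x in (chartAt Plane j).target, transitionDensity Xt (chartAt Plane j) i j x := by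
  have hi := chart_mem_atlas Plane i
  have hj := chart_mem_atlas Plane j
  set τ := (chartAt Plane i).symm.trans (chartAt Plane j) with hτ
  have h1 : ∫ x in τ.target, transitionDensity Xt (chartAt Plane j) i j x =
      ∫ x in τ.source, transitionDensity Xt (chartAt Plane i) i j x := by
    rw [integral_target_eq_integral_abs_det_fderiv_smul volume (f := τ)
      (f' := fun x => fderiv ℝ τ x) fun x hx =>
        ((contDiffOn_transition hi hj).differentiableAt_top τ.open_source hx).hasFDerivAt]
    exact setIntegral_congr_fun τ.open_source.measurableSet fun x hx =>
      (hV.transitionDensity_transition hM hi hj i j hx).symm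
  have h2 : ∫ x in (chartAt Plane i).target, transitionDensity Xt (chartAt Plane i) i j x =
      ∫ x in τ.source, transitionDensity Xt (chartAt Plane i) i j x := by
    refine setIntegral_eq_of_subset_of_forall_sdiff_eq_zero
      (chartAt Plane i).open_target.measurableSet (fun x hx => hx.1) fun x hx => ?_
    have : (chartAt Plane i).symm x ∉ tsupport (chartPartition M j) := fun h =>
      hx.2 ⟨hx.1, tsupport_chartPartition_subset j h⟩
    simp [transitionDensity, chartCutoff_eq_zero this]
  have h3 : ∫ x in (chartAt Plane j).target, transitionDensity Xt (chartAt Plane j) i j x =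
      ∫ x in τ.target, transitionDensity Xt (chartAt Plane j) i j x := by
    refine setIntegral_eq_of_subset_of_forall_sdiff_eq_zero
      (chartAt Plane j).open_target.measurableSet (fun x hx => hx.1) fun x hx => ?_
    have : (chartAt Plane j).symm x ∉ tsupport (chartPartition M i) := fun h =>
      hx.2 ⟨hx.1, tsupport_chartPartition_subset i h⟩
    simp [transitionDensity, fderiv_chartCutoff_eq_zero hx.1 this, wedge]
  rw [h2, h3, h1]

theorem integrableOn_chartCutoff_mul_extD (hV : IsLegendrianVariation X K ε Xt) (hK : IsCompact K)
    (i : M) :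
    IntegrableOn (fun x => chartCutoff (chartAt Plane i) i x *
        extD (familyBoundary fun t => Xt t ∘ (chartAt Plane i).symm) x)
      (chartAt Plane i).target := by
  have hc := chart_mem_atlas Plane i
  refine integrableOn_of_eq_zero_diff (ContDiffOn.continuousOn (n := ∞)
    ((contDiffOn_chartCutoff hc i).mul (ContDiffOn.extD (hV.contDiffOn_familyBoundary hc)
      (chartAt Plane i).open_target))) (chartAt Plane i).open_target
    (isCompact_cutoffSet hK i) (cutoffSet_subset K i) fun x hx => ?_
  rcases chartPartition_eq_zero_or hx with h | h
  · rw [hV.extD_familyBoundary_eq_zero hK.isClosed hc hx.1 h, mul_zero]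
  · rw [chartCutoff_eq_zero h, zero_mul]

theorem integrableOn_chartPartition_mul_familyResidue (hV : IsLegendrianVariation X K ε Xt)
    (hK : IsCompact K) (i : M) :
    IntegrableOn (fun x => chartPartition M i ((chartAt Plane i).symm x) *
        familyResidue (fun t => Xt t ∘ (chartAt Plane i).symm) x) (chartAt Plane i).target := by
  have hc := chart_mem_atlas Plane i
  refine integrableOn_of_eq_zero_diff ((contDiffOn_chartPartition hc i).continuousOn.mul
    (hV.continuousOn_familyResidue hc)) (chartAt Plane i).open_target
    (isCompact_cutoffSet hK i) (cutoffSet_subset K i) fun x hx => ?_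
  rcases chartPartition_eq_zero_or hx with h | h
  · rw [hV.familyResidue_eq_zero hK.isClosed hc hx.1 h, mul_zero]
  · rw [image_eq_zero_of_notMem_tsupport h, zero_mul]

/-- Integrating d(ρᵢΞ) = dρᵢ∧Ξ + ρᵢ dΞ to zero and inserting Σⱼρⱼ = 1 where Ξ does not vanish. -/
theorem integral_chartCutoff_mul_extD (hV : IsLegendrianVariation X K ε Xt) (hK : IsCompact K)
    (i : M) :
    ∫ x in (chartAt Plane i).target, chartCutoff (chartAt Plane i) i x *
        extD (familyBoundary fun t => Xt t ∘ (chartAt Plane i).symm) x =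
      -∑ j ∈ chartIndices hK, ∫ x in (chartAt Plane i).target,
        transitionDensity Xt (chartAt Plane i) i j x := by
  have hc := chart_mem_atlas Plane i
  set c := chartAt Plane i with hcdef
  set Ξ := familyBoundary fun t => Xt t ∘ c.symm with hΞ
  have hΞs := hV.contDiffOn_familyBoundary hc
  have h0 := integral_extD_eq_zero ((contDiffOn_chartCutoff hc i).fun_smul hΞs) c.open_target
    (isCompact_cutoffSet hK i) (cutoffSet_subset K i) (fun x hx => by
      rcases chartPartition_eq_zero_or hx with h | h
      · rw [hV.familyBoundary_eq_zero hK.isClosed hc hx.1 h, smul_zero]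
      · rw [chartCutoff_eq_zero h]; exact zero_smul ℂ (Ξ x))
  have h1 : ∀ x ∈ c.target, extD (fun y => chartCutoff c i y • Ξ y) x =
      ∑ j ∈ chartIndices hK, transitionDensity Xt c i j x + chartCutoff c i x * extD Ξ x := by
    intro x hx
    have := extD_smul (differentiableAt_chartCutoff hc i hx)
      (hΞs.differentiableAt_top c.open_target hx)
    rw [this]
    congr 1
    simp only [transitionDensity, ← Finset.sum_mul]
    by_cases h : c.symm x ∈ K
    · simp only [chartCutoff, ← Complex.ofReal_sum, sum_chartPartition hK h, Complex.ofReal_one,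
        one_mul]
    · simp [hV.familyBoundary_eq_zero hK.isClosed hc hx h, wedge]
  have hint : IntegrableOn (fun x => chartCutoff c i x * extD Ξ x) c.target :=
    hV.integrableOn_chartCutoff_mul_extD hK i
  rw [setIntegral_congr_fun c.open_target.measurableSet h1, integral_add
    (integrable_finsetSum _ fun j _ => hV.integrableOn_transitionDensity_left hK i j) hint,
    integral_finsetSum _ fun j _ => hV.integrableOn_transitionDensity_left hK i j] at h0
  linear_combination h0

/-- Stokes' theorem on M: after each term ρⱼ dρᵢ∧Ξ is moved to chart j, the sum over i can be taken
first, and Σᵢdρᵢ∧Ξ = 0. -/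
theorem sum_integral_chartCutoff_mul_extD (hM : IsOrientedAtlas M)
    (hV : IsLegendrianVariation X K ε Xt) (hK : IsCompact K) :
    ∑ i ∈ chartIndices hK, ∫ x in (chartAt Plane i).target, chartCutoff (chartAt Plane i) i x *
        extD (familyBoundary fun t => Xt t ∘ (chartAt Plane i).symm) x = 0 := by
  simp only [hV.integral_chartCutoff_mul_extD hK, Finset.sum_neg_distrib, neg_eq_zero]
  rw [Finset.sum_congr rfl fun i _ => Finset.sum_congr rfl fun j _ =>
    hV.integral_transitionDensity hM i j, Finset.sum_comm]
  refine Finset.sum_eq_zero fun j _ => ?_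
  rw [← integral_finsetSum _ fun i _ => hV.integrableOn_transitionDensity_right hK i j]
  refine setIntegral_eq_zero_of_forall_eq_zero fun x hx => ?_
  simp only [transitionDensity, ← Finset.mul_sum,
    hV.sum_wedge_fderiv_chartCutoff hK (chart_mem_atlas _ j) hx, mul_zero]

/-- The first variation formula. -/
theorem hasDerivAt_willmoreEnergy (hM : IsOrientedAtlas M)
    (hV : IsLegendrianVariation X K ε Xt) (hK : IsCompact K) :
    HasDerivAt (fun t => willmoreEnergy K (Xt t))
      (-4 * ∑ i ∈ chartIndices hK, ∫ x in (chartAt Plane i).target,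
        chartPartition M i ((chartAt Plane i).symm x) *
          familyResidue (fun t => Xt t ∘ (chartAt Plane i).symm) x) 0 := by
  convert hV.hasDerivAt_willmoreEnergy_deriv hK using 1
  -- By definition of the residue the density splits into an exact part, which sums to zero over the
  -- charts, and -4 times the residue.
  have key : ∀ i : M, ∫ x in (chartAt Plane i).target,
      chartPartition M i ((chartAt Plane i).symm x) *
        deriv (fun t => localWillmoreForm (Xt t ∘ (chartAt Plane i).symm) x) 0 =
      2 * (Complex.I * ∫ x in (chartAt Plane i).target, chartCutoff (chartAt Plane i) i x *
        extD (familyBoundary fun t => Xt t ∘ (chartAt Plane i).symm) x).re -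
      4 * ∫ x in (chartAt Plane i).target, chartPartition M i ((chartAt Plane i).symm x) *
        familyResidue (fun t => Xt t ∘ (chartAt Plane i).symm) x := by
    intro i
    have h1 := hV.integrableOn_chartCutoff_mul_extD hK i
    have h2 := hV.integrableOn_chartPartition_mul_familyResidue hK i
    have h3 : (Complex.I * ∫ x in (chartAt Plane i).target, chartCutoff (chartAt Plane i) i x *
        extD (familyBoundary fun t => Xt t ∘ (chartAt Plane i).symm) x).re =
        ∫ x in (chartAt Plane i).target, (Complex.I * (chartCutoff (chartAt Plane i) i x *
        extD (familyBoundary fun t => Xt t ∘ (chartAt Plane i).symm) x)).re := by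
      rw [← integral_const_mul]
      exact (Complex.reCLM.integral_comp_comm (h1.const_mul Complex.I)).symm
    have h4 := (Complex.reCLM.integrable_comp (h1.const_mul Complex.I)).const_mul 2
    simp only [Complex.reCLM_apply] at h4
    rw [h3, ← integral_const_mul, ← integral_const_mul, ← integral_sub h4 (h2.const_mul 4)]
    refine integral_congr_ae (Filter.Eventually.of_forall fun x => ?_)
    simp only [familyResidue, chartCutoff, mul_left_comm Complex.I, Complex.re_ofReal_mul]
    ring
  simp only [key, Finset.sum_sub_distrib, ← Finset.mul_sum, ← Complex.re_sum,
    hV.sum_integral_chartCutoff_mul_extD hM hK]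
  simp

end IsLegendrianVariation

end Energy

/-! ### Legendrian deformations in an affine chart -/

/-- The Jacobian determinant of the real parts of the coordinates `1, 2`. -/
def realJac (z : Plane → C31) (x : Plane) : ℝ :=
  (fderiv ℝ z x e₁ 1).re * (fderiv ℝ z x e₂ 2).re -
    (fderiv ℝ z x e₂ 1).re * (fderiv ℝ z x e₁ 2).re

/-- The first component of the solution `G` of `G₁ dξ₁ + G₂ dξ₂ = dw`. -/
def gradOne (z : Plane → C31) (w : Plane → ℝ) (x : Plane) : ℝ :=
  (fderiv ℝ w x e₁ * (fderiv ℝ z x e₂ 2).re - fderiv ℝ w x e₂ * (fderiv ℝ z x e₁ 2).re) /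
    realJac z x

/-- The second component of the solution `G` of `G₁ dξ₁ + G₂ dξ₂ = dw`. -/
def gradTwo (z : Plane → C31) (w : Plane → ℝ) (x : Plane) : ℝ :=
  ((fderiv ℝ z x e₁ 1).re * fderiv ℝ w x e₂ - (fderiv ℝ z x e₂ 1).re * fderiv ℝ w x e₁) /
    realJac z x

/-- The linear part of the deformation. -/
def deformLin (z : Plane → C31) (w : Plane → ℝ) (x : Plane) : C31 :=
  ![0, Complex.I * gradOne z w x, Complex.I * gradTwo z w x,
    (z x 1).re * gradOne z w x + (z x 2).re * gradTwo z w x - 2 * w x -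
      Complex.I * ((z x 1).im * gradOne z w x + (z x 2).im * gradTwo z w x)]

/-- The quadratic part of the deformation. -/
def deformQuad (z : Plane → C31) (w : Plane → ℝ) (x : Plane) : C31 :=
  ![0, 0, 0, -(Complex.I / 2) * ((gradOne z w x : ℂ) ^ 2 + (gradTwo z w x : ℂ) ^ 2)]

/-- The Legendrian deformation of `z` with the Hamiltonian `w`. -/
def deform (z : Plane → C31) (w : Plane → ℝ) (y : ℝ × Plane) : C31 :=
  z y.2 + y.1 • deformLin z w y.2 + y.1 ^ 2 • deformQuad z w y.2

/-- `z` is a smooth lift with `z⁰ = 1` of a Legendrian surface, for which the real parts of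
`z¹, z²` are local coordinates. -/
structure IsAffineLift (V : Set Plane) (z : Plane → C31) : Prop where
  isOpen : IsOpen V
  smooth : ContDiffOn ℝ ∞ z V
  one : ∀ x ∈ V, z x 0 = 1
  null : ∀ x ∈ V, herm (z x) (z x) = 0
  leg : ∀ x ∈ V, ∀ v, herm (fderiv ℝ z x v) (z x) = 0
  jac : ∀ x ∈ V, realJac z x ≠ 0

theorem deform_apply (z : Plane → C31) (w : Plane → ℝ) (y : ℝ × Plane) (k : Fin 4) :
    deform z w y k = z y.2 k + (y.1 : ℂ) * deformLin z w y.2 k +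
      (y.1 : ℂ) ^ 2 * deformQuad z w y.2 k := by
  simp only [deform, Pi.add_apply, Pi.smul_apply, Complex.real_smul]
  push_cast
  rfl

namespace IsAffineLift

variable {V : Set Plane} {z : Plane → C31} {w : Plane → ℝ}

theorem contDiffOn_coord (hz : IsAffineLift V z) (k : Fin 4) :
    ContDiffOn ℝ ∞ (fun x => z x k) V := contDiffOn_pi.1 hz.smooth k

theorem contDiffOn_fderiv (hz : IsAffineLift V z) (v : Plane) (k : Fin 4) :
    ContDiffOn ℝ ∞ (fun x => (fderiv ℝ z x v k).re) V :=
  (contDiffOn_pi.1 ((hz.smooth.fderiv_of_isOpen hz.isOpen (m := ∞) (by simp)).clm_apply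
    contDiffOn_const) k).re_complex

theorem contDiffOn_realJac (hz : IsAffineLift V z) : ContDiffOn ℝ ∞ (realJac z) V :=
  ((hz.contDiffOn_fderiv _ _).mul (hz.contDiffOn_fderiv _ _)).sub
    ((hz.contDiffOn_fderiv _ _).mul (hz.contDiffOn_fderiv _ _))

theorem contDiffOn_grad (hz : IsAffineLift V z) (hw : ContDiff ℝ ∞ w) :
    ContDiffOn ℝ ∞ (gradOne z w) V ∧ ContDiffOn ℝ ∞ (gradTwo z w) V := by
  have hd : ∀ v, ContDiffOn ℝ ∞ (fun x => fderiv ℝ w x v) V := fun v =>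
    ((hw.fderiv_right (m := ∞) (by simp)).clm_apply contDiff_const).contDiffOn
  exact ⟨(((hd _).mul (hz.contDiffOn_fderiv _ _)).sub ((hd _).mul (hz.contDiffOn_fderiv _ _))).div
      hz.contDiffOn_realJac hz.jac,
    (((hz.contDiffOn_fderiv _ _).mul (hd _)).sub ((hz.contDiffOn_fderiv _ _).mul (hd _))).div
      hz.contDiffOn_realJac hz.jac⟩

theorem contDiffOn_deformLin (hz : IsAffineLift V z) (hw : ContDiff ℝ ∞ w) :
    ContDiffOn ℝ ∞ (deformLin z w) V := by
  obtain ⟨h1, h2⟩ := hz.contDiffOn_grad hw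
  have k := hz.contDiffOn_coord
  have hr := fun i => (k i).re_complex.ofReal_complex
  have hi := fun i => (k i).im_complex.ofReal_complex
  refine contDiffOn_pi.2 fun i => ?_
  fin_cases i
  · exact contDiffOn_const
  · exact contDiffOn_const.mul h1.ofReal_complex
  · exact contDiffOn_const.mul h2.ofReal_complex
  · exact ((((hr 1).mul h1.ofReal_complex).add ((hr 2).mul h2.ofReal_complex)).sub
      (contDiffOn_const.mul hw.contDiffOn.ofReal_complex)).sub
      (contDiffOn_const.mul (((hi 1).mul h1.ofReal_complex).add ((hi 2).mul h2.ofReal_complex)))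

theorem contDiffOn_deformQuad (hz : IsAffineLift V z) (hw : ContDiff ℝ ∞ w) :
    ContDiffOn ℝ ∞ (deformQuad z w) V := by
  obtain ⟨h1, h2⟩ := hz.contDiffOn_grad hw
  refine contDiffOn_pi.2 fun i => ?_
  fin_cases i
  · exact contDiffOn_const
  · exact contDiffOn_const
  · exact contDiffOn_const
  · exact contDiffOn_const.mul ((h1.ofReal_complex.pow 2).add (h2.ofReal_complex.pow 2))

theorem contDiffOn_deform (hz : IsAffineLift V z) (hw : ContDiff ℝ ∞ w) :
    ContDiffOn ℝ ∞ (deform z w) (Set.univ ×ˢ V) := by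
  have hs : ∀ {f : Plane → C31}, ContDiffOn ℝ ∞ f V →
      ContDiffOn ℝ ∞ (fun y : ℝ × Plane => f y.2) (Set.univ ×ˢ V) := fun hf =>
    hf.comp contDiffOn_snd fun y hy => hy.2
  exact ((hs hz.smooth).add (contDiffOn_fst.smul (hs (hz.contDiffOn_deformLin hw)))).add
    ((contDiffOn_fst.pow 2).smul (hs (hz.contDiffOn_deformQuad hw)))

/-- Cramer's rule in the coordinates ξ = Re(z¹, z²), so G is the gradient of w there. With y =
Im(z¹, z²), the Legendre condition reads du = 2y·dξ for u = ξ·y - Re z³. The deformation replaces y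
by y + tG and u by u + 2tw, which preserves this relation. -/
theorem grad_mul_fderiv (hz : IsAffineLift V z) {x : Plane} (hx : x ∈ V) (v : Plane) :
    gradOne z w x * (fderiv ℝ z x v 1).re + gradTwo z w x * (fderiv ℝ z x v 2).re =
      fderiv ℝ w x v := by
  have hj := hz.jac x hx
  rw [plane_eq v]
  simp only [map_add, map_smul, Pi.add_apply, Pi.smul_apply, Complex.add_re, Complex.smul_re,
    smul_eq_mul, gradOne, gradTwo]
  field_simp
  rw [realJac]
  ring

theorem null_eq (hz : IsAffineLift V z) {x : Plane} (hx : x ∈ V) :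
    2 * (z x 3).im = -((z x 1).re ^ 2 + (z x 1).im ^ 2 + (z x 2).re ^ 2 + (z x 2).im ^ 2) := by
  have h := congrArg Complex.re (hz.null x hx)
  simp [herm, hz.one x hx] at h
  linarith

theorem deform_zero_apply (hz : IsAffineLift V z) {y : ℝ × Plane} (hy : y.2 ∈ V) :
    deform z w y 0 = 1 := by
  rw [deform_apply, hz.one y.2 hy]
  simp [deformLin, deformQuad]

/-- The null condition fixes Im z³ as -(|z¹|² + |z²|²)/2. Shifting the imaginary parts by tG changes
this by a linear and a quadratic term in t, the latter being `deformQuad`. -/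
theorem herm_deform (hz : IsAffineLift V z) {y : ℝ × Plane} (hy : y.2 ∈ V) :
    herm (deform z w y) (deform z w y) = 0 := by
  have h := hz.null_eq hy
  have h1 := hz.one y.2 hy
  apply Complex.ext
  · simp [herm, deform_apply, deformLin, deformQuad, h1, pow_two]
    linear_combination h
  · simp [herm, deform_apply, deformLin, deformQuad, h1, pow_two]
    ring

theorem fderiv_deform (hz : IsAffineLift V z) (hw : ContDiff ℝ ∞ w) {y : ℝ × Plane} (hy : y.2 ∈ V)
    (u : ℝ × Plane) :
    fderiv ℝ (deform z w) y u = fderiv ℝ z y.2 u.2 + y.1 • fderiv ℝ (deformLin z w) y.2 u.2 +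
      y.1 ^ 2 • fderiv ℝ (deformQuad z w) y.2 u.2 +
      u.1 • (deformLin z w y.2 + (2 * y.1) • deformQuad z w y.2) := by
  have hs : ∀ {f : Plane → C31}, ContDiffOn ℝ ∞ f V → HasFDerivAt (fun y : ℝ × Plane => f y.2)
      ((fderiv ℝ f y.2).comp (ContinuousLinearMap.snd ℝ ℝ Plane)) y := fun hf =>
    HasFDerivAt.comp y (g := _) (hf.differentiableAt_top hz.isOpen hy).hasFDerivAt hasFDerivAt_snd
  have h := ((hs hz.smooth).fun_add (hasFDerivAt_fst.fun_smul
    (hs (hz.contDiffOn_deformLin hw)))).fun_add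
    ((hasFDerivAt_fst.pow 2).fun_smul (hs (hz.contDiffOn_deformQuad hw)))
  have e : fderiv ℝ (deform z w) y = _ := h.fderiv
  rw [e]
  simp
  module

theorem fderiv_deformLin (hz : IsAffineLift V z) (hw : ContDiff ℝ ∞ w) {x : Plane}
    (hx : x ∈ V) (v : Plane) :
    fderiv ℝ (deformLin z w) x v =
      ![0, Complex.I * (fderiv ℝ (gradOne z w) x v : ℝ), Complex.I * (fderiv ℝ (gradTwo z w) x v : ℝ),
        (fderiv ℝ z x v 1).re * gradOne z w x + (z x 1).re * (fderiv ℝ (gradOne z w) x v : ℝ) +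
        ((fderiv ℝ z x v 2).re * gradTwo z w x + (z x 2).re * (fderiv ℝ (gradTwo z w) x v : ℝ)) -
        2 * (fderiv ℝ w x v : ℝ) -
        Complex.I * ((fderiv ℝ z x v 1).im * gradOne z w x +
          (z x 1).im * (fderiv ℝ (gradOne z w) x v : ℝ) +
          ((fderiv ℝ z x v 2).im * gradTwo z w x +
            (z x 2).im * (fderiv ℝ (gradTwo z w) x v : ℝ)))] := by
  obtain ⟨h1, h2⟩ := hz.contDiffOn_grad hw
  have g1 := (h1.differentiableAt_top hz.isOpen hx).hasFDerivAt
  have g2 := (h2.differentiableAt_top hz.isOpen hx).hasFDerivAt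
  have gw := (hw.differentiable (by simp) x).hasFDerivAt
  have gz : ∀ k, HasFDerivAt (fun x => z x k) ((ContinuousLinearMap.proj k).comp (fderiv ℝ z x)) x :=
    fun k => hasFDerivAt_pi'.1 (hz.smooth.differentiableAt_top hz.isOpen hx).hasFDerivAt k
  have cast : ∀ {f : Plane → ℝ} {f' : Plane →L[ℝ] ℝ}, HasFDerivAt f f' x →
      HasFDerivAt (fun x => (f x : ℂ)) (Complex.ofRealCLM.comp f') x := fun h =>
    Complex.ofRealCLM.hasFDerivAt.comp x h
  have gr := fun k => cast (Complex.reCLM.hasFDerivAt.comp x (gz k))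
  have gi := fun k => cast (Complex.imCLM.hasFDerivAt.comp x (gz k))
  have d := (hz.contDiffOn_deformLin hw).differentiableAt_top hz.isOpen hx
  have e : ∀ k, fderiv ℝ (deformLin z w) x v k = fderiv ℝ (fun x => deformLin z w x k) x v :=
    fun k => by
      rw [(hasFDerivAt_pi'.1 d.hasFDerivAt k).fderiv]; rfl
  ext k
  rw [e]
  fin_cases k
  · simp [deformLin]
  · have h := (cast g1).const_mul Complex.I
    have e' : fderiv ℝ (fun x => deformLin z w x 1) x = _ := h.fderiv
    simp [e']
  · have h := (cast g2).const_mul Complex.I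
    have e' : fderiv ℝ (fun x => deformLin z w x 2) x = _ := h.fderiv
    simp [e']
  · have h := ((((gr 1).fun_mul (cast g1)).fun_add ((gr 2).fun_mul (cast g2))).fun_sub
      ((cast gw).const_mul 2)).fun_sub
      ((((gi 1).fun_mul (cast g1)).fun_add ((gi 2).fun_mul (cast g2))).const_mul Complex.I)
    have e' : fderiv ℝ (fun x => deformLin z w x 3) x = _ := h.fderiv
    simp [e']
    ring

theorem fderiv_deformQuad (hz : IsAffineLift V z) (hw : ContDiff ℝ ∞ w) {x : Plane}
    (hx : x ∈ V) (v : Plane) :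
    fderiv ℝ (deformQuad z w) x v =
      ![0, 0, 0, -Complex.I * (gradOne z w x * (fderiv ℝ (gradOne z w) x v : ℝ) +
        gradTwo z w x * (fderiv ℝ (gradTwo z w) x v : ℝ))] := by
  obtain ⟨h1, h2⟩ := hz.contDiffOn_grad hw
  have g1 := (h1.differentiableAt_top hz.isOpen hx).hasFDerivAt
  have g2 := (h2.differentiableAt_top hz.isOpen hx).hasFDerivAt
  have cast : ∀ {f : Plane → ℝ} {f' : Plane →L[ℝ] ℝ}, HasFDerivAt f f' x →
      HasFDerivAt (fun x => (f x : ℂ)) (Complex.ofRealCLM.comp f') x := fun h =>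
    Complex.ofRealCLM.hasFDerivAt.comp x h
  have d := (hz.contDiffOn_deformQuad hw).differentiableAt_top hz.isOpen hx
  have e : ∀ k, fderiv ℝ (deformQuad z w) x v k = fderiv ℝ (fun x => deformQuad z w x k) x v :=
    fun k => by
      rw [(hasFDerivAt_pi'.1 d.hasFDerivAt k).fderiv]; rfl
  ext k
  rw [e]
  fin_cases k
  · simp [deformQuad]
  · simp [deformQuad]
  · simp [deformQuad]
  · have h := (((cast g1).pow 2).fun_add ((cast g2).pow 2)).const_mul (-(Complex.I / 2))
    have e' : fderiv ℝ (fun x => deformQuad z w x 3) x = _ := h.fderiv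
    simp [e']
    ring

theorem fderiv_apply_zero (hz : IsAffineLift V z) {x : Plane} (hx : x ∈ V) (v : Plane) :
    fderiv ℝ z x v 0 = 0 := by
  have hev : (fun x => z x 0) =ᶠ[nhds x] fun _ => 1 := by
    filter_upwards [hz.isOpen.mem_nhds hx] with y hy using hz.one y hy
  have h := (hasFDerivAt_pi'.1
    (hz.smooth.differentiableAt_top hz.isOpen hx).hasFDerivAt 0).fderiv.symm.trans hev.fderiv_eq
  have := DFunLike.congr_fun h v
  simpa using this

theorem leg_eq (hz : IsAffineLift V z) {x : Plane} (hx : x ∈ V) (v : Plane) :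
    fderiv ℝ z x v 3 = -Complex.I * (fderiv ℝ z x v 1 * star (z x 1) +
      fderiv ℝ z x v 2 * star (z x 2)) := by
  have h := hz.leg x hx v
  rw [herm, hz.one x hx, hz.fderiv_apply_zero hx] at h
  simp only [star_one] at h
  linear_combination (norm := (ring_nf; simp only [Complex.I_sq]; ring)) Complex.I * h

/-- The Legendre condition holds exactly for every t, not merely to first order, because the jet
relation is linear in u; its only input about w is dw = G·dξ. -/
theorem herm_fderiv_deform (hz : IsAffineLift V z) (hw : ContDiff ℝ ∞ w) {y : ℝ × Plane}
    (hy : y.2 ∈ V) (v : Plane) :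
    herm (fderiv ℝ (deform z w) y (0, v)) (deform z w y) = 0 := by
  have hg := hz.grad_mul_fderiv (w := w) hy v
  have h3 := hz.leg_eq hy v
  have h0 := hz.fderiv_apply_zero hy v
  have h1 := hz.one y.2 hy
  rw [hz.fderiv_deform hw hy]
  simp only [herm, Pi.add_apply, Pi.smul_apply, hz.fderiv_deformLin hw hy,
    hz.fderiv_deformQuad hw hy, deform_apply]
  apply Complex.ext
  · simp [deformLin, deformQuad, h0, h1, h3, pow_two]
    ring
  · simp [deformLin, deformQuad, h0, h1, h3, pow_two]
    linear_combination (-2 * y.1) * hg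

/-- The real parts of z¹, z² do not move, so they remain coordinates for every t. The coordinate 0
is constantly 1, which forces a = 0. -/
theorem fderiv_deform_injective (hz : IsAffineLift V z) (hw : ContDiff ℝ ∞ w) {y : ℝ × Plane}
    (hy : y.2 ∈ V) {v : Plane} {a : ℂ} (h : fderiv ℝ (deform z w) y (0, v) = a • deform z w y) :
    v = 0 := by
  rw [hz.fderiv_deform hw hy, hz.fderiv_deformLin hw hy, hz.fderiv_deformQuad hw hy] at h
  have h0 := congrFun h 0
  have h1 := congrFun h 1
  have h2 := congrFun h 2
  simp only [Pi.add_apply, Pi.smul_apply, hz.deform_zero_apply hy, hz.fderiv_apply_zero hy,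
    Matrix.cons_val, smul_zero, zero_smul, add_zero, smul_eq_mul, mul_one, Pi.zero_apply] at h0 h1 h2
  rw [← h0, zero_mul] at h1 h2
  have r1 := congrArg Complex.re h1
  have r2 := congrArg Complex.re h2
  simp at r1 r2
  rw [plane_eq v] at r1 r2
  simp at r1 r2
  have hj := hz.jac y.2 hy
  have v0 : v 0 = 0 := by
    have : realJac z y.2 * v 0 = 0 := by
      rw [realJac]
      linear_combination (fderiv ℝ z y.2 e₂ 2).re * r1 - (fderiv ℝ z y.2 e₂ 1).re * r2
    exact (mul_eq_zero.1 this).resolve_left hj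
  have v1 : v 1 = 0 := by
    have : realJac z y.2 * v 1 = 0 := by
      rw [realJac]
      linear_combination (fderiv ℝ z y.2 e₁ 1).re * r2 - (fderiv ℝ z y.2 e₁ 2).re * r1
    exact (mul_eq_zero.1 this).resolve_left hj
  rw [plane_eq v, v0, v1]; simp

/-- Multiplied by i this is -2w: up to a positive factor, which depends on the frame, w determines
the Hamiltonian. -/
theorem herm_fderiv_deform_time (hz : IsAffineLift V z) (hw : ContDiff ℝ ∞ w) {x : Plane}
    (hx : x ∈ V) :
    herm (fderiv ℝ (deform z w) (0, x) (1, 0)) (deform z w (0, x)) = 2 * Complex.I * w x := by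
  have h1 := hz.one x hx
  rw [hz.fderiv_deform hw (y := (0, x)) hx]
  apply Complex.ext
  · simp [herm, deform_apply, deformLin, h1]
    ring
  · simp [herm, deform_apply, deformLin, h1]
    ring

theorem deform_of_notMem (z : Plane → C31) {x : Plane} (hx : x ∉ tsupport w) (t : ℝ) :
    deform z w (t, x) = z x := by
  have h : w =ᶠ[nhds x] fun _ => 0 := notMem_tsupport_iff_eventuallyEq.1 hx
  have hd : fderiv ℝ w x = 0 := by rw [h.fderiv_eq]; simp
  have h0 : w x = 0 := h.eq_of_nhds
  ext k
  rw [deform_apply]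
  fin_cases k <;> simp [deformLin, deformQuad, gradOne, gradTwo, hd, h0]

theorem deform_zero (z : Plane → C31) (w : Plane → ℝ) (x : Plane) : deform z w (0, x) = z x := by
  simp [deform]

end IsAffineLift

/-! ### Affine lifts of Legendrian surfaces -/

/-- A constant matrix as a real linear operator. -/
def mulVecCLM (A : Matrix (Fin 4) (Fin 4) ℂ) : C31 →L[ℝ] C31 :=
  (LinearMap.toContinuousLinearMap (Matrix.mulVecLin A)).restrictScalars ℝ

theorem fderiv_mulVec {E : Type*} [NormedAddCommGroup E] [NormedSpace ℝ E]
    (A : Matrix (Fin 4) (Fin 4) ℂ) {f : E → C31} {x : E} (hf : DifferentiableAt ℝ f x) (v : E) :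
    fderiv ℝ (fun y => A.mulVec (f y)) x v = A.mulVec (fderiv ℝ f x v) := by
  have h := (mulVecCLM A).hasFDerivAt.comp x hf.hasFDerivAt
  have e : fderiv ℝ (fun y => A.mulVec (f y)) x = _ := h.fderiv
  rw [e]; rfl

theorem IsSU31.inv_mulVec {A : Matrix (Fin 4) (Fin 4) ℂ} (hA : IsSU31 A) (v : C31) :
    A.mulVec (A⁻¹.mulVec v) = v := by
  rw [Matrix.mulVec_mulVec, Matrix.mul_nonsing_inv _ (by rw [hA.1]; exact isUnit_one),
    Matrix.one_mulVec]

theorem IsSU31.mulVec_inv {A : Matrix (Fin 4) (Fin 4) ℂ} (hA : IsSU31 A) (v : C31) :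
    A⁻¹.mulVec (A.mulVec v) = v := by
  rw [Matrix.mulVec_mulVec, Matrix.nonsing_inv_mul _ (by rw [hA.1]; exact isUnit_one),
    Matrix.one_mulVec]

theorem IsSU31.herm_inv {A : Matrix (Fin 4) (Fin 4) ℂ} (hA : IsSU31 A) (u v : C31) :
    herm (A⁻¹.mulVec u) (A⁻¹.mulVec v) = herm u v := by
  rw [← hA.2, hA.inv_mulVec, hA.inv_mulVec]

theorem IsLegFrame.herm_fderiv {Y : Plane → PCSphere} {V : Set Plane} {Z : FrameField}
    (hZ : IsLegFrame Y V Z) {x : Plane} (hx : x ∈ V) (v : Plane) :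
    herm (fderiv ℝ (fun y => col (Z y) 0) x v) (col (Z x) 0) = 0 := by
  have h := DFunLike.congr_fun (hZ.leg x hx) v
  rw [FrameField.mc_eq, hZ.smoothSU.mcForm_apply hx] at h
  simpa using h

/-- The unitary matrix Z(x₀) carries the first basis vector to the frame vector at x₀. Undoing it
and dividing by coordinate 0 gives a lift whose differential at x₀ has real components 1, 2, so
their real parts are coordinates nearby. -/
theorem IsLegFrame.exists_isAffineLift {Y : Plane → PCSphere} {V : Set Plane} {Z : FrameField}
    (hZ : IsLegFrame Y V Z) {x₀ : Plane} (hx₀ : x₀ ∈ V) :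
    ∃ (A : Matrix (Fin 4) (Fin 4) ℂ) (V' : Set Plane) (z : Plane → C31), IsSU31 A ∧ x₀ ∈ V' ∧
      V' ⊆ V ∧ IsAffineLift V' z ∧ ∀ x ∈ V', Represents (A.mulVec (z x)) (Y x) := by
  set A := Z x₀ with hAdef
  have hA : IsSU31 A := hZ.unitary x₀ hx₀
  set σ : Plane → C31 := fun x => A⁻¹.mulVec (col (Z x) 0) with hσ
  have hcol : ContDiffOn ℝ ∞ (fun x => col (Z x) 0) V := contDiffOn_pi.2 fun i => hZ.smooth i 0
  have hσs : ContDiffOn ℝ ∞ σ V := (mulVecCLM A⁻¹).contDiff.comp_contDiffOn hcol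
  set V₁ := V ∩ (fun x => σ x 0) ⁻¹' {0}ᶜ with hV₁
  have h1 : IsOpen V₁ := (contDiffOn_pi.1 hσs 0).continuousOn.isOpen_inter_preimage hZ.isOpen
    isOpen_compl_singleton
  set z : Plane → C31 := fun x => (σ x 0)⁻¹ • σ x with hz
  have ha : ContDiffOn ℝ ∞ (fun x => (σ x 0)⁻¹) V₁ :=
    ((contDiffOn_pi.1 hσs 0).mono Set.inter_subset_left).inv fun x hx => hx.2
  have hzs : ContDiffOn ℝ ∞ z V₁ := ha.fun_smul (hσs.mono Set.inter_subset_left)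
  have hdz : ∀ x ∈ V₁, ∀ v, fderiv ℝ z x v = (σ x 0)⁻¹ • A⁻¹.mulVec
      (fderiv ℝ (fun y => col (Z y) 0) x v) + fderiv ℝ (fun x => (σ x 0)⁻¹) x v • σ x := by
    intro x hx v
    rw [hz, fderiv_fun_smul (ha.differentiableAt_top h1 hx)
      (hσs.differentiableAt_top hZ.isOpen hx.1)]
    simp only [add_apply, smul_apply, ContinuousLinearMap.smulRight_apply]
    rw [hσ, fderiv_mulVec _ (hcol.differentiableAt_top hZ.isOpen hx.1)]
  have hnull : ∀ x ∈ V, herm (σ x) (σ x) = 0 := fun x hx => by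
    rw [hσ, hA.herm_inv]
    exact (hZ.base x hx).herm_self
  have hjs : ContinuousOn (realJac z) V₁ := by
    have := fun v k => ((contDiffOn_pi.1 ((hzs.fderiv_of_isOpen h1 (m := ∞) (by simp)).clm_apply
      (contDiffOn_const (c := v))) k).re_complex).continuousOn
    exact ((this _ _).mul (this _ _)).sub ((this _ _).mul (this _ _))
  have hσ₀ : σ x₀ = Pi.single 0 1 := by
    have : col (Z x₀) 0 = A.mulVec (Pi.single 0 1) := by
      rw [Matrix.mulVec_single_one]; rfl
    rw [hσ]
    simp only [this]
    exact hA.mulVec_inv _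
  have hx₁ : x₀ ∈ V₁ := ⟨hx₀, by simp [hσ₀]⟩
  have hj₀ : realJac z x₀ ≠ 0 := by
    -- At x₀ the derivative of the scaling factor only adds a multiple of the basis vector 0. The
    -- other components are πⁱ₀, and the Jacobian becomes ω¹∧ω² > 0.
    have hmc : ∀ i, i ≠ 0 → ∀ v, fderiv ℝ z x₀ v i = Z.mc i 0 x₀ v := by
      intro i hi v
      rw [hdz x₀ hx₁, Pi.add_apply, Pi.smul_apply, Pi.smul_apply, hσ₀]
      have e : ∀ C, fderiv ℝ (fun y => col (Z y) 0) x₀ v C = fderiv ℝ (fun y => Z y C 0) x₀ v :=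
        fun C => by
          have := hasFDerivAt_pi'.1 (hcol.differentiableAt_top hZ.isOpen hx₀).hasFDerivAt C
          have e' : fderiv ℝ (fun y => Z y C 0) x₀ = _ := this.fderiv
          rw [e']; rfl
      simp only [Pi.single_eq_same, inv_one, Pi.single_eq_of_ne hi, FrameField.mc, sum_apply,
        smul_apply, Matrix.mulVec, dotProduct, smul_eq_mul, one_mul, mul_zero,
        add_zero, e]
      rfl
    have hre : ∀ i v, (Z.om i x₀ v).im = 0 := fun i v => by
      have := DFunLike.congr_fun (hZ.real x₀ hx₀ i) v
      simpa [imForm_apply] using this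
    have hp := hZ.positive x₀ hx₀
    simp only [wedge, Complex.sub_re, Complex.mul_re, hre, mul_zero, sub_zero] at hp
    rw [realJac, hmc 1 (by decide), hmc 2 (by decide), hmc 1 (by decide), hmc 2 (by decide)]
    exact hp.ne'
  refine ⟨A, V₁ ∩ realJac z ⁻¹' {0}ᶜ, z, hA, ⟨hx₁, hj₀⟩, fun x hx => hx.1.1, ?_, fun x hx => ?_⟩
  · refine ⟨hjs.isOpen_inter_preimage h1 isOpen_compl_singleton,
      hzs.mono Set.inter_subset_left, fun x hx => ?_, fun x hx => ?_, fun x hx v => ?_,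
      fun x hx => hx.2⟩
    · exact inv_mul_cancel₀ hx.1.2
    · simp only [hz, herm_smul_left, herm_smul_right, hnull x hx.1.1, mul_zero]
    · have hl : herm (A⁻¹.mulVec (fderiv ℝ (fun y => col (Z y) 0) x v)) (σ x) = 0 := by
        rw [hσ, hA.herm_inv, hZ.herm_fderiv hx.1.1]
      rw [hdz x hx.1]
      simp only [hz, herm_smul_right, herm_add_left, herm_smul_left, hnull x hx.1.1, hl, mul_zero,
        add_zero]
  · have : A.mulVec (z x) = (σ x 0)⁻¹ • col (Z x) 0 := by
      simp only [hz, Matrix.mulVec_smul, hσ, hA.inv_mulVec]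
    rw [this]
    exact (hZ.base x hx.1.1).smul (inv_ne_zero hx.1.2)

/-! ### Compactly supported Legendrian variations -/

/-- The point of the sphere represented by a vector. -/
def sphereMk (v : C31) (l : PCSphere) : PCSphere :=
  open Classical in
  if h : ∃ l' : PCSphere, Represents v l' then h.choose else l

theorem Represents.of_null {v : C31} (h : v ≠ 0) (h0 : herm v v = 0) :
    ∃ l : PCSphere, Represents v l := by
  refine ⟨⟨Projectivization.mk ℂ v h, ?_⟩, h, rfl⟩
  obtain ⟨a, ha⟩ := Projectivization.exists_smul_eq_mk_rep ℂ v h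
  rw [← ha]
  change herm ((a : ℂ) • v) ((a : ℂ) • v) = 0
  rw [herm_smul_left, herm_smul_right, h0]
  simp

theorem Represents.unique {v : C31} {l l' : PCSphere} (h : Represents v l) (h' : Represents v l') :
    l = l' := by
  obtain ⟨_, h⟩ := h
  obtain ⟨_, h'⟩ := h'
  exact Subtype.ext (h.symm.trans h')

theorem represents_sphereMk {v : C31} (h : v ≠ 0) (h0 : herm v v = 0) (l : PCSphere) :
    Represents v (sphereMk v l) := by
  have H := Represents.of_null h h0
  rw [sphereMk, dif_pos H]
  exact H.choose_spec

/-- The lift of the deformation. -/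
def deformLift (A : Matrix (Fin 4) (Fin 4) ℂ) (z : Plane → C31) (w : Plane → ℝ) (y : ℝ × Plane) :
    C31 := A.mulVec (deform z w y)

namespace IsAffineLift

variable {V : Set Plane} {z : Plane → C31} {w : Plane → ℝ} {A : Matrix (Fin 4) (Fin 4) ℂ}

theorem deformLift_ne_zero (hz : IsAffineLift V z) (hA : IsSU31 A) {y : ℝ × Plane} (hy : y.2 ∈ V) :
    deformLift A z w y ≠ 0 := by
  intro h
  have h1 := congrArg A⁻¹.mulVec h
  rw [deformLift, hA.mulVec_inv, Matrix.mulVec_zero] at h1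
  have h2 := hz.deform_zero_apply (w := w) hy
  rw [h1] at h2
  simp at h2

theorem herm_deformLift (hz : IsAffineLift V z) (hA : IsSU31 A) {y : ℝ × Plane} (hy : y.2 ∈ V) :
    herm (deformLift A z w y) (deformLift A z w y) = 0 := by
  rw [deformLift, hA.2, hz.herm_deform hy]

theorem contDiffOn_deformLift (hz : IsAffineLift V z) (hw : ContDiff ℝ ∞ w) :
    ContDiffOn ℝ ∞ (deformLift A z w) (Set.univ ×ˢ V) :=
  (mulVecCLM A).contDiff.comp_contDiffOn (hz.contDiffOn_deform hw)

theorem fderiv_deformLift (hz : IsAffineLift V z) (hw : ContDiff ℝ ∞ w) {y : ℝ × Plane}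
    (hy : y.2 ∈ V) (u : ℝ × Plane) :
    fderiv ℝ (deformLift A z w) y u = A.mulVec (fderiv ℝ (deform z w) y u) :=
  fderiv_mulVec A ((hz.contDiffOn_deform hw).differentiableAt_top
    (isOpen_univ.prod hz.isOpen) ⟨Set.mem_univ _, hy⟩) u

theorem isLegLift (hz : IsAffineLift V z) (hA : IsSU31 A) (hw : ContDiff ℝ ∞ w)
    {Y : ℝ → Plane → PCSphere} (hY : ∀ t, ∀ x ∈ V, Represents (deformLift A z w (t, x)) (Y t x)) :
    IsLegLift Y (Set.univ ×ˢ V) (deformLift A z w) where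
  isOpen := isOpen_univ.prod hz.isOpen
  smooth := hz.contDiffOn_deformLift hw
  base y hy := hY y.1 y.2 hy.2
  leg y hy v := by
    rw [hz.fderiv_deformLift hw hy.2, deformLift, hA.2, hz.herm_fderiv_deform hw hy.2]
  imm y hy v a h := by
    rw [hz.fderiv_deformLift hw hy.2, deformLift, ← Matrix.mulVec_smul] at h
    have h1 := congrArg A⁻¹.mulVec h
    rw [hA.mulVec_inv, hA.mulVec_inv] at h1
    exact hz.fderiv_deform_injective hw hy.2 h1

theorem herm_fderiv_deformLift_time (hz : IsAffineLift V z) (hA : IsSU31 A) (hw : ContDiff ℝ ∞ w)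
    {x : Plane} (hx : x ∈ V) :
    herm (fderiv ℝ (deformLift A z w) (0, x) (1, 0)) (deformLift A z w (0, x)) =
      2 * Complex.I * w x := by
  rw [hz.fderiv_deformLift hw (y := (0, x)) hx, deformLift, hA.2, hz.herm_fderiv_deform_time hw hx]

end IsAffineLift

section Variation

variable {M : Type*} [TopologicalSpace M] [ChartedSpace Plane M]

/-- The deformation of a Legendrian surface in a coordinate domain. -/
def deformMap (c : OpenPartialHomeomorph M Plane) (V : Set Plane) (A : Matrix (Fin 4) (Fin 4) ℂ)
    (z : Plane → C31) (w : Plane → ℝ) (X : M → PCSphere) (t : ℝ) (m : M) : PCSphere :=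
  open Classical in
  if m ∈ c.source ∧ c m ∈ V then sphereMk (deformLift A z w (t, c m)) (X m) else X m

/-- An affine lift in a coordinate domain of a surface. -/
structure IsChartLift (X : M → PCSphere) (c : OpenPartialHomeomorph M Plane) (V : Set Plane)
    (A : Matrix (Fin 4) (Fin 4) ℂ) (z : Plane → C31) : Prop extends IsAffineLift V z where
  mem_atlas : c ∈ atlas Plane M
  subset : V ⊆ c.target
  unitary : IsSU31 A
  base : ∀ x ∈ V, Represents (A.mulVec (z x)) (X (c.symm x))

namespace IsChartLift

variable {X : M → PCSphere} {c : OpenPartialHomeomorph M Plane} {V : Set Plane}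
  {A : Matrix (Fin 4) (Fin 4) ℂ} {z : Plane → C31} {w : Plane → ℝ}

theorem represents_deformMap (hz : IsChartLift X c V A z) (w : Plane → ℝ) (t : ℝ) {m : M}
    (hm : m ∈ c.source) (hmV : c m ∈ V) :
    Represents (deformLift A z w (t, c m)) (deformMap c V A z w X t m) := by
  rw [deformMap, if_pos ⟨hm, hmV⟩]
  exact represents_sphereMk (hz.deformLift_ne_zero hz.unitary hmV)
    (hz.herm_deformLift hz.unitary hmV) _

theorem deformMap_eq (hz : IsChartLift X c V A z) {t : ℝ} {m : M}
    (h : m ∈ c.source → c m ∈ V → deform z w (t, c m) = z (c m)) :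
    deformMap c V A z w X t m = X m := by
  by_cases hm : m ∈ c.source ∧ c m ∈ V
  · have h1 := hz.represents_deformMap w t hm.1 hm.2
    rw [deformLift, h hm.1 hm.2] at h1
    have h2 := hz.base _ hm.2
    rw [c.left_inv hm.1] at h2
    exact h1.unique h2
  · rw [deformMap, if_neg hm]

theorem deformMap_of_notMem (hz : IsChartLift X c V A z) (t : ℝ) {m : M}
    (hm : m ∉ c.symm '' tsupport w) : deformMap c V A z w X t m = X m :=
  hz.deformMap_eq fun hs _ => IsAffineLift.deform_of_notMem z
    (fun h => hm ⟨c m, h, c.left_inv hs⟩) t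

theorem isLegLift_deformMap (hz : IsChartLift X c V A z) (hw : ContDiff ℝ ∞ w) :
    IsLegLift (fun t => deformMap c V A z w X t ∘ c.symm) (Set.univ ×ˢ V) (deformLift A z w) :=
  hz.isLegLift hz.unitary hw fun t x hx => by
    have h := hz.represents_deformMap w t (c.map_target (hz.subset hx))
      (by rwa [c.right_inv (hz.subset hx)])
    rwa [c.right_inv (hz.subset hx)] at h

variable [IsManifold (𝓡 2) ∞ M]

/-- Near the support of w the deformed affine lift serves; on the open complement of its image
nothing has changed and the old lift serves. -/
theorem isLegendrianImmersion_deformMap (hz : IsChartLift X c V A z)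
    (hX : IsLegendrianImmersion X) (hw : ContDiff ℝ ∞ w) (hK : IsClosed (c.symm '' tsupport w))
    (hwV : tsupport w ⊆ V) (t : ℝ) : IsLegendrianImmersion (deformMap c V A z w X t) := by
  have : IsManifold (𝓡 2) 1 M := IsManifold.of_le (n := ∞) (by simp)
  intro m
  by_cases hm : m ∈ c.symm '' tsupport w
  · obtain ⟨x, hx, rfl⟩ := hm
    have hxc := hz.subset (hwV hx)
    have hL := hz.isLegLift_deformMap hw
    have hcm : ContMDiffOn (𝓡 2) (𝓡 2) ∞ c c.source :=
      contMDiffOn_of_mem_maximalAtlas (IsManifold.subset_maximalAtlas hz.mem_atlas)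
    have hs : ContDiffOn ℝ ∞ (fun x => deformLift A z w (t, x)) V :=
      (hz.contDiffOn_deformLift hw).comp (by fun_prop) fun x hx => ⟨Set.mem_univ _, hx⟩
    have hd : ∀ y ∈ c.source ∩ c ⁻¹' V, ∀ v : TangentSpace (𝓡 2) y,
        dVec (fun m => deformLift A z w (t, c m)) y v =
          fderiv ℝ (deformLift A z w) (t, c y) (0, mfderiv (𝓡 2) (𝓡 2) c y v) := by
      intro y hy v
      have h1 : MDifferentiableAt (𝓡 2) 𝓘(ℝ, C31) (fun x => deformLift A z w (t, x)) (c y) :=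
        (hs.differentiableAt_top hz.isOpen hy.2).mdifferentiableAt
      have h2 : MDifferentiableAt (𝓡 2) (𝓡 2) c y :=
        (hcm.contMDiffAt (c.open_source.mem_nhds hy.1)).mdifferentiableAt (by simp)
      have h3 := mfderiv_comp y h1 h2
      rw [mfderiv_eq_fderiv] at h3
      exact (DFunLike.congr_fun h3 v).trans
        (hL.fderiv_slice (y := (t, c y)) ⟨Set.mem_univ _, hy.2⟩ _)
    refine ⟨c.source ∩ c ⁻¹' V, c.continuousOn.isOpen_inter_preimage c.open_source hz.isOpen,
      ⟨c.map_target hxc, by rw [Set.mem_preimage, c.right_inv hxc]; exact hwV hx⟩,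
      fun m => deformLift A z w (t, c m), ?_, fun y hy => ⟨?_, fun v => ?_, fun v a h => ?_⟩⟩
    · exact (contMDiffOn_iff_contDiffOn.2 hs).comp (hcm.mono Set.inter_subset_left)
        fun y hy => hy.2
    · exact hz.represents_deformMap w t hy.1 hy.2
    · rw [hd y hy]
      exact hL.leg (t, c y) ⟨Set.mem_univ _, hy.2⟩ _
    · rw [hd y hy] at h
      have h0 := hL.imm (t, c y) ⟨Set.mem_univ _, hy.2⟩ _ a h
      exact (mdifferentiable_of_mem_atlas (I := 𝓡 2) hz.mem_atlas).mfderiv_injective hy.1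
        (h0.trans (map_zero _).symm)
  · obtain ⟨U, hU, hmU, s, hs, hp⟩ := hX m
    refine ⟨U ∩ (c.symm '' tsupport w)ᶜ, hU.inter hK.isOpen_compl, ⟨hmU, hm⟩, s,
      hs.mono Set.inter_subset_left, fun y hy => ?_⟩
    rw [hz.deformMap_of_notMem t hy.2]
    exact hp y hy.1

theorem isLegendrianVariation_deformMap (hz : IsChartLift X c V A z)
    (hX : IsLegendrianImmersion X) (hw : ContDiff ℝ ∞ w) (hK : IsClosed (c.symm '' tsupport w))
    (hwV : tsupport w ⊆ V) :
    IsLegendrianVariation X (c.symm '' tsupport w) 1 (deformMap c V A z w X) where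
  pos := one_pos
  zero := funext fun m => hz.deformMap_eq fun _ _ => IsAffineLift.deform_zero z w _
  smooth := by
    rintro ⟨t, m⟩ ⟨ht, -⟩
    by_cases hm : m ∈ c.symm '' tsupport w
    · obtain ⟨x, hx, rfl⟩ := hm
      have hxc := hz.subset (hwV hx)
      have hcm : ContMDiffOn (𝓡 2) (𝓡 2) ∞ c c.source :=
        contMDiffOn_of_mem_maximalAtlas (IsManifold.subset_maximalAtlas hz.mem_atlas)
      have hs : ContMDiffOn (𝓘(ℝ, ℝ).prod (𝓡 2)) 𝓘(ℝ, C31) ∞ (deformLift A z w)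
          (Set.univ ×ˢ V) := by
        have := contMDiffOn_iff_contDiffOn.2 (hz.contDiffOn_deformLift (A := A) hw)
        rwa [modelWithCornersSelf_prod, ← chartedSpaceSelf_prod] at this
      refine ⟨Set.Ioo (-1) 1 ×ˢ (c.source ∩ c ⁻¹' V), isOpen_Ioo.prod
        (c.continuousOn.isOpen_inter_preimage c.open_source hz.isOpen),
        ⟨ht, c.map_target hxc, by rw [Set.mem_preimage, c.right_inv hxc]; exact hwV hx⟩,
        Set.prod_mono_right (Set.subset_univ _), fun q => deformLift A z w (q.1, c q.2), ?_,
        fun q hq => hz.represents_deformMap w q.1 hq.2.1 hq.2.2⟩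
      exact hs.comp (f := Prod.map id c) (((contMDiffOn_id.prodMap hcm)).mono
        (Set.prod_mono (Set.subset_univ _) Set.inter_subset_left))
        fun q hq => ⟨Set.mem_univ _, hq.2.2⟩
    · obtain ⟨U, hU, hmU, s, hs, hp⟩ := hX m
      refine ⟨Set.Ioo (-1) 1 ×ˢ (U ∩ (c.symm '' tsupport w)ᶜ),
        isOpen_Ioo.prod (hU.inter hK.isOpen_compl), ⟨ht, hmU, hm⟩,
        Set.prod_mono_right (Set.subset_univ _), fun q => s q.2,
        hs.comp (t := U) contMDiffOn_snd (fun q hq => hq.2.1), fun q hq => ?_⟩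
      simp only [hz.deformMap_of_notMem q.1 hq.2.2]
      exact (hp _ hq.2.1).1
  legendrian t _ := hz.isLegendrianImmersion_deformMap hX hw hK hwV t
  support t _ m hm := hz.deformMap_of_notMem t hm

end IsChartLift

end Variation

/-! ### The Hamiltonian of a lift -/

/-- Λ³₀ = i⟨∂ₜZ₀, Z̄₀⟩. With Z₀ = a s the derivative of a contributes a multiple of ⟨s, s̄⟩ = 0, and
the factor is |a|². -/
theorem IsFrameFamily.exists_hamiltonian_eq {Y : ℝ → Plane → PCSphere} {O : Set (ℝ × Plane)}
    {Z : ℝ × Plane → Matrix (Fin 4) (Fin 4) ℂ} (hZ : IsFrameFamily Y O Z) {s : ℝ × Plane → C31}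
    {t : ℝ} {x : Plane} (hx : (t, x) ∈ O) (hs : DifferentiableAt ℝ s (t, x))
    (hrep : ∀ᶠ y in nhds (t, x), Represents (s y) (Y y.1 y.2)) :
    ∃ l : ℝ, 0 < l ∧ hamiltonian Z t x =
      l * (Complex.I * herm (fderiv ℝ s (t, x) (1, 0)) (s (t, x))) := by
  have hdiff : DifferentiableAt ℝ (fun y => col (Z y) 0) (t, x) :=
    differentiableAt_pi.2 fun i => hZ.smoothSU.differentiableAt hx i 0
  have hbase : ∀ᶠ y in nhds (t, x), Represents (col (Z y) 0) (Y y.1 y.2) := by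
    filter_upwards [hZ.isOpen.mem_nhds hx] with y hy using (hZ.frame y.1).base y.2 hy
  obtain ⟨a, ha, he, b, hd⟩ := Represents.exists_fderiv_eq hdiff hs hbase hrep
  refine ⟨Complex.normSq a, Complex.normSq_pos.2 ha, ?_⟩
  have hself := hrep.self_of_nhds.herm_self
  rw [hamiltonian, timeMC, hZ.smoothSU.mcForm_apply hx]
  simp only [Matrix.cons_val]
  rw [he, hd, herm_smul_right, herm_add_left, herm_smul_left, herm_smul_left, hself,
    ← Complex.mul_conj, Complex.star_def]
  ring

/-- The frame construction differentiates the lift only in spatial directions. At time zero its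
domain is therefore the same for every deformation of one surface and can be fixed before w is
chosen. -/
theorem IsLegLift.zero_mem_domain_iff {Y Y' : ℝ → Plane → PCSphere} {O : Set (ℝ × Plane)}
    {s s' : ℝ × Plane → C31} (hs : IsLegLift Y O s) (hs' : IsLegLift Y' O s')
    (h : ∀ x, s (0, x) = s' (0, x)) (w : C31) (l : ℂ) (x : Plane) :
    ((0 : ℝ), x) ∈ domain s O w l ↔ ((0 : ℝ), x) ∈ domain s' O w l := by
  have hd : ((0 : ℝ), x) ∈ O → ∀ v : Plane,
      fderiv ℝ s ((0 : ℝ), x) (0, v) = fderiv ℝ s' ((0 : ℝ), x) (0, v) := fun hx v => by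
    rw [← hs.fderiv_slice hx, ← hs'.fderiv_slice hx]
    simp only [h]
  simp only [domain, Set.mem_ofPred_eq, frameOf, h]
  constructor
  · rintro ⟨⟨h1, h2⟩, h3⟩
    exact ⟨⟨h1, h2⟩, by rwa [hd h1, hd h1] at h3⟩
  · rintro ⟨⟨h1, h2⟩, h3⟩
    exact ⟨⟨h1, h2⟩, by rwa [hd h1, hd h1]⟩

/-! ### The two equivalences -/

section Surface

open MeasureTheory

variable {M : Type*} [TopologicalSpace M] [ChartedSpace Plane M] [IsManifold (𝓡 2) ∞ M]
  {X : M → PCSphere}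

/-- Compares the residue in one chart with a frame living in another. The positive factor is the
pulled-back area element; only its sign will matter. -/
theorem IsLegendrianVariation.exists_familyResidue_eq (hM : IsOrientedAtlas M) {K : Set M} {ε : ℝ}
    {Xt : ℝ → M → PCSphere} (hV : IsLegendrianVariation X K ε Xt)
    {c c' : OpenPartialHomeomorph M Plane} (hc : c ∈ atlas Plane M) (hc' : c' ∈ atlas Plane M)
    {O : Set (ℝ × Plane)} {Z : ℝ × Plane → Matrix (Fin 4) (Fin 4) ℂ}
    (hZ : IsFrameFamily (fun t => Xt t ∘ c'.symm) O Z) {x : Plane}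
    (hx : x ∈ (c.symm.trans c').source) (hxO : ((0 : ℝ), c.symm.trans c' x) ∈ O) :
    ∃ a : ℝ, 0 < a ∧ familyResidue (fun t => Xt t ∘ c.symm) x =
      a * ((hamiltonian Z 0 (c.symm.trans c' x)).re *
        ((slice Z 0).r (c.symm.trans c' x)).re) := by
  have hT := (c.symm.trans c').open_source
  have hτ := contDiffOn_transition hc hc'
  have hmem : ((0 : ℝ), x) ∈ pullbackSet (c.symm.trans c') (c.symm.trans c').source O := ⟨hx, hxO⟩
  have hp := (hZ.pullback_frame hT hτ (hM c hc c' hc')).congr_base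
    (Y' := fun t => Xt t ∘ c.symm) fun y hy => by
      simp only [Function.comp_apply, OpenPartialHomeomorph.coe_trans,
        c'.left_inv (show c.symm y.2 ∈ c'.source from hy.1.2)]
  refine ⟨_, (hp.frame 0).positive x hmem, ?_⟩
  rw [hV.familyResidue_eq hc hp hmem hx.1, hZ.r_pullback hT hτ (hM c hc c' hc') hmem, hamiltonian,
    hZ.timeMC_pullback hT hτ hmem]
  simp only [FrameField.om, FrameField.pos, if_true, one_ne_zero, if_false]
  rw [hamiltonian]
  ring

/-- The quartic differential is holomorphic exactly when the coefficient `r` vanishes. -/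
theorem IsLegendrianImmersion.isHolomorphicPhi_iff (hX : IsLegendrianImmersion X) :
    IsHolomorphicPhi X ↔ RVanishes X := by
  refine ⟨fun h c hc V hV Z hZ => ?_, fun h c hc V hV Z hZ => ?_⟩
  · exact (hX.isLegFrame hc hV hZ).dbarQuartic_eq_zero_iff.1 (h c hc V hV Z hZ)
  · exact (hX.isLegFrame hc hV hZ).dbarQuartic_eq_zero_iff.2 (h c hc V hV Z hZ)

variable [T2Space M] [SigmaCompactSpace M]

/-- If the coefficient `r` vanishes, then the surface is Willmore. -/
theorem RVanishes.isWillmore (hM : IsOrientedAtlas M) (hr : RVanishes X) : IsWillmore X := by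
  intro K ε Xt hK hV
  convert hV.hasDerivAt_willmoreEnergy hM hK using 1
  refine (mul_eq_zero_of_right _ (Finset.sum_eq_zero fun i _ =>
    setIntegral_eq_zero_of_forall_eq_zero fun x hx => ?_)).symm
  have hc := chart_mem_atlas Plane i
  obtain ⟨O, Z, hmem, hsub, hZ⟩ := hV.exists_isFrameFamily hc hV.zero_mem hx
  have F := (hZ.frame 0).toIsAdaptedFrame
  rw [hV.zero] at F
  rw [hV.familyResidue_eq hc hZ hmem hx, hr _ hc _ (fun y hy => (hsub hy).2) _ F x hmem]
  simp

/-- A vanishing sum of integrals of nonnegative functions makes each of them vanish almost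
everywhere, hence everywhere by continuity. -/
theorem IsLegendrianVariation.chartPartition_mul_familyResidue_eq_zero (hM : IsOrientedAtlas M)
    {K : Set M} {ε : ℝ} {Xt : ℝ → M → PCSphere} (hV : IsLegendrianVariation X K ε Xt)
    (hK : IsCompact K) (hE : HasDerivAt (fun t => willmoreEnergy K (Xt t)) 0 0)
    (hneg : ∀ i : M, ∀ x ∈ (chartAt Plane i).target,
      0 ≤ familyResidue (fun t => Xt t ∘ (chartAt Plane i).symm) x)
    {i : M} (hi : i ∈ chartIndices hK) {x : Plane} (hx : x ∈ (chartAt Plane i).target) :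
    chartPartition M i ((chartAt Plane i).symm x) *
      familyResidue (fun t => Xt t ∘ (chartAt Plane i).symm) x = 0 := by
  have hnn : ∀ j : M, ∀ x ∈ (chartAt Plane j).target,
      0 ≤ chartPartition M j ((chartAt Plane j).symm x) *
        familyResidue (fun t => Xt t ∘ (chartAt Plane j).symm) x := fun j x hx =>
    mul_nonneg ((chartPartition M).nonneg j _) (hneg j x hx)
  have h0 := (hV.hasDerivAt_willmoreEnergy hM hK).unique hE
  have h1 := (Finset.sum_eq_zero_iff_of_nonneg fun j _ =>
    setIntegral_nonneg (chartAt Plane j).open_target.measurableSet (hnn j)).1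
    ((mul_eq_zero.1 h0).resolve_left (by norm_num)) i hi
  rw [setIntegral_eq_zero_iff_of_nonneg_ae ((ae_restrict_iff'
    (chartAt Plane i).open_target.measurableSet).2 (Filter.Eventually.of_forall (hnn i)))
    (hV.integrableOn_chartPartition_mul_familyResidue hK i)] at h1
  have hc := chart_mem_atlas Plane i
  exact Measure.eqOn_open_of_ae_eq h1 (chartAt Plane i).open_target
    ((contDiffOn_chartPartition hc i).continuousOn.mul (hV.continuousOn_familyResidue hc))
    continuousOn_const hx

/-- On a Willmore surface the coefficient `r` vanishes in the frames which are constructed from an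
affine lift. -/
theorem IsChartLift.r_eq_zero (hM : IsOrientedAtlas M) (hX : IsLegendrianImmersion X)
    (hW : IsWillmore X) {c : OpenPartialHomeomorph M Plane} {V : Set Plane}
    {A : Matrix (Fin 4) (Fin 4) ℂ} {z : Plane → C31} (hz : IsChartLift X c V A z) {v : C31} {l : ℂ}
    (hl : l ≠ 0) {D : Set Plane} {Z : FrameField}
    (hZ : Z = adaptedFrame v l fun x => A.mulVec (z x))
    (hD : D = {x | ((0 : ℝ), x) ∈ IsLegLift.domain (deformLift A z fun _ => 0) (Set.univ ×ˢ V) v l})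
    (F : IsLegFrame (X ∘ c.symm) D Z) {x₀ : Plane} (hx₀ : x₀ ∈ D) : Z.r x₀ = 0 := by
  have hDV : D ⊆ V := fun x hx => by
    rw [hD] at hx
    exact (IsLegLift.domain_subset v l hx).2
  set b := (Z.r x₀).re with hb
  by_contra hne
  have hb0 : b ≠ 0 := fun h => hne (by
    have h1 := F.star_r hx₀
    have h2 : (Z.r x₀).im = 0 := Complex.conj_eq_iff_im.1 h1
    exact Complex.ext h h2)
  -- On S the coefficient r has the same sign as at x₀; the bump will be supported there.
  set S := D ∩ (fun x => b * (Z.r x).re) ⁻¹' Set.Ioi 0 with hS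
  have hSo : IsOpen S := (continuousOn_const.mul
    F.contDiffOn_r.re_complex.continuousOn).isOpen_inter_preimage F.isOpen isOpen_Ioi
  have hx₀S : x₀ ∈ S := ⟨hx₀, mul_self_pos.2 hb0⟩
  obtain ⟨δ, hδ, hball⟩ := Metric.nhds_basis_closedBall.mem_iff.1 (hSo.mem_nhds hx₀S)
  set f : ContDiffBump x₀ := ⟨δ / 2, δ, half_pos hδ, half_lt_self hδ⟩ with hf
  -- The Hamiltonian is a positive multiple of -2w, so with this sign it is a positive multiple of b
  -- times the bump.
  set w : Plane → ℝ := fun x => -b * f x with hw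
  have hws : ContDiff ℝ ∞ w := contDiff_const.mul f.contDiff
  have hwS : tsupport w ⊆ S := by
    refine (tsupport_mul_subset_right (f := fun _ => -b) (g := f)).trans ?_
    rw [f.tsupport_eq]
    exact hball
  have hwc : IsCompact (tsupport w) :=
    (isCompact_closedBall x₀ δ).of_isClosed_subset (isClosed_tsupport _)
      ((tsupport_mul_subset_right (f := fun _ => -b) (g := f)).trans f.tsupport_eq.subset)
  have hwV : tsupport w ⊆ V := hwS.trans (Set.inter_subset_left.trans hDV)
  have hK : IsCompact (c.symm '' tsupport w) :=
    hwc.image_of_continuousOn (c.continuousOn_symm.mono (hwV.trans hz.subset))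
  have hVar := hz.isLegendrianVariation_deformMap hX hws hK.isClosed hwV
  have hL := hz.isLegLift_deformMap hws
  have hfam := hL.isFrameFamily v hl
  have hdom : ∀ x ∈ D, ((0 : ℝ), x) ∈
      IsLegLift.domain (deformLift A z w) (Set.univ ×ˢ V) v l := fun x hx => by
    rw [hD] at hx
    refine (hL.zero_mem_domain_iff (hz.isLegLift_deformMap contDiff_const) (fun x => ?_) v l x).2 hx
    rw [deformLift, deformLift, IsAffineLift.deform_zero, IsAffineLift.deform_zero]
  set Zt := fun y : ℝ × Plane => adaptedFrame v l (fun x => deformLift A z w (y.1, x)) y.2 with hZt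
  -- The frame is an explicit expression in the spatial derivatives of the lift, so at time zero it
  -- is Z whatever w is.
  have hslice : slice Zt 0 = Z := by
    rw [hZ]
    funext x
    simp only [slice, hZt, deformLift, IsAffineLift.deform_zero]
  have hham : ∀ x ∈ D, ∃ a : ℝ, 0 < a ∧ (hamiltonian Zt 0 x).re = a * (b * f x) := by
    intro x hx
    have hmem : ((0 : ℝ), x) ∈ Set.univ ×ˢ V := ⟨Set.mem_univ _, hDV hx⟩
    obtain ⟨a, ha, h⟩ := hfam.exists_hamiltonian_eq (hdom x hx) (hL.differentiableAt hmem) (by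
      filter_upwards [hL.isOpen.mem_nhds hmem] with y hy using hL.base y hy)
    refine ⟨2 * a, by positivity, ?_⟩
    rw [h, hz.herm_fderiv_deformLift_time hz.unitary hws (hDV hx)]
    simp [hw]
    ring
  have hres : ∀ i : M, ∀ x ∈ ((chartAt Plane i).symm.trans c).source,
      (chartAt Plane i).symm.trans c x ∈ D →
      ∃ a : ℝ, 0 < a ∧
      familyResidue (fun t => deformMap c V A z w X t ∘ (chartAt Plane i).symm) x =
        a * (f ((chartAt Plane i).symm.trans c x) *
          (b * (Z.r ((chartAt Plane i).symm.trans c x)).re)) := by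
    intro i x hx hxD
    obtain ⟨a, ha, h1⟩ := hVar.exists_familyResidue_eq hM (chart_mem_atlas Plane i) hz.mem_atlas
      hfam
      hx (hdom _ hxD)
    obtain ⟨a', ha', h2⟩ := hham _ hxD
    refine ⟨a * a', by positivity, ?_⟩
    rw [h1, h2, hslice]
    ring
  have hneg : ∀ i : M, ∀ x ∈ (chartAt Plane i).target,
      0 ≤ familyResidue (fun t => deformMap c V A z w X t ∘ (chartAt Plane i).symm) x := by
    intro i x hx
    by_cases hxK : (chartAt Plane i).symm x ∈ c.symm '' tsupport w
    · obtain ⟨y, hy, hyx⟩ := hxK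
      have hyc := hz.subset (hwV hy)
      have hxs : x ∈ ((chartAt Plane i).symm.trans c).source :=
        ⟨hx, show (chartAt Plane i).symm x ∈ c.source by rw [← hyx]; exact c.map_target hyc⟩
      have hxy : (chartAt Plane i).symm.trans c x = y := by
        rw [OpenPartialHomeomorph.coe_trans, Function.comp_apply, ← hyx, c.right_inv hyc]
      obtain ⟨a, ha, h⟩ := hres i x hxs (hxy ▸ (hwS hy).1)
      rw [h, hxy]
      exact mul_nonneg ha.le (mul_nonneg f.nonneg (le_of_lt (hwS hy).2))
    · rw [hVar.familyResidue_eq_zero hK.isClosed (chart_mem_atlas Plane i) hx hxK]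
  have hfx : 0 < f x₀ := f.pos_of_mem_ball (Metric.mem_ball_self hδ)
  have hx₀c := hz.subset (hDV hx₀)
  have hmK : c.symm x₀ ∈ c.symm '' tsupport w :=
    ⟨x₀, subset_tsupport _ (mul_ne_zero (neg_ne_zero.2 hb0) hfx.ne'), rfl⟩
  -- Since the cutoffs sum to 1, one is nonzero at the point over x₀. In its chart the integrand is
  -- strictly positive there, contradicting the vanishing just obtained.
  obtain ⟨i, hi, hi0⟩ := Finset.exists_ne_zero_of_sum_ne_zero
    ((sum_chartPartition hK hmK).trans_ne one_ne_zero)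
  have hms : c.symm x₀ ∈ (chartAt Plane i).source :=
    tsupport_chartPartition_subset i (subset_tsupport _ hi0)
  have hinv := (chartAt Plane i).left_inv hms
  have htgt := (chartAt Plane i).map_source hms
  have h0 := hVar.chartPartition_mul_familyResidue_eq_zero hM hK (hW _ _ _ hK hVar) hneg hi htgt
  rw [hinv] at h0
  have hxs : (chartAt Plane i) (c.symm x₀) ∈ ((chartAt Plane i).symm.trans c).source :=
    ⟨htgt, show (chartAt Plane i).symm _ ∈ c.source by rw [hinv]; exact c.map_target hx₀c⟩
  have hxy : (chartAt Plane i).symm.trans c ((chartAt Plane i) (c.symm x₀)) = x₀ := by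
    rw [OpenPartialHomeomorph.coe_trans, Function.comp_apply, hinv, c.right_inv hx₀c]
  obtain ⟨a, ha, h⟩ := hres i _ hxs (hxy.symm ▸ hx₀)
  rw [h, hxy] at h0
  exact (mul_ne_zero hi0 (mul_pos ha (mul_pos hfx hx₀S.2)).ne') h0

/-- The quartic differential of a Willmore surface is holomorphic. -/
theorem IsWillmore.isHolomorphicPhi (hM : IsOrientedAtlas M) (hX : IsLegendrianImmersion X)
    (hW : IsWillmore X) : IsHolomorphicPhi X := by
  intro c hc V hV Z hZ x₀ hx₀
  have F := hX.isLegFrame hc hV hZ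
  obtain ⟨A, V', z, hA, hx₀', hV', hz, hbase⟩ := F.exists_isAffineLift hx₀
  have hC : IsChartLift X c V' A z := ⟨hz, hc, hV'.trans hV, hA, hbase⟩
  -- The deformation with w = 0 is the surface itself and yields a reference frame near x₀
  -- constructed from the affine lift.
  have hL := hC.isLegLift_deformMap (w := fun _ => 0) contDiff_const
  obtain ⟨v, l, hl, hmem⟩ := hL.exists_mem_domain (y := ((0 : ℝ), x₀)) ⟨Set.mem_univ _, hx₀'⟩
  have F₀ := (hL.isFrameFamily v hl).frame 0
  have e1 : slice (fun y : ℝ × Plane => adaptedFrame v l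
      (fun x => deformLift A z (fun _ => 0) (y.1, x)) y.2) 0 =
      adaptedFrame v l fun x => A.mulVec (z x) := by
    funext x
    simp only [slice, deformLift, IsAffineLift.deform_zero]
  have e2 : deformMap c V' A z (fun _ => 0) X 0 = X :=
    funext fun m => hC.deformMap_eq fun _ _ => IsAffineLift.deform_zero z _ _
  rw [e1, e2] at F₀
  have hr := hC.r_eq_zero hM hX hW hl rfl rfl F₀ hmem
  -- Vanishing of ∂̄Φ passes from the reference frame to the given one, so no transformation law for
  -- r is needed.
  refine F₀.dbarQuartic_change F hmem hx₀ ?_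
  rw [F₀.dbarQuartic_eq hmem, hr]
  simp

end Surface

end WillmoreLegendrian

end

theorem proposition3p1 {M : Type*} [TopologicalSpace M] [ChartedSpace WillmoreLegendrian.Plane M]
    [IsManifold (𝓡 2) ∞ M] [T2Space M] [SigmaCompactSpace M]
    (hM : WillmoreLegendrian.IsOrientedAtlas M)
    (X : M → WillmoreLegendrian.PCSphere) (hX : WillmoreLegendrian.IsLegendrianImmersion X) :
    (WillmoreLegendrian.IsWillmore X ↔ WillmoreLegendrian.IsHolomorphicPhi X) ∧
      (WillmoreLegendrian.IsHolomorphicPhi X ↔ WillmoreLegendrian.RVanishes X) := by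
  have h1 := hX.isHolomorphicPhi_iff
  -- Holomorphy gives the Willmore property by way of r = 0, through the first variation formula.
  exact ⟨⟨fun hW => hW.isHolomorphicPhi hM hX, fun h => (h1.1 h).isWillmore hM⟩, h1⟩
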